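/- **Notation.** Let $q:\mathbb{R}^{2n}\to\mathbb{C}$ be a (complex-valued) quadratic form in $(x,\xi)\in\mathbb{R}^n\times\mathbb{R}^n$, extended to a complex quadratic form on $\mathbb{C}^{2n}$. Let $\sigma((x,\xi),(y,\eta))=\xi\cdot y-\eta\cdot x$, and let $F$ be the Hamilton map of $q$, i.e. the $\sigma$-antisymmetric complex $2n\times 2n$ matrix with $q(X)=\sigma(X,FX)$. For $h>0$ let $q^w(x,hD_x)$ be the Weyl quantization of $q$, obtained by replacing $\xi_j$ by $hD_{x_j}=\frac{h}{i}\partial_{x_j}$ and $x_j\xi_k$ by $\frac12(x_j\,hD_{x_k}+hD_{x_k}\,x_j)$; it acts on $L^2(\mathbb{R}^n)$ with its maximal domain $\{u\in L^2 : q^w(x,hD_x)u\in L^2\}$. For a real-valued, strictly convex quadratic form $\Phi$ on $\mathbb{C}^n\cong\mathbb{R}^{2n}$ let $H_\Phi(\mathbb{C}^n;h)$ be the Hilbert space of entire functions in $L^2(\mathbb{C}^n;e^{-2\Phi(x)/h}\,dL(x))$, where $dL$ is Lebesgue measure, and let $\Lambda_\Phi=\{(x,\frac2i\partial_x\Phi(x))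 : x\in\mathbb{C}^n\}$, where $\partial_x=\frac12(\partial_{\operatorname{Re}x}-i\partial_{\operatorname{Im}x})$. On $H_\Phi(\mathbb{C}^n;h)$ derivatives are holomorphic and quantizations of quadratic forms are again taken with maximal domain. For a closed densely defined operator $A$ and $z\in\mathbb{C}$ such that some closed disc about $z$ contains no point of $\operatorname{Spec}A$ except possibly $z$, the Riesz projection of $A$ onto $\{z\}$ is $P_{\{z\},A}=\frac{1}{2\pi i}\int_{|\zeta-z|=r}(\zeta-A)^{-1}\,d\zeta$ for any such radius $r>0$. A *normal form* of $q$ consists of a $\mathbb{C}$-linear canonical transformation $\varkappa$ of $\mathbb{C}^{2n}$ (one preserving $\sigma$), a matrix $M\in\mathbb{C}^{n\times n}$, numbers $\lambda_1,\dots,\lambda_n$, and a real-valued, strictly convex quadratic form $\Phi_2$ on $\mathbb{C}^n$, such that: $\tilde q(x,\xi):=(q\circ\varkappa^{-1})(x,\xi)=(Mx)\cdot\xi$; $M$ is in Jordan form with diagonal entries $2\lambda_1,\dots,2\lambda_n$; $\lambda_1,\dots,\lambda_n$ are the eigenvalues of $F$ in the open upper half-plane, listed with algebraic multiplicity; and $\varkappa(\mathbb{R}^{2n})=\Lambda_{\Phi_2}$.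 For such a normal form and $\alpha\in\mathbb{N}_0^n$ put $$\mu_\alpha=\frac{h}{i}\sum_{j=1}^n(2\alpha_j+1)\lambda_j .$$ **Theorem.** Suppose that $\operatorname{Re}q\ge 0$ on $\mathbb{R}^{2n}$ and that the singular space is trivial, $\bigcap_{k\ge0}\ker\big((\operatorname{Re}F)(\operatorname{Im}F)^k\big)=\{0\}\subset\mathbb{R}^{2n}$. Then $q$ has a normal form. Moreover, for every normal form $(\varkappa,M,(\lambda_j),\Phi_2)$ of $q$ and every $h>0$: 1. the operator $q^w(x,hD_x)$ on $L^2(\mathbb{R}^n)$ is unitarily equivalent to $\tilde q^w(x,hD_x)$ on $H_{\Phi_2}(\mathbb{C}^n;h)$; 2. $\tilde q^w(x,hD_x)$ is closed and densely defined on $H_{\Phi_2}(\mathbb{C}^n;h)$, and for every $z\in\mathbb{C}$ some closed disc about $z$ contains no point of its spectrum except possibly $z$, the set $\{\alpha:\mu_\alpha=z\}$ is finite, and the Riesz projection $\Pi_z=P_{\{z\},\tilde q^w(x,hD_x)}$ is the truncation of the Taylor series at $0$ to the monomials $x^\alpha$ with $\mu_\alpha=z$: $$\Pi_z u(x)=\sum_{\alpha:\,\mu_\alpha=z}(\alpha!)^{-1}\,(\partial^\alpha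 u(0))\,x^\alpha,\qquad u\in H_{\Phi_2}(\mathbb{C}^n;h),\ x\in\mathbb{C}^n .$$ -/

import Mathlib

open MeasureTheory Matrix
open scoped SchwartzMap ContDiff

noncomputable section

namespace QuadOp

/-! ### Quadratic forms on phase space and their Hamilton maps

A point `(x, ξ)` of `ℝⁿ × ℝⁿ` (or `ℂⁿ × ℂⁿ`) is a function `X` on `Fin n ⊕ Fin n`:
`x j = X (inl j)` and `ξ j = X (inr j)`. -/

/-- The symmetric matrix `Q` with `q X = ∑ a b, Q a b * X a * X b`. -/
def coeffMatrix {n : ℕ} (q : QuadraticMap ℝ (Fin n ⊕ Fin n → ℝ) ℂ) :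
    Matrix (Fin n ⊕ Fin n) (Fin n ⊕ Fin n) ℂ :=
  fun a b => QuadraticMap.polar q (Pi.single a 1) (Pi.single b 1) / 2

/-- The extension of `q` to a complex quadratic form on `ℂ²ⁿ`. -/
def complexify {n : ℕ} (q : QuadraticMap ℝ (Fin n ⊕ Fin n → ℝ) ℂ)
    (X : Fin n ⊕ Fin n → ℂ) : ℂ :=
  X ⬝ᵥ (coeffMatrix q *ᵥ X)

/-- The symplectic form `σ((x, ξ), (y, η)) = ξ · y - η · x` on `ℂ²ⁿ`. -/
def sympForm {n : ℕ} (X Y : Fin n ⊕ Fin n → ℂ) : ℂ :=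
  ∑ j : Fin n, (X (Sum.inr j) * Y (Sum.inl j) - Y (Sum.inr j) * X (Sum.inl j))

/-- The Hamilton map `F = ½ H_q`; if `Q = (A, B; Bᵀ, C)` in blocks, then
`F = (Bᵀ, C; -A, -B)`. -/
def hamiltonMap {n : ℕ} (q : QuadraticMap ℝ (Fin n ⊕ Fin n → ℝ) ℂ) :
    Matrix (Fin n ⊕ Fin n) (Fin n ⊕ Fin n) ℂ :=
  fromBlocks (coeffMatrix q).toBlocks₂₁ (coeffMatrix q).toBlocks₂₂
    (-(coeffMatrix q).toBlocks₁₁) (-(coeffMatrix q).toBlocks₁₂)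

/-- The singular space `S = ⋂_{k ≥ 0} ker ((Re F) (Im F)ᵏ) ⊆ ℝ²ⁿ`. -/
def singularSpace {n : ℕ} (q : QuadraticMap ℝ (Fin n ⊕ Fin n → ℝ) ℂ) :
    Submodule ℝ (Fin n ⊕ Fin n → ℝ) :=
  ⨅ k : ℕ, LinearMap.ker
    (((hamiltonMap q).map Complex.re * (hamiltonMap q).map Complex.im ^ k).mulVecLin)

/-- The inclusion `ℝ²ⁿ ⊆ ℂ²ⁿ`. -/
def realPoint {n : ℕ} (X : Fin n ⊕ Fin n → ℝ) : Fin n ⊕ Fin n → ℂ := fun a => (X a : ℂ)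

theorem coeffMatrix_isSymm {n : ℕ} (q : QuadraticMap ℝ (Fin n ⊕ Fin n → ℝ) ℂ) :
    (coeffMatrix q).IsSymm := by
  ext a b
  simp only [transpose_apply, coeffMatrix]
  rw [QuadraticMap.polar_comm]

/-- `complexify q` does extend `q`. -/
theorem complexify_realPoint {n : ℕ} (q : QuadraticMap ℝ (Fin n ⊕ Fin n → ℝ) ℂ)
    (X : Fin n ⊕ Fin n → ℝ) : complexify q (realPoint X) = q X := by
  have hX : X = ∑ a, X a • (Pi.single a 1 : Fin n ⊕ Fin n → ℝ) := by
    ext b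
    simp [Finset.sum_apply, Pi.single_apply]
  have h2 : QuadraticMap.polar q X X = 2 * q X := by
    rw [QuadraticMap.polar_self]; simp
  have h3 : QuadraticMap.polar q X X =
      ∑ a, ∑ b, (X a : ℂ) * (X b) * QuadraticMap.polar q (Pi.single a 1) (Pi.single b 1) := by
    have : QuadraticMap.polar q X X = q.polarBilin X X := rfl
    rw [this]
    conv_lhs => rw [hX]
    simp only [map_sum, LinearMap.sum_apply, map_smul, LinearMap.smul_apply,
      QuadraticMap.polarBilin_apply_apply, Complex.real_smul, Finset.mul_sum]
    rw [Finset.sum_comm]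
    refine Finset.sum_congr rfl fun a _ => Finset.sum_congr rfl fun b _ => ?_
    ring
  have h4 : q X = (∑ a, ∑ b, (X a : ℂ) * (X b) *
      QuadraticMap.polar q (Pi.single a 1) (Pi.single b 1)) / 2 := by
    rw [← h3, h2]; ring
  rw [h4]
  simp only [complexify, dotProduct, mulVec, coeffMatrix, realPoint, Finset.mul_sum,
    Finset.sum_div]
  refine Finset.sum_congr rfl fun a _ => Finset.sum_congr rfl fun b _ => ?_
  ring

/-- The defining relation `q(X) = σ(X, F X)` of the Hamilton map. -/
theorem sympForm_hamiltonMap {n : ℕ} (q : QuadraticMap ℝ (Fin n ⊕ Fin n → ℝ) ℂ)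
    (X : Fin n ⊕ Fin n → ℂ) : sympForm X (hamiltonMap q *ᵥ X) = complexify q X := by
  simp only [sympForm, complexify, hamiltonMap, mulVec, dotProduct, Fintype.sum_sum_type,
    fromBlocks_apply₁₁, fromBlocks_apply₁₂, fromBlocks_apply₂₁, fromBlocks_apply₂₂,
    toBlocks₁₁, toBlocks₁₂, toBlocks₂₁, toBlocks₂₂, Matrix.neg_apply, of_apply, neg_mul,
    Finset.sum_neg_distrib]
  rw [← Finset.sum_add_distrib]
  refine Finset.sum_congr rfl fun j _ => ?_
  ring

/-! ### Weyl quantization of quadratic forms -/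

/-- The operators `x_j` (index `inl j`) and `h D_{x_j} = (h / i) ∂_{x_j}` (index `inr j`) on
functions of `x ∈ 𝕜ⁿ`. For `𝕜 = ℝ` the derivative is the usual one, for `𝕜 = ℂ` it is the
holomorphic one. -/
def phaseOp {𝕜 : Type*} [RCLike 𝕜] [NormedAlgebra 𝕜 ℂ] {n : ℕ} (h : ℝ) :
    Fin n ⊕ Fin n → ((Fin n → 𝕜) → ℂ) → ((Fin n → 𝕜) → ℂ)
  | Sum.inl j, g => fun x => algebraMap 𝕜 ℂ (x j) * g x
  | Sum.inr j, g => fun x => ((h : ℂ) / Complex.I) * fderiv 𝕜 g x (Pi.single j 1)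

/-- The Weyl quantization of the quadratic form with symmetric coefficient matrix `Q`, as a
differential expression: since `Q` is symmetric, each product `2 Q a b X_a X_b` of two different
variables is replaced by the symmetrized product `2 Q a b (Z_a Z_b + Z_b Z_a) / 2`, with `Z` the
operators of `phaseOp`. -/
def weylOp {𝕜 : Type*} [RCLike 𝕜] [NormedAlgebra 𝕜 ℂ] {n : ℕ}
    (Q : Matrix (Fin n ⊕ Fin n) (Fin n ⊕ Fin n) ℂ) (h : ℝ) (g : (Fin n → 𝕜) → ℂ) :
    (Fin n → 𝕜) → ℂ :=
  fun x => ∑ a, ∑ b, Q a b * phaseOp h a (phaseOp h b g) x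

/-! ### The operator on `L²(ℝⁿ)` -/

/-- The Hilbert space `L²(ℝⁿ)`. -/
abbrev L2 (n : ℕ) : Type := Lp ℂ 2 (volume : Measure (Fin n → ℝ))

theorem exists_schwartz_phaseOp {n : ℕ} (h : ℝ) (a : Fin n ⊕ Fin n) (φ : 𝓢(Fin n → ℝ, ℂ)) :
    ∃ ψ : 𝓢(Fin n → ℝ, ℂ), (ψ : (Fin n → ℝ) → ℂ) = phaseOp h a φ := by
  cases a with
  | inl j =>
    refine ⟨SchwartzMap.smulLeftCLM ℂ (fun x : Fin n → ℝ => ((x j : ℝ) : ℂ)) φ, ?_⟩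
    have hg : Function.HasTemperateGrowth (fun x : Fin n → ℝ => ((x j : ℝ) : ℂ)) :=
      (Complex.ofRealCLM.comp
        (ContinuousLinearMap.proj (R := ℝ) (φ := fun _ : Fin n => ℝ) j)).hasTemperateGrowth
    rw [SchwartzMap.smulLeftCLM_apply hg]
    rfl
  | inr j =>
    refine ⟨((h : ℂ) / Complex.I) •
      LineDeriv.lineDerivOp (Pi.single j 1 : Fin n → ℝ) φ, ?_⟩
    ext x
    simp [phaseOp, SchwartzMap.lineDerivOp_apply_eq_fderiv]

theorem exists_schwartz_weylOp {n : ℕ} (Q : Matrix (Fin n ⊕ Fin n) (Fin n ⊕ Fin n) ℂ) (h : ℝ)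
    (φ : 𝓢(Fin n → ℝ, ℂ)) :
    ∃ ψ : 𝓢(Fin n → ℝ, ℂ), (ψ : (Fin n → ℝ) → ℂ) = weylOp Q h φ := by
  choose Z hZ using fun (a : Fin n ⊕ Fin n) (φ : 𝓢(Fin n → ℝ, ℂ)) =>
    exists_schwartz_phaseOp h a φ
  refine ⟨∑ a, ∑ b, Q a b • Z a (Z b φ), ?_⟩
  ext x
  simp [weylOp, hZ]

theorem integrable_mul_schwartz {n : ℕ} (u : L2 n) (φ : 𝓢(Fin n → ℝ, ℂ)) :
    Integrable (fun x => u x * φ x) :=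
  (Lp.memLp u).integrable_mul (φ.memLp 2)

theorem integrable_mul_weylOp {n : ℕ} (Q : Matrix (Fin n ⊕ Fin n) (Fin n ⊕ Fin n) ℂ) (h : ℝ)
    (u : L2 n) (φ : 𝓢(Fin n → ℝ, ℂ)) : Integrable (fun x => u x * weylOp Q h φ x) := by
  obtain ⟨ψ, hψ⟩ := exists_schwartz_weylOp Q h φ
  rw [← hψ]
  exact integrable_mul_schwartz u ψ

/-- The graph of the maximal realization of `q^w(x, hD_x)` on `L²(ℝⁿ)`, `Q` being the symmetric
coefficient matrix of `q`: the pairs `(u, v)` of `L²` functions with `q^w(x, hD_x) u = v` in the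
sense of tempered distributions. The transpose of `x_j` is `x_j` and that of `h D_{x_j}` is
`-h D_{x_j}`, so that the transpose of the differential expression is `weylOp Q (-h)`. -/
def weylL2Graph {n : ℕ} (Q : Matrix (Fin n ⊕ Fin n) (Fin n ⊕ Fin n) ℂ) (h : ℝ) :
    Submodule ℂ (L2 n × L2 n) where
  carrier := {p | ∀ φ : 𝓢(Fin n → ℝ, ℂ),
    ∫ x, p.1 x * weylOp Q (-h) φ x = ∫ x, p.2 x * φ x}
  zero_mem' := by
    intro φ
    have h0 : ∀ g : (Fin n → ℝ) → ℂ, ∫ x, (0 : L2 n) x * g x = 0 := fun g => by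
      rw [integral_congr_ae (g := fun _ => (0 : ℂ)), integral_zero]
      filter_upwards [Lp.coeFn_zero ℂ 2 (volume : Measure (Fin n → ℝ))] with x hx
      rw [hx]; simp
    exact (h0 _).trans (h0 _).symm
  add_mem' := by
    intro p r hp hr φ
    have hadd : ∀ (u v : L2 n) (g : (Fin n → ℝ) → ℂ), Integrable (fun x => u x * g x) →
        Integrable (fun x => v x * g x) →
        ∫ x, (u + v : L2 n) x * g x = (∫ x, u x * g x) + ∫ x, v x * g x := by
      intro u v g hu hv
      rw [← integral_add hu hv]
      refine integral_congr_ae ?_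
      filter_upwards [Lp.coeFn_add u v] with x hx
      rw [hx, Pi.add_apply, add_mul]
    have := congrArg₂ (· + ·) (hp φ) (hr φ)
    beta_reduce at this
    rw [← hadd _ _ _ (integrable_mul_weylOp Q (-h) _ φ) (integrable_mul_weylOp Q (-h) _ φ),
      ← hadd _ _ _ (integrable_mul_schwartz _ φ) (integrable_mul_schwartz _ φ)] at this
    exact this
  smul_mem' := by
    intro c p hp φ
    have hsmul : ∀ (u : L2 n) (g : (Fin n → ℝ) → ℂ),
        ∫ x, (c • u : L2 n) x * g x = c * ∫ x, u x * g x := by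
      intro u g
      rw [← integral_const_mul]
      refine integral_congr_ae ?_
      filter_upwards [Lp.coeFn_smul c u] with x hx
      rw [hx, Pi.smul_apply, smul_eq_mul, mul_assoc]
    have := congrArg (c * ·) (hp φ)
    beta_reduce at this
    rw [← hsmul, ← hsmul] at this
    exact this

/-- The operator `q^w(x, hD_x)` on `L²(ℝⁿ)`, with its maximal domain
`{u ∈ L² | q^w(x, hD_x) u ∈ L²}`; see `mem_graph_weylL2`. -/
def weylL2 {n : ℕ} (Q : Matrix (Fin n ⊕ Fin n) (Fin n ⊕ Fin n) ℂ) (h : ℝ) :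
    L2 n →ₗ.[ℂ] L2 n :=
  (weylL2Graph Q h).toLinearPMap

theorem mem_graph_weylL2 {n : ℕ} (Q : Matrix (Fin n ⊕ Fin n) (Fin n ⊕ Fin n) ℂ) (h : ℝ)
    (u v : L2 n) :
    (u, v) ∈ (weylL2 Q h).graph ↔
      ∀ φ : 𝓢(Fin n → ℝ, ℂ), ∫ x, u x * weylOp Q (-h) φ x = ∫ x, v x * φ x := by
  rw [weylL2, Submodule.toLinearPMap_graph_eq]
  · rfl
  rintro ⟨u, v⟩ hp hu
  obtain rfl : u = 0 := hu
  show v = 0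
  have hz : ∀ φ : 𝓢(Fin n → ℝ, ℂ), ∫ x, v x * φ x = 0 := by
    intro φ
    rw [← hp φ, integral_congr_ae (g := fun _ => (0 : ℂ)), integral_zero]
    filter_upwards [Lp.coeFn_zero ℂ 2 (volume : Measure (Fin n → ℝ))] with x hx
    rw [hx]; simp
  refine (Lp.eq_zero_iff_ae_eq_zero).2
    (ae_eq_zero_of_integral_contDiff_smul_eq_zero
      ((Lp.memLp v).locallyIntegrable (by norm_num)) ?_)
  intro g hg hgc
  have hs : HasCompactSupport (fun x => ((g x : ℝ) : ℂ)) :=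
    hgc.comp_left (g := fun r : ℝ => (r : ℂ)) (by simp)
  have hd : ContDiff ℝ ∞ (fun x => ((g x : ℝ) : ℂ)) := Complex.ofRealCLM.contDiff.comp hg
  rw [← hz (hs.toSchwartzMap hd)]
  refine integral_congr_ae (Filter.Eventually.of_forall fun x => ?_)
  change g x • v x = v x * ((g x : ℝ) : ℂ)
  rw [Complex.real_smul, mul_comm]

/-! ### Weighted spaces of entire functions -/

/-- The measure `e^{-2 Φ(x) / h} dL(x)` on `ℂⁿ`, with `dL(x) = d(Re x) d(Im x)`. -/
def weightMeasure {n : ℕ} (Φ : QuadraticForm ℝ (Fin n → ℂ)) (h : ℝ) :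
    Measure (Fin n → ℂ) :=
  (volume : Measure (Fin n → ℂ)).withDensity
    fun x => ENNReal.ofReal (Real.exp (-2 * Φ x / h))

/-- Entire functions on `ℂⁿ`. -/
def Entire {n : ℕ} (f : (Fin n → ℂ) → ℂ) : Prop := AnalyticOnNhd ℂ f Set.univ

/-- The space `H_Φ(ℂⁿ; h)` of entire functions in `L²(ℂⁿ; e^{-2 Φ(x) / h} dL(x))`, with the norm
and the inner product of that `L²` space. -/
def HPhi {n : ℕ} (Φ : QuadraticForm ℝ (Fin n → ℂ)) (h : ℝ) :
    Submodule ℂ (Lp ℂ 2 (weightMeasure Φ h)) where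
  carrier := {u | ∃ f, Entire f ∧ u =ᵐ[weightMeasure Φ h] f}
  zero_mem' := ⟨0, fun _ _ => analyticAt_const, Lp.coeFn_zero _ _ _⟩
  add_mem' := by
    rintro u v ⟨f, hf, huf⟩ ⟨g, hg, hvg⟩
    exact ⟨f + g, fun x hx => (hf x hx).add (hg x hx), (Lp.coeFn_add u v).trans (huf.add hvg)⟩
  smul_mem' := by
    rintro c u ⟨f, hf, huf⟩
    exact ⟨c • f, fun x hx => (hf x hx).const_smul,
      (Lp.coeFn_smul c u).trans (huf.const_smul c)⟩

/-- The entire function represented by an element of `H_Φ`; it is unique by `rep_eq`. -/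
def rep {n : ℕ} {Φ : QuadraticForm ℝ (Fin n → ℂ)} {h : ℝ} (u : HPhi Φ h) :
    (Fin n → ℂ) → ℂ :=
  Classical.choose u.2

theorem entire_rep {n : ℕ} {Φ : QuadraticForm ℝ (Fin n → ℂ)} {h : ℝ} (u : HPhi Φ h) :
    Entire (rep u) :=
  (Classical.choose_spec u.2).1

theorem coeFn_ae_eq_rep {n : ℕ} {Φ : QuadraticForm ℝ (Fin n → ℂ)} {h : ℝ} (u : HPhi Φ h) :
    (u : Lp ℂ 2 (weightMeasure Φ h)) =ᵐ[weightMeasure Φ h] rep u :=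
  (Classical.choose_spec u.2).2

theorem continuous_quadratic {n : ℕ} (Φ : QuadraticForm ℝ (Fin n → ℂ)) : Continuous Φ := by
  have h : ∀ x, Φ x = (1 / 2 : ℝ) * Φ.polarBilin x x := fun x => by
    rw [QuadraticMap.polarBilin_apply_apply, QuadraticMap.polar_self]
    simp
  have hc : Continuous fun x : Fin n → ℂ => Φ.polarBilin x x := by
    have : ∀ x, Φ.polarBilin x x =
        (LinearMap.toContinuousLinearMap.toLinearMap ∘ₗ Φ.polarBilin).toContinuousLinearMap x x :=
      fun _ => rfl
    simp_rw [this]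
    fun_prop
  exact (continuous_const.mul hc).congr fun x => (h x).symm

theorem volume_absolutelyContinuous_weightMeasure {n : ℕ} (Φ : QuadraticForm ℝ (Fin n → ℂ))
    (h : ℝ) : (volume : Measure (Fin n → ℂ)) ≪ weightMeasure Φ h := by
  refine withDensity_absolutelyContinuous' ?_ (Filter.Eventually.of_forall fun x => ?_)
  · have := continuous_quadratic Φ
    exact (ENNReal.continuous_ofReal.comp (by fun_prop :
      Continuous fun x => Real.exp (-2 * Φ x / h))).aemeasurable
  · simpa using Real.exp_pos _

theorem Entire.differentiable {n : ℕ} {f : (Fin n → ℂ) → ℂ} (hf : Entire f) :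
    Differentiable ℂ f := fun x => (hf x trivial).differentiableAt

theorem rep_eq {n : ℕ} {Φ : QuadraticForm ℝ (Fin n → ℂ)} {h : ℝ} (u : HPhi Φ h)
    {f : (Fin n → ℂ) → ℂ} (hf : Entire f)
    (huf : (u : Lp ℂ 2 (weightMeasure Φ h)) =ᵐ[weightMeasure Φ h] f) : rep u = f := by
  have h1 : rep u =ᵐ[volume] f :=
    (volume_absolutelyContinuous_weightMeasure Φ h).ae_eq ((coeFn_ae_eq_rep u).symm.trans huf)
  exact ((entire_rep u).differentiable.continuous.ae_eq_iff_eq volume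
    hf.differentiable.continuous).1 h1

theorem rep_zero {n : ℕ} {Φ : QuadraticForm ℝ (Fin n → ℂ)} {h : ℝ} :
    rep (0 : HPhi Φ h) = 0 :=
  rep_eq 0 (fun _ _ => analyticAt_const) (Lp.coeFn_zero _ _ _)

theorem rep_add {n : ℕ} {Φ : QuadraticForm ℝ (Fin n → ℂ)} {h : ℝ} (u v : HPhi Φ h) :
    rep (u + v) = rep u + rep v :=
  rep_eq (u + v) (fun x hx => ((entire_rep u) x hx).add ((entire_rep v) x hx))
    ((Lp.coeFn_add (u : Lp ℂ 2 (weightMeasure Φ h)) v).trans ((coeFn_ae_eq_rep u).add (coeFn_ae_eq_rep v)))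

theorem rep_smul {n : ℕ} {Φ : QuadraticForm ℝ (Fin n → ℂ)} {h : ℝ} (c : ℂ)
    (u : HPhi Φ h) : rep (c • u) = c • rep u :=
  rep_eq (c • u) (fun x hx => ((entire_rep u) x hx).const_smul)
    ((Lp.coeFn_smul c (u : Lp ℂ 2 (weightMeasure Φ h))).trans ((coeFn_ae_eq_rep u).const_smul c))

theorem rep_injective {n : ℕ} {Φ : QuadraticForm ℝ (Fin n → ℂ)} {h : ℝ} :
    Function.Injective (rep : HPhi Φ h → (Fin n → ℂ) → ℂ) := by
  intro u v huv
  refine Subtype.ext (Lp.ext ((coeFn_ae_eq_rep u).trans ?_))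
  rw [huv]
  exact (coeFn_ae_eq_rep v).symm

/-! ### The operator on `H_Φ` -/

theorem Entire.phaseOp {n : ℕ} {f : (Fin n → ℂ) → ℂ} (hf : Entire f) (h : ℝ)
    (a : Fin n ⊕ Fin n) : Entire (phaseOp h a f) := by
  cases a with
  | inl j =>
    intro x hx
    exact ((ContinuousLinearMap.proj (R := ℂ) (φ := fun _ : Fin n => ℂ) j).analyticAt x).mul
      (hf x hx)
  | inr j =>
    intro x hx
    exact analyticAt_const.mul
      (((ContinuousLinearMap.apply ℂ ℂ (Pi.single j 1 : Fin n → ℂ)).analyticAt _).comp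
        (hf x hx).fderiv)

theorem phaseOp_add {n : ℕ} (h : ℝ) (a : Fin n ⊕ Fin n) {f g : (Fin n → ℂ) → ℂ}
    (hf : Entire f) (hg : Entire g) : phaseOp h a (f + g) = phaseOp h a f + phaseOp h a g := by
  cases a with
  | inl j => ext x; simp [phaseOp, mul_add]
  | inr j =>
    ext x
    simp [phaseOp, fderiv_add (hf.differentiable x) (hg.differentiable x), mul_add]

theorem phaseOp_smul {n : ℕ} (h : ℝ) (a : Fin n ⊕ Fin n) (c : ℂ) {f : (Fin n → ℂ) → ℂ}
    (hf : Entire f) : phaseOp h a (c • f) = c • phaseOp h a f := by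
  cases a with
  | inl j => ext x; simp [phaseOp]; ring
  | inr j =>
    ext x
    simp [phaseOp, fderiv_const_smul (hf.differentiable x)]
    ring

theorem weylOp_add {n : ℕ} (Q : Matrix (Fin n ⊕ Fin n) (Fin n ⊕ Fin n) ℂ) (h : ℝ)
    {f g : (Fin n → ℂ) → ℂ} (hf : Entire f) (hg : Entire g) :
    weylOp Q h (f + g) = weylOp Q h f + weylOp Q h g := by
  ext x
  simp only [weylOp, Pi.add_apply, ← Finset.sum_add_distrib]
  refine Finset.sum_congr rfl fun a _ => Finset.sum_congr rfl fun b _ => ?_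
  rw [phaseOp_add h b hf hg, phaseOp_add h a (hf.phaseOp h b) (hg.phaseOp h b), Pi.add_apply,
    mul_add]

theorem weylOp_smul {n : ℕ} (Q : Matrix (Fin n ⊕ Fin n) (Fin n ⊕ Fin n) ℂ) (h : ℝ) (c : ℂ)
    {f : (Fin n → ℂ) → ℂ} (hf : Entire f) : weylOp Q h (c • f) = c • weylOp Q h f := by
  ext x
  simp only [weylOp, Pi.smul_apply, smul_eq_mul, Finset.mul_sum]
  refine Finset.sum_congr rfl fun a _ => Finset.sum_congr rfl fun b _ => ?_
  rw [phaseOp_smul h b c hf, phaseOp_smul h a c (hf.phaseOp h b), Pi.smul_apply, smul_eq_mul]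
  ring

/-- The graph of the maximal realization on `H_Φ` of the Weyl quantization of the quadratic form
with symmetric coefficient matrix `Q`. -/
def weylHGraph {n : ℕ} (Φ : QuadraticForm ℝ (Fin n → ℂ))
    (Q : Matrix (Fin n ⊕ Fin n) (Fin n ⊕ Fin n) ℂ) (h : ℝ) :
    Submodule ℂ (HPhi Φ h × HPhi Φ h) where
  carrier := {p | rep p.2 = weylOp Q h (rep p.1)}
  zero_mem' := by
    have := weylOp_smul Q h 0 (f := 0) (fun _ _ => analyticAt_const)
    simp only [zero_smul] at this
    simp only [Set.mem_ofPred_eq, Prod.fst_zero, Prod.snd_zero, rep_zero, this]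
  add_mem' := by
    intro p r hp hr
    simp only [Set.mem_ofPred_eq, Prod.fst_add, Prod.snd_add, rep_add] at *
    rw [hp, hr, weylOp_add Q h (entire_rep p.1) (entire_rep r.1)]
  smul_mem' := by
    intro c p hp
    simp only [Set.mem_ofPred_eq, Prod.smul_fst, Prod.smul_snd, rep_smul] at *
    rw [hp, weylOp_smul Q h c (entire_rep p.1)]

/-- The Weyl quantization on `H_Φ(ℂⁿ; h)` of the quadratic form with symmetric coefficient matrix
`Q`, with its maximal domain; see `mem_graph_weylH`. -/
def weylH {n : ℕ} (Φ : QuadraticForm ℝ (Fin n → ℂ))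
    (Q : Matrix (Fin n ⊕ Fin n) (Fin n ⊕ Fin n) ℂ) (h : ℝ) : HPhi Φ h →ₗ.[ℂ] HPhi Φ h :=
  (weylHGraph Φ Q h).toLinearPMap

theorem mem_graph_weylH {n : ℕ} (Φ : QuadraticForm ℝ (Fin n → ℂ))
    (Q : Matrix (Fin n ⊕ Fin n) (Fin n ⊕ Fin n) ℂ) (h : ℝ) (u v : HPhi Φ h) :
    (u, v) ∈ (weylH Φ Q h).graph ↔ rep v = weylOp Q h (rep u) := by
  rw [weylH, Submodule.toLinearPMap_graph_eq]
  · rfl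
  rintro ⟨u, v⟩ hp hu
  obtain rfl : u = 0 := hu
  have hp' : rep v = weylOp Q h (rep (0 : HPhi Φ h)) := hp
  have h0 := weylOp_smul Q h 0 (f := 0) (fun _ _ => analyticAt_const)
  simp only [zero_smul] at h0
  refine rep_injective ?_
  rw [hp', rep_zero, h0]

/-! ### Resolvents and Riesz projections of unbounded operators -/

section Riesz

variable {H : Type*} [NormedAddCommGroup H] [NormedSpace ℂ H]

/-- `R` is a bounded two-sided inverse of `ζ - A : D(A) → H`. -/
def IsResolventAt (A : H →ₗ.[ℂ] H) (ζ : ℂ) (R : H →L[ℂ] H) : Prop :=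
  (∀ v : H, ∃ hv : R v ∈ A.domain, ζ • R v - A ⟨R v, hv⟩ = v) ∧
    ∀ u : A.domain, R (ζ • (u : H) - A u) = u

/-- The spectrum of an unbounded operator. -/
def spec (A : H →ₗ.[ℂ] H) : Set ℂ := {ζ | ¬ ∃ R : H →L[ℂ] H, IsResolventAt A ζ R}

open Classical in
/-- The resolvent `(ζ - A)⁻¹`, with the value `0` on the spectrum. -/
def resolv (A : H →ₗ.[ℂ] H) (ζ : ℂ) : H →L[ℂ] H :=
  if hR : ∃ R : H →L[ℂ] H, IsResolventAt A ζ R then Classical.choose hR else 0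

/-- `P` is the Riesz projection `(2πi)⁻¹ ∮ (ζ - A)⁻¹ dζ` of `A` and `{z}`: the operator `A` is
closed and densely defined, some closed disc about `z` contains no point of the spectrum other
than (possibly) `z`, and `P` is given by the integral over the boundary of each such disc. -/
def IsRieszProjection (A : H →ₗ.[ℂ] H) (z : ℂ) (P : H →L[ℂ] H) : Prop :=
  A.IsClosed ∧ Dense (A.domain : Set H) ∧
    (∃ r : ℝ, 0 < r ∧ Metric.closedBall z r ∩ spec A ⊆ {z}) ∧
    ∀ r : ℝ, 0 < r → Metric.closedBall z r ∩ spec A ⊆ {z} →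
      P = (2 * (Real.pi : ℂ) * Complex.I)⁻¹ • circleIntegral (fun ζ => resolv A ζ) z r

theorem IsResolventAt.unique {A : H →ₗ.[ℂ] H} {ζ : ℂ} {R R' : H →L[ℂ] H}
    (hR : IsResolventAt A ζ R) (hR' : IsResolventAt A ζ R') : R = R' := by
  ext v
  obtain ⟨hv, h1⟩ := hR'.1 v
  have h2 := hR.2 ⟨R' v, hv⟩
  simp only [h1] at h2
  exact h2

end Riesz

/-! ### The normal form -/

/-- Block diagonal matrices whose blocks are (upper triangular) Jordan blocks. -/
def IsJordanForm {n : ℕ} (M : Matrix (Fin n) (Fin n) ℂ) : Prop :=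
  (∀ i j : Fin n, j ≠ i → (j : ℕ) ≠ (i : ℕ) + 1 → M i j = 0) ∧
    ∀ i j : Fin n, (j : ℕ) = (i : ℕ) + 1 → M i j = 0 ∨ (M i j = 1 ∧ M i i = M j j)

/-- The holomorphic derivative `∂_{x_j} = (∂_{Re x_j} - i ∂_{Im x_j}) / 2` of a real-valued
function on `ℂⁿ`. -/
def wirtinger {n : ℕ} (Φ : (Fin n → ℂ) → ℝ) (j : Fin n) (x : Fin n → ℂ) : ℂ :=
  ((fderiv ℝ Φ x (Pi.single j 1) : ℝ) - Complex.I * (fderiv ℝ Φ x (Pi.single j Complex.I) : ℝ)) / 2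

/-- The set `Λ_Φ = {(x, (2 / i) ∂_x Φ(x)) | x ∈ ℂⁿ}`. -/
def lagrangian {n : ℕ} (Φ : (Fin n → ℂ) → ℝ) : Set (Fin n ⊕ Fin n → ℂ) :=
  Set.range fun x : Fin n → ℂ => Sum.elim x fun j => 2 / Complex.I * wirtinger Φ j x

/-- A reduction of `q` to normal form: a complex linear canonical transformation `κ` with
`(q ∘ κ⁻¹)(x, ξ) = (M x) · ξ`, where `M` is in Jordan form, its diagonal entries are `2 lam j`
and `lam 0, …, lam (n - 1)` are the eigenvalues of `F(q)` in the open upper half-plane, listed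
with algebraic multiplicity; and a strictly convex real quadratic weight `Φ` which is associated
with `κ` in that `Λ_Φ = κ(ℝ²ⁿ)`. -/
structure NormalForm {n : ℕ} (q : QuadraticMap ℝ (Fin n ⊕ Fin n → ℝ) ℂ) where
  κ : (Fin n ⊕ Fin n → ℂ) ≃ₗ[ℂ] (Fin n ⊕ Fin n → ℂ)
  M : Matrix (Fin n) (Fin n) ℂ
  lam : Fin n → ℂ
  Φ : QuadraticForm ℝ (Fin n → ℂ)
  canonical : ∀ X Y, sympForm (κ X) (κ Y) = sympForm X Y
  symbol : ∀ x ξ : Fin n → ℂ, complexify q (κ.symm (Sum.elim x ξ)) = (M *ᵥ x) ⬝ᵥ ξ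
  jordan : IsJordanForm M
  diag : ∀ j, M j j = 2 * lam j
  eigenvalues : Finset.univ.val.map lam =
    (hamiltonMap q).charpoly.roots.filter fun z => 0 < z.im
  strictConvex : StrictConvexOn ℝ Set.univ Φ
  weight : Set.range (fun X : Fin n ⊕ Fin n → ℝ => κ (realPoint X)) = lagrangian Φ

/-- The symmetric coefficient matrix of the quadratic form `(x, ξ) ↦ (M x) · ξ`. -/
def normalMatrix {n : ℕ} (M : Matrix (Fin n) (Fin n) ℂ) :
    Matrix (Fin n ⊕ Fin n) (Fin n ⊕ Fin n) ℂ :=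
  fromBlocks 0 ((1 / 2 : ℂ) • Mᵀ) ((1 / 2 : ℂ) • M) 0

theorem normalMatrix_apply {n : ℕ} (M : Matrix (Fin n) (Fin n) ℂ) (x ξ : Fin n → ℂ) :
    Sum.elim x ξ ⬝ᵥ (normalMatrix M *ᵥ Sum.elim x ξ) = (M *ᵥ x) ⬝ᵥ ξ := by
  have h1 : x ⬝ᵥ (Mᵀ *ᵥ ξ) = (M *ᵥ x) ⬝ᵥ ξ := by
    rw [dotProduct_mulVec, vecMul_transpose]
  rw [normalMatrix, fromBlocks_mulVec, sumElim_dotProduct_sumElim]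
  simp only [Sum.elim_comp_inl, Sum.elim_comp_inr, zero_mulVec, zero_add, add_zero,
    smul_mulVec, dotProduct_smul, h1, smul_eq_mul]
  rw [dotProduct_comm ξ]
  ring

/-- The operator `q̃^w(x, hD_x)` on `H_Φ(ℂⁿ; h)`, where `q̃(x, ξ) = (M x) · ξ`. -/
def NormalForm.op {n : ℕ} {q : QuadraticMap ℝ (Fin n ⊕ Fin n → ℝ) ℂ} (N : NormalForm q)
    (h : ℝ) : HPhi N.Φ h →ₗ.[ℂ] HPhi N.Φ h :=
  weylH N.Φ (normalMatrix N.M) h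

/-- `μ_α = (h / i) ∑_j (2 α_j + 1) λ_j`. -/
def mu {n : ℕ} (h : ℝ) (lam : Fin n → ℂ) (α : Fin n → ℕ) : ℂ :=
  (h : ℂ) / Complex.I * ∑ j, (2 * (α j : ℂ) + 1) * lam j

/-! ### Taylor coefficients -/

/-- The (holomorphic) partial derivative `∂_{x_j}`. -/
def partialD {n : ℕ} (j : Fin n) (f : (Fin n → ℂ) → ℂ) : (Fin n → ℂ) → ℂ :=
  fun x => fderiv ℂ f x (Pi.single j 1)

/-- The iterated partial derivative `∂^α`. -/
def multiD {n : ℕ} (α : Fin n → ℕ) (f : (Fin n → ℂ) → ℂ) : (Fin n → ℂ) → ℂ :=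
  (List.finRange n).foldr (fun j g => (partialD j)^[α j] g) f

end QuadOp

end

/-!
The proof passes to phase space twice: once to find the normal form, once to conjugate the operator.

*Existence of a normal form.* Since `Re q ≥ 0` and the singular space is trivial, no trajectory of
the flow of `2 i F` is free of dissipation (`eq_zero_of_no_dissipation`). Hence `F` has no real
eigenvalue, and `ℂ²ⁿ` is the sum of the stable spaces `E₊`, `E₋` of the eigenvalues in the upper and
in the lower half-plane. The symplectic form is constant along the flow and trajectories in `E±`
decay forwards or backwards in time, so `E±` are isotropic; the form `i⁻¹ σ(X̄, X)` is monotone along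
the flow, so it is negative definite on `E₊` and positive definite on `E₋`
(`im_sympForm_star_neg_of_stable`). A Jordan basis of `2 F` on `E₊` and its `σ`-dual basis in `E₋`
form a symplectic basis, whose coordinates are `κ` (`exists_symplectic_jordan`). Definiteness makes
`κ(ℝ²ⁿ)` the graph of `(2 / i) ∂_x Φ` for `Φ(x) = -½ Im ξ · x`, which is positive (`exists_weight`).

*Unitary equivalence.* For any normal form, `(x, y) ↦ (ξ, η)` with `κ(y, η) = (x, ξ)` has a
quadratic generating function `φ`, and the FBI kernels `exp(i φ(x, y) / h)` have a Gram matrix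
proportional to the reproducing kernel of `H_Φ` (`NormalForm.integral_fbi_mul_conj`,
`inner_kernelVec`). As they are total in `L²`, they define a unitary `T : L² → H_Φ`
(`NormalForm.exists_fbi_unitary`). The kernels are Schwartz functions on which the two quantizations
agree (`NormalForm.weylOp_fbi`), so `T` maps the graph of `q^w` into that of `q̃^w`. Equality of the
maximal domains follows because `q^w + 1` is surjective, by accretivity on Schwartz functions, and
`q̃^w + 1` is injective, by the description of `q̃^w` on Taylor coefficients.

*Spectrum and Riesz projections.* On the Taylor coefficients at the origin `q̃^w` is triangular with
diagonal entries `μ_α`: the nilpotent part of `M` lowers the weight `∑ j α_j` and preserves `μ_α`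
(`exists_multiD_weylOp`). Thus `ζ - q̃^w` is injective for `ζ` different from all `μ_α`. It is also
surjective: a polynomial solves the equation to high order at `0`, and for a right hand side
vanishing to high order the equation is solved by a Laplace integral along the flow of `i M`, which
contracts to the origin and along which `Φ` decreases (`exists_solution`). By the closed graph
theorem the spectrum is `{μ_α}` (`NormalForm.spec_op`). Triangularity also shows that the Taylor
coefficients of `(ζ - q̃^w)⁻¹ u` are `∂^α u(0) / (ζ - μ_α)` plus poles of higher order at `μ_α`
(`NormalForm.multiD_resolv`). The contour integral annihilates the latter, and retains `∂^α u(0)`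
exactly when `μ_α = z`; an entire function is determined by its Taylor coefficients.
-/

noncomputable section

namespace QuadOp

open Set Filter Topology ComplexConjugate

/-! ### Cauchy's formula on polydiscs and analyticity -/

open scoped BoundedContinuousFunction

/-- The measure on `ℝⁿ` which parametrizes the torus `|x_j| = R`. -/
def torusMeasure (n : ℕ) : Measure (Fin n → ℝ) :=
  Measure.pi fun _ => volume.restrict (Ioc 0 (2 * Real.pi))

/-- Cauchy's formula as an integral over the angle: `dz / (z - w) = i (1 - w / z)⁻¹ dθ`. -/
theorem cauchy_circle {f : ℂ → ℂ} (hf : Differentiable ℂ f) {R : ℝ} (hR : 0 < R) {w : ℂ}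
    (hw : ‖w‖ < R) :
    ∫ θ in Ioc 0 (2 * Real.pi), (1 - w * (circleMap 0 R θ)⁻¹)⁻¹ * f (circleMap 0 R θ)
      = 2 * Real.pi * f w := by
  have h1 := Complex.two_pi_I_inv_smul_circleIntegral_sub_inv_smul_of_differentiable_on_off_countable
    (c := 0) (R := R) (w := w) (f := f) (s := ∅) countable_empty (by simpa using hw)
    hf.continuous.continuousOn (fun z _ => hf z)
  rw [circleIntegral, intervalIntegral.integral_of_le (by positivity)] at h1
  have h2 : ∀ θ : ℝ, deriv (circleMap 0 R) θ • (circleMap 0 R θ - w)⁻¹ • f (circleMap 0 R θ)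
      = Complex.I * ((1 - w * (circleMap 0 R θ)⁻¹)⁻¹ * f (circleMap 0 R θ)) := by
    intro θ
    have h0 : circleMap 0 R θ ≠ 0 := circleMap_ne_center hR.ne'
    have h3 : circleMap 0 R θ - w ≠ 0 := by
      intro h
      have : ‖circleMap 0 R θ‖ = R := by simp [abs_of_pos hR]
      rw [sub_eq_zero.1 h] at this
      exact hw.ne this
    have h4 : 1 - w * (circleMap 0 R θ)⁻¹ = (circleMap 0 R θ - w) * (circleMap 0 R θ)⁻¹ := by
      field_simp
    rw [deriv_circleMap, h4, mul_inv, inv_inv]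
    simp only [smul_eq_mul]
    ring
  simp only [h2, integral_const_mul] at h1
  rw [← h1]
  have := Complex.I_ne_zero
  have : (Real.pi : ℂ) ≠ 0 := by exact_mod_cast Real.pi_ne_zero
  simp only [smul_eq_mul]
  field_simp

theorem continuous_torusKernel {n : ℕ} {R : ℝ} {x : Fin n → ℂ} (hx : ∀ j, ‖x j‖ < R) :
    Continuous fun θ : Fin n → ℝ => ∏ j, (1 - x j * (circleMap 0 R (θ j))⁻¹)⁻¹ := by
  refine continuous_finsetProd _ fun j _ => Continuous.inv₀ ?_ ?_
  · have hR : 0 < R := (norm_nonneg _).trans_lt (hx j)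
    have : Continuous fun θ : Fin n → ℝ => circleMap 0 R (θ j) :=
      (continuous_circleMap 0 R).comp (continuous_apply j)
    exact continuous_const.sub (continuous_const.mul
      (this.inv₀ fun θ => circleMap_ne_center hR.ne'))
  · intro θ h
    have hR : 0 < R := (norm_nonneg _).trans_lt (hx j)
    have h0 : circleMap 0 R (θ j) ≠ 0 := circleMap_ne_center hR.ne'
    have : x j = circleMap 0 R (θ j) := by
      field_simp at h
      rw [mul_zero, sub_eq_zero] at h
      exact h.symm
    have h2 : ‖circleMap 0 R (θ j)‖ = R := by simp [abs_of_pos hR]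
    rw [← this] at h2
    exact (hx j).ne h2

theorem integrable_torusMeasure {n : ℕ} {g : (Fin n → ℝ) → ℂ} (hg : Continuous g) :
    Integrable g (torusMeasure n) := by
  have h1 : torusMeasure n = (volume : Measure (Fin n → ℝ)).restrict
      (univ.pi fun _ => Ioc 0 (2 * Real.pi)) := by
    rw [torusMeasure, volume_pi, Measure.restrict_pi_pi]
  rw [h1]
  have h2 : IsCompact (univ.pi fun _ : Fin n => Icc 0 (2 * Real.pi)) :=
    isCompact_univ_pi fun _ => isCompact_Icc
  exact (hg.continuousOn.integrableOn_compact h2).mono_set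
    (pi_mono fun _ _ => Ioc_subset_Icc_self)

/-- Cauchy's formula on a polydisc. -/
theorem cauchy_torus : ∀ {n : ℕ} {f : (Fin n → ℂ) → ℂ} (_ : Differentiable ℂ f) {R : ℝ}
    (_ : 0 < R) {x : Fin n → ℂ} (_ : ∀ j, ‖x j‖ < R),
    ∫ θ, (∏ j, (1 - x j * (circleMap 0 R (θ j))⁻¹)⁻¹) * f (fun j => circleMap 0 R (θ j))
      ∂torusMeasure n = (2 * Real.pi) ^ n * f x
  | 0, f, _, R, _, x, _ => by
    have : ∀ y : Fin 0 → ℂ, f y = f x := fun y => congrArg f (Subsingleton.elim _ _)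
    simp [torusMeasure, this, Measure.real]
  | n + 1, f, hf, R, hR, x, hx => by
    -- integrate over the last `n` angles first, with the point on the first circle frozen
    have hmp := measurePreserving_piFinSuccAbove
      (fun _ : Fin (n + 1) => (volume : Measure ℝ).restrict (Ioc 0 (2 * Real.pi))) 0
    have hcont : Continuous fun θ : Fin (n + 1) → ℝ =>
        (∏ j, (1 - x j * (circleMap 0 R (θ j))⁻¹)⁻¹) * f (fun j => circleMap 0 R (θ j)) :=
      (continuous_torusKernel hx).mul (hf.continuous.comp (continuous_pi fun j =>
        (continuous_circleMap 0 R).comp (continuous_apply j)))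
    have hint := integrable_torusMeasure hcont
    have hsymm := hmp.symm
    rw [torusMeasure] at hint ⊢
    rw [← hsymm.integral_comp' , integral_prod]
    swap
    · exact (hsymm.integrable_comp_emb (MeasurableEquiv.measurableEmbedding _)).2 hint
    have hin : ∀ a : ℝ, ∫ (y : Fin n → ℝ), (∏ j, (1 - x j * (circleMap 0 R
        (((MeasurableEquiv.piFinSuccAbove (fun _ : Fin (n + 1) => ℝ) 0).symm (a, y)) j))⁻¹)⁻¹) *
        f (fun j => circleMap 0 R
        (((MeasurableEquiv.piFinSuccAbove (fun _ : Fin (n + 1) => ℝ) 0).symm (a, y)) j))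
        ∂(Measure.pi fun _ => volume.restrict (Ioc 0 (2 * Real.pi)))
        = (2 * Real.pi) ^ n * ((1 - x 0 * (circleMap 0 R a)⁻¹)⁻¹ *
          f (Fin.cons (circleMap 0 R a) fun j => x j.succ)) := by
      intro a
      have hd : Differentiable ℂ fun y : Fin n → ℂ =>
          f (Fin.cons (circleMap 0 R a) y : Fin (n + 1) → ℂ) := by
        refine hf.comp (differentiable_pi.2 fun j => ?_)
        refine Fin.cases ?_ (fun j => ?_) j
        · simp
        · simpa using differentiable_apply j
      have := cauchy_torus hd hR (x := fun j => x j.succ) fun j => hx j.succ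
      rw [torusMeasure] at this
      rw [mul_left_comm, ← this, ← integral_const_mul]
      refine integral_congr_ae (Eventually.of_forall fun y => ?_)
      have e0 : ((MeasurableEquiv.piFinSuccAbove (fun _ : Fin (n + 1) => ℝ) 0).symm (a, y))
          = Fin.cons a y := by
        simp [MeasurableEquiv.piFinSuccAbove, Fin.insertNthEquiv]
      have e1 : (fun j => circleMap 0 R ((Fin.cons a y : Fin (n + 1) → ℝ) j)) =
          (Fin.cons (circleMap 0 R a) fun j => circleMap 0 R (y j) : Fin (n + 1) → ℂ) := by
        ext j
        refine Fin.cases ?_ (fun j => ?_) j <;> simp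
      simp only [e0, e1, Fin.prod_univ_succ, Fin.cons_zero, Fin.cons_succ, mul_assoc]
    have h1 : Differentiable ℂ fun z : ℂ => f (Fin.cons z fun j => x j.succ) := by
      refine hf.comp (differentiable_pi.2 fun j => ?_)
      refine Fin.cases ?_ (fun j => ?_) j
      · simp
      · simp
    have h2 := cauchy_circle h1 hR (hx 0)
    have h3 : (Fin.cons (x 0) fun j => x j.succ : Fin (n + 1) → ℂ) = x := Fin.cons_self_tail x
    rw [h3] at h2
    refine (integral_congr_ae (Eventually.of_forall hin)).trans ?_
    rw [integral_const_mul, h2]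
    ring

/-- Osgood's lemma: a complex differentiable function on `ℂⁿ` is analytic. The right-hand side of
Cauchy's formula on a polydisc is a continuous linear functional of the kernel, and the kernel is
an analytic function of `x` with values in the Banach algebra of bounded continuous functions. -/
theorem Entire.of_differentiable {n : ℕ} {f : (Fin n → ℂ) → ℂ} (hf : Differentiable ℂ f) :
    Entire f := by
  have key : ∀ f : (Fin n → ℂ) → ℂ, Differentiable ℂ f → AnalyticAt ℂ f 0 := by
    clear hf f
    intro f hf
    -- the functions `θ ↦ 1 / z_j(θ)` on the unit torus, and the Cauchy kernel built from them
    let η : Fin n → ((Fin n → ℝ) →ᵇ ℂ) := fun j =>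
      BoundedContinuousFunction.ofNormedAddCommGroup (fun θ => (circleMap 0 1 (θ j))⁻¹)
        (((continuous_circleMap 0 1).comp (continuous_apply j)).inv₀
          fun θ => circleMap_ne_center one_ne_zero) 1 (fun θ => by simp)
    have hη : ∀ j, ‖η j‖ ≤ 1 := fun j =>
      BoundedContinuousFunction.norm_ofNormedAddCommGroup_le _ zero_le_one _
    let G : (Fin n → ℂ) → ((Fin n → ℝ) →ᵇ ℂ) := fun x =>
      ∏ j, Ring.inverse (1 - x j • η j)
    have hG : AnalyticAt ℂ G 0 := by
      refine Finset.analyticAt_fun_prod _ fun j _ => ?_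
      have h1 : AnalyticAt ℂ (fun x : Fin n → ℂ => 1 - x j • η j) 0 :=
        analyticAt_const.sub (((ContinuousLinearMap.proj (R := ℂ) (φ := fun _ : Fin n => ℂ) j).analyticAt
          0).smul analyticAt_const)
      have h2 : AnalyticAt ℂ (Ring.inverse : ((Fin n → ℝ) →ᵇ ℂ) → _) (1 - (0 : Fin n → ℂ) j • η j) := by
        have := analyticAt_inverse (𝕜 := ℂ) (1 : ((Fin n → ℝ) →ᵇ ℂ)ˣ)
        simpa using this
      exact h2.comp_of_eq h1 rfl
    have hfc : Continuous fun θ : Fin n → ℝ => f (fun j => circleMap 0 1 (θ j)) :=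
      hf.continuous.comp (continuous_pi fun j =>
        (continuous_circleMap 0 1).comp (continuous_apply j))
    have hΛi : ∀ g : (Fin n → ℝ) →ᵇ ℂ, Integrable
        (fun θ => g θ * f (fun j => circleMap 0 1 (θ j))) (torusMeasure n) := fun g =>
      integrable_torusMeasure (g.continuous.mul hfc)
    -- integration against `f` over the torus, so that `(2π)ⁿ f = Λ ∘ G` near the origin
    let Λ : ((Fin n → ℝ) →ᵇ ℂ) →L[ℂ] ℂ := LinearMap.mkContinuous
      { toFun := fun g => ∫ θ, g θ * f (fun j => circleMap 0 1 (θ j)) ∂torusMeasure n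
        map_add' := fun g g' => by
          simp only [BoundedContinuousFunction.coe_add, Pi.add_apply, add_mul]
          exact integral_add (hΛi g) (hΛi g')
        map_smul' := fun c g => by
          simp only [BoundedContinuousFunction.coe_smul, smul_eq_mul, mul_assoc,
            integral_const_mul, RingHom.id_apply] }
      (∫ θ, ‖f (fun j => circleMap 0 1 (θ j))‖ ∂torusMeasure n) (fun g => by
        refine (norm_integral_le_integral_norm _).trans ?_
        rw [mul_comm, ← integral_const_mul]
        refine integral_mono (hΛi g).norm ((integrable_torusMeasure hfc).norm.const_mul _)
          fun θ => ?_
        simp only [norm_mul]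
        exact mul_le_mul_of_nonneg_right (g.norm_coe_le_norm θ) (norm_nonneg _))
    have hpi : ((2 * Real.pi : ℂ) ^ n) ≠ 0 :=
      pow_ne_zero _ (mul_ne_zero two_ne_zero (by exact_mod_cast Real.pi_ne_zero))
    have hev : (fun x => ((2 * Real.pi : ℂ) ^ n)⁻¹ * Λ (G x)) =ᶠ[𝓝 0] f := by
      filter_upwards [Metric.ball_mem_nhds (0 : Fin n → ℂ) one_pos] with x hx
      rw [mem_ball_zero_iff] at hx
      have hx' : ∀ j, ‖x j‖ < 1 := fun j => (norm_le_pi_norm x j).trans_lt hx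
      have hGx : ∀ θ, G x θ = ∏ j, (1 - x j * (circleMap 0 1 (θ j))⁻¹)⁻¹ := by
        intro θ
        let evθ : ((Fin n → ℝ) →ᵇ ℂ) →+* ℂ :=
          { toFun := fun g => g θ, map_one' := rfl, map_mul' := fun _ _ => rfl,
            map_zero' := rfl, map_add' := fun _ _ => rfl }
        change evθ (∏ j, Ring.inverse (1 - x j • η j)) = _
        rw [map_prod]
        refine Finset.prod_congr rfl fun j _ => ?_
        have hu : IsUnit (1 - x j • η j) := by
          refine isUnit_one_sub_of_norm_lt_one ?_
          rw [norm_smul]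
          calc _ ≤ ‖x j‖ * 1 := mul_le_mul_of_nonneg_left (hη j) (norm_nonneg _)
            _ < 1 := by simpa using hx' j
        have h1 : evθ (1 - x j • η j) = 1 - x j * (circleMap 0 1 (θ j))⁻¹ := rfl
        rw [← h1]
        refine eq_inv_of_mul_eq_one_left ?_
        rw [← map_mul, Ring.inverse_mul_cancel _ hu, map_one]
      have h2 : Λ (G x) = (2 * Real.pi) ^ n * f x := by
        rw [← cauchy_torus hf one_pos hx']
        exact integral_congr_ae (Eventually.of_forall fun θ => by simp only [hGx θ])
      rw [h2, inv_mul_cancel_left₀ hpi]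
    exact (analyticAt_const.mul (Λ.analyticAt _ |>.comp hG)).congr hev
  intro a _
  have h1 := key (fun x => f (x + a)) (hf.comp (differentiable_id.add_const a))
  have h2 : AnalyticAt ℂ (fun x : Fin n → ℂ => x - a) a := analyticAt_id.sub analyticAt_const
  have h3 := h1.comp_of_eq h2 (sub_self a)
  simpa [Function.comp_def] using h3

/-! ### Integrals depending holomorphically on a parameter -/

/-- Cauchy's estimate for the derivative of a function bounded on a ball. -/
theorem norm_fderiv_le_of_bounded {n : ℕ} {f : (Fin n → ℂ) → ℂ} (hf : Differentiable ℂ f)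
    {x : Fin n → ℂ} {r B : ℝ} (hr : 0 < r) (hB : ∀ z, ‖z - x‖ < r → ‖f z‖ ≤ B) :
    ‖fderiv ℂ f x‖ ≤ 2 * B / r := by
  refine Complex.norm_fderiv_le_div_of_mapsTo_ball hf.differentiableOn (fun z hz => ?_) hr
  rw [Metric.mem_closedBall, dist_eq_norm]
  have h1 := hB z (by simpa [dist_eq_norm] using hz)
  have h2 := hB x (by simpa using hr)
  calc _ ≤ ‖f z‖ + ‖f x‖ := norm_sub_le _ _
    _ ≤ 2 * B := by linarith

/-- Differentiation under the integral sign for holomorphic dependence on the parameter: a locally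
uniform integrable bound on the integrand suffices, the derivative being controlled by Cauchy's
estimate. -/
theorem hasFDerivAt_integral_holomorphic {Y : Type*} [TopologicalSpace Y]
    [SecondCountableTopology Y] [MeasurableSpace Y]
    [OpensMeasurableSpace Y] {μ : Measure Y} {n : ℕ} {k : Y → (Fin n → ℂ) → ℂ}
    (hk : Continuous (Function.uncurry k)) (hd : ∀ y, Differentiable ℂ (k y)) {u : Y → ℂ}
    (hu : AEStronglyMeasurable u μ)
    (hb : ∀ R : ℝ, ∃ g : Y → ℝ, Integrable g μ ∧ ∀ᵐ y ∂μ, ∀ x, ‖x‖ ≤ R → ‖k y x * u y‖ ≤ g y)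
    (x : Fin n → ℂ) :
    Integrable (fun y => u y • fderiv ℂ (k y) x) μ ∧
    HasFDerivAt (fun x => ∫ y, k y x * u y ∂μ) (∫ y, u y • fderiv ℂ (k y) x ∂μ) x := by
  obtain ⟨g, hg, hgb⟩ := hb (‖x‖ + 2)
  have hm : ∀ x, AEStronglyMeasurable (fun y => k y x * u y) μ := fun x =>
    (hk.comp (Continuous.prodMk_left x)).aestronglyMeasurable.mul hu
  have hm' : AEStronglyMeasurable (fun y => u y • fderiv ℂ (k y) x) μ := by
    refine hu.smul (Measurable.aestronglyMeasurable ?_)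
    exact (measurable_fderiv_with_param ℂ hk).comp (measurable_id.prodMk measurable_const)
  have hbd : ∀ᵐ y ∂μ, ∀ z ∈ Metric.ball x 1, ‖u y • fderiv ℂ (k y) z‖ ≤ 2 * g y := by
    filter_upwards [hgb] with y hy z hz
    have h1 : u y • fderiv ℂ (k y) z = fderiv ℂ (fun x => k y x * u y) z := by
      rw [fderiv_mul_const (hd y z)]
    rw [h1]
    have hz' : ‖z - x‖ < 1 := by simpa [dist_eq_norm] using hz
    have := norm_fderiv_le_of_bounded (f := fun x => k y x * u y) (x := z) (r := 1) (B := g y)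
      ((hd y).mul_const _) one_pos (fun w hw => hy w ?_)
    · simpa using this
    · have : w = (w - z) + (z - x) + x := by abel
      calc ‖w‖ = ‖(w - z) + (z - x) + x‖ := by rw [← this]
        _ ≤ ‖w - z‖ + ‖z - x‖ + ‖x‖ := norm_add₃_le
        _ ≤ ‖x‖ + 2 := by linarith
  refine ⟨(hg.const_mul 2).mono' hm' ?_, hasFDerivAt_integral_of_dominated_of_fderiv_le
    (Metric.ball_mem_nhds x one_pos) (Eventually.of_forall hm) ?_ hm' hbd (hg.const_mul 2) ?_⟩
  · filter_upwards [hbd] with y hy using hy x (Metric.mem_ball_self one_pos)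
  · refine hg.mono' (hm x) ?_
    filter_upwards [hgb] with y hy using hy x (by linarith)
  · exact Eventually.of_forall fun y z _ => by
      simpa using ((hd y z).hasFDerivAt.mul_const (u y))

theorem entire_integral {Y : Type*} [TopologicalSpace Y]
    [SecondCountableTopology Y] [MeasurableSpace Y]
    [OpensMeasurableSpace Y] {μ : Measure Y} {n : ℕ} {k : Y → (Fin n → ℂ) → ℂ}
    (hk : Continuous (Function.uncurry k)) (hd : ∀ y, Differentiable ℂ (k y)) {u : Y → ℂ}
    (hu : AEStronglyMeasurable u μ)
    (hb : ∀ R : ℝ, ∃ g : Y → ℝ, Integrable g μ ∧ ∀ᵐ y ∂μ, ∀ x, ‖x‖ ≤ R → ‖k y x * u y‖ ≤ g y) :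
    Entire fun x => ∫ y, k y x * u y ∂μ :=
  Entire.of_differentiable fun x =>
    (hasFDerivAt_integral_holomorphic hk hd hu hb x).2.differentiableAt

theorem fderiv_integral_holomorphic {Y : Type*} [TopologicalSpace Y]
    [SecondCountableTopology Y] [MeasurableSpace Y]
    [OpensMeasurableSpace Y] {μ : Measure Y} {n : ℕ} {k : Y → (Fin n → ℂ) → ℂ}
    (hk : Continuous (Function.uncurry k)) (hd : ∀ y, Differentiable ℂ (k y)) {u : Y → ℂ}
    (hu : AEStronglyMeasurable u μ)
    (hb : ∀ R : ℝ, ∃ g : Y → ℝ, Integrable g μ ∧ ∀ᵐ y ∂μ, ∀ x, ‖x‖ ≤ R → ‖k y x * u y‖ ≤ g y)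
    (x v : Fin n → ℂ) :
    fderiv ℂ (fun x => ∫ y, k y x * u y ∂μ) x v = ∫ y, fderiv ℂ (k y) x v * u y ∂μ := by
  obtain ⟨h1, h2⟩ := hasFDerivAt_integral_holomorphic hk hd hu hb x
  rw [h2.fderiv, ContinuousLinearMap.integral_apply h1]
  simp [mul_comm]

/-- An entire function of one variable vanishing on the real line is zero. -/
theorem eq_zero_of_real {g : ℂ → ℂ} (hg : Differentiable ℂ g) (h0 : ∀ s : ℝ, g s = 0) (z : ℂ) :
    g z = 0 := by
  have ha : AnalyticOnNhd ℂ g univ := hg.differentiableOn.analyticOnNhd isOpen_univ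
  have hfr : ∃ᶠ w in 𝓝[≠] (0 : ℂ), g w = 0 := by
    have ht : Tendsto (fun s : ℝ => (s : ℂ)) (𝓝[≠] 0) (𝓝[≠] 0) := by
      refine tendsto_nhdsWithin_of_tendsto_nhds_of_eventually_within _ ?_ ?_
      · have := Complex.continuous_ofReal.tendsto (0 : ℝ)
        rw [Complex.ofReal_zero] at this
        exact this.mono_left nhdsWithin_le_nhds
      · filter_upwards [self_mem_nhdsWithin] with s hs
        simpa using hs
    exact ht.frequently (Frequently.of_forall h0)
  exact ha.eqOn_zero_of_preconnected_of_frequently_eq_zero isPreconnected_univ (mem_univ 0) hfr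
    (mem_univ z)

/-- Multiplication by `e^{iθ}` preserves Lebesgue measure on `ℂⁿ`. -/
theorem measurePreserving_circleMul {n : ℕ} (θ : ℝ) :
    MeasurePreserving (fun z : Fin n → ℂ => circleMap 0 1 θ • z) volume volume := by
  have h1 : MeasurePreserving (fun z : ℂ => circleMap 0 1 θ * z) volume volume := by
    have := (rotation (Circle.exp θ)).measurePreserving
    have e : (fun z : ℂ => circleMap 0 1 θ * z) = rotation (Circle.exp θ) := by
      funext z
      simp [circleMap, rotation_apply]
    rw [e]
    exact this
  exact volume_preserving_pi (fun _ => h1)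

/-- The mean value property with respect to a rotation invariant density on `ℂⁿ`. -/
theorem integral_mul_rotationInvariant {n : ℕ} {F : (Fin n → ℂ) → ℂ} (hF : Differentiable ℂ F)
    {w : (Fin n → ℂ) → ℝ} (hw : Continuous w) (hrot : ∀ θ z, w (circleMap 0 1 θ • z) = w z)
    (hint : Integrable fun z => F z * w z) :
    ∫ z, F z * w z = F 0 * ∫ z, (w z : ℂ) := by
  set J := ∫ z, F z * w z with hJ
  have hmeas : ∀ θ, MeasurePreserving (fun z : Fin n → ℂ => circleMap 0 1 θ • z) volume volume :=
    measurePreserving_circleMul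
  have hemb : ∀ θ, MeasurableEmbedding (fun z : Fin n → ℂ => circleMap 0 1 θ • z) := fun θ =>
    (Homeomorph.smulOfNeZero (circleMap 0 1 θ)
      (circleMap_ne_center one_ne_zero)).measurableEmbedding
  have h1 : ∀ θ, ∫ z, F (circleMap 0 1 θ • z) * w z = J := fun θ => by
    rw [hJ, ← (hmeas θ).integral_comp (hemb θ) (fun z => F z * w z)]
    simp only [hrot]
  have hnorm : ∀ θ, ∫ z, ‖F (circleMap 0 1 θ • z) * w z‖ = ∫ z, ‖F z * w z‖ := fun θ => by
    rw [← (hmeas θ).integral_comp (hemb θ) (fun z => ‖F z * w z‖)]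
    simp only [hrot]
  have hinti : ∀ θ, Integrable (fun z => F (circleMap 0 1 θ • z) * w z) := fun θ => by
    have := (hmeas θ).integrable_comp_emb (hemb θ) (g := fun z => F z * w z)
    simp only [Function.comp_def, hrot] at this
    exact this.2 hint
  let ν : Measure ℝ := volume.restrict (Ioc 0 (2 * Real.pi))
  have hcont : Continuous fun p : ℝ × (Fin n → ℂ) => F (circleMap 0 1 p.1 • p.2) * w p.2 := by
    have h1 : Continuous fun p : ℝ × (Fin n → ℂ) => circleMap 0 1 p.1 • p.2 :=
      ((continuous_circleMap 0 1).comp continuous_fst).smul continuous_snd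
    exact (hF.continuous.comp h1).mul (Complex.continuous_ofReal.comp (hw.comp continuous_snd))
  have hprod : Integrable (fun p : ℝ × (Fin n → ℂ) => F (circleMap 0 1 p.1 • p.2) * w p.2)
      (ν.prod volume) := by
    rw [integrable_prod_iff hcont.aestronglyMeasurable]
    refine ⟨Eventually.of_forall fun θ => hinti θ, ?_⟩
    simp only [hnorm]
    exact integrable_const _
  -- average over the rotation angle, and apply the one-dimensional mean value property
  -- along each complex line
  have h2 := integral_integral_swap (f := fun θ z => F (circleMap 0 1 θ • z) * w z)
    (μ := ν) (ν := volume) hprod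
  simp only [h1] at h2
  have h3 : ∀ z : Fin n → ℂ, ∫ θ, F (circleMap 0 1 θ • z) * w z ∂ν
      = (2 * Real.pi) * F 0 * w z := by
    intro z
    have hg : Differentiable ℂ fun s : ℂ => F (s • z) :=
      hF.comp (differentiable_id.smul_const z)
    have := cauchy_circle hg one_pos (w := 0) (by simp)
    simp only [zero_mul, sub_zero, inv_one, one_mul, zero_smul] at this
    rw [integral_mul_const, this]
  simp only [h3] at h2
  rw [integral_const_mul] at h2
  have h4 : ∫ _θ, J ∂ν = 2 * Real.pi * J := by
    simp [ν, Real.pi_nonneg, Measure.real]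
  rw [h4, mul_assoc (2 * (Real.pi : ℂ))] at h2
  have hpi : (2 * Real.pi : ℂ) ≠ 0 := mul_ne_zero two_ne_zero (by exact_mod_cast Real.pi_ne_zero)
  exact mul_left_cancel₀ hpi h2

/-! ### Taylor coefficients of entire functions -/

theorem Entire.partialD {n : ℕ} {f : (Fin n → ℂ) → ℂ} (hf : Entire f) (j : Fin n) :
    Entire (partialD j f) := fun x hx =>
  ((ContinuousLinearMap.apply ℂ ℂ (Pi.single j 1 : Fin n → ℂ)).analyticAt _).comp (hf x hx).fderiv

theorem Entire.partialD_iterate {n : ℕ} {f : (Fin n → ℂ) → ℂ} (hf : Entire f) (j : Fin n) (m : ℕ) :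
    Entire ((QuadOp.partialD j)^[m] f) := by
  induction m with
  | zero => exact hf
  | succ m ih => rw [Function.iterate_succ_apply']; exact ih.partialD j

theorem partialD_comm {n : ℕ} {f : (Fin n → ℂ) → ℂ} (hf : Entire f) (i j : Fin n) :
    partialD i (partialD j f) = partialD j (partialD i f) := by
  funext x
  have hfd : DifferentiableAt ℂ (fderiv ℂ f) x := (hf x trivial).fderiv.differentiableAt
  have h : ∀ v w : Fin n → ℂ, fderiv ℂ (fun x => fderiv ℂ f x v) x w = fderiv ℂ (fderiv ℂ f) x w v := by
    intro v w
    rw [fderiv_clm_apply hfd (differentiableAt_const v)]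
    simp
  have hs : IsSymmSndFDerivAt ℂ f x :=
    ((hf x trivial).contDiffAt (n := 2)).isSymmSndFDerivAt (by simp)
  change fderiv ℂ (fun x => fderiv ℂ f x (Pi.single j 1)) x (Pi.single i 1) =
    fderiv ℂ (fun x => fderiv ℂ f x (Pi.single i 1)) x (Pi.single j 1)
  rw [h, h]
  exact hs _ _

/-- The composition of the operators `∂_{x_j}^{α_j}` over a list of indices `j`. -/
def listD {n : ℕ} (l : List (Fin n)) (α : Fin n → ℕ) (f : (Fin n → ℂ) → ℂ) : (Fin n → ℂ) → ℂ :=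
  l.foldr (fun j g => (partialD j)^[α j] g) f

theorem Entire.listD {n : ℕ} {f : (Fin n → ℂ) → ℂ} (hf : Entire f) (l : List (Fin n))
    (α : Fin n → ℕ) : Entire (listD l α f) := by
  induction l with
  | nil => exact hf
  | cons a l ih => exact ih.partialD_iterate a _

theorem partialD_iterate_comm {n : ℕ} {f : (Fin n → ℂ) → ℂ} (hf : Entire f) (i j : Fin n)
    (m : ℕ) : (partialD i)^[m] (partialD j f) = partialD j ((partialD i)^[m] f) := by
  induction m with
  | zero => rfl
  | succ m ih =>
    rw [Function.iterate_succ_apply', ih, Function.iterate_succ_apply',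
      partialD_comm (hf.partialD_iterate i m)]

theorem listD_partialD {n : ℕ} {f : (Fin n → ℂ) → ℂ} (hf : Entire f) (l : List (Fin n))
    (α : Fin n → ℕ) (j : Fin n) : listD l α (partialD j f) = partialD j (listD l α f) := by
  induction l with
  | nil => rfl
  | cons a l ih =>
    change (partialD a)^[α a] (listD l α (partialD j f)) = _
    rw [ih, partialD_iterate_comm (hf.listD l α)]
    rfl

theorem listD_add_single {n : ℕ} {f : (Fin n → ℂ) → ℂ} (hf : Entire f) (l : List (Fin n))
    (hl : l.Nodup) (α : Fin n → ℕ) (j : Fin n) :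
    listD l (α + Pi.single j 1) f = if j ∈ l then partialD j (listD l α f) else listD l α f := by
  induction l with
  | nil => rfl
  | cons a l ih =>
    have ih' := ih hl.of_cons
    change (partialD a)^[(α + Pi.single j 1 : Fin n → ℕ) a] (listD l (α + Pi.single j 1) f) = _
    rw [ih']
    by_cases haj : a = j
    · subst haj
      have h1 : a ∉ l := (List.nodup_cons.1 hl).1
      simp only [h1, if_false, Pi.add_apply, Pi.single_eq_same, List.mem_cons, true_or, if_true]
      rw [Function.iterate_succ_apply']
      rfl
    · have h2 : (α + Pi.single j 1 : Fin n → ℕ) a = α a := by simp [Pi.single_eq_of_ne haj]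
      rw [h2]
      by_cases hjl : j ∈ l
      · simp only [hjl, if_true, List.mem_cons, or_true]
        rw [partialD_iterate_comm (hf.listD l α)]
        rfl
      · have h3 : j ∉ a :: l := by simp [hjl, Ne.symm haj]
        simp only [hjl, h3, if_false]
        rfl

theorem multiD_add_single {n : ℕ} {f : (Fin n → ℂ) → ℂ} (hf : Entire f) (α : Fin n → ℕ)
    (j : Fin n) : multiD (α + Pi.single j 1) f = multiD α (partialD j f) := by
  have h1 := listD_add_single hf (List.finRange n) (List.nodup_finRange n) α j
  rw [if_pos (List.mem_finRange j), ← listD_partialD hf] at h1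
  exact h1

theorem multiD_zero {n : ℕ} (f : (Fin n → ℂ) → ℂ) : multiD 0 f = f := by
  have : ∀ l : List (Fin n), listD l 0 f = f := by
    intro l
    induction l with
    | nil => rfl
    | cons a l ih =>
      change (partialD a)^[0] (listD l 0 f) = f
      rw [ih]; rfl
  exact this _

theorem multiIndex_induction {n : ℕ} {P : (Fin n → ℕ) → Prop} (h0 : P 0)
    (hs : ∀ α j, P α → P (α + Pi.single j 1)) (α : Fin n → ℕ) : P α := by
  induction h : ∑ j, α j generalizing α with
  | zero =>
    have : α = 0 := by
      funext j
      exact (Finset.sum_eq_zero_iff.1 h) j (Finset.mem_univ j)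
    rw [this]; exact h0
  | succ m ih =>
    obtain ⟨j, hj⟩ : ∃ j, α j ≠ 0 := by
      by_contra! hc
      simp [hc] at h
    have hα : α = (α - Pi.single j 1) + Pi.single j 1 := by
      refine (tsub_add_cancel_of_le ?_).symm
      intro i
      by_cases hij : i = j
      · subst hij; simpa using Nat.one_le_iff_ne_zero.2 hj
      · simp [Pi.single_eq_of_ne hij]
    rw [hα]
    refine hs _ j (ih _ ?_)
    rw [hα] at h
    simp only [Pi.add_apply, Finset.sum_add_distrib, Finset.sum_pi_single', Finset.mem_univ,
      if_true] at h
    exact Nat.succ_injective h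

theorem partialD_add {n : ℕ} {f g : (Fin n → ℂ) → ℂ} (hf : Entire f) (hg : Entire g)
    (j : Fin n) : partialD j (f + g) = partialD j f + partialD j g := by
  funext x
  simp [partialD, fderiv_add (hf.differentiable x) (hg.differentiable x)]

theorem partialD_smul {n : ℕ} {f : (Fin n → ℂ) → ℂ} (hf : Entire f) (c : ℂ)
    (j : Fin n) : partialD j (c • f) = c • partialD j f := by
  funext x
  simp [partialD, fderiv_const_smul (hf.differentiable x)]

theorem Entire.add {n : ℕ} {f g : (Fin n → ℂ) → ℂ} (hf : Entire f) (hg : Entire g) :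
    Entire (f + g) := fun x hx => (hf x hx).add (hg x hx)

theorem Entire.smul {n : ℕ} {f : (Fin n → ℂ) → ℂ} (hf : Entire f) (c : ℂ) :
    Entire (c • f) := fun x hx => (hf x hx).const_smul

theorem Entire.coord_mul {n : ℕ} {f : (Fin n → ℂ) → ℂ} (hf : Entire f) (k : Fin n) :
    Entire (fun x => x k * f x) := fun x hx =>
  ((ContinuousLinearMap.proj (R := ℂ) (φ := fun _ : Fin n => ℂ) k).analyticAt x).mul (hf x hx)

theorem entire_zero {n : ℕ} : Entire (0 : (Fin n → ℂ) → ℂ) := fun _ _ => analyticAt_const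

theorem multiD_add {n : ℕ} {f g : (Fin n → ℂ) → ℂ} (hf : Entire f) (hg : Entire g)
    (α : Fin n → ℕ) : multiD α (f + g) = multiD α f + multiD α g := by
  induction α using multiIndex_induction generalizing f g with
  | h0 => simp only [multiD_zero]
  | hs α j ih =>
    rw [multiD_add_single (hf.add hg), multiD_add_single hf, multiD_add_single hg,
      partialD_add hf hg, ih (hf.partialD j) (hg.partialD j)]

theorem multiD_smul {n : ℕ} {f : (Fin n → ℂ) → ℂ} (hf : Entire f) (c : ℂ)
    (α : Fin n → ℕ) : multiD α (c • f) = c • multiD α f := by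
  induction α using multiIndex_induction generalizing f with
  | h0 => simp only [multiD_zero]
  | hs α j ih =>
    rw [multiD_add_single (hf.smul c), multiD_add_single hf,
      partialD_smul hf, ih (hf.partialD j)]

theorem Entire.sum {n : ℕ} {ι : Type*} {s : Finset ι} {f : ι → (Fin n → ℂ) → ℂ}
    (hf : ∀ i ∈ s, Entire (f i)) : Entire (∑ i ∈ s, f i) := by
  classical
  induction s using Finset.induction_on with
  | empty => simpa using entire_zero
  | insert a s ha ih =>
    rw [Finset.sum_insert ha]
    exact (hf a (Finset.mem_insert_self a s)).add
      (ih fun i hi => hf i (Finset.mem_insert_of_mem hi))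

theorem multiD_sum {n : ℕ} {ι : Type*} {s : Finset ι} {f : ι → (Fin n → ℂ) → ℂ}
    (hf : ∀ i ∈ s, Entire (f i)) (α : Fin n → ℕ) :
    multiD α (∑ i ∈ s, f i) = ∑ i ∈ s, multiD α (f i) := by
  classical
  induction s using Finset.induction_on with
  | empty =>
    have := multiD_smul (n := n) entire_zero 0 α
    simpa using this
  | insert a s ha ih =>
    rw [Finset.sum_insert ha, Finset.sum_insert ha, multiD_add (hf a (Finset.mem_insert_self a s))
      (Entire.sum fun i hi => hf i (Finset.mem_insert_of_mem hi)),
      ih fun i hi => hf i (Finset.mem_insert_of_mem hi)]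

theorem partialD_coord_mul {n : ℕ} {g : (Fin n → ℂ) → ℂ} (hg : Entire g) (j k : Fin n) :
    partialD j (fun x => x k * g x) =
      (if j = k then (1 : ℂ) else 0) • g + fun x => x k * partialD j g x := by
  funext x
  have h1 : HasFDerivAt (fun x : Fin n → ℂ => x k)
      (ContinuousLinearMap.proj (R := ℂ) (φ := fun _ : Fin n => ℂ) k) x :=
    (ContinuousLinearMap.proj (R := ℂ) (φ := fun _ : Fin n => ℂ) k).hasFDerivAt
  have h2 := h1.mul (hg.differentiable x).hasFDerivAt
  simp only [partialD]
  rw [show (fun x => x k * g x) = (fun x : Fin n → ℂ => x k) * g from rfl, h2.fderiv]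
  by_cases hjk : j = k
  · subst hjk; simp [add_comm]
  · simp [hjk]

/-- Taylor coefficients of `x_k g`. -/
theorem multiD_coord_mul {n : ℕ} {g : (Fin n → ℂ) → ℂ} (hg : Entire g) (k : Fin n)
    (α : Fin n → ℕ) :
    multiD α (fun x => x k * g x) 0 = α k * multiD (α - Pi.single k 1) g 0 := by
  induction α using multiIndex_induction generalizing g with
  | h0 => simp [multiD_zero]
  | hs α j ih =>
    rw [multiD_add_single (hg.coord_mul k), partialD_coord_mul hg,
      multiD_add (hg.smul _) ((hg.partialD j).coord_mul k), multiD_smul hg, Pi.add_apply,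
      Pi.smul_apply, ih (hg.partialD j), ← multiD_add_single hg]
    by_cases hjk : j = k
    · subst hjk
      by_cases h0 : α j = 0
      · simp [h0]
      · have h1 : α - Pi.single j 1 + Pi.single j 1 = α := by
          refine tsub_add_cancel_of_le fun i => ?_
          by_cases hij : i = j
          · subst hij; simpa using Nat.one_le_iff_ne_zero.2 h0
          · simp [Pi.single_eq_of_ne hij]
        rw [h1, add_tsub_cancel_right]
        simp
        ring
    · have h3 : (α + Pi.single j 1 : Fin n → ℕ) k = α k := by simp [Pi.single_eq_of_ne (Ne.symm hjk)]
      rw [h3]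
      simp only [hjk, if_false, zero_smul, zero_add]
      congr 3
      funext i
      simp only [Pi.add_apply, Pi.sub_apply]
      by_cases hik : i = k
      · subst hik; simp [Pi.single_eq_of_ne (Ne.symm hjk)]
      · simp [Pi.single_eq_of_ne hik]

/-- The monomial `x^β`. -/
def monomialFun {n : ℕ} (β : Fin n → ℕ) (x : Fin n → ℂ) : ℂ := ∏ j, x j ^ β j

theorem monomialFun_zero {n : ℕ} : monomialFun (0 : Fin n → ℕ) = fun _ => 1 := by
  funext x; simp [monomialFun]

theorem monomialFun_add_single {n : ℕ} (β : Fin n → ℕ) (k : Fin n) :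
    monomialFun (β + Pi.single k 1) = fun x => x k * monomialFun β x := by
  funext x
  simp only [monomialFun, Pi.add_apply, pow_add, Finset.prod_mul_distrib]
  rw [mul_comm]
  congr 1
  rw [Finset.prod_eq_single k]
  · simp
  · intro j _ hj; simp [Pi.single_eq_of_ne hj]
  · simp

theorem entire_monomialFun {n : ℕ} (β : Fin n → ℕ) : Entire (monomialFun β) := by
  induction β using multiIndex_induction with
  | h0 => rw [monomialFun_zero]; exact fun _ _ => analyticAt_const
  | hs β k ih => rw [monomialFun_add_single]; exact ih.coord_mul k

theorem multiD_one {n : ℕ} (α : Fin n → ℕ) :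
    multiD α (fun _ : Fin n → ℂ => (1 : ℂ)) 0 = if α = 0 then 1 else 0 := by
  induction α using multiIndex_induction with
  | h0 => simp [multiD_zero]
  | hs α j _ =>
    have h1 : Entire (fun _ : Fin n → ℂ => (1 : ℂ)) := fun _ _ => analyticAt_const
    have h2 : partialD j (fun _ : Fin n → ℂ => (1 : ℂ)) = 0 := by
      funext x; simp [partialD]
    have h3 : multiD α (0 : (Fin n → ℂ) → ℂ) = 0 := by
      have := multiD_smul (n := n) entire_zero 0 α
      simpa using this
    have h4 : α + Pi.single j 1 ≠ 0 := fun h => by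
      have := congrFun h j
      simp at this
    rw [multiD_add_single h1, h2, h3, if_neg h4]
    rfl

theorem multiD_monomialFun {n : ℕ} (α β : Fin n → ℕ) :
    multiD α (monomialFun β) 0 = if α = β then ∏ j, ((α j).factorial : ℂ) else 0 := by
  induction β using multiIndex_induction generalizing α with
  | h0 =>
    rw [monomialFun_zero, multiD_one]
    split_ifs with h
    · simp [h]
    · rfl
  | hs β k ih =>
    rw [monomialFun_add_single, multiD_coord_mul (entire_monomialFun β), ih]
    by_cases h0 : α k = 0
    · have : α ≠ β + Pi.single k 1 := fun h => by rw [h] at h0; simp at h0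
      simp [h0, this]
    · have h1 : α - Pi.single k 1 + Pi.single k 1 = α := by
        refine tsub_add_cancel_of_le fun i => ?_
        by_cases hij : i = k
        · subst hij; simpa using Nat.one_le_iff_ne_zero.2 h0
        · simp [Pi.single_eq_of_ne hij]
      by_cases h2 : α - Pi.single k 1 = β
      · have h3 : α = β + Pi.single k 1 := by rw [← h2, h1]
        rw [if_pos h2, if_pos h3, ← Finset.mul_prod_erase _ _ (Finset.mem_univ k),
          ← Finset.mul_prod_erase (Finset.univ) (fun j => ((α j).factorial : ℂ))
            (Finset.mem_univ k)]
        have h4 : ∏ x ∈ Finset.univ.erase k, (((α - Pi.single k 1 : Fin n → ℕ) x).factorial : ℂ) =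
            ∏ x ∈ Finset.univ.erase k, ((α x).factorial : ℂ) := by
          refine Finset.prod_congr rfl fun x hx => ?_
          simp [Pi.single_eq_of_ne (Finset.ne_of_mem_erase hx)]
        rw [h4, ← mul_assoc]
        congr 1
        obtain ⟨m, hm⟩ := Nat.exists_eq_succ_of_ne_zero h0
        simp [hm, Nat.factorial_succ]
      · have h3 : α ≠ β + Pi.single k 1 := fun h => h2 (by rw [h, add_tsub_cancel_right])
        rw [if_neg h2, if_neg h3, mul_zero]

/-- A locally uniform bound for the derivatives `∂^α`. -/
theorem norm_multiD_le {n : ℕ} {f : (Fin n → ℂ) → ℂ} (hf : Entire f) (α : Fin n → ℕ)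
    {R B : ℝ} (hB : ∀ z, ‖z‖ ≤ R + ∑ j, α j → ‖f z‖ ≤ B) {x : Fin n → ℂ} (hx : ‖x‖ ≤ R) :
    ‖multiD α f x‖ ≤ 2 ^ (∑ j, α j) * B := by
  induction α using multiIndex_induction generalizing f B with
  | h0 => simpa [multiD_zero] using hB x (by simpa using hx)
  | hs α j ih =>
    rw [multiD_add_single hf]
    have hs : ∑ i, (α + Pi.single j 1 : Fin n → ℕ) i = ∑ i, α i + 1 := by
      simp [Finset.sum_add_distrib]
    rw [hs] at hB ⊢
    refine (ih (hf.partialD j) (B := 2 * B) fun z hz => ?_).trans_eq (by ring)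
    have h1 := norm_fderiv_le_of_bounded hf.differentiable (x := z) one_pos (B := B)
      (fun w hw => hB w ?_)
    · refine ((fderiv ℂ f z).le_opNorm _).trans ?_
      rw [div_one] at h1
      simpa [Pi.norm_single] using h1
    · have : w = (w - z) + z := by abel
      have h2 := norm_add_le (w - z) z
      rw [← this] at h2
      rw [Nat.cast_add, Nat.cast_one]
      linarith

/-- An entire function whose Taylor coefficients of order less than `N` vanish is `O(‖x‖ᴺ)`. -/
theorem isBigO_of_multiD_eq_zero {n : ℕ} {f : (Fin n → ℂ) → ℂ} (hf : Entire f) (N : ℕ)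
    (h0 : ∀ α : Fin n → ℕ, ∑ j, α j < N → multiD α f 0 = 0) :
    ∃ C : ℝ, 0 ≤ C ∧ ∀ x, ‖x‖ ≤ 1 → ‖f x‖ ≤ C * ‖x‖ ^ N := by
  induction N generalizing f with
  | zero =>
    obtain ⟨C, hC⟩ := (isCompact_closedBall (0 : Fin n → ℂ) 1).exists_bound_of_continuousOn
      hf.differentiable.continuous.continuousOn
    refine ⟨C, (norm_nonneg _).trans (hC 0 (by simp)), fun x hx => ?_⟩
    simpa using hC x (by simpa using hx)
  | succ N ih =>
    have h1 : ∀ j, ∃ C : ℝ, 0 ≤ C ∧ ∀ x, ‖x‖ ≤ 1 → ‖partialD j f x‖ ≤ C * ‖x‖ ^ N := by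
      intro j
      refine ih (hf.partialD j) fun α hα => ?_
      rw [← multiD_add_single hf]
      refine h0 _ ?_
      simp [Finset.sum_add_distrib, hα]
    choose C hC0 hC using h1
    refine ⟨∑ j, C j, Finset.sum_nonneg fun j _ => hC0 j, fun x hx => ?_⟩
    have hf0 : f 0 = 0 := by
      have := h0 0 (by simp)
      rwa [multiD_zero] at this
    -- the gradient is `O(‖x‖ᴺ)` on the ball of radius `‖x‖`; integrate it from the origin
    have hfd : ∀ z, ‖z‖ ≤ ‖x‖ → ‖fderiv ℂ f z‖ ≤ (∑ j, C j) * ‖x‖ ^ N := by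
      intro z hz
      refine ContinuousLinearMap.opNorm_le_bound _ (mul_nonneg
        (Finset.sum_nonneg fun j _ => hC0 j) (by positivity)) fun v => ?_
      have hv : fderiv ℂ f z v = ∑ j, v j * partialD j f z := by
        conv_lhs => rw [pi_eq_sum_univ' v]
        simp only [map_sum, map_smul, smul_eq_mul]
        refine Finset.sum_congr rfl fun j _ => ?_
        simp only [partialD]
      rw [hv, Finset.sum_mul, Finset.sum_mul]
      refine (norm_sum_le _ _).trans (Finset.sum_le_sum fun j _ => ?_)
      rw [norm_mul, mul_comm]
      refine mul_le_mul ((hC j z (hz.trans hx)).trans ?_) (norm_le_pi_norm v j) (norm_nonneg _)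
        (mul_nonneg (hC0 j) (by positivity))
      exact mul_le_mul_of_nonneg_left (pow_le_pow_left₀ (norm_nonneg _) hz N) (hC0 j)
    have h2 := (convex_closedBall (0 : Fin n → ℂ) ‖x‖).norm_image_sub_le_of_norm_fderiv_le
      (𝕜 := ℂ) (f := f) (fun z _ => hf.differentiable z)
      (fun z hz => hfd z (by simpa using hz)) (x := 0) (y := x) (by simp) (by simp)
    rw [hf0, sub_zero, sub_zero] at h2
    rw [pow_succ, ← mul_assoc]
    exact h2

/-- Schwarz's lemma for functions vanishing to order `N` at the origin. -/
theorem norm_le_pow_of_multiD_eq_zero {n : ℕ} {f : (Fin n → ℂ) → ℂ} (hf : Entire f) (N : ℕ)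
    (h0 : ∀ α : Fin n → ℕ, ∑ j, α j < N → multiD α f 0 = 0) {R B ρ : ℝ} (hR : 0 < R)
    (hB : ∀ z, ‖z‖ ≤ R → ‖f z‖ ≤ B) (hρ1 : ρ < 1) {x : Fin n → ℂ}
    (hx : ‖x‖ ≤ ρ * R) : ‖f x‖ ≤ B * ρ ^ N := by
  have hxR : ‖x‖ < R := hx.trans_lt (by nlinarith)
  have hB0 : 0 ≤ B := (norm_nonneg _).trans (hB 0 (by simpa using hR.le))
  cases N with
  | zero => simpa using hB x hxR.le
  | succ m =>
    have hf0 : f 0 = 0 := by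
      have := h0 0 (by simp)
      rwa [multiD_zero] at this
    obtain ⟨C, _, hC⟩ := isBigO_of_multiD_eq_zero hf (m + 1) h0
    have hO : (f · - f 0) =o[𝓝 0] (fun w : Fin n → ℂ => ‖w - 0‖ ^ m) := by
      simp only [hf0, sub_zero]
      have h1 : f =O[𝓝 0] (fun w : Fin n → ℂ => ‖w‖ ^ m * ‖w‖) := by
        refine Asymptotics.IsBigO.of_bound C ?_
        filter_upwards [Metric.closedBall_mem_nhds (0 : Fin n → ℂ) one_pos] with w hw
        rw [← pow_succ]
        simpa using hC w (by simpa using hw)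
      refine h1.trans_isLittleO ?_
      have h2 : (fun w : Fin n → ℂ => ‖w‖) =o[𝓝 0] fun _ => (1 : ℝ) := by
        rw [Asymptotics.isLittleO_one_iff]
        exact tendsto_norm_zero
      simpa using (Asymptotics.isBigO_refl (fun w : Fin n → ℂ => ‖w‖ ^ m) (𝓝 0)).mul_isLittleO h2
    have h1 := Complex.dist_le_mul_div_pow_of_mapsTo_ball_of_isLittleO
      (f := f) (c := 0) (z := x) (R₁ := R) (R₂ := B) hf.differentiable.differentiableOn
      (fun z hz => by
        rw [hf0, mem_closedBall_zero_iff]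
        exact hB z (by simpa using (mem_ball_zero_iff.1 hz).le)) hO (by simpa using hxR)
    rw [hf0, dist_zero_right, dist_zero_right] at h1
    refine h1.trans (mul_le_mul_of_nonneg_left (pow_le_pow_left₀ (by positivity) ?_ _) hB0)
    rwa [div_le_iff₀ hR]

theorem entire_eq_zero_of_multiD {n : ℕ} {f : (Fin n → ℂ) → ℂ} (hf : Entire f)
    (h0 : ∀ α : Fin n → ℕ, multiD α f 0 = 0) : f = 0 := by
  funext x
  obtain ⟨B, hB⟩ := (isCompact_closedBall (0 : Fin n → ℂ) (2 * (‖x‖ + 1))).exists_bound_of_continuousOn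
      hf.differentiable.continuous.continuousOn
  have h1 : ∀ N : ℕ, ‖f x‖ ≤ B * (1 / 2) ^ N := fun N =>
    norm_le_pow_of_multiD_eq_zero hf N (fun α _ => h0 α) (R := 2 * (‖x‖ + 1)) (by positivity)
      (fun z hz => hB z (by simpa using hz)) (by norm_num) (by linarith [norm_nonneg x])
  have h2 : Tendsto (fun N : ℕ => B * (1 / 2 : ℝ) ^ N) atTop (𝓝 (B * 0)) :=
    (tendsto_pow_atTop_nhds_zero_of_lt_one (by norm_num) (by norm_num)).const_mul B
  rw [mul_zero] at h2
  simpa using ge_of_tendsto' h2 h1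

theorem entire_eq_of_multiD {n : ℕ} {f g : (Fin n → ℂ) → ℂ} (hf : Entire f) (hg : Entire g)
    (h : ∀ α : Fin n → ℕ, multiD α f 0 = multiD α g 0) : f = g := by
  have h1 : f + (-1 : ℂ) • g = 0 := by
    refine entire_eq_zero_of_multiD (hf.add (hg.smul _)) fun α => ?_
    rw [multiD_add hf (hg.smul _), multiD_smul hg, Pi.add_apply, Pi.smul_apply, h]
    simp
  have h2 : f = f + (-1 : ℂ) • g + g := by
    funext x; simp
  rw [h2, h1, zero_add]

/-! ### Hermitian and complex bilinear parts of a real quadratic form -/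

section RealForms

variable {n : ℕ} (Φ : QuadraticForm ℝ (Fin n → ℂ))

/-- The symmetric real bilinear form with `Φ x = polarForm Φ x x`. -/
def polarForm : (Fin n → ℂ) →ₗ[ℝ] (Fin n → ℂ) →ₗ[ℝ] ℝ := QuadraticMap.associated (R := ℝ) Φ

theorem polarForm_self (x : Fin n → ℂ) : polarForm Φ x x = Φ x :=
  QuadraticMap.associated_eq_self_apply ℝ Φ x

theorem polarForm_comm (x y : Fin n → ℂ) : polarForm Φ x y = polarForm Φ y x := by
  simp only [polarForm, QuadraticMap.associated_apply, add_comm]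
  ring_nf

theorem smul_eq_re_im (c : ℂ) (x : Fin n → ℂ) :
    c • x = c.re • x + c.im • (Complex.I • x) := by
  funext j
  simp only [Pi.smul_apply, Pi.add_apply, smul_eq_mul, Complex.real_smul]
  conv_lhs => rw [← Complex.re_add_im c]
  ring

theorem polarForm_smul_left (c : ℂ) (x y : Fin n → ℂ) : polarForm Φ (c • x) y =
    c.re * polarForm Φ x y + c.im * polarForm Φ (Complex.I • x) y := by
  rw [smul_eq_re_im]
  simp only [map_add, map_smul, LinearMap.add_apply, LinearMap.smul_apply, smul_eq_mul]

theorem I_smul_smul (c : ℂ) (x : Fin n → ℂ) : Complex.I • c • x = (Complex.I * c) • x :=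
  smul_smul _ _ _

/-- The Hermitian part of the real quadratic form `Φ`, linear in the first variable: the form
`(x, y) ↦ ∑ (∂²Φ / ∂x_j ∂x̄_k) x_j ȳ_k`. -/
def hermForm (x y : Fin n → ℂ) : ℂ :=
  (((polarForm Φ x y + polarForm Φ (Complex.I • x) (Complex.I • y)) / 2 : ℝ) : ℂ) -
    Complex.I * (((polarForm Φ (Complex.I • x) y - polarForm Φ x (Complex.I • y)) / 2 : ℝ) : ℂ)

/-- The complex bilinear part of the real quadratic form `Φ`: the form
`(x, y) ↦ ∑ (∂²Φ / ∂x_j ∂x_k) x_j y_k`. -/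
def holForm (x y : Fin n → ℂ) : ℂ :=
  (((polarForm Φ x y - polarForm Φ (Complex.I • x) (Complex.I • y)) / 2 : ℝ) : ℂ) -
    Complex.I * (((polarForm Φ (Complex.I • x) y + polarForm Φ x (Complex.I • y)) / 2 : ℝ) : ℂ)

theorem hermForm_add_left (x y z : Fin n → ℂ) :
    hermForm Φ (x + y) z = hermForm Φ x z + hermForm Φ y z := by
  simp only [hermForm, smul_add, map_add, LinearMap.add_apply]
  push_cast; ring

theorem hermForm_add_right (x y z : Fin n → ℂ) :
    hermForm Φ x (y + z) = hermForm Φ x y + hermForm Φ x z := by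
  simp only [hermForm, smul_add, map_add]
  push_cast; ring

theorem holForm_add_left (x y z : Fin n → ℂ) :
    holForm Φ (x + y) z = holForm Φ x z + holForm Φ y z := by
  simp only [holForm, smul_add, map_add, LinearMap.add_apply]
  push_cast; ring

theorem hermForm_smul_left (c : ℂ) (x y : Fin n → ℂ) :
    hermForm Φ (c • x) y = c * hermForm Φ x y := by
  simp only [hermForm, I_smul_smul, polarForm_smul_left Φ c, polarForm_smul_left Φ (Complex.I * c)]
  apply Complex.ext <;> simp <;> ring_nf

theorem holForm_smul_left (c : ℂ) (x y : Fin n → ℂ) :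
    holForm Φ (c • x) y = c * holForm Φ x y := by
  simp only [holForm, I_smul_smul, polarForm_smul_left Φ c, polarForm_smul_left Φ (Complex.I * c)]
  apply Complex.ext <;> simp <;> ring_nf

theorem holForm_comm (x y : Fin n → ℂ) : holForm Φ x y = holForm Φ y x := by
  simp only [holForm, polarForm_comm Φ x, polarForm_comm Φ (Complex.I • x)]
  push_cast; ring

theorem conj_hermForm (x y : Fin n → ℂ) : conj (hermForm Φ x y) = hermForm Φ y x := by
  simp only [hermForm, polarForm_comm Φ x, polarForm_comm Φ (Complex.I • x), map_sub, map_mul,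
    Complex.conj_ofReal, Complex.conj_I]
  push_cast; ring

theorem holForm_add_right (x y z : Fin n → ℂ) :
    holForm Φ x (y + z) = holForm Φ x y + holForm Φ x z := by
  rw [holForm_comm, holForm_add_left, holForm_comm, holForm_comm Φ z]

theorem holForm_smul_right (c : ℂ) (x y : Fin n → ℂ) :
    holForm Φ x (c • y) = c * holForm Φ x y := by
  rw [holForm_comm, holForm_smul_left, holForm_comm]

/-- The rotation invariant part `Φ₊(x) = (Φ(x) + Φ(ix)) / 2`. -/
def hermPart (x : Fin n → ℂ) : ℝ := (Φ x + Φ (Complex.I • x)) / 2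

theorem hermForm_self (x : Fin n → ℂ) : hermForm Φ x x = (hermPart Φ x : ℂ) := by
  simp only [hermForm, hermPart, polarForm_self, polarForm_comm Φ (Complex.I • x) x]
  simp

theorem form_eq (x : Fin n → ℂ) : Φ x = hermPart Φ x + (holForm Φ x x).re := by
  simp only [holForm, hermPart, polarForm_self]
  simp
  ring

theorem hermForm_zero_left (y : Fin n → ℂ) : hermForm Φ 0 y = 0 := by simp [hermForm]

theorem hermPart_sub (x w : Fin n → ℂ) :
    hermPart Φ (x - w) = hermPart Φ x + hermPart Φ w - 2 * (hermForm Φ x w).re := by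
  have h1 : hermForm Φ (x - w) (x - w) = hermForm Φ x x + hermForm Φ w w -
      hermForm Φ x w - hermForm Φ w x := by
    have e : x = (x - w) + w := by abel
    have e1 : hermForm Φ x x = hermForm Φ (x - w) (x - w) + hermForm Φ w (x - w) +
        (hermForm Φ (x - w) w + hermForm Φ w w) := by
      conv_lhs => rw [e]
      rw [hermForm_add_left, hermForm_add_right, hermForm_add_right]; ring
    have e2 : hermForm Φ x w = hermForm Φ (x - w) w + hermForm Φ w w := by
      conv_lhs => rw [e]
      rw [hermForm_add_left]
    have e3 : hermForm Φ w x = hermForm Φ w (x - w) + hermForm Φ w w := by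
      conv_lhs => rw [e]
      rw [hermForm_add_right]
    rw [e1, e2, e3]; ring
  have h2 := congrArg Complex.re h1
  rw [← conj_hermForm Φ x w] at h2
  simp only [hermForm_self, Complex.sub_re, Complex.add_re, Complex.ofReal_re,
    Complex.conj_re] at h2
  rw [h2]; ring

theorem continuous_polarForm : Continuous fun p : (Fin n → ℂ) × (Fin n → ℂ) =>
    polarForm Φ p.1 p.2 := by
  have : ∀ p : (Fin n → ℂ) × (Fin n → ℂ), polarForm Φ p.1 p.2 =
      (LinearMap.toContinuousLinearMap.toLinearMap ∘ₗ polarForm Φ).toContinuousLinearMap p.1 p.2 :=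
    fun _ => rfl
  simp_rw [this]
  fun_prop

theorem continuous_hermForm : Continuous fun p : (Fin n → ℂ) × (Fin n → ℂ) =>
    hermForm Φ p.1 p.2 := by
  have h := continuous_polarForm Φ
  have h1 : Continuous fun p : (Fin n → ℂ) × (Fin n → ℂ) =>
      polarForm Φ (Complex.I • p.1) (Complex.I • p.2) :=
    h.comp (f := fun p : (Fin n → ℂ) × (Fin n → ℂ) => (Complex.I • p.1, Complex.I • p.2))
      (by fun_prop)
  have h2 : Continuous fun p : (Fin n → ℂ) × (Fin n → ℂ) =>
      polarForm Φ (Complex.I • p.1) p.2 :=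
    h.comp (f := fun p : (Fin n → ℂ) × (Fin n → ℂ) => (Complex.I • p.1, p.2)) (by fun_prop)
  have h3 : Continuous fun p : (Fin n → ℂ) × (Fin n → ℂ) =>
      polarForm Φ p.1 (Complex.I • p.2) :=
    h.comp (f := fun p : (Fin n → ℂ) × (Fin n → ℂ) => (p.1, Complex.I • p.2)) (by fun_prop)
  unfold hermForm
  fun_prop

theorem continuous_holForm : Continuous fun p : (Fin n → ℂ) × (Fin n → ℂ) =>
    holForm Φ p.1 p.2 := by
  have h := continuous_polarForm Φ
  have h1 : Continuous fun p : (Fin n → ℂ) × (Fin n → ℂ) =>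
      polarForm Φ (Complex.I • p.1) (Complex.I • p.2) :=
    h.comp (f := fun p : (Fin n → ℂ) × (Fin n → ℂ) => (Complex.I • p.1, Complex.I • p.2))
      (by fun_prop)
  have h2 : Continuous fun p : (Fin n → ℂ) × (Fin n → ℂ) =>
      polarForm Φ (Complex.I • p.1) p.2 :=
    h.comp (f := fun p : (Fin n → ℂ) × (Fin n → ℂ) => (Complex.I • p.1, p.2)) (by fun_prop)
  have h3 : Continuous fun p : (Fin n → ℂ) × (Fin n → ℂ) =>
      polarForm Φ p.1 (Complex.I • p.2) :=
    h.comp (f := fun p : (Fin n → ℂ) × (Fin n → ℂ) => (p.1, Complex.I • p.2)) (by fun_prop)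
  unfold holForm
  fun_prop

theorem continuous_hermPart : Continuous (hermPart Φ) := by
  have := continuous_quadratic Φ
  unfold hermPart
  fun_prop

theorem differentiable_hermForm_left (y : Fin n → ℂ) : Differentiable ℂ fun x => hermForm Φ x y := by
  let l : (Fin n → ℂ) →ₗ[ℂ] ℂ :=
    { toFun := fun x => hermForm Φ x y
      map_add' := fun a b => hermForm_add_left Φ a b y
      map_smul' := fun c a => hermForm_smul_left Φ c a y }
  exact l.toContinuousLinearMap.differentiable

theorem differentiable_holForm_left (y : Fin n → ℂ) : Differentiable ℂ fun x => holForm Φ x y := by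
  let l : (Fin n → ℂ) →ₗ[ℂ] ℂ :=
    { toFun := fun x => holForm Φ x y
      map_add' := fun a b => holForm_add_left Φ a b y
      map_smul' := fun c a => holForm_smul_left Φ c a y }
  exact l.toContinuousLinearMap.differentiable

theorem differentiable_holForm_self : Differentiable ℂ fun x => holForm Φ x x := by
  let G : (Fin n → ℂ) →ₗ[ℂ] (Fin n → ℂ) →ₗ[ℂ] ℂ := LinearMap.mk₂ ℂ (holForm Φ)
    (holForm_add_left Φ) (holForm_smul_left Φ) (holForm_add_right Φ) (holForm_smul_right Φ)
  have : ∀ x, holForm Φ x x =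
      (LinearMap.toContinuousLinearMap.toLinearMap ∘ₗ G).toContinuousLinearMap x x :=
    fun _ => rfl
  simp_rw [this]
  fun_prop

end RealForms

/-! ### Gaussian bounds -/

theorem exists_pow_mul_exp_le (m : ℕ) {a : ℝ} (ha : 0 < a) :
    ∃ C : ℝ, 0 < C ∧ ∀ t : ℝ, 0 ≤ t → (1 + t) ^ m * Real.exp (-a * t ^ 2) ≤ C := by
  refine ⟨(m + 1) ^ m * Real.exp (1 + 1 / (4 * a)), by positivity, fun t ht => ?_⟩
  have h1 : 1 + t ≤ (m + 1) * Real.exp ((1 + t) / (m + 1)) := by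
    have := Real.add_one_le_exp ((1 + t) / (m + 1))
    have h2 : (1 + t) / (m + 1) ≤ Real.exp ((1 + t) / (m + 1)) := by linarith
    rw [div_le_iff₀ (by positivity)] at h2
    linarith
  have h2 : (1 + t) ^ m ≤ (m + 1) ^ m * Real.exp (1 + t) := by
    refine (pow_le_pow_left₀ (by positivity) h1 m).trans ?_
    rw [mul_pow, ← Real.exp_nat_mul]
    refine mul_le_mul_of_nonneg_left (Real.exp_le_exp.2 ?_) (by positivity)
    rw [mul_div_assoc', div_le_iff₀ (by positivity)]
    nlinarith
  calc (1 + t) ^ m * Real.exp (-a * t ^ 2)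
      ≤ (m + 1) ^ m * Real.exp (1 + t) * Real.exp (-a * t ^ 2) :=
        mul_le_mul_of_nonneg_right h2 (Real.exp_pos _).le
    _ = (m + 1) ^ m * Real.exp (1 + t + -a * t ^ 2) := by rw [mul_assoc, ← Real.exp_add]
    _ ≤ _ := by
        refine mul_le_mul_of_nonneg_left (Real.exp_le_exp.2 ?_) (by positivity)
        have h3 : 0 ≤ a * (t - 1 / (2 * a)) ^ 2 := by positivity
        have h4 : a * (t - 1 / (2 * a)) ^ 2 = a * t ^ 2 - t + 1 / (4 * a) := by
          field_simp; ring
        linarith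

theorem integrable_pow_mul_gaussian {E : Type*} [NormedAddCommGroup E] [NormedSpace ℝ E]
    [FiniteDimensional ℝ E] [MeasurableSpace E] [BorelSpace E] (μ : Measure E)
    [μ.IsAddHaarMeasure] (m : ℕ) {a : ℝ} (ha : 0 < a) :
    Integrable (fun x : E => (1 + ‖x‖) ^ m * Real.exp (-a * ‖x‖ ^ 2)) μ := by
  obtain ⟨C, _, hC⟩ := exists_pow_mul_exp_le (m + (Module.finrank ℝ E + 1)) ha
  have h1 := (integrable_one_add_norm (μ := μ) (E := E)
    (r := ((Module.finrank ℝ E + 1 : ℕ) : ℝ)) (by push_cast; linarith)).const_mul C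
  refine h1.mono' (by
    have : Continuous fun x : E => (1 + ‖x‖) ^ m * Real.exp (-a * ‖x‖ ^ 2) := by fun_prop
    exact this.aestronglyMeasurable) (Eventually.of_forall fun x => ?_)
  rw [Real.norm_of_nonneg (by positivity), Real.rpow_neg (by positivity), Real.rpow_natCast,
    ← div_eq_mul_inv, le_div_iff₀ (by positivity)]
  have := hC ‖x‖ (norm_nonneg x)
  rw [pow_add] at this
  linarith

theorem integrable_gaussian {E : Type*} [NormedAddCommGroup E] [NormedSpace ℝ E]
    [FiniteDimensional ℝ E] [MeasurableSpace E] [BorelSpace E] (μ : Measure E)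
    [μ.IsAddHaarMeasure] {a : ℝ} (ha : 0 < a) :
    Integrable (fun x : E => Real.exp (-a * ‖x‖ ^ 2)) μ := by
  simpa using integrable_pow_mul_gaussian μ 0 ha

/-- A continuous positive definite function which is homogeneous of degree two dominates a multiple
of `‖x‖²`. -/
theorem exists_le_of_homogeneous {E : Type*} [NormedAddCommGroup E] [NormedSpace ℝ E]
    [FiniteDimensional ℝ E] {f : E → ℝ} (hf : Continuous f)
    (hh : ∀ (t : ℝ) x, f (t • x) = t ^ 2 * f x) (hpos : ∀ x, x ≠ 0 → 0 < f x) :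
    ∃ c : ℝ, 0 < c ∧ ∀ x, c * ‖x‖ ^ 2 ≤ f x := by
  rcases subsingleton_or_nontrivial E with hE | hE
  · refine ⟨1, one_pos, fun x => ?_⟩
    have h0 : f 0 = 0 := by simpa using hh 0 0
    rw [Subsingleton.elim x 0, h0]; simp
  · obtain ⟨x0, hx0, hmin⟩ := (isCompact_sphere (0 : E) 1).exists_isMinOn
      (NormedSpace.sphere_nonempty.2 zero_le_one) hf.continuousOn
    have hx0' : x0 ≠ 0 := by
      rintro rfl
      simp at hx0
    refine ⟨f x0, hpos x0 hx0', fun x => ?_⟩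
    by_cases hx : x = 0
    · subst hx
      have h0 : f 0 = 0 := by simpa using hh 0 0
      simp [h0]
    · have hn : 0 < ‖x‖ := norm_pos_iff.2 hx
      have h1 : f x0 ≤ f (‖x‖⁻¹ • x) := hmin (by
        simp [norm_smul, hn.ne'])
      rw [hh] at h1
      have h2 : (‖x‖⁻¹) ^ 2 * ‖x‖ ^ 2 = 1 := by field_simp
      have h3 := mul_le_mul_of_nonneg_right h1 (sq_nonneg ‖x‖)
      calc f x0 * ‖x‖ ^ 2 ≤ (‖x‖⁻¹) ^ 2 * ‖x‖ ^ 2 * f x := by linarith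
        _ = f x := by rw [h2, one_mul]

theorem exists_ge_of_homogeneous {E : Type*} [NormedAddCommGroup E] [NormedSpace ℝ E]
    [FiniteDimensional ℝ E] {f : E → ℝ} (hf : Continuous f)
    (hh : ∀ (t : ℝ) x, f (t • x) = t ^ 2 * f x) :
    ∃ C : ℝ, 0 ≤ C ∧ ∀ x, f x ≤ C * ‖x‖ ^ 2 := by
  obtain ⟨C, hC⟩ := (isCompact_sphere (0 : E) 1).exists_bound_of_continuousOn hf.continuousOn
  refine ⟨max C 0, le_max_right _ _, fun x => ?_⟩
  by_cases hx : x = 0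
  · subst hx
    have h0 : f 0 = 0 := by simpa using hh 0 0
    simp [h0]
  · have hn : 0 < ‖x‖ := norm_pos_iff.2 hx
    have h1 := (le_abs_self _).trans (hC (‖x‖⁻¹ • x) (by simp [norm_smul, hn.ne']))
    rw [hh] at h1
    have h2 : (‖x‖⁻¹) ^ 2 * ‖x‖ ^ 2 = 1 := by field_simp
    have h3 := mul_le_mul_of_nonneg_right (h1.trans (le_max_left C 0)) (sq_nonneg ‖x‖)
    calc f x = (‖x‖⁻¹) ^ 2 * ‖x‖ ^ 2 * f x := by rw [h2, one_mul]
      _ ≤ _ := by linarith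

theorem form_smul_real {n : ℕ} (Φ : QuadraticForm ℝ (Fin n → ℂ)) (t : ℝ) (x : Fin n → ℂ) :
    Φ (t • x) = t ^ 2 * Φ x := by
  rw [QuadraticMap.map_smul, smul_eq_mul]; ring

theorem hermPart_smul_real {n : ℕ} (Φ : QuadraticForm ℝ (Fin n → ℂ)) (t : ℝ) (x : Fin n → ℂ) :
    hermPart Φ (t • x) = t ^ 2 * hermPart Φ x := by
  simp only [hermPart]
  rw [smul_comm Complex.I t x, form_smul_real, form_smul_real]; ring

/-- A strictly convex quadratic form is positive definite. -/
theorem pos_of_strictConvexOn {n : ℕ} {Φ : QuadraticForm ℝ (Fin n → ℂ)}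
    (hΦ : StrictConvexOn ℝ univ Φ) (x : Fin n → ℂ) (hx : x ≠ 0) : 0 < Φ x := by
  have hne : x ≠ -x := fun h => hx (by
    have h2 : (2 : ℝ) • x = 0 := by rw [two_smul]; nth_rewrite 1 [h]; simp
    simpa using h2)
  have h12 : (0 : ℝ) < 1 / 2 := by norm_num
  have := hΦ.2 (mem_univ x) (mem_univ (-x)) hne h12 h12 (by norm_num)
  simp only [smul_neg, add_neg_cancel, QuadraticMap.map_zero, QuadraticMap.map_neg,
    smul_eq_mul] at this
  linarith

theorem hermPart_pos {n : ℕ} {Φ : QuadraticForm ℝ (Fin n → ℂ)}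
    (hΦ : ∀ x, x ≠ 0 → 0 < Φ x) (x : Fin n → ℂ) (hx : x ≠ 0) : 0 < hermPart Φ x := by
  have h1 := hΦ x hx
  have h2 := hΦ (Complex.I • x) (by simp [hx])
  unfold hermPart
  linarith

section Weighted

variable {n : ℕ} {Φ : QuadraticForm ℝ (Fin n → ℂ)} {h : ℝ}

theorem continuous_weight (Φ : QuadraticForm ℝ (Fin n → ℂ)) (h : ℝ) :
    Continuous fun x => Real.exp (-2 * Φ x / h) := by
  have := continuous_quadratic Φ
  fun_prop

theorem integral_weightMeasure (f : (Fin n → ℂ) → ℂ) :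
    ∫ x, f x ∂weightMeasure Φ h = ∫ x, f x * (Real.exp (-2 * Φ x / h) : ℝ) := by
  have hm : Measurable fun x => ENNReal.ofReal (Real.exp (-2 * Φ x / h)) :=
    (ENNReal.continuous_ofReal.comp (continuous_weight Φ h)).measurable
  rw [weightMeasure, integral_withDensity_eq_integral_toReal_smul hm (by simp)]
  refine integral_congr_ae (Eventually.of_forall fun x => ?_)
  simp only [ENNReal.toReal_ofReal (Real.exp_pos _).le, Complex.real_smul, mul_comm]

theorem integrable_weightMeasure_iff {E : Type*} [NormedAddCommGroup E] [NormedSpace ℝ E]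
    {f : (Fin n → ℂ) → E} :
    Integrable f (weightMeasure Φ h) ↔ Integrable fun x => Real.exp (-2 * Φ x / h) • f x := by
  have hm : Measurable fun x => ENNReal.ofReal (Real.exp (-2 * Φ x / h)) :=
    (ENNReal.continuous_ofReal.comp (continuous_weight Φ h)).measurable
  rw [weightMeasure, integrable_withDensity_iff_integrable_smul' hm (by simp)]
  simp only [ENNReal.toReal_ofReal (Real.exp_pos _).le]

/-- A continuous function belongs to `L²(e^{-2Φ/h})` if it is bounded by a continuous function whose
square is integrable against the weight. -/
theorem memLp_weightMeasure_of_le {f : (Fin n → ℂ) → ℂ} (hf : Continuous f)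
    {g : (Fin n → ℂ) → ℝ} (hg : Integrable g)
    (hfg : ∀ x, ‖f x‖ ^ 2 * Real.exp (-2 * Φ x / h) ≤ g x) : MemLp f 2 (weightMeasure Φ h) := by
  rw [memLp_two_iff_integrable_sq_norm hf.aestronglyMeasurable, integrable_weightMeasure_iff]
  have hc := continuous_weight Φ h
  refine hg.mono' ?_ (Eventually.of_forall fun x => ?_)
  · exact (hc.smul (hf.norm.pow 2)).aestronglyMeasurable
  · rw [norm_smul, Real.norm_of_nonneg (Real.exp_pos _).le, Real.norm_of_nonneg (by positivity),
      mul_comm]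
    exact hfg x

theorem exists_rep_eq {f : (Fin n → ℂ) → ℂ} (hf : Entire f) (hm : MemLp f 2 (weightMeasure Φ h)) :
    ∃ u : HPhi Φ h, rep u = f :=
  ⟨⟨hm.toLp f, f, hf, hm.coeFn_toLp⟩, rep_eq _ hf hm.coeFn_toLp⟩

theorem memLp_rep (u : HPhi Φ h) : MemLp (rep u) 2 (weightMeasure Φ h) :=
  (memLp_congr_ae (coeFn_ae_eq_rep u)).1 (Lp.memLp _)

/-- The exponent of the reproducing kernel: `2 Ψ(x, w̄)`, where `Ψ` is the holomorphic quadratic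
form with `Ψ(x, x̄) = Φ(x)`. -/
def kernelExp (Φ : QuadraticForm ℝ (Fin n → ℂ)) (x w : Fin n → ℂ) : ℂ :=
  2 * hermForm Φ x w + holForm Φ x x + conj (holForm Φ w w)

theorem kernelExp_self (x : Fin n → ℂ) : kernelExp Φ x x = 2 * Φ x := by
  rw [kernelExp, hermForm_self, form_eq Φ x]
  apply Complex.ext <;> simp
  ring

theorem conj_kernelExp (x w : Fin n → ℂ) : conj (kernelExp Φ x w) = kernelExp Φ w x := by
  simp only [kernelExp, map_add, map_mul, conj_hermForm, Complex.conj_conj]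
  rw [show conj (2 : ℂ) = 2 from Complex.conj_ofNat 2]
  ring

theorem re_kernelExp (x w : Fin n → ℂ) :
    (kernelExp Φ x w).re = Φ x + Φ w - hermPart Φ (x - w) := by
  rw [hermPart_sub, form_eq Φ x, form_eq Φ w, kernelExp]
  simp
  ring

theorem continuous_kernelExp :
    Continuous fun p : (Fin n → ℂ) × (Fin n → ℂ) => kernelExp Φ p.1 p.2 := by
  have h1 := continuous_hermForm Φ
  have h2 : Continuous fun p : (Fin n → ℂ) × (Fin n → ℂ) => holForm Φ p.1 p.1 :=
    (continuous_holForm Φ).comp (f := fun p : (Fin n → ℂ) × (Fin n → ℂ) => (p.1, p.1))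
      (by fun_prop)
  have h3 : Continuous fun p : (Fin n → ℂ) × (Fin n → ℂ) => holForm Φ p.2 p.2 :=
    (continuous_holForm Φ).comp (f := fun p : (Fin n → ℂ) × (Fin n → ℂ) => (p.2, p.2))
      (by fun_prop)
  exact ((continuous_const.mul h1).add h2).add (Complex.continuous_conj.comp h3)

theorem differentiable_kernelExp (w : Fin n → ℂ) :
    Differentiable ℂ fun x => kernelExp Φ x w := by
  have h1 := differentiable_hermForm_left Φ w
  have h2 := differentiable_holForm_self Φ
  unfold kernelExp
  fun_prop

/-- The (unnormalized) reproducing kernel `e^{2Ψ(x, w̄)/h}`. -/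
def kernelFun (Φ : QuadraticForm ℝ (Fin n → ℂ)) (h : ℝ) (w x : Fin n → ℂ) : ℂ :=
  Complex.exp (kernelExp Φ x w / h)

theorem entire_kernelFun (w : Fin n → ℂ) : Entire (kernelFun Φ h w) :=
  Entire.of_differentiable fun x => by
    have h1 := (differentiable_kernelExp (Φ := Φ) w x).mul_const ((h : ℂ)⁻¹)
    simp only [← div_eq_mul_inv] at h1
    exact h1.cexp

theorem norm_kernelFun (w x : Fin n → ℂ) :
    ‖kernelFun Φ h w x‖ = Real.exp ((Φ x + Φ w - hermPart Φ (x - w)) / h) := by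
  rw [kernelFun, Complex.norm_exp, ← re_kernelExp]
  simp [Complex.div_ofReal_re]

theorem integrable_exp_hermPart (hΦ : ∀ x, x ≠ 0 → 0 < Φ x) {a : ℝ} (ha : 0 < a) :
    Integrable fun z : Fin n → ℂ => Real.exp (-a * hermPart Φ z) := by
  obtain ⟨c, hc, hcb⟩ := exists_le_of_homogeneous (continuous_hermPart Φ)
    (hermPart_smul_real Φ) (hermPart_pos hΦ)
  refine (integrable_gaussian volume (mul_pos ha hc)).mono' ?_ (Eventually.of_forall fun x => ?_)
  · have := continuous_hermPart Φ
    exact (by fun_prop : Continuous fun z => Real.exp (-a * hermPart Φ z)).aestronglyMeasurable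
  · rw [Real.norm_of_nonneg (Real.exp_pos _).le]
    refine Real.exp_le_exp.2 ?_
    nlinarith [mul_le_mul_of_nonneg_left (hcb x) ha.le]

theorem memLp_kernelFun (hΦ : ∀ x, x ≠ 0 → 0 < Φ x) (hh : 0 < h) (w : Fin n → ℂ) :
    MemLp (kernelFun Φ h w) 2 (weightMeasure Φ h) := by
  have h1 := ((integrable_exp_hermPart hΦ (a := 2 / h) (by positivity)).comp_sub_right w).const_mul
    (Real.exp (2 * Φ w / h))
  refine memLp_weightMeasure_of_le (entire_kernelFun w).differentiable.continuous h1 fun x => ?_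
  rw [norm_kernelFun, ← Real.exp_nat_mul, ← Real.exp_add, ← Real.exp_add]
  refine Real.exp_le_exp.2 (le_of_eq ?_)
  push_cast
  field_simp
  ring

/-- The element of `H_Φ` represented by `kernelFun`. -/
def kernelVec (hΦ : ∀ x, x ≠ 0 → 0 < Φ x) (hh : 0 < h) (w : Fin n → ℂ) : HPhi Φ h :=
  Classical.choose (exists_rep_eq (entire_kernelFun w) (memLp_kernelFun hΦ hh w))

theorem rep_kernelVec (hΦ : ∀ x, x ≠ 0 → 0 < Φ x) (hh : 0 < h) (w : Fin n → ℂ) :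
    rep (kernelVec hΦ hh w) = kernelFun Φ h w :=
  Classical.choose_spec (exists_rep_eq (entire_kernelFun w) (memLp_kernelFun hΦ hh w))

/-- The normalizing constant `∫ e^{-2Φ₊(z)/h} dL(z)` of the reproducing kernel. -/
def kernelConst (Φ : QuadraticForm ℝ (Fin n → ℂ)) (h : ℝ) : ℝ :=
  ∫ z : Fin n → ℂ, Real.exp (-2 / h * hermPart Φ z)

theorem kernelConst_pos (hΦ : ∀ x, x ≠ 0 → 0 < Φ x) (hh : 0 < h) : 0 < kernelConst Φ h := by
  have h1 := integrable_exp_hermPart hΦ (a := 2 / h) (by positivity)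
  rw [← neg_div] at h1
  exact integral_exp_pos h1

/-- The exponent `conj 2Ψ(w + z, w̄) - 2Φ(w + z) + 2Φ₊(z)` is a holomorphic function of `z`. -/
theorem conj_kernelExp_add (w z : Fin n → ℂ) :
    conj (kernelExp Φ (w + z) w) - 2 * Φ (w + z) =
      -2 * hermForm Φ z w - 2 * holForm Φ z w - holForm Φ z z - 2 * hermPart Φ z := by
  have h1 : (2 * Φ (w + z) : ℂ) = kernelExp Φ (w + z) (w + z) := (kernelExp_self _).symm
  rw [h1, conj_kernelExp]
  simp only [kernelExp, hermForm_add_left, hermForm_add_right, holForm_add_left,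
    holForm_add_right, map_add, ← hermForm_self, holForm_comm Φ w z]
  ring

/-- The reproducing property of `kernelFun`, from the mean value property of entire functions with
respect to the rotation invariant weight `e^{-2Φ₊/h}`, translated to the point `w`. -/
theorem inner_kernelVec (hΦ : ∀ x, x ≠ 0 → 0 < Φ x) (hh : 0 < h) (w : Fin n → ℂ) (u : HPhi Φ h) :
    inner ℂ (kernelVec hΦ hh w) u = kernelConst Φ h * rep u w := by
  have hin : inner ℂ (kernelVec hΦ hh w) u =
      ∫ x, rep u x * conj (kernelFun Φ h w x) ∂weightMeasure Φ h := by
    rw [Submodule.coe_inner, L2.inner_def]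
    refine integral_congr_ae ?_
    have h1 := coeFn_ae_eq_rep (kernelVec hΦ hh w)
    rw [rep_kernelVec] at h1
    filter_upwards [h1, coeFn_ae_eq_rep u] with x hx1 hx2
    rw [hx1, hx2]
    rfl
  have hint : Integrable (fun x => rep u x * conj (kernelFun Φ h w x)) (weightMeasure Φ h) :=
    (memLp_rep u).integrable_mul (memLp_kernelFun hΦ hh w).star
  rw [integrable_weightMeasure_iff] at hint
  rw [hin, integral_weightMeasure, ← integral_add_left_eq_self _ w]
  have hint2 := hint.comp_add_left w
  -- after the translation by `w` the exponent splits into `-2Φ₊(z)/h` and a part holomorphic in `z`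
  let F : (Fin n → ℂ) → ℂ := fun z => rep u (w + z) *
    Complex.exp ((-2 * hermForm Φ z w - 2 * holForm Φ z w - holForm Φ z z) / h)
  have hF : Differentiable ℂ F := by
    have h1 := differentiable_hermForm_left Φ w
    have h2 := differentiable_holForm_left Φ w
    have h3 := differentiable_holForm_self Φ
    have h4 : Differentiable ℂ fun z => rep u (w + z) :=
      (entire_rep u).differentiable.comp (differentiable_id.const_add w)
    exact h4.mul ((by fun_prop : Differentiable ℂ fun z =>
      (-2 * hermForm Φ z w - 2 * holForm Φ z w - holForm Φ z z) / h).cexp)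
  have hkey : ∀ z, rep u (w + z) * conj (kernelFun Φ h w (w + z)) *
      (Real.exp (-2 * Φ (w + z) / h) : ℝ) = F z * (Real.exp (-2 / h * hermPart Φ z) : ℝ) := by
    intro z
    simp only [F, kernelFun]
    rw [← Complex.exp_conj, mul_assoc, mul_assoc, Complex.ofReal_exp, Complex.ofReal_exp,
      ← Complex.exp_add, ← Complex.exp_add]
    congr 2
    rw [map_div₀, Complex.conj_ofReal]
    have hh' : (h : ℂ) ≠ 0 := by exact_mod_cast hh.ne'
    have := conj_kernelExp_add (Φ := Φ) w z
    rw [sub_eq_iff_eq_add] at this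
    rw [this]
    push_cast
    field_simp
    ring
  simp only [hkey]
  rw [integral_mul_rotationInvariant hF (w := fun z => Real.exp (-2 / h * hermPart Φ z))]
  · have : F 0 = rep u w := by
      simp [F, hermForm_zero_left, holForm]
    rw [this, kernelConst, mul_comm]
    congr 1
    exact integral_ofReal
  · have := continuous_hermPart Φ
    fun_prop
  · intro θ z
    have e : hermPart Φ (circleMap 0 1 θ • z) = hermPart Φ z := by
      have h1 := hermForm_self Φ (circleMap 0 1 θ • z)
      rw [hermForm_smul_left, ← conj_hermForm, hermForm_smul_left, map_mul, conj_hermForm,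
        ← mul_assoc, Complex.mul_conj, hermForm_self, Complex.normSq_eq_norm_sq] at h1
      simp only [norm_circleMap_zero, abs_one, one_pow, Complex.ofReal_one, one_mul] at h1
      exact_mod_cast h1.symm
    rw [e]
  · refine (integrable_congr (Eventually.of_forall fun z => ?_)).1 hint2
    simp only [← hkey, Complex.real_smul]
    ring

theorem norm_kernelVec (hΦ : ∀ x, x ≠ 0 → 0 < Φ x) (hh : 0 < h) (w : Fin n → ℂ) :
    ‖kernelVec hΦ hh w‖ = Real.sqrt (kernelConst Φ h) * Real.exp (Φ w / h) := by
  have h1 := inner_kernelVec hΦ hh w (kernelVec hΦ hh w)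
  rw [rep_kernelVec, kernelFun, kernelExp_self] at h1
  replace h1 := (inner_self_eq_norm_sq_to_K (𝕜 := ℂ) (kernelVec hΦ hh w)).symm.trans h1
  have h2 : ‖kernelVec hΦ hh w‖ ^ 2 = kernelConst Φ h * Real.exp (2 * Φ w / h) := by
    apply Complex.ofReal_injective
    push_cast
    exact h1
  have h3 := kernelConst_pos hΦ hh
  rw [← abs_of_nonneg (norm_nonneg (kernelVec hΦ hh w)), ← Real.sqrt_sq_eq_abs, h2,
    Real.sqrt_mul h3.le]
  congr 1
  rw [← Real.sqrt_sq (Real.exp_pos (Φ w / h)).le, ← Real.exp_nat_mul]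
  congr 2
  push_cast
  ring

/-- The pointwise bound for functions in `H_Φ`. -/
theorem norm_rep_le (hΦ : ∀ x, x ≠ 0 → 0 < Φ x) (hh : 0 < h) (u : HPhi Φ h) (w : Fin n → ℂ) :
    ‖rep u w‖ ≤ (Real.sqrt (kernelConst Φ h))⁻¹ * Real.exp (Φ w / h) * ‖u‖ := by
  have h1 := norm_inner_le_norm (𝕜 := ℂ) (kernelVec hΦ hh w) u
  have h3 := kernelConst_pos hΦ hh
  rw [inner_kernelVec, norm_mul, Complex.norm_real, Real.norm_of_nonneg h3.le,
    norm_kernelVec] at h1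
  have h4 : 0 < Real.sqrt (kernelConst Φ h) := Real.sqrt_pos.2 h3
  have h5 : kernelConst Φ h = Real.sqrt (kernelConst Φ h) * Real.sqrt (kernelConst Φ h) :=
    (Real.mul_self_sqrt h3.le).symm
  have h6 : Real.sqrt (kernelConst Φ h) * ‖rep u w‖ ≤ Real.exp (Φ w / h) * ‖u‖ := by
    refine le_of_mul_le_mul_left ?_ h4
    rwa [← mul_assoc, ← h5, ← mul_assoc]
  rw [mul_assoc, ← mul_le_mul_iff_of_pos_left h4, mul_inv_cancel_left₀ h4.ne']
  exact h6

theorem exists_norm_rep_le (hΦ : ∀ x, x ≠ 0 → 0 < Φ x) (hh : 0 < h) :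
    ∃ C : ℝ, 0 ≤ C ∧ ∀ (u : HPhi Φ h) (w : Fin n → ℂ), ‖rep u w‖ ≤ Real.exp (C * ‖w‖ ^ 2) * (C * ‖u‖) := by
  obtain ⟨C, hC, hCb⟩ := exists_ge_of_homogeneous (continuous_quadratic Φ) (form_smul_real Φ)
  refine ⟨max (C / h) (Real.sqrt (kernelConst Φ h))⁻¹, le_max_of_le_left (by positivity), fun u w => ?_⟩
  refine (norm_rep_le hΦ hh u w).trans ?_
  rw [mul_comm _ (Real.exp _), mul_assoc]
  gcongr ?_ * (?_ * _)
  · refine Real.exp_le_exp.2 ?_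
    refine le_trans ?_ (mul_le_mul_of_nonneg_right (le_max_left _ _) (sq_nonneg _))
    rw [div_mul_eq_mul_div]
    exact div_le_div_of_nonneg_right (hCb w) hh.le
  · exact le_max_right _ _

end Weighted

section Weighted

variable {n : ℕ} {Φ : QuadraticForm ℝ (Fin n → ℂ)} {h : ℝ}

/-- The Bergman projection of an arbitrary `L²` function is entire. -/
theorem entire_bergman (hΦ : ∀ x, x ≠ 0 → 0 < Φ x) (hh : 0 < h)
    (u : Lp ℂ 2 (weightMeasure Φ h)) :
    Entire fun x => ∫ z, kernelFun Φ h z x * u z ∂weightMeasure Φ h := by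
  refine entire_integral (k := fun z x => kernelFun Φ h z x) ?_
    (fun z => (entire_kernelFun z).differentiable) (Lp.aestronglyMeasurable u) ?_
  · have h1 := continuous_kernelExp (Φ := Φ)
    have h2 : Continuous fun p : (Fin n → ℂ) × (Fin n → ℂ) => kernelExp Φ p.2 p.1 :=
      h1.comp (f := fun p : (Fin n → ℂ) × (Fin n → ℂ) => (p.2, p.1)) (by fun_prop)
    exact Complex.continuous_exp.comp (h2.div_const _)
  · intro R
    obtain ⟨c, hc, hcb⟩ := exists_le_of_homogeneous (continuous_hermPart Φ)
      (hermPart_smul_real Φ) (hermPart_pos hΦ)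
    obtain ⟨C, hC, hCb⟩ := exists_ge_of_homogeneous (continuous_quadratic Φ) (form_smul_real Φ)
    -- a square integrable majorant of the kernel, uniform in `‖x‖ ≤ R`
    let G : (Fin n → ℂ) → ℝ := fun z =>
      Real.exp ((C * R ^ 2 + Φ z - c / 2 * ‖z‖ ^ 2 + c * R ^ 2) / h)
    have hGc : Continuous G := by
      have := continuous_quadratic Φ
      fun_prop
    have hG : MemLp (fun z => (G z : ℂ)) 2 (weightMeasure Φ h) := by
      have h1 := (integrable_gaussian (volume : Measure (Fin n → ℂ))
        (a := c / h) (by positivity)).const_mul (Real.exp (2 * (C * R ^ 2 + c * R ^ 2) / h))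
      refine memLp_weightMeasure_of_le (Complex.continuous_ofReal.comp hGc) h1 fun z => ?_
      simp only [G]
      rw [Complex.norm_real, Real.norm_of_nonneg (Real.exp_pos _).le, ← Real.exp_nat_mul,
        ← Real.exp_add, ← Real.exp_add]
      refine Real.exp_le_exp.2 (le_of_eq ?_)
      push_cast
      field_simp
      ring
    refine ⟨fun z => ‖(G z : ℂ) * u z‖, (hG.integrable_mul (Lp.memLp u)).norm,
      Eventually.of_forall fun z x hx => ?_⟩
    beta_reduce
    rw [norm_mul, norm_mul]
    refine mul_le_mul_of_nonneg_right ?_ (norm_nonneg _)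
    rw [norm_kernelFun, Complex.norm_real, Real.norm_of_nonneg (Real.exp_pos _).le]
    refine Real.exp_le_exp.2 (div_le_div_of_nonneg_right ?_ hh.le)
    have h1 := hCb x
    have h2 := hcb (x - z)
    have h3 : ‖z‖ ≤ ‖x - z‖ + ‖x‖ := by
      have := norm_sub_le x (x - z)
      rw [sub_sub_cancel] at this
      linarith
    have h4 : ‖x‖ ^ 2 ≤ R ^ 2 := pow_le_pow_left₀ (norm_nonneg _) hx 2
    have h5 : ‖z‖ ^ 2 ≤ 2 * ‖x - z‖ ^ 2 + 2 * ‖x‖ ^ 2 := by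
      have := pow_le_pow_left₀ (norm_nonneg z) h3 2
      nlinarith [sq_nonneg (‖x - z‖ - ‖x‖)]
    nlinarith [mul_le_mul_of_nonneg_left h4 hC, mul_le_mul_of_nonneg_left h4 hc.le,
      mul_le_mul_of_nonneg_left h5 hc.le]

/-- `H_Φ` is a closed subspace of `L²`: limits are reproduced by the Bergman projection. -/
theorem isClosed_HPhi (hΦ : ∀ x, x ≠ 0 → 0 < Φ x) (hh : 0 < h) :
    IsClosed (HPhi Φ h : Set (Lp ℂ 2 (weightMeasure Φ h))) := by
  refine IsSeqClosed.isClosed fun u v hu hv => ?_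
  have hc : (kernelConst Φ h : ℂ) ≠ 0 := by exact_mod_cast (kernelConst_pos hΦ hh).ne'
  let f : (Fin n → ℂ) → ℂ := fun x =>
    (kernelConst Φ h : ℂ)⁻¹ * ∫ z, kernelFun Φ h z x * v z ∂weightMeasure Φ h
  have hf : Entire f := (entire_bergman hΦ hh v).smul ((kernelConst Φ h : ℂ)⁻¹)
  have hinner : ∀ x (w : Lp ℂ 2 (weightMeasure Φ h)),
      inner ℂ (kernelVec hΦ hh x : Lp ℂ 2 (weightMeasure Φ h)) w =
      ∫ z, kernelFun Φ h z x * w z ∂weightMeasure Φ h := by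
    intro x w
    rw [L2.inner_def]
    refine integral_congr_ae ?_
    have h1 := coeFn_ae_eq_rep (kernelVec hΦ hh x)
    rw [rep_kernelVec] at h1
    filter_upwards [h1] with z hz
    rw [hz]
    change w z * conj (kernelFun Φ h x z) = _
    rw [mul_comm, kernelFun, kernelFun, ← Complex.exp_conj, map_div₀, conj_kernelExp,
      Complex.conj_ofReal]
  let u' : ℕ → HPhi Φ h := fun k => ⟨u k, hu k⟩
  -- by the reproducing property, `L²` convergence implies pointwise convergence
  have hpt : ∀ x, Tendsto (fun k => rep (u' k) x) atTop (𝓝 (f x)) := by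
    intro x
    have h1 : Tendsto (fun k => inner ℂ (kernelVec hΦ hh x : Lp ℂ 2 (weightMeasure Φ h)) (u k))
        atTop (𝓝 (inner ℂ (kernelVec hΦ hh x : Lp ℂ 2 (weightMeasure Φ h)) v)) :=
      tendsto_const_nhds.inner hv
    have h2 := h1.const_mul (kernelConst Φ h : ℂ)⁻¹
    rw [hinner x v] at h2
    refine h2.congr fun k => ?_
    have h3 := inner_kernelVec hΦ hh x (u' k)
    rw [Submodule.coe_inner] at h3
    change (kernelConst Φ h : ℂ)⁻¹ * inner ℂ (kernelVec hΦ hh x : Lp ℂ 2 (weightMeasure Φ h))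
      (u' k : Lp ℂ 2 (weightMeasure Φ h)) = _
    rw [h3, inv_mul_cancel_left₀ hc]
  obtain ⟨ns, _, hns2⟩ := (tendstoInMeasure_of_tendsto_Lp hv).exists_seq_tendsto_ae
  refine ⟨f, hf, ?_⟩
  have h4 : ∀ᵐ z ∂weightMeasure Φ h, ∀ k, u k z = rep (u' k) z :=
    ae_all_iff.2 fun k => coeFn_ae_eq_rep (u' k)
  filter_upwards [hns2, h4] with z hz1 hz2
  have hns : Tendsto ns atTop atTop := by
    have : StrictMono ns := by assumption
    exact this.tendsto_atTop
  refine tendsto_nhds_unique hz1 (((hpt z).comp hns).congr fun k => ?_)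
  simp only [Function.comp, hz2]

theorem completeSpace_HPhi (hΦ : ∀ x, x ≠ 0 → 0 < Φ x) (hh : 0 < h) :
    CompleteSpace (HPhi Φ h) :=
  (isClosed_HPhi hΦ hh).completeSpace_coe

end Weighted

/-! ### Unitary operators from equality of Gram matrices -/

theorem denseRange_linearCombination {ι E : Type*} [NormedAddCommGroup E] [InnerProductSpace ℂ E]
    [CompleteSpace E] (e : ι → E) (he : ∀ u, (∀ i, inner ℂ (e i) u = 0) → u = 0) :
    DenseRange (Finsupp.linearCombination ℂ e) := by
  have h1 : (LinearMap.range (Finsupp.linearCombination ℂ e)).topologicalClosure = ⊤ := by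
    rw [Submodule.topologicalClosure_eq_top_iff, Submodule.eq_bot_iff]
    intro u hu
    refine he u fun i => ?_
    rw [Submodule.mem_orthogonal] at hu
    refine hu (e i) ⟨Finsupp.single i 1, by simp⟩
  have := Submodule.dense_iff_topologicalClosure_eq_top.2 h1
  rwa [LinearMap.coe_range] at this

theorem norm_linearCombination_eq {ι E F : Type*} [NormedAddCommGroup E] [InnerProductSpace ℂ E]
    [NormedAddCommGroup F] [InnerProductSpace ℂ F] (e : ι → E) (f : ι → F)
    (hef : ∀ i j, inner ℂ (e i) (e j) = inner ℂ (f i) (f j)) (x : ι →₀ ℂ) :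
    ‖Finsupp.linearCombination ℂ e x‖ = ‖Finsupp.linearCombination ℂ f x‖ := by
  have h1 : inner ℂ (Finsupp.linearCombination ℂ e x) (Finsupp.linearCombination ℂ e x) =
      inner ℂ (Finsupp.linearCombination ℂ f x) (Finsupp.linearCombination ℂ f x) := by
    simp only [Finsupp.linearCombination_apply, Finsupp.sum, sum_inner, inner_sum,
      inner_smul_left, inner_smul_right, hef]
  rw [inner_self_eq_norm_sq_to_K, inner_self_eq_norm_sq_to_K] at h1
  have h2 : ‖Finsupp.linearCombination ℂ e x‖ ^ 2 = ‖Finsupp.linearCombination ℂ f x‖ ^ 2 := by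
    exact_mod_cast h1
  exact (sq_eq_sq₀ (norm_nonneg _) (norm_nonneg _)).1 h2

/-- Two total families in Hilbert spaces with the same Gram matrix are unitarily equivalent. -/
theorem exists_unitary_of_gram {ι E F : Type*} [NormedAddCommGroup E] [InnerProductSpace ℂ E]
    [CompleteSpace E] [NormedAddCommGroup F] [InnerProductSpace ℂ F] [CompleteSpace F]
    (e : ι → E) (f : ι → F) (hef : ∀ i j, inner ℂ (e i) (e j) = inner ℂ (f i) (f j))
    (he : ∀ u, (∀ i, inner ℂ (e i) u = 0) → u = 0)
    (hf : ∀ u, (∀ i, inner ℂ (f i) u = 0) → u = 0) :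
    ∃ T : E ≃ₗᵢ[ℂ] F, ∀ i, T (e i) = f i := by
  have hde := denseRange_linearCombination e he
  have hdf := denseRange_linearCombination f hf
  have hn := norm_linearCombination_eq e f hef
  refine ⟨LinearEquiv.extendOfIsometry (LinearEquiv.refl ℂ (ι →₀ ℂ)) (Finsupp.linearCombination ℂ e)
    (Finsupp.linearCombination ℂ f) hde hdf (fun x => (hn x).symm), fun i => ?_⟩
  have h1 := LinearEquiv.extendOfIsometry_eq (LinearEquiv.refl ℂ (ι →₀ ℂ))
    (Finsupp.linearCombination ℂ e) (Finsupp.linearCombination ℂ f) hde hdf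
    (fun x => (hn x).symm) (Finsupp.single i 1)
  simpa using h1

/-! ### The phase function of a canonical transformation -/

theorem fderiv_form {n : ℕ} (Φ : QuadraticForm ℝ (Fin n → ℂ)) (x v : Fin n → ℂ) :
    fderiv ℝ Φ x v = 2 * polarForm Φ x v := by
  let b := (LinearMap.toContinuousLinearMap.toLinearMap ∘ₗ polarForm Φ).toContinuousLinearMap
  have hb : ∀ x y, b x y = polarForm Φ x y := fun _ _ => rfl
  have h1 : (Φ : (Fin n → ℂ) → ℝ) = fun x => b x x := by
    funext x; rw [hb, polarForm_self]
  have h2 : HasFDerivAt (fun x => b x x) (b x + b.flip x) x := by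
    exact (b.hasFDerivAt (x := x) |>.clm_apply (hasFDerivAt_id x)).congr_fderiv (by ext; simp)
  rw [h1, h2.fderiv]
  simp only [_root_.add_apply, ContinuousLinearMap.flip_apply, hb]
  rw [polarForm_comm Φ v]; ring

/-- The momentum `(2/i) ∂_x Φ(x)` of the point of `Λ_Φ` above `x`. -/
def momentum {n : ℕ} (Φ : QuadraticForm ℝ (Fin n → ℂ)) (x : Fin n → ℂ) : Fin n → ℂ :=
  fun j => 2 / Complex.I * wirtinger Φ j x

theorem momentum_dot {n : ℕ} (Φ : QuadraticForm ℝ (Fin n → ℂ)) (x v : Fin n → ℂ) :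
    ∑ j, momentum Φ x j * v j =
      -2 * Complex.I * polarForm Φ x v - 2 * polarForm Φ x (Complex.I • v) := by
  have h1 : ∀ j, momentum Φ x j = -2 * Complex.I * (polarForm Φ x (Pi.single j 1) : ℝ)
      - 2 * (polarForm Φ x (Pi.single j Complex.I) : ℝ) := by
    intro j
    have hI := Complex.I_ne_zero
    simp only [momentum, wirtinger, fderiv_form]
    rw [div_eq_mul_inv, Complex.inv_I]
    push_cast
    linear_combination (-2 * (polarForm Φ x (Pi.single j Complex.I) : ℂ)) * Complex.I_sq * (-1)
  have h2 : ∀ j (w : ℂ), (Pi.single j w : Fin n → ℂ) =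
      w.re • (Pi.single j 1 : Fin n → ℂ) + w.im • (Pi.single j Complex.I : Fin n → ℂ) := by
    intro j w
    funext i
    by_cases hij : i = j
    · subst hij
      simp
    · simp [Pi.single_eq_of_ne hij]
  have h3 : ∀ w : Fin n → ℂ, w = ∑ j, Pi.single j (w j) := fun w =>
    (Finset.univ_sum_single w).symm
  have h4 : ∀ w : Fin n → ℂ, polarForm Φ x w = ∑ j, ((w j).re * polarForm Φ x (Pi.single j 1)
      + (w j).im * polarForm Φ x (Pi.single j Complex.I)) := by
    intro w
    conv_lhs => rw [h3 w]
    rw [map_sum]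
    refine Finset.sum_congr rfl fun j _ => ?_
    rw [h2, map_add, map_smul, map_smul, smul_eq_mul, smul_eq_mul]
  rw [h4 v, h4 (Complex.I • v)]
  push_cast
  rw [Finset.mul_sum, Finset.mul_sum, ← Finset.sum_sub_distrib]
  refine Finset.sum_congr rfl fun j _ => ?_
  rw [h1]
  have : v j = (v j).re + (v j).im * Complex.I := (Complex.re_add_im _).symm
  conv_lhs => rw [this]
  simp only [Pi.smul_apply, smul_eq_mul, Complex.mul_re, Complex.mul_im, Complex.I_re,
    Complex.I_im, zero_mul, one_mul, zero_sub, zero_add]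
  push_cast
  linear_combination (-2 * (polarForm Φ x (Pi.single j 1) : ℂ) * (v j).im) * Complex.I_sq

section Phase

variable {n : ℕ} {q : QuadraticMap ℝ (Fin n ⊕ Fin n → ℝ) ℂ} (N : NormalForm q)

theorem NormalForm.pos (x : Fin n → ℂ) (hx : x ≠ 0) : 0 < N.Φ x :=
  pos_of_strictConvexOn N.strictConvex x hx

/-- Every point of `ℂⁿ` is the base point of the image of a real point under `κ`. -/
theorem NormalForm.exists_real (x : Fin n → ℂ) : ∃ X : Fin n ⊕ Fin n → ℝ,
    N.κ (realPoint X) = Sum.elim x (momentum N.Φ x) := by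
  have h1 : Sum.elim x (momentum N.Φ x) ∈ lagrangian N.Φ := ⟨x, rfl⟩
  rw [← N.weight] at h1
  exact h1

theorem NormalForm.eq_momentum (X : Fin n ⊕ Fin n → ℝ) :
    N.κ (realPoint X) = Sum.elim (fun j => N.κ (realPoint X) (Sum.inl j))
      (momentum N.Φ fun j => N.κ (realPoint X) (Sum.inl j)) := by
  have h1 : N.κ (realPoint X) ∈ lagrangian N.Φ := by
    rw [← N.weight]; exact ⟨X, rfl⟩
  obtain ⟨x, hx⟩ := h1
  rw [← hx]
  rfl

theorem realPoint_add_I_smul (X : Fin n ⊕ Fin n → ℂ) :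
    X = realPoint (fun a => (X a).re) + Complex.I • realPoint (fun a => (X a).im) := by
  funext a
  simp only [realPoint, Pi.add_apply, Pi.smul_apply, smul_eq_mul]
  rw [mul_comm, Complex.re_add_im]

theorem im_sum_conj (X : Fin n ⊕ Fin n → ℂ) :
    ((∑ j, conj (X (Sum.inr j)) * X (Sum.inl j)).im : ℂ) =
      sympForm (realPoint fun a => (X a).re) (realPoint fun a => (X a).im) := by
  simp only [sympForm, realPoint, Complex.im_sum]
  push_cast
  refine Finset.sum_congr rfl fun j _ => ?_
  simp only [Complex.mul_im, Complex.conj_re, Complex.conj_im]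
  push_cast
  ring

/-- The Lagrangian plane `κ⁻¹({x = 0})` is strictly definite with respect to `ℝ²ⁿ`. -/
theorem NormalForm.im_pos_of_fiber (X : Fin n ⊕ Fin n → ℂ) (hX : X ≠ 0)
    (h0 : ∀ j, N.κ X (Sum.inl j) = 0) :
    0 < (∑ j, conj (X (Sum.inr j)) * X (Sum.inl j)).im := by
  set X1 : Fin n ⊕ Fin n → ℝ := fun a => (X a).re
  set X2 : Fin n ⊕ Fin n → ℝ := fun a => (X a).im
  set x1 : Fin n → ℂ := fun j => N.κ (realPoint X1) (Sum.inl j) with hx1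
  set x2 : Fin n → ℂ := fun j => N.κ (realPoint X2) (Sum.inl j) with hx2
  have hdec : X = realPoint X1 + Complex.I • realPoint X2 := realPoint_add_I_smul X
  -- write `X = X₁ + i X₂` with `X₁`, `X₂` real; the base points of `κ X₁` and `κ X₂` satisfy
  -- `x₁ = -i x₂`, so that the form reduces to `4 Φ₊(x₂)`
  have h12 : x1 = -(Complex.I • x2) := by
    funext j
    have := h0 j
    rw [hdec, map_add, map_smul] at this
    simpa [hx1, hx2] using eq_neg_of_add_eq_zero_left this
  have h3 : x2 ≠ 0 := by
    intro h
    have hx1' : x1 = 0 := by rw [h12, h]; simp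
    have e2 : N.κ (realPoint X2) = N.κ (realPoint (0 : Fin n ⊕ Fin n → ℝ)) := by
      have z0 : N.κ (realPoint (0 : Fin n ⊕ Fin n → ℝ)) = 0 := by
        have : realPoint (0 : Fin n ⊕ Fin n → ℝ) = 0 := by funext a; simp [realPoint]
        rw [this, map_zero]
      rw [N.eq_momentum X2, N.eq_momentum 0]
      congr 1
      · rw [z0]; exact h
      · rw [z0]; exact congrArg _ h
    have e1 : N.κ (realPoint X1) = N.κ (realPoint (0 : Fin n ⊕ Fin n → ℝ)) := by
      have z0 : N.κ (realPoint (0 : Fin n ⊕ Fin n → ℝ)) = 0 := by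
        have : realPoint (0 : Fin n ⊕ Fin n → ℝ) = 0 := by funext a; simp [realPoint]
        rw [this, map_zero]
      rw [N.eq_momentum X1, N.eq_momentum 0]
      congr 1
      · rw [z0]; exact hx1'
      · rw [z0]; exact congrArg _ hx1'
    apply hX
    rw [hdec, N.κ.injective e1, N.κ.injective e2]
    funext a; simp [realPoint]
  have h4 := im_sum_conj X
  rw [← N.canonical, N.eq_momentum X1, N.eq_momentum X2] at h4
  simp only [sympForm, Sum.elim_inr, Sum.elim_inl] at h4
  rw [Finset.sum_sub_distrib] at h4
  change _ = ∑ j, momentum N.Φ x1 j * x2 j - ∑ j, momentum N.Φ x2 j * x1 j at h4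
  rw [momentum_dot, momentum_dot, h12] at h4
  have h5 : Complex.I • Complex.I • x2 = -x2 := by
    rw [smul_smul, Complex.I_mul_I, neg_one_smul]
  simp only [map_neg, LinearMap.neg_apply, smul_neg, h5, neg_neg, polarForm_self,
    polarForm_comm N.Φ x2] at h4
  have h6 : (∑ j, conj (X (Sum.inr j)) * X (Sum.inl j)).im = 4 * hermPart N.Φ x2 := by
    apply Complex.ofReal_injective
    rw [h4, hermPart]
    push_cast
    ring
  rw [h6]
  have := hermPart_pos N.pos x2 h3
  linarith

/-- The linear map `X ↦ (π κ X, π X)`, where `π (x, ξ) = x`. -/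
def NormalForm.baseMap : (Fin n ⊕ Fin n → ℂ) →ₗ[ℂ] (Fin n ⊕ Fin n → ℂ) where
  toFun X := Sum.elim (fun j => N.κ X (Sum.inl j)) (fun j => X (Sum.inl j))
  map_add' X Y := by
    funext a; cases a <;> simp
  map_smul' c X := by
    funext a; cases a <;> simp

theorem NormalForm.baseMap_injective : Function.Injective N.baseMap := by
  rw [injective_iff_map_eq_zero]
  intro X hX
  by_contra hne
  have h1 := N.im_pos_of_fiber X hne fun j => congrFun hX (Sum.inl j)
  have h2 : ∀ j, X (Sum.inl j) = 0 := fun j => congrFun hX (Sum.inr j)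
  simp [h2] at h1

/-- The graph of `κ` is parametrized by its base points `(x, y)`: the point `(y, η)` such that
`κ (y, η)` lies above `x`. -/
def NormalForm.lift : (Fin n ⊕ Fin n → ℂ) ≃ₗ[ℂ] (Fin n ⊕ Fin n → ℂ) :=
  (LinearEquiv.ofInjectiveEndo N.baseMap N.baseMap_injective).symm

theorem NormalForm.baseMap_lift (v : Fin n ⊕ Fin n → ℂ) : N.baseMap (N.lift v) = v :=
  LinearEquiv.apply_symm_apply (LinearEquiv.ofInjectiveEndo N.baseMap N.baseMap_injective) v

theorem NormalForm.lift_baseMap (X : Fin n ⊕ Fin n → ℂ) : N.lift (N.baseMap X) = X :=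
  LinearEquiv.symm_apply_apply (LinearEquiv.ofInjectiveEndo N.baseMap N.baseMap_injective) X

theorem NormalForm.lift_inl (x y : Fin n → ℂ) (j : Fin n) :
    N.lift (Sum.elim x y) (Sum.inl j) = y j :=
  congrFun (N.baseMap_lift (Sum.elim x y)) (Sum.inr j)

theorem NormalForm.κ_lift_inl (x y : Fin n → ℂ) (j : Fin n) :
    N.κ (N.lift (Sum.elim x y)) (Sum.inl j) = x j :=
  congrFun (N.baseMap_lift (Sum.elim x y)) (Sum.inl j)

/-- The symmetric bilinear form `((y, η), (y', η')) ↦ ξ · x' - η · y'` on the graph of `κ`, where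
`(x, ξ) = κ (y, η)` and `(x', ξ') = κ (y', η')`. -/
def NormalForm.graphForm (X Y : Fin n ⊕ Fin n → ℂ) : ℂ :=
  ∑ j, (N.κ X (Sum.inr j) * N.κ Y (Sum.inl j) - X (Sum.inr j) * Y (Sum.inl j))

theorem NormalForm.graphForm_comm (X Y : Fin n ⊕ Fin n → ℂ) :
    N.graphForm X Y = N.graphForm Y X := by
  have h := N.canonical X Y
  simp only [sympForm, graphForm, Finset.sum_sub_distrib] at h ⊢
  linear_combination h

theorem NormalForm.graphForm_add_left (X Y Z : Fin n ⊕ Fin n → ℂ) :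
    N.graphForm (X + Y) Z = N.graphForm X Z + N.graphForm Y Z := by
  simp only [graphForm, map_add, Pi.add_apply, ← Finset.sum_add_distrib]
  exact Finset.sum_congr rfl fun j _ => by ring

theorem NormalForm.graphForm_smul_left (c : ℂ) (X Z : Fin n ⊕ Fin n → ℂ) :
    N.graphForm (c • X) Z = c * N.graphForm X Z := by
  simp only [graphForm, map_smul, Pi.smul_apply, smul_eq_mul, Finset.mul_sum]
  exact Finset.sum_congr rfl fun j _ => by ring

theorem NormalForm.graphForm_add_right (X Y Z : Fin n ⊕ Fin n → ℂ) :
    N.graphForm X (Y + Z) = N.graphForm X Y + N.graphForm X Z := by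
  rw [graphForm_comm, graphForm_add_left, graphForm_comm, N.graphForm_comm Z]

theorem NormalForm.graphForm_smul_right (c : ℂ) (X Z : Fin n ⊕ Fin n → ℂ) :
    N.graphForm X (c • Z) = c * N.graphForm X Z := by
  rw [graphForm_comm, graphForm_smul_left, graphForm_comm]

/-- `graphForm` in the coordinates `(x, y)`, as a continuous bilinear form. -/
def NormalForm.phaseForm :
    (Fin n ⊕ Fin n → ℂ) →L[ℂ] (Fin n ⊕ Fin n → ℂ) →L[ℂ] ℂ :=
  (LinearMap.toContinuousLinearMap.toLinearMap ∘ₗ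
    (LinearMap.mk₂ ℂ (fun v w => N.graphForm (N.lift v) (N.lift w))
      (fun a b c => by simp only [map_add, N.graphForm_add_left])
      (fun r a c => by simp only [map_smul, N.graphForm_smul_left, smul_eq_mul])
      (fun a b c => by simp only [map_add, N.graphForm_add_right])
      (fun r a c => by
        simp only [map_smul, N.graphForm_smul_right, smul_eq_mul]))).toContinuousLinearMap

theorem NormalForm.phaseForm_apply (v w : Fin n ⊕ Fin n → ℂ) :
    N.phaseForm v w = N.graphForm (N.lift v) (N.lift w) := rfl

theorem NormalForm.phaseForm_comm (v w : Fin n ⊕ Fin n → ℂ) :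
    N.phaseForm v w = N.phaseForm w v := by
  rw [phaseForm_apply, graphForm_comm]; rfl

/-- The differential of the phase: `dφ = ξ · dx - η · dy`. -/
theorem NormalForm.phaseForm_elim (v : Fin n ⊕ Fin n → ℂ) (x y : Fin n → ℂ) :
    N.phaseForm v (Sum.elim x y) =
      ∑ j, N.κ (N.lift v) (Sum.inr j) * x j - ∑ j, N.lift v (Sum.inr j) * y j := by
  rw [phaseForm_apply, graphForm]
  simp only [κ_lift_inl, lift_inl, Finset.sum_sub_distrib]

/-- The holomorphic phase function `φ(x, y)` of the FBI transform, a generating function of `κ`: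
`κ (y, -∂_y φ) = (x, ∂_x φ)`. -/
def NormalForm.phase (v : Fin n ⊕ Fin n → ℂ) : ℂ := N.phaseForm v v / 2

theorem NormalForm.hasFDerivAt_phase (v : Fin n ⊕ Fin n → ℂ) :
    HasFDerivAt N.phase (N.phaseForm v) v := by
  have h := ((N.phaseForm.hasFDerivAt (x := v)).clm_apply (hasFDerivAt_id v)).mul_const (2⁻¹ : ℂ)
  have e : (fun v => N.phaseForm v (id v) * 2⁻¹) = N.phase := by
    funext v; simp [phase, div_eq_mul_inv]
  rw [e] at h
  refine h.congr_fderiv (ContinuousLinearMap.ext fun w => ?_)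
  simp only [_root_.add_apply, _root_.smul_apply,
    ContinuousLinearMap.comp_apply, ContinuousLinearMap.flip_apply, id, smul_eq_mul,
    ContinuousLinearMap.coe_id']
  rw [N.phaseForm_comm w v]; ring

/-- Inclusion of `ℝⁿ` into `ℂⁿ`. -/
def ofRealVec (y : Fin n → ℝ) : Fin n → ℂ := fun j => (y j : ℂ)

/-- The quadratic form `Im ∂_y² φ` on `ℝⁿ`. -/
def NormalForm.imForm (y : Fin n → ℝ) : ℝ :=
  (N.phaseForm (Sum.elim 0 (ofRealVec y)) (Sum.elim 0 (ofRealVec y))).im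

theorem NormalForm.imForm_pos (y : Fin n → ℝ) (hy : y ≠ 0) : 0 < N.imForm y := by
  have hne : N.lift (Sum.elim 0 (ofRealVec y)) ≠ 0 := by
    intro h
    apply hy
    funext j
    have := N.lift_inl 0 (ofRealVec y) j
    rw [h] at this
    simpa [ofRealVec] using this.symm
  have h1 := N.im_pos_of_fiber _ hne fun j => N.κ_lift_inl _ _ j
  rw [imForm, phaseForm_elim]
  simp only [lift_inl] at h1
  simp only [ofRealVec, Pi.zero_apply, mul_zero, Finset.sum_const_zero, zero_sub, Complex.neg_im,
    Complex.im_sum, Complex.mul_im, Complex.conj_re, Complex.conj_im, Complex.ofReal_re,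
    Complex.ofReal_im, zero_add] at h1 ⊢
  rw [← Finset.sum_neg_distrib]
  simpa using h1

theorem elim_add (x x' y y' : Fin n → ℂ) :
    (Sum.elim (x + x') (y + y') : Fin n ⊕ Fin n → ℂ) = Sum.elim x y + Sum.elim x' y' := by
  funext a; cases a <;> simp

/-- `-Im φ(x, y) = Φ(x) - Im ∂_y²φ (y - y(x)) / 2`, where `κ (y(x), η(x))` lies above `x` and
`(y(x), η(x))` is real. -/
theorem NormalForm.exists_im_phase (x : Fin n → ℂ) : ∃ y₀ : Fin n → ℝ, ∀ y : Fin n → ℝ,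
    (N.phase (Sum.elim x (ofRealVec y))).im = -N.Φ x + N.imForm (y - y₀) / 2 := by
  obtain ⟨X, hX⟩ := N.exists_real x
  refine ⟨fun j => X (Sum.inl j), fun y => ?_⟩
  set y₀ : Fin n → ℝ := fun j => X (Sum.inl j)
  have hl : N.lift (Sum.elim x (ofRealVec y₀)) = realPoint X := by
    rw [← N.lift_baseMap (realPoint X)]
    congr 1
    funext a
    cases a with
    | inl j => simp [baseMap, hX]
    | inr j => simp [baseMap, realPoint, ofRealVec, y₀]
  have hdec : Sum.elim x (ofRealVec y) =
      Sum.elim x (ofRealVec y₀) + Sum.elim (0 : Fin n → ℂ) (ofRealVec (y - y₀)) := by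
    rw [← elim_add, add_zero]
    congr 1
    funext j
    simp [ofRealVec]
  -- expand about `y₀`: the linear term is real, because its covector is
  have h1 : N.phaseForm (Sum.elim x (ofRealVec y)) (Sum.elim x (ofRealVec y)) =
      N.phaseForm (Sum.elim x (ofRealVec y₀)) (Sum.elim x (ofRealVec y₀)) +
      2 * N.phaseForm (Sum.elim x (ofRealVec y₀)) (Sum.elim 0 (ofRealVec (y - y₀))) +
      N.phaseForm (Sum.elim 0 (ofRealVec (y - y₀))) (Sum.elim 0 (ofRealVec (y - y₀))) := by
    rw [hdec]
    simp only [map_add, _root_.add_apply]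
    rw [N.phaseForm_comm (Sum.elim 0 (ofRealVec (y - y₀))) (Sum.elim x (ofRealVec y₀))]
    ring
  have h2 : (N.phaseForm (Sum.elim x (ofRealVec y₀)) (Sum.elim x (ofRealVec y₀))).im
      = -2 * N.Φ x := by
    rw [phaseForm_elim, hl, hX]
    simp only [Sum.elim_inr]
    rw [momentum_dot, polarForm_self]
    have : (∑ j, realPoint X (Sum.inr j) * ofRealVec y₀ j).im = 0 := by
      simp [Complex.im_sum, realPoint, ofRealVec]
    rw [Complex.sub_im, this]
    simp
  have h3 : (N.phaseForm (Sum.elim x (ofRealVec y₀)) (Sum.elim 0 (ofRealVec (y - y₀)))).im = 0 := by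
    rw [phaseForm_elim, hl]
    simp [Complex.im_sum, realPoint, ofRealVec]
  have h4 : (N.phase (Sum.elim x (ofRealVec y))).im =
      (N.phaseForm (Sum.elim x (ofRealVec y)) (Sum.elim x (ofRealVec y))).im / 2 := by
    rw [phase]
    exact Complex.div_ofNat_im _ 2
  rw [h4, h1, Complex.add_im, Complex.add_im, h2, Complex.mul_im, h3]
  simp only [imForm]
  simp
  ring

/-- A bound for `-Im φ(x, y)`. -/
theorem NormalForm.exists_im_phase_ge : ∃ c C : ℝ, 0 < c ∧ 0 ≤ C ∧
    ∀ (x : Fin n → ℂ) (y : Fin n → ℝ),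
      -(N.phase (Sum.elim x (ofRealVec y))).im ≤ C * ‖x‖ ^ 2 - c * ‖y‖ ^ 2 := by
  have hcont : Continuous N.imForm := by
    unfold imForm
    have h1 : Continuous fun y : Fin n → ℝ =>
        (Sum.elim 0 (ofRealVec y) : Fin n ⊕ Fin n → ℂ) := by
      refine continuous_pi fun a => ?_
      cases a with
      | inl j => exact continuous_const
      | inr j => exact Complex.continuous_ofReal.comp (continuous_apply j)
    fun_prop
  have hhom : ∀ (t : ℝ) y, N.imForm (t • y) = t ^ 2 * N.imForm y := by
    intro t y
    have : (Sum.elim 0 (ofRealVec (t • y)) : Fin n ⊕ Fin n → ℂ) =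
        (t : ℂ) • Sum.elim (0 : Fin n → ℂ) (ofRealVec y) := by
      funext a; cases a <;> simp [ofRealVec]
    simp only [imForm]
    rw [this]
    simp only [map_smul, _root_.smul_apply, smul_eq_mul,
      Complex.im_ofReal_mul]
    ring
  obtain ⟨c, hc, hcb⟩ := exists_le_of_homogeneous hcont hhom N.imForm_pos
  set M := ‖N.phaseForm‖
  have hM : 0 ≤ M := ContinuousLinearMap.opNorm_nonneg N.phaseForm
  refine ⟨c / 4, M / 2 + M ^ 2 / c, by positivity, by positivity, fun x y => ?_⟩
  have hdec : Sum.elim x (ofRealVec y) =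
      Sum.elim x (0 : Fin n → ℂ) + Sum.elim (0 : Fin n → ℂ) (ofRealVec y) := by
    rw [← elim_add, add_zero, zero_add]
  have h1 : N.phaseForm (Sum.elim x (ofRealVec y)) (Sum.elim x (ofRealVec y)) =
      N.phaseForm (Sum.elim x 0) (Sum.elim x 0) +
      2 * N.phaseForm (Sum.elim x 0) (Sum.elim 0 (ofRealVec y)) +
      N.phaseForm (Sum.elim 0 (ofRealVec y)) (Sum.elim 0 (ofRealVec y)) := by
    rw [hdec]
    simp only [map_add, _root_.add_apply]
    rw [N.phaseForm_comm (Sum.elim 0 (ofRealVec y)) (Sum.elim x 0)]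
    ring
  have hnx : ‖(Sum.elim x 0 : Fin n ⊕ Fin n → ℂ)‖ ≤ ‖x‖ := by
    refine (pi_norm_le_iff_of_nonneg (norm_nonneg _)).2 fun a => ?_
    cases a with
    | inl j => exact norm_le_pi_norm x j
    | inr j => simp
  have hny : ‖(Sum.elim 0 (ofRealVec y) : Fin n ⊕ Fin n → ℂ)‖ ≤ ‖y‖ := by
    refine (pi_norm_le_iff_of_nonneg (norm_nonneg _)).2 fun a => ?_
    cases a with
    | inl j => simp
    | inr j => simpa [ofRealVec] using norm_le_pi_norm y j
  have h2 : |(N.phaseForm (Sum.elim x 0) (Sum.elim x 0)).im| ≤ M * ‖x‖ * ‖x‖ := by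
    refine (Complex.abs_im_le_norm _).trans ((N.phaseForm.le_opNorm₂ _ _).trans ?_)
    gcongr
  have h3 : |(N.phaseForm (Sum.elim x 0) (Sum.elim 0 (ofRealVec y))).im| ≤ M * ‖x‖ * ‖y‖ := by
    refine (Complex.abs_im_le_norm _).trans ((N.phaseForm.le_opNorm₂ _ _).trans ?_)
    gcongr
  have h4 : (N.phase (Sum.elim x (ofRealVec y))).im =
      (N.phaseForm (Sum.elim x (ofRealVec y)) (Sum.elim x (ofRealVec y))).im / 2 := by
    rw [phase]
    exact Complex.div_ofNat_im _ 2
  have h5 : c * ‖y‖ ^ 2 ≤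
      (N.phaseForm (Sum.elim 0 (ofRealVec y)) (Sum.elim 0 (ofRealVec y))).im := hcb y
  rw [h4, h1, Complex.add_im, Complex.add_im, Complex.mul_im]
  simp only [Complex.re_ofNat, Complex.im_ofNat, zero_mul, add_zero]
  have h6 := neg_abs_le (N.phaseForm (Sum.elim x 0) (Sum.elim x 0)).im
  have h7 := neg_abs_le (N.phaseForm (Sum.elim x 0) (Sum.elim 0 (ofRealVec y))).im
  -- absorb the mixed term
  have h8 : M * ‖x‖ * ‖y‖ ≤ M ^ 2 / c * ‖x‖ ^ 2 + c / 4 * ‖y‖ ^ 2 := by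
    have : 0 ≤ (M * ‖x‖ - c / 2 * ‖y‖) ^ 2 / c := by positivity
    have e : (M * ‖x‖ - c / 2 * ‖y‖) ^ 2 / c =
        M ^ 2 / c * ‖x‖ ^ 2 - M * ‖x‖ * ‖y‖ + c / 4 * ‖y‖ ^ 2 := by
      field_simp; ring
    linarith
  nlinarith

end Phase

/-! ### Gaussians are Schwartz functions, and characteristic functions determine densities -/

theorem iteratedFDeriv_cexp (i : ℕ) (z : ℂ) : iteratedFDeriv ℝ i Complex.exp z =
    Complex.exp z • iteratedFDeriv ℝ i Complex.exp 0 := by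
  have h1 : Complex.exp = fun w => Complex.exp z • Complex.exp (w - z) := by
    funext w
    rw [smul_eq_mul, ← Complex.exp_add]; ring_nf
  have hc : ContDiff ℝ ∞ Complex.exp := Complex.contDiff_exp
  have h2 : iteratedFDeriv ℝ i (fun w => Complex.exp z • Complex.exp (w - z)) z =
      Complex.exp z • iteratedFDeriv ℝ i (fun w => Complex.exp (w - z)) z :=
    iteratedFDeriv_const_smul_apply' (f := fun w => Complex.exp (w - z))
      ((Complex.contDiff_exp.comp (contDiff_id.sub contDiff_const)).contDiffAt)
  conv_lhs => rw [h1]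
  rw [h2, iteratedFDeriv_comp_sub, sub_self]

/-- The exponential of a function of temperate growth whose real part tends to `-∞` at least
quadratically is a Schwartz function. -/
theorem exists_schwartz_exp {E : Type*} [NormedAddCommGroup E] [NormedSpace ℝ E] {p : E → ℂ}
    (hp : Function.HasTemperateGrowth p) {c K : ℝ} (hc : 0 < c)
    (hre : ∀ y, (p y).re ≤ K - c * ‖y‖ ^ 2) :
    ∃ ψ : 𝓢(E, ℂ), ∀ y, ψ y = Complex.exp (p y) := by
  refine ⟨⟨fun y => Complex.exp (p y), Complex.contDiff_exp.comp hp.1, fun k m => ?_⟩,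
    fun y => rfl⟩
  -- by Faà di Bruno the derivatives are `exp p` times functions of polynomial growth
  obtain ⟨l, D, hD0, hD⟩ := hp.norm_iteratedFDeriv_le_uniform m
  obtain ⟨C₀, hC₀, hexp⟩ := exists_pow_mul_exp_le (k + l * m) hc
  set S : ℝ := ∑ i ∈ Finset.range (m + 1), ‖iteratedFDeriv ℝ i Complex.exp 0‖
  have hS : ∀ i, i ≤ m → ‖iteratedFDeriv ℝ i Complex.exp 0‖ ≤ S := fun i hi =>
    Finset.single_le_sum (f := fun i => ‖iteratedFDeriv ℝ i Complex.exp 0‖)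
      (fun _ _ => norm_nonneg _) (Finset.mem_range.2 (by omega))
  have hS0 : 0 ≤ S := Finset.sum_nonneg fun _ _ => norm_nonneg _
  refine ⟨m.factorial * S * (D + 1) ^ m * Real.exp K * C₀, fun y => ?_⟩
  have hone : (1 : ℝ) ≤ (1 + ‖y‖) ^ l := one_le_pow₀ (by linarith [norm_nonneg y])
  have h1 : ‖iteratedFDeriv ℝ m (Complex.exp ∘ p) y‖ ≤
      m.factorial * (Real.exp (p y).re * S) * ((D + 1) * (1 + ‖y‖) ^ l) ^ m := by
    refine norm_iteratedFDeriv_comp_le (N := ∞) Complex.contDiff_exp hp.1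
      (mod_cast le_top) y ?_ ?_
    · intro i hi
      rw [iteratedFDeriv_cexp, norm_smul, Complex.norm_exp]
      exact mul_le_mul_of_nonneg_left (hS i hi) (Real.exp_pos _).le
    · intro i hi1 him
      have h2 : 1 ≤ (D + 1) * (1 + ‖y‖) ^ l := by nlinarith
      calc _ ≤ D * (1 + ‖y‖) ^ l := hD i him y
        _ ≤ (D + 1) * (1 + ‖y‖) ^ l := by gcongr; linarith
        _ ≤ _ := le_self_pow₀ h2 (by omega)
  have h3 : Real.exp (p y).re ≤ Real.exp K * Real.exp (-c * ‖y‖ ^ 2) := by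
    rw [← Real.exp_add]
    exact Real.exp_le_exp.2 (by linarith [hre y])
  have h4 := hexp ‖y‖ (norm_nonneg y)
  have h5 : ‖y‖ ^ k ≤ (1 + ‖y‖) ^ k := by gcongr; linarith
  calc ‖y‖ ^ k * ‖iteratedFDeriv ℝ m (Complex.exp ∘ p) y‖
      ≤ (1 + ‖y‖) ^ k * (m.factorial * ((Real.exp K * Real.exp (-c * ‖y‖ ^ 2)) * S) *
        ((D + 1) * (1 + ‖y‖) ^ l) ^ m) := by
        refine mul_le_mul h5 (h1.trans ?_) (norm_nonneg _) (by positivity)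
        gcongr
    _ = m.factorial * S * (D + 1) ^ m * Real.exp K *
        ((1 + ‖y‖) ^ (k + l * m) * Real.exp (-c * ‖y‖ ^ 2)) := by
        rw [mul_pow, ← pow_mul, pow_add]; ring
    _ ≤ _ := by gcongr

section Fourier

variable {E : Type*} [NormedAddCommGroup E] [NormedSpace ℝ E] [MeasurableSpace E]
  [BorelSpace E] [SecondCountableTopology E] [CompleteSpace E] {μ : Measure E}

/-- A real integrable function with vanishing Fourier transform: its positive and negative parts are
densities of finite measures with the same characteristic function. -/
theorem ae_eq_zero_of_fourier_real {f : E → ℝ} (hf : Integrable f μ)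
    (h : ∀ L : StrongDual ℝ E, ∫ y, Complex.exp (L y * Complex.I) * f y ∂μ = 0) : f =ᵐ[μ] 0 := by
  have key : ∀ {g : E → ℝ}, Integrable g μ → ∀ L : StrongDual ℝ E,
      charFunDual (μ.withDensity fun y => ENNReal.ofReal (g y)) L =
        ∫ y, Complex.exp (L y * Complex.I) * (max (g y) 0 : ℝ) ∂μ := by
    intro g hg L
    rw [charFunDual_apply, integral_withDensity_eq_integral_toReal_smul₀
      hg.aestronglyMeasurable.aemeasurable.ennreal_ofReal (by simp)]
    refine integral_congr_ae (Eventually.of_forall fun y => ?_)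
    simp only [ENNReal.toReal_ofReal', Complex.real_smul]
    ring
  have hbd : ∀ {g : E → ℝ}, Integrable g μ → ∀ L : StrongDual ℝ E,
      Integrable (fun y => Complex.exp (L y * Complex.I) * (g y : ℂ)) μ := by
    intro g hg L
    refine (hg.ofReal (𝕜 := ℂ)).bdd_mul (c := 1) (by fun_prop) (Eventually.of_forall fun y => ?_)
    rw [Complex.norm_exp_ofReal_mul_I]
  have hfin : ∀ {g : E → ℝ}, Integrable g μ →
      IsFiniteMeasure (μ.withDensity fun y => ENNReal.ofReal (g y)) := by
    intro g hg
    refine isFiniteMeasure_withDensity ?_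
    exact (hg.lintegral_lt_top).ne
  have := hfin hf
  have := hfin hf.neg
  have heq : (μ.withDensity fun y => ENNReal.ofReal (f y)) =
      μ.withDensity fun y => ENNReal.ofReal ((-f) y) := by
    refine Measure.ext_of_charFunDual ?_
    funext L
    rw [key hf, key hf.neg, ← sub_eq_zero,
      ← integral_sub (hbd hf.pos_part L) (hbd hf.neg.pos_part L), ← h L]
    refine integral_congr_ae (Eventually.of_forall fun y => ?_)
    simp only [Pi.neg_apply]
    rw [← mul_sub, ← Complex.ofReal_sub, max_comm, max_comm (-f y)]
    congr 2
    rcases le_total 0 (f y) with h0 | h0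
    · rw [max_eq_right h0, max_eq_left (by linarith)]; ring
    · rw [max_eq_left h0, max_eq_right (by linarith)]; ring
  have h1 := (withDensity_eq_iff hf.aestronglyMeasurable.aemeasurable.ennreal_ofReal
    hf.neg.aestronglyMeasurable.aemeasurable.ennreal_ofReal hf.lintegral_lt_top.ne).1 heq
  filter_upwards [h1] with y hy
  simp only [Pi.neg_apply] at hy
  show f y = 0
  rcases lt_trichotomy (f y) 0 with h0 | h0 | h0
  · rw [ENNReal.ofReal_of_nonpos h0.le, eq_comm, ENNReal.ofReal_eq_zero] at hy
    linarith
  · exact h0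
  · rw [ENNReal.ofReal_of_nonpos (by linarith : -f y ≤ 0), ENNReal.ofReal_eq_zero] at hy
    linarith

/-- An integrable function with vanishing Fourier transform vanishes almost everywhere. -/
theorem ae_eq_zero_of_fourier {f : E → ℂ} (hf : Integrable f μ)
    (h : ∀ L : StrongDual ℝ E, ∫ y, Complex.exp (L y * Complex.I) * f y ∂μ = 0) : f =ᵐ[μ] 0 := by
  have hint : ∀ L : StrongDual ℝ E,
      Integrable (fun y => Complex.exp (L y * Complex.I) * f y) μ := by
    intro L
    refine hf.bdd_mul (c := 1) (by fun_prop) (Eventually.of_forall fun y => ?_)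
    rw [Complex.norm_exp_ofReal_mul_I]
  have hconj : ∀ L : StrongDual ℝ E,
      ∫ y, Complex.exp (L y * Complex.I) * conj (f y) ∂μ = 0 := by
    intro L
    have h1 := congrArg conj (h (-L))
    rw [← integral_conj, map_zero] at h1
    rw [← h1]
    refine integral_congr_ae (Eventually.of_forall fun y => ?_)
    simp [← Complex.exp_conj]
  have hintc : ∀ L : StrongDual ℝ E,
      Integrable (fun y => Complex.exp (L y * Complex.I) * conj (f y)) μ := by
    intro L
    have hfc : Integrable (fun y => conj (f y)) μ :=
      (Complex.conjLIE.toContinuousLinearEquiv.toContinuousLinearMap).integrable_comp hf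
    refine hfc.bdd_mul (c := 1) (by fun_prop) (Eventually.of_forall fun y => ?_)
    rw [Complex.norm_exp_ofReal_mul_I]
  have hre : (fun y => (f y).re) =ᵐ[μ] 0 := by
    refine ae_eq_zero_of_fourier_real hf.re fun L => ?_
    have : ∀ y, Complex.exp (L y * Complex.I) * ((f y).re : ℂ) =
        (1 / 2 : ℂ) * (Complex.exp (L y * Complex.I) * f y +
          Complex.exp (L y * Complex.I) * conj (f y)) := fun y => by
      rw [Complex.re_eq_add_conj]; ring
    simp_rw [this]
    rw [integral_const_mul, integral_add (hint L) (hintc L), h, hconj]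
    simp
  have him : (fun y => (f y).im) =ᵐ[μ] 0 := by
    refine ae_eq_zero_of_fourier_real hf.im fun L => ?_
    have : ∀ y, Complex.exp (L y * Complex.I) * ((f y).im : ℂ) =
        (1 / (2 * Complex.I) : ℂ) * (Complex.exp (L y * Complex.I) * f y -
          Complex.exp (L y * Complex.I) * conj (f y)) := fun y => by
      rw [Complex.im_eq_sub_conj]; ring
    simp_rw [this]
    rw [integral_const_mul, integral_sub (hint L) (hintc L), h, hconj]
    simp
  filter_upwards [hre, him] with y h1 h2
  exact Complex.ext h1 h2

end Fourier

/-! ### The FBI transform -/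

section FBI

variable {n : ℕ} {q : QuadraticMap ℝ (Fin n ⊕ Fin n → ℝ) ℂ} (N : NormalForm q) {h : ℝ}

/-- The kernel `exp(i φ(x, y) / h)` of the FBI transform. -/
def NormalForm.fbi (h : ℝ) (x : Fin n → ℂ) (y : Fin n → ℝ) : ℂ :=
  Complex.exp (Complex.I * N.phase (Sum.elim x (ofRealVec y)) / h)

/-- The inclusion `y ↦ (0, y)`. -/
def inrReal : (Fin n → ℝ) →L[ℝ] (Fin n ⊕ Fin n → ℂ) :=
  ContinuousLinearMap.pi fun a => match a with
    | Sum.inl _ => 0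
    | Sum.inr j => Complex.ofRealCLM.comp (ContinuousLinearMap.proj (R := ℝ) j)

theorem inrReal_apply (y : Fin n → ℝ) : inrReal y = Sum.elim (0 : Fin n → ℂ) (ofRealVec y) := by
  funext a; cases a <;> simp [inrReal, ofRealVec]

/-- The inclusion `x ↦ (x, 0)`. -/
def inlVec : (Fin n → ℂ) →L[ℂ] (Fin n ⊕ Fin n → ℂ) :=
  ContinuousLinearMap.pi fun a => match a with
    | Sum.inl j => ContinuousLinearMap.proj (R := ℂ) (φ := fun _ : Fin n => ℂ) j
    | Sum.inr _ => 0

theorem inlVec_apply (x : Fin n → ℂ) : inlVec x = Sum.elim x (0 : Fin n → ℂ) := by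
  funext a; cases a <;> simp [inlVec]

theorem elim_ofRealVec (x : Fin n → ℂ) (y : Fin n → ℝ) :
    (Sum.elim x (ofRealVec y) : Fin n ⊕ Fin n → ℂ) = inlVec x + inrReal y := by
  rw [inlVec_apply, inrReal_apply, ← elim_add, add_zero, zero_add]

theorem NormalForm.continuous_phase : Continuous N.phase := by
  unfold phase; fun_prop

theorem NormalForm.continuous_fbi (h : ℝ) :
    Continuous fun p : (Fin n → ℂ) × (Fin n → ℝ) => N.fbi h p.1 p.2 := by
  have := N.continuous_phase
  unfold fbi
  simp only [elim_ofRealVec]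
  fun_prop

theorem NormalForm.differentiable_fbi (h : ℝ) (y : Fin n → ℝ) :
    Differentiable ℂ fun x => N.fbi h x y := by
  have h1 : Differentiable ℂ N.phase := fun v => (N.hasFDerivAt_phase v).differentiableAt
  unfold fbi
  simp only [elim_ofRealVec]
  fun_prop

theorem NormalForm.norm_fbi (h : ℝ) (x : Fin n → ℂ) (y : Fin n → ℝ) :
    ‖N.fbi h x y‖ = Real.exp (-(N.phase (Sum.elim x (ofRealVec y))).im / h) := by
  rw [fbi, Complex.norm_exp]
  congr 1
  rw [Complex.div_ofReal_re]
  simp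

theorem NormalForm.exists_norm_fbi_le (hh : 0 < h) : ∃ c C : ℝ, 0 < c ∧ 0 ≤ C ∧
    ∀ (x : Fin n → ℂ) (y : Fin n → ℝ),
      ‖N.fbi h x y‖ ≤ Real.exp (C * ‖x‖ ^ 2) * Real.exp (-c * ‖y‖ ^ 2) := by
  obtain ⟨c, C, hc, hC, hb⟩ := N.exists_im_phase_ge
  refine ⟨c / h, C / h, by positivity, by positivity, fun x y => ?_⟩
  rw [norm_fbi, ← Real.exp_add]
  refine Real.exp_le_exp.2 ?_
  calc _ ≤ (C * ‖x‖ ^ 2 - c * ‖y‖ ^ 2) / h := by gcongr; exact hb x y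
    _ = _ := by ring

theorem NormalForm.exists_schwartz_fbi (hh : 0 < h) (x : Fin n → ℂ) :
    ∃ ψ : 𝓢(Fin n → ℝ, ℂ), ∀ y, ψ y = N.fbi h x y := by
  obtain ⟨c, C, hc, hC, hb⟩ := N.exists_im_phase_ge
  refine exists_schwartz_exp (c := c / h) (K := C * ‖x‖ ^ 2 / h) ?_ (by positivity) fun y => ?_
  · have hv : Function.HasTemperateGrowth
        (fun y : Fin n → ℝ => (Sum.elim x (ofRealVec y) : Fin n ⊕ Fin n → ℂ)) := by
      have e1 : (fun y : Fin n → ℝ => (Sum.elim x (ofRealVec y) : Fin n ⊕ Fin n → ℂ)) =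
          (fun _ => inlVec x) + ⇑(inrReal (n := n)) := funext fun y => elim_ofRealVec x y
      rw [e1]
      exact (Function.HasTemperateGrowth.const _).add inrReal.hasTemperateGrowth
    have h1 := N.phaseForm.bilinear_hasTemperateGrowth hv hv
    have h2 := (Function.HasTemperateGrowth.const (E := Fin n → ℝ) (Complex.I / (2 * h))).mul h1
    have e2 : (fun y => Complex.I * N.phase (Sum.elim x (ofRealVec y)) / h) =
        (fun _ => Complex.I / (2 * h)) * fun y : Fin n → ℝ =>
          N.phaseForm (Sum.elim x (ofRealVec y)) (Sum.elim x (ofRealVec y)) := by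
      funext y
      simp only [phase, Pi.mul_apply]
      ring
    rw [e2]
    exact h2
  · rw [Complex.div_ofReal_re]
    have h1 := hb x y
    simp only [Complex.mul_re, Complex.I_re, Complex.I_im, zero_mul, one_mul, zero_sub]
    calc _ ≤ (C * ‖x‖ ^ 2 - c * ‖y‖ ^ 2) / h := by gcongr
      _ = _ := by ring

/-- The constant `∫ exp(-Im ∂_y²φ(y) / h) dy`. -/
def NormalForm.fbiConst (h : ℝ) : ℝ := ∫ y, Real.exp (-N.imForm y / h)

theorem NormalForm.integrable_norm_sq_fbi (hh : 0 < h) (x : Fin n → ℂ) :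
    Integrable fun y => ‖N.fbi h x y‖ ^ 2 := by
  obtain ⟨ψ, hψ⟩ := N.exists_schwartz_fbi hh x
  simp only [← hψ]
  exact (ψ.memLp 2).integrable_norm_pow (by norm_num)

theorem NormalForm.integral_norm_sq_fbi (x : Fin n → ℂ) :
    ∫ y, ‖N.fbi h x y‖ ^ 2 = N.fbiConst h * Real.exp (2 * N.Φ x / h) := by
  obtain ⟨y₀, hy⟩ := N.exists_im_phase x
  have h1 : ∀ y, ‖N.fbi h x y‖ ^ 2 =
      (fun y => Real.exp (-N.imForm y / h) * Real.exp (2 * N.Φ x / h)) (y - y₀) := by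
    intro y
    beta_reduce
    rw [norm_fbi, hy, ← Real.exp_nat_mul, ← Real.exp_add]
    congr 1
    push_cast
    ring
  simp_rw [h1]
  rw [integral_sub_right_eq_self (fun y => Real.exp (-N.imForm y / h) *
    Real.exp (2 * N.Φ x / h)), integral_mul_const, fbiConst]

theorem NormalForm.fbiConst_pos (hh : 0 < h) : 0 < N.fbiConst h := by
  have h1 := N.integral_norm_sq_fbi (h := h) 0
  have h2 : 0 < ∫ y, ‖N.fbi h 0 y‖ ^ 2 := by
    have hc : Continuous fun y => ‖N.fbi h 0 y‖ ^ 2 :=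
      ((N.continuous_fbi h).comp (Continuous.prodMk_right 0)).norm.pow 2
    refine (integral_pos_iff_support_of_nonneg (fun y => by positivity)
      (N.integrable_norm_sq_fbi hh 0)).2 ?_
    have : Function.support (fun y => ‖N.fbi h 0 y‖ ^ 2) = univ := by
      ext y; simp [fbi]
    rw [this]
    exact isOpen_univ.measure_pos _ univ_nonempty
  rw [h1] at h2
  exact pos_of_mul_pos_left h2 (Real.exp_pos _).le

/-- The Gram matrix of the functions `exp(i φ(x, ·) / h)` is a multiple of the reproducing kernel
of `H_Φ`. On the diagonal this is `integral_norm_sq_fbi`, and both sides are holomorphic in `x`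
and antiholomorphic in `w`. -/
theorem NormalForm.integral_fbi_mul_conj (hh : 0 < h) (x w : Fin n → ℂ) :
    ∫ y, N.fbi h x y * conj (N.fbi h w y) =
      N.fbiConst h * Complex.exp (kernelExp N.Φ x w / h) := by
  -- `x = p + i r` and `w = p - i r`: both sides are the values at `s = i` of entire functions of
  -- `s` which agree for real `s`, where the two arguments `p + s r` and `p + s̄ r` coincide
  set p : Fin n → ℂ := (1 / 2 : ℂ) • (x + w)
  set r : Fin n → ℂ := (1 / (2 * Complex.I) : ℂ) • (x - w)
  let F : ℂ → (Fin n → ℝ) → ℂ := fun s y =>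
    N.fbi h (p + s • r) y * conj (N.fbi h (p + conj s • r) y)
  let G : ℂ → ℂ := fun s => N.fbiConst h *
    Complex.exp (kernelExp N.Φ (p + s • r) (p + conj s • r) / h)
  have hFc : Continuous fun z : ℂ × (Fin n → ℝ) => F z.1 z.2 := by
    have h1 : Continuous fun z : ℂ × (Fin n → ℝ) => N.fbi h (p + z.1 • r) z.2 :=
      (N.continuous_fbi h).comp (f := fun z : ℂ × (Fin n → ℝ) => (p + z.1 • r, z.2)) (by fun_prop)
    have h2 : Continuous fun z : ℂ × (Fin n → ℝ) => N.fbi h (p + conj z.1 • r) z.2 :=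
      (N.continuous_fbi h).comp (f := fun z : ℂ × (Fin n → ℝ) => (p + conj z.1 • r, z.2)) (by
        have : Continuous fun z : ℂ × (Fin n → ℝ) => conj z.1 :=
          Complex.continuous_conj.comp continuous_fst
        fun_prop)
    exact h1.mul (Complex.continuous_conj.comp h2)
  have hFd : ∀ y, Differentiable ℂ fun s => F s y := by
    intro y
    have h1 : Differentiable ℂ fun s : ℂ => N.fbi h (p + s • r) y :=
      (N.differentiable_fbi h y).comp (f := fun s : ℂ => p + s • r) (by fun_prop)
    have h2 : Differentiable ℂ fun s : ℂ => conj (N.fbi h (p + conj s • r) y) := fun s =>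
      differentiableAt_conj_conj_iff.2 (h1 (conj s))
    exact h1.mul h2
  obtain ⟨c, C, hc, hC, hb⟩ := N.exists_norm_fbi_le hh
  have hFi : Differentiable ℂ fun s => ∫ y, F s y := by
    have h1 : Entire fun s : Fin 1 → ℂ => ∫ y, F (s 0) y * 1 := by
      refine entire_integral (k := fun y (s : Fin 1 → ℂ) => F (s 0) y) (u := fun _ => 1)
        (hFc.comp (f := fun z : (Fin n → ℝ) × (Fin 1 → ℂ) => (z.2 0, z.1)) (by fun_prop))
        (fun y => (hFd y).comp (f := fun s : Fin 1 → ℂ => s 0) (by fun_prop))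
        aestronglyMeasurable_const fun R => ?_
      refine ⟨fun y => (Real.exp (C * (‖p‖ + R * ‖r‖) ^ 2)) ^ 2 * Real.exp (-(2 * c) * ‖y‖ ^ 2),
        (integrable_gaussian volume (by positivity)).const_mul _,
        Eventually.of_forall fun y s hs => ?_⟩
      have hs0 : ‖s 0‖ ≤ R := (norm_le_pi_norm s 0).trans hs
      have e1 : ∀ t : ℂ, ‖t‖ ≤ R → ‖N.fbi h (p + t • r) y‖ ≤
          Real.exp (C * (‖p‖ + R * ‖r‖) ^ 2) * Real.exp (-c * ‖y‖ ^ 2) := by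
        intro t ht
        refine (hb _ y).trans ?_
        have : ‖p + t • r‖ ≤ ‖p‖ + R * ‖r‖ := (norm_add_le _ _).trans (by
          rw [norm_smul t r]
          exact add_le_add le_rfl (mul_le_mul_of_nonneg_right ht (norm_nonneg _)))
        gcongr
      have e2 := e1 (s 0) hs0
      have e3 := e1 (conj (s 0)) (by rwa [RCLike.norm_conj])
      simp only [F, mul_one, norm_mul, RCLike.norm_conj]
      calc _ ≤ (Real.exp (C * (‖p‖ + R * ‖r‖) ^ 2) * Real.exp (-c * ‖y‖ ^ 2)) *
            (Real.exp (C * (‖p‖ + R * ‖r‖) ^ 2) * Real.exp (-c * ‖y‖ ^ 2)) := by gcongr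
        _ = Real.exp (C * (‖p‖ + R * ‖r‖) ^ 2) ^ 2 *
            (Real.exp (-c * ‖y‖ ^ 2) * Real.exp (-c * ‖y‖ ^ 2)) := by ring
        _ = _ := by rw [← Real.exp_add]; ring_nf
    have h2 := h1.differentiable.comp
      (f := fun s : ℂ => (fun _ => s : Fin 1 → ℂ)) (by fun_prop)
    simpa [Function.comp_def] using h2
  have hGd : Differentiable ℂ G := by
    have hdh : Differentiable ℂ fun s : ℂ => holForm N.Φ (p + s • r) (p + s • r) :=
      (differentiable_holForm_self N.Φ).comp (f := fun s : ℂ => p + s • r) (by fun_prop)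
    have h2 : Differentiable ℂ fun s : ℂ =>
        conj (holForm N.Φ (p + conj s • r) (p + conj s • r)) := fun s =>
      differentiableAt_conj_conj_iff.2 (hdh (conj s))
    have h3 : ∀ s : ℂ, hermForm N.Φ (p + s • r) (p + conj s • r) =
        hermForm N.Φ p p + s * hermForm N.Φ r p + s * (hermForm N.Φ p r + s * hermForm N.Φ r r) := by
      intro s
      have hr : ∀ z, hermForm N.Φ z (conj s • r) = s * hermForm N.Φ z r := by
        intro z
        rw [← conj_hermForm, hermForm_smul_left, map_mul, Complex.conj_conj, conj_hermForm]
      rw [hermForm_add_right, hr, hermForm_add_left, hermForm_add_left,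
        hermForm_smul_left N.Φ s r p, hermForm_smul_left N.Φ s r r]
    simp only [G, kernelExp, h3]
    fun_prop
  have hreal : ∀ s : ℝ, (∫ y, F s y) - G s = 0 := by
    intro s
    rw [sub_eq_zero]
    simp only [F, G, Complex.conj_ofReal]
    rw [kernelExp_self]
    have h1 := congrArg (fun t : ℝ => (t : ℂ)) (N.integral_norm_sq_fbi (h := h) (p + (s : ℂ) • r))
    beta_reduce at h1
    rw [← integral_complex_ofReal] at h1
    push_cast at h1
    rw [← h1]
    refine integral_congr_ae (Eventually.of_forall fun y => ?_)
    beta_reduce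
    rw [Complex.mul_conj, Complex.normSq_eq_norm_sq]
    push_cast
    rfl
  have hfin := eq_zero_of_real (hFi.sub hGd) hreal Complex.I
  rw [Pi.sub_apply, sub_eq_zero] at hfin
  have hx : p + Complex.I • r = x := by
    funext j
    simp only [p, r, Pi.add_apply, Pi.smul_apply, Pi.sub_apply, smul_eq_mul]
    field_simp
    ring
  have hw : p + conj Complex.I • r = w := by
    funext j
    simp only [p, r, Pi.add_apply, Pi.smul_apply, Pi.sub_apply, smul_eq_mul, Complex.conj_I]
    field_simp
    ring
  simpa only [F, G, hx, hw] using hfin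

/-- The functions `exp(i φ(x, ·) / h)` are total in `L²(ℝⁿ)`: up to the Gaussian factor
`exp(i φ(0, y) / h)`, integration against them is a Fourier transform. -/
theorem NormalForm.eq_zero_of_integral_fbi (hh : 0 < h) (u : L2 n)
    (hu : ∀ x, ∫ y, N.fbi h x y * u y = 0) : u = 0 := by
  have hint : Integrable fun y => N.fbi h 0 y * u y := by
    obtain ⟨ψ, hψ⟩ := N.exists_schwartz_fbi hh 0
    simp only [← hψ]
    exact ((integrable_mul_schwartz u ψ).congr (Eventually.of_forall fun y => mul_comm _ _))
  -- the momentum at `y = 0` is a bijective linear function of `x`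
  let eta : (Fin n → ℂ) →ₗ[ℂ] (Fin n → ℂ) :=
    LinearMap.funLeft ℂ ℂ Sum.inr ∘ₗ N.lift.toLinearMap ∘ₗ (inlVec : (Fin n → ℂ) →L[ℂ] _)
  have heta : ∀ x j, eta x j = N.lift (Sum.elim x 0) (Sum.inr j) := by
    intro x j
    simp [eta, inlVec_apply, LinearMap.funLeft]
  have hinj : Function.Injective eta := by
    rw [injective_iff_map_eq_zero]
    intro x hx
    have h0 : N.lift (Sum.elim x 0) = 0 := by
      funext a
      cases a with
      | inl j => rw [lift_inl]; rfl
      | inr j => rw [← heta, hx]; rfl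
    have h1 := N.lift.map_eq_zero_iff.1 h0
    funext j
    exact congrFun h1 (Sum.inl j)
  have hsurj := LinearMap.injective_iff_surjective.1 hinj
  have hphase : ∀ (x : Fin n → ℂ) (y : Fin n → ℝ), N.phase (Sum.elim x (ofRealVec y)) =
      N.phase (Sum.elim x 0) - ∑ j, eta x j * y j + N.phase (Sum.elim 0 (ofRealVec y)) := by
    intro x y
    have h1 := N.phaseForm_elim (Sum.elim x 0) 0 (ofRealVec y)
    simp only [Pi.zero_apply, mul_zero, Finset.sum_const_zero, zero_sub] at h1
    have hdec : (Sum.elim x (ofRealVec y) : Fin n ⊕ Fin n → ℂ) =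
        Sum.elim x (0 : Fin n → ℂ) + Sum.elim (0 : Fin n → ℂ) (ofRealVec y) := by
      rw [← elim_add, add_zero, zero_add]
    have h2 : ∑ j, eta x j * y j = ∑ j, N.lift (Sum.elim x 0) (Sum.inr j) * ofRealVec y j :=
      Finset.sum_congr rfl fun j _ => by rw [heta]; rfl
    rw [h2]
    simp only [phase]
    rw [hdec]
    simp only [map_add, _root_.add_apply]
    rw [N.phaseForm_comm (Sum.elim 0 (ofRealVec y)) (Sum.elim x 0), h1]
    ring
  have hz : (fun y => N.fbi h 0 y * u y) =ᵐ[volume] 0 := by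
    refine ae_eq_zero_of_fourier hint fun L => ?_
    obtain ⟨x, hx⟩ := hsurj fun j => -(h : ℂ) * (L (Pi.single j 1) : ℝ)
    have hL : ∀ y : Fin n → ℝ, (L y : ℂ) * Complex.I =
        Complex.I * (-∑ j, eta x j * y j) / h := by
      intro y
      have h1 : L y = ∑ j, y j * L (Pi.single j 1) := by
        conv_lhs => rw [← Finset.univ_sum_single y]
        rw [map_sum]
        refine Finset.sum_congr rfl fun j _ => ?_
        rw [← smul_eq_mul, ← map_smul]
        congr 1
        funext i
        by_cases hij : i = j
        · subst hij; simp
        · simp [Pi.single_eq_of_ne hij]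
      have h2 : (h : ℂ) ≠ 0 := by exact_mod_cast hh.ne'
      rw [h1, hx, ← Finset.sum_neg_distrib]
      push_cast
      rw [Finset.sum_mul, Finset.mul_sum, Finset.sum_div]
      refine Finset.sum_congr rfl fun j _ => ?_
      field_simp
    have h3 := hu x
    have h4 : ∀ y, N.fbi h x y * u y = Complex.exp (Complex.I * N.phase (Sum.elim x 0) / h) *
        (Complex.exp (L y * Complex.I) * (N.fbi h 0 y * u y)) := by
      intro y
      rw [hL, fbi, fbi, hphase, ← mul_assoc, ← mul_assoc, ← Complex.exp_add, ← Complex.exp_add]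
      congr 2
      ring
    simp_rw [h4] at h3
    rw [integral_const_mul] at h3
    exact (mul_eq_zero.1 h3).resolve_left (Complex.exp_ne_zero _)
  refine Lp.eq_zero_iff_ae_eq_zero.2 ?_
  filter_upwards [hz] with y hy
  exact (mul_eq_zero.1 hy).resolve_left (Complex.exp_ne_zero _)

/-- The FBI transform `u ↦ c ∫ exp(i φ(x, y) / h) u(y) dy` is a unitary map of `L²(ℝⁿ)` onto
`H_Φ`, for a suitable constant `c`. -/
theorem NormalForm.exists_fbi_unitary (hh : 0 < h) : ∃ T : L2 n ≃ₗᵢ[ℂ] HPhi N.Φ h,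
    ∃ c : ℂ, c ≠ 0 ∧ ∀ u x, rep (T u) x = c * ∫ y, N.fbi h x y * u y := by
  have := completeSpace_HPhi N.pos hh
  choose ψ hψ using N.exists_schwartz_fbi hh
  have hm : ∀ x, MemLp (fun y => conj (N.fbi h x y)) 2 (volume : Measure (Fin n → ℝ)) := by
    intro x
    have h1 := (ψ x).memLp 2 (μ := volume)
    have h2 : (ψ x : (Fin n → ℝ) → ℂ) = N.fbi h x := funext (hψ x)
    rw [h2] at h1
    exact h1.star
  set e : (Fin n → ℂ) → L2 n := fun x => (hm x).toLp _
  have he : ∀ x (u : L2 n), inner ℂ (e x) u = ∫ y, N.fbi h x y * u y := by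
    intro x u
    rw [L2.inner_def]
    refine integral_congr_ae ?_
    filter_upwards [(hm x).coeFn_toLp] with y hy
    rw [hy, RCLike.inner_apply, Complex.conj_conj, mul_comm]
  have hk := kernelConst_pos N.pos hh
  have hf := N.fbiConst_pos hh
  set a : ℝ := Real.sqrt (N.fbiConst h / kernelConst N.Φ h)
  have ha : 0 < a := Real.sqrt_pos.2 (by positivity)
  have ha2 : a * a * kernelConst N.Φ h = N.fbiConst h := by
    rw [Real.mul_self_sqrt (by positivity)]; field_simp
  have hsl : ∀ (x : Fin n → ℂ) (v : HPhi N.Φ h), inner ℂ ((a : ℂ) • kernelVec N.pos hh x) v =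
      a * (kernelConst N.Φ h * rep v x) := fun x v => by
    rw [← inner_kernelVec N.pos hh]
    refine (inner_smul_left (𝕜 := ℂ) (kernelVec N.pos hh x) v (a : ℂ)).trans ?_
    rw [Complex.conj_ofReal]
  -- `T` maps the conjugate of the FBI kernel at `x` to a multiple of the reproducing kernel at `x`
  obtain ⟨T, hT⟩ := exists_unitary_of_gram e (fun x => (a : ℂ) • kernelVec N.pos hh x)
    (fun x w => by
      rw [he, hsl, rep_smul, rep_kernelVec, Pi.smul_apply, smul_eq_mul, kernelFun]
      have h1 := N.integral_fbi_mul_conj hh x w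
      have h2 : ∫ y, N.fbi h x y * e w y = ∫ y, N.fbi h x y * conj (N.fbi h w y) := by
        refine integral_congr_ae ?_
        filter_upwards [(hm w).coeFn_toLp] with y hy
        rw [hy]
      rw [h2, h1, ← ha2]
      push_cast
      ring)
    (fun u hu => N.eq_zero_of_integral_fbi hh u fun x => by rw [← he, hu])
    (fun u hu => by
      refine rep_injective ?_
      rw [rep_zero]
      funext x
      have h1 := hu x
      rw [hsl] at h1
      simpa [ha.ne', hk.ne'] using h1)
  refine ⟨T, ((a : ℂ) * kernelConst N.Φ h)⁻¹, ?_, fun u x => ?_⟩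
  · have : (a : ℂ) ≠ 0 := by exact_mod_cast ha.ne'
    have : (kernelConst N.Φ h : ℂ) ≠ 0 := by exact_mod_cast hk.ne'
    positivity
  · have h1 : (a : ℂ) ≠ 0 := by exact_mod_cast ha.ne'
    have h2 : (kernelConst N.Φ h : ℂ) ≠ 0 := by exact_mod_cast hk.ne'
    rw [← he, ← T.inner_map_map, hT, hsl]
    field_simp

end FBI

/-! ### Weyl quantization on Schwartz functions -/

section Schwartz

variable {n : ℕ}

/-- `phaseOp h a` on Schwartz functions. -/
def schwartzPhase (h : ℝ) : Fin n ⊕ Fin n → 𝓢(Fin n → ℝ, ℂ) →L[ℂ] 𝓢(Fin n → ℝ, ℂ)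
  | Sum.inl j => SchwartzMap.smulLeftCLM ℂ (fun x : Fin n → ℝ => ((x j : ℝ) : ℂ))
  | Sum.inr j => ((h : ℂ) / Complex.I) •
      LineDeriv.lineDerivOpCLM ℂ 𝓢(Fin n → ℝ, ℂ) (Pi.single j 1 : Fin n → ℝ)

theorem schwartzPhase_inl_apply (h : ℝ) (j : Fin n) (φ : 𝓢(Fin n → ℝ, ℂ)) (x : Fin n → ℝ) :
    schwartzPhase h (Sum.inl j) φ x = x j * φ x := by
  have hg : Function.HasTemperateGrowth (fun x : Fin n → ℝ => ((x j : ℝ) : ℂ)) :=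
    (Complex.ofRealCLM.comp
      (ContinuousLinearMap.proj (R := ℝ) (φ := fun _ : Fin n => ℝ) j)).hasTemperateGrowth
  rw [schwartzPhase, SchwartzMap.smulLeftCLM_apply hg]
  rfl

theorem schwartzPhase_inr (h : ℝ) (j : Fin n) (φ : 𝓢(Fin n → ℝ, ℂ)) :
    schwartzPhase h (Sum.inr j) φ = ((h : ℂ) / Complex.I) •
      LineDeriv.lineDerivOp (Pi.single j 1 : Fin n → ℝ) φ := rfl

theorem coe_schwartzPhase (h : ℝ) (a : Fin n ⊕ Fin n) (φ : 𝓢(Fin n → ℝ, ℂ)) :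
    (schwartzPhase h a φ : (Fin n → ℝ) → ℂ) = phaseOp h a φ := by
  cases a with
  | inl j =>
    funext x
    rw [schwartzPhase_inl_apply]; rfl
  | inr j =>
    funext x
    simp [schwartzPhase_inr, phaseOp, SchwartzMap.lineDerivOp_apply_eq_fderiv]

/-- `weylOp Q h` on Schwartz functions. -/
def schwartzWeyl (Q : Matrix (Fin n ⊕ Fin n) (Fin n ⊕ Fin n) ℂ) (h : ℝ) :
    𝓢(Fin n → ℝ, ℂ) →L[ℂ] 𝓢(Fin n → ℝ, ℂ) :=
  ∑ a, ∑ b, Q a b • (schwartzPhase h a ∘L schwartzPhase h b)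

theorem schwartzWeyl_apply (Q : Matrix (Fin n ⊕ Fin n) (Fin n ⊕ Fin n) ℂ) (h : ℝ)
    (φ : 𝓢(Fin n → ℝ, ℂ)) (x : Fin n → ℝ) : schwartzWeyl Q h φ x =
      ∑ a, ∑ b, Q a b * schwartzPhase h a (schwartzPhase h b φ) x := by
  simp [schwartzWeyl]

theorem coe_schwartzWeyl (Q : Matrix (Fin n ⊕ Fin n) (Fin n ⊕ Fin n) ℂ) (h : ℝ)
    (φ : 𝓢(Fin n → ℝ, ℂ)) : (schwartzWeyl Q h φ : (Fin n → ℝ) → ℂ) = weylOp Q h φ := by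
  funext x
  rw [schwartzWeyl_apply]
  simp only [weylOp, coe_schwartzPhase]

theorem integrable_schwartz_mul (f g : 𝓢(Fin n → ℝ, ℂ)) : Integrable fun x => f x * g x :=
  (f.memLp 2).integrable_mul (g.memLp 2)

theorem integrable_conj_schwartz_mul (f g : 𝓢(Fin n → ℝ, ℂ)) :
    Integrable fun x => conj (f x) * g x :=
  (f.memLp 2).star.integrable_mul (g.memLp 2)

/-- The transpose of `x_j` is `x_j` and that of `h D_{x_j}` is `-h D_{x_j}`. -/
theorem integral_mul_schwartzPhase (h : ℝ) (a : Fin n ⊕ Fin n) (f g : 𝓢(Fin n → ℝ, ℂ)) :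
    ∫ x, f x * schwartzPhase h a g x = ∫ x, schwartzPhase (-h) a f x * g x := by
  cases a with
  | inl j =>
    simp only [schwartzPhase_inl_apply]
    exact integral_congr_ae (Eventually.of_forall fun x => by ring)
  | inr j =>
    simp only [schwartzPhase_inr, _root_.smul_apply, smul_eq_mul]
    have h1 := SchwartzMap.integral_mul_lineDerivOp_right_eq_neg_left (μ := volume) f g
      (Pi.single j 1 : Fin n → ℝ)
    simp only [mul_left_comm _ ((h : ℂ) / Complex.I), mul_assoc, integral_const_mul]
    rw [h1]
    push_cast
    ring

/-- `x_j` and `h D_{x_j}` are formally self-adjoint. -/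
theorem integral_conj_mul_schwartzPhase (h : ℝ) (a : Fin n ⊕ Fin n) (f g : 𝓢(Fin n → ℝ, ℂ)) :
    ∫ x, conj (f x) * schwartzPhase h a g x = ∫ x, conj (schwartzPhase h a f x) * g x := by
  cases a with
  | inl j =>
    simp only [schwartzPhase_inl_apply, map_mul, Complex.conj_ofReal]
    exact integral_congr_ae (Eventually.of_forall fun x => by ring)
  | inr j =>
    simp only [schwartzPhase_inr, _root_.smul_apply, smul_eq_mul, map_mul, map_div₀,
      Complex.conj_ofReal, Complex.conj_I]
    have h1 := SchwartzMap.integral_bilinear_lineDerivOp_right_eq_neg_left (μ := volume) f g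
      ((ContinuousLinearMap.mul ℝ ℂ).comp
        (Complex.conjLIE.toContinuousLinearEquiv : ℂ →L[ℝ] ℂ)) (Pi.single j 1 : Fin n → ℝ)
    have h2 : ∀ z w : ℂ, ((ContinuousLinearMap.mul ℝ ℂ).comp
        (Complex.conjLIE.toContinuousLinearEquiv : ℂ →L[ℝ] ℂ)) z w = conj z * w :=
      fun _ _ => rfl
    simp only [h2] at h1
    simp only [mul_left_comm _ ((h : ℂ) / Complex.I), mul_assoc, integral_const_mul]
    rw [h1, div_neg]
    ring

theorem integral_mul_schwartzWeyl {Q : Matrix (Fin n ⊕ Fin n) (Fin n ⊕ Fin n) ℂ}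
    (hQ : Q.IsSymm) (h : ℝ) (f g : 𝓢(Fin n → ℝ, ℂ)) :
    ∫ x, f x * schwartzWeyl Q (-h) g x = ∫ x, schwartzWeyl Q h f x * g x := by
  simp only [schwartzWeyl_apply, Finset.mul_sum, Finset.sum_mul]
  have hL : ∀ a b, Integrable fun x => f x * (Q a b * schwartzPhase (-h) a
      (schwartzPhase (-h) b g) x) := fun a b => by
    simp only [mul_left_comm _ (Q a b)]
    exact (integrable_schwartz_mul f (schwartzPhase (-h) a (schwartzPhase (-h) b g))).const_mul _
  have hR : ∀ a b, Integrable fun x => Q a b * schwartzPhase h a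
      (schwartzPhase h b f) x * g x := fun a b => by
    simp only [mul_assoc]
    exact (integrable_schwartz_mul (schwartzPhase h a (schwartzPhase h b f)) g).const_mul _
  rw [integral_finsetSum _ fun a _ => integrable_finsetSum _ fun b _ => hL a b,
    integral_finsetSum _ fun a _ => integrable_finsetSum _ fun b _ => hR a b]
  simp only [integral_finsetSum _ fun b _ => hL _ b, integral_finsetSum _ fun b _ => hR _ b]
  rw [Finset.sum_comm]
  refine Finset.sum_congr rfl fun a _ => Finset.sum_congr rfl fun b _ => ?_
  simp only [mul_left_comm _ (Q b a), mul_assoc, integral_const_mul]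
  rw [integral_mul_schwartzPhase, integral_mul_schwartzPhase, neg_neg, hQ.apply a b]

end Schwartz

section Accretive

variable {n : ℕ} (q : QuadraticMap ℝ (Fin n ⊕ Fin n → ℝ) ℂ)

theorem re_conj_dot_coeffMatrix_eq (Z : Fin n ⊕ Fin n → ℂ) :
    (∑ a, ∑ b, coeffMatrix q a b * (conj (Z a) * Z b)).re =
      (q fun a => (Z a).re).re + (q fun a => (Z a).im).re := by
  have h1 : ∀ X : Fin n ⊕ Fin n → ℝ, q X = ∑ a, ∑ b, coeffMatrix q a b * (X a * X b) := by
    intro X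
    rw [← complexify_realPoint]
    simp only [complexify, dotProduct, mulVec, realPoint, Finset.mul_sum]
    exact Finset.sum_congr rfl fun a _ => Finset.sum_congr rfl fun b _ => by ring
  have h2 : ∑ a, ∑ b, coeffMatrix q a b * (conj (Z a) * Z b) =
      q (fun a => (Z a).re) + q (fun a => (Z a).im) +
      Complex.I * (∑ a, ∑ b, coeffMatrix q a b * ((Z a).re * (Z b).im) -
        ∑ a, ∑ b, coeffMatrix q b a * ((Z a).im * (Z b).re)) := by
    rw [h1, h1, ← Finset.sum_sub_distrib, Finset.mul_sum, ← Finset.sum_add_distrib,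
      ← Finset.sum_add_distrib]
    refine Finset.sum_congr rfl fun a _ => ?_
    rw [← Finset.sum_sub_distrib, Finset.mul_sum, ← Finset.sum_add_distrib,
      ← Finset.sum_add_distrib]
    refine Finset.sum_congr rfl fun b _ => ?_
    rw [(coeffMatrix_isSymm q).apply a b]
    have e1 : conj (Z a) = (Z a).re - (Z a).im * Complex.I := by
      apply Complex.ext <;> simp
    have e2 : Z b = (Z b).re + (Z b).im * Complex.I := (Complex.re_add_im _).symm
    rw [e1]
    conv_lhs => rw [e2]
    linear_combination (-coeffMatrix q a b * (Z a).im * (Z b).im) * Complex.I_sq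
  have h3 : ∑ a, ∑ b, coeffMatrix q a b * ((Z a).re * (Z b).im : ℂ) =
      ∑ a, ∑ b, coeffMatrix q b a * ((Z a).im * (Z b).re) := by
    rw [Finset.sum_comm]
    exact Finset.sum_congr rfl fun a _ => Finset.sum_congr rfl fun b _ => by ring
  rw [h2, h3, sub_self, mul_zero, add_zero, Complex.add_re]

theorem re_conj_dot_coeffMatrix (hre : ∀ X, 0 ≤ (q X).re) (Z : Fin n ⊕ Fin n → ℂ) :
    0 ≤ (∑ a, ∑ b, coeffMatrix q a b * (conj (Z a) * Z b)).re := by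
  rw [re_conj_dot_coeffMatrix_eq]
  exact add_nonneg (hre _) (hre _)

/-- The Weyl quantization is accretive on Schwartz functions when `Re q ≥ 0`: the form
`⟨q^w φ, φ⟩` is the integral of the Hermitian extension of `q` at the vector `(x φ, hD φ)`. -/
theorem re_integral_conj_mul_schwartzWeyl (hre : ∀ X, 0 ≤ (q X).re) (h : ℝ)
    (φ : 𝓢(Fin n → ℝ, ℂ)) :
    0 ≤ (∫ x, conj (φ x) * schwartzWeyl (coeffMatrix q) h φ x).re := by
  have hL : ∀ a b, Integrable fun x => conj (φ x) * (coeffMatrix q a b * schwartzPhase h a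
      (schwartzPhase h b φ) x) := fun a b => by
    simp only [mul_left_comm _ (coeffMatrix q a b)]
    exact (integrable_conj_schwartz_mul φ (schwartzPhase h a (schwartzPhase h b φ))).const_mul _
  have hR : ∀ a b, Integrable fun x => coeffMatrix q a b *
      (conj (schwartzPhase h a φ x) * schwartzPhase h b φ x) := fun a b =>
    (integrable_conj_schwartz_mul (schwartzPhase h a φ) (schwartzPhase h b φ)).const_mul _
  have h1 : ∫ x, conj (φ x) * schwartzWeyl (coeffMatrix q) h φ x =
      ∫ x, ∑ a, ∑ b, coeffMatrix q a b *
        (conj (schwartzPhase h a φ x) * schwartzPhase h b φ x) := by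
    simp only [schwartzWeyl_apply, Finset.mul_sum]
    rw [integral_finsetSum _ fun a _ => integrable_finsetSum _ fun b _ => hL a b,
      integral_finsetSum _ fun a _ => integrable_finsetSum _ fun b _ => hR a b]
    simp only [integral_finsetSum _ fun b _ => hL _ b, integral_finsetSum _ fun b _ => hR _ b]
    refine Finset.sum_congr rfl fun a _ => Finset.sum_congr rfl fun b _ => ?_
    simp only [mul_left_comm _ (coeffMatrix q a b), integral_const_mul]
    rw [integral_conj_mul_schwartzPhase]
  have hint : Integrable fun x => ∑ a, ∑ b, coeffMatrix q a b *
        (conj (schwartzPhase h a φ x) * schwartzPhase h b φ x) :=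
    integrable_finsetSum _ fun a _ => integrable_finsetSum _ fun b _ => hR a b
  have h3 : (∫ x, ∑ a, ∑ b, coeffMatrix q a b *
        (conj (schwartzPhase h a φ x) * schwartzPhase h b φ x)).re = ∫ x, (∑ a, ∑ b,
        coeffMatrix q a b * (conj (schwartzPhase h a φ x) * schwartzPhase h b φ x)).re :=
    (integral_re hint).symm
  rw [h1, h3]
  exact integral_nonneg fun x => re_conj_dot_coeffMatrix q hre fun a => schwartzPhase h a φ x

end Accretive

/-! ### The operator on `L²(ℝⁿ)` -/

/-- The functional `ψ ↦ ⟨f, Jφ⟩`, `ψ = Sφ`, extends boundedly when `S` dominates `J`. -/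
theorem exists_inner_eq_of_le {X H : Type*} [AddCommGroup X] [Module ℂ X] [NormedAddCommGroup H]
    [InnerProductSpace ℂ H] [CompleteSpace H] (S J : X →ₗ[ℂ] H) {c : ℝ}
    (hc : ∀ φ, ‖J φ‖ ≤ c * ‖S φ‖) (f : H) : ∃ g : H, ∀ φ, inner ℂ g (S φ) = inner ℂ f (J φ) := by
  have hker : LinearMap.ker S ≤ LinearMap.ker ((innerSL ℂ f).toLinearMap ∘ₗ J) := by
    intro φ hφ
    have h1 := hc φ
    rw [LinearMap.mem_ker.1 hφ, norm_zero, mul_zero] at h1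
    simp [norm_le_zero_iff.1 h1]
  let e := S.quotKerEquivRange
  let l : LinearMap.range S →ₗ[ℂ] ℂ :=
    ((LinearMap.ker S).liftQ ((innerSL ℂ f).toLinearMap ∘ₗ J) hker) ∘ₗ e.symm.toLinearMap
  have hl : ∀ φ, l ⟨S φ, φ, rfl⟩ = inner ℂ f (J φ) := by
    intro φ
    have h1 : e.symm ⟨S φ, φ, rfl⟩ = (LinearMap.ker S).mkQ φ := by
      rw [LinearEquiv.symm_apply_eq]
      rfl
    simp [l, h1]
  have hb : ∀ ψ : LinearMap.range S, ‖l ψ‖ ≤ (‖f‖ * c) * ‖ψ‖ := by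
    rintro ⟨_, φ, rfl⟩
    rw [hl, mul_assoc]
    refine (norm_inner_le_norm f _).trans ?_
    exact mul_le_mul_of_nonneg_left (hc φ) (norm_nonneg f)
  obtain ⟨g, hg, -⟩ := exists_extension_norm_eq (LinearMap.range S) (l.mkContinuous _ hb)
  refine ⟨(InnerProductSpace.toDual ℂ H).symm g, fun φ => ?_⟩
  rw [InnerProductSpace.toDual_symm_apply, ← hl]
  exact hg ⟨S φ, φ, rfl⟩

theorem norm_le_of_re_inner_nonneg {H : Type*} [NormedAddCommGroup H] [InnerProductSpace ℂ H]
    {v w : H} (hvw : 0 ≤ (inner ℂ v w).re) {ζ : ℂ} (hζ : ζ.re < 0) :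
    ‖v‖ ≤ (-ζ.re)⁻¹ * ‖w - ζ • v‖ := by
  have h1 : (inner ℂ v (w - ζ • v)).re = (inner ℂ v w).re + (-ζ.re) * ‖v‖ ^ 2 := by
    rw [inner_sub_right, inner_smul_right, Complex.sub_re, sub_eq_add_neg]
    congr 1
    have h2 : inner ℂ v v = ((‖v‖ ^ 2 : ℝ) : ℂ) := by
      rw [inner_self_eq_norm_sq_to_K (𝕜 := ℂ)]; push_cast; rfl
    rw [h2, Complex.re_mul_ofReal]
    ring
  have h5 : (inner ℂ v (w - ζ • v)).re ≤ ‖v‖ * ‖w - ζ • v‖ :=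
    (Complex.re_le_norm _).trans (norm_inner_le_norm _ _)
  have h6 : (-ζ.re) * ‖v‖ ^ 2 ≤ ‖v‖ * ‖w - ζ • v‖ := by linarith
  rcases (norm_nonneg v).eq_or_lt with h0 | h0
  · rw [← h0]
    have : 0 < -ζ.re := by linarith
    positivity
  · rw [le_inv_mul_iff₀ (by linarith)]
    nlinarith

section L2

variable {n : ℕ}

/-- The inclusion of the Schwartz functions into `L²(ℝⁿ)`. -/
def schwartzL2 : 𝓢(Fin n → ℝ, ℂ) →ₗ[ℂ] L2 n :=
  (SchwartzMap.toLpCLM ℂ ℂ 2 (volume : Measure (Fin n → ℝ))).toLinearMap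

theorem coeFn_schwartzL2 (φ : 𝓢(Fin n → ℝ, ℂ)) : schwartzL2 φ =ᵐ[volume] φ :=
  φ.coeFn_toLp 2 volume

theorem denseRange_schwartzL2 : DenseRange (schwartzL2 (n := n)) :=
  SchwartzMap.denseRange_toLpCLM (E := Fin n → ℝ) (F := ℂ) (μ := volume) (p := 2)
    (by norm_num)

theorem inner_schwartzL2_right (g : L2 n) (φ : 𝓢(Fin n → ℝ, ℂ)) :
    inner ℂ g (schwartzL2 φ) = ∫ x, (star g : L2 n) x * φ x := by
  rw [L2.inner_def]
  refine integral_congr_ae ?_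
  filter_upwards [coeFn_schwartzL2 φ, Lp.coeFn_star g] with x h1 h2
  rw [h1, h2, RCLike.inner_apply, mul_comm]
  rfl

theorem inner_schwartzL2_schwartzL2 (φ ψ : 𝓢(Fin n → ℝ, ℂ)) :
    inner ℂ (schwartzL2 φ) (schwartzL2 ψ) = ∫ x, conj (φ x) * ψ x := by
  rw [L2.inner_def]
  refine integral_congr_ae ?_
  filter_upwards [coeFn_schwartzL2 φ, coeFn_schwartzL2 ψ] with x h1 h2
  rw [h1, h2, RCLike.inner_apply, mul_comm]

theorem continuous_integral_mul_schwartz (φ : 𝓢(Fin n → ℝ, ℂ)) :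
    Continuous fun u : L2 n => ∫ x, u x * φ x := by
  have h1 : ∀ u : L2 n, ∫ x, u x * φ x = inner ℂ (star (schwartzL2 φ)) u := by
    intro u
    rw [L2.inner_def]
    refine integral_congr_ae ?_
    filter_upwards [coeFn_schwartzL2 φ, Lp.coeFn_star (schwartzL2 φ)] with x h1 h2
    rw [h2, RCLike.inner_apply, Pi.star_apply, h1]
    simp
  simp_rw [h1]
  fun_prop

theorem mem_graph_weylL2_iff (Q : Matrix (Fin n ⊕ Fin n) (Fin n ⊕ Fin n) ℂ) (h : ℝ) (u v : L2 n) :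
    (u, v) ∈ (weylL2 Q h).graph ↔
      ∀ φ : 𝓢(Fin n → ℝ, ℂ), ∫ x, u x * schwartzWeyl Q (-h) φ x = ∫ x, v x * φ x := by
  rw [mem_graph_weylL2]
  simp only [coe_schwartzWeyl]

theorem isClosed_weylL2 (Q : Matrix (Fin n ⊕ Fin n) (Fin n ⊕ Fin n) ℂ) (h : ℝ) :
    (weylL2 Q h).IsClosed := by
  have h1 : ((weylL2 Q h).graph : Set (L2 n × L2 n)) = ⋂ φ : 𝓢(Fin n → ℝ, ℂ),
      {p | ∫ x, p.1 x * schwartzWeyl Q (-h) φ x = ∫ x, p.2 x * φ x} := by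
    ext ⟨u, v⟩
    rw [SetLike.mem_coe, mem_graph_weylL2_iff]
    simp
  rw [LinearPMap.IsClosed, h1]
  exact isClosed_iInter fun φ => isClosed_eq
    ((continuous_integral_mul_schwartz _).comp continuous_fst)
    ((continuous_integral_mul_schwartz _).comp continuous_snd)

theorem schwartz_mem_graph {Q : Matrix (Fin n ⊕ Fin n) (Fin n ⊕ Fin n) ℂ} (hQ : Q.IsSymm)
    (h : ℝ) (f : 𝓢(Fin n → ℝ, ℂ)) :
    (schwartzL2 f, schwartzL2 (schwartzWeyl Q h f)) ∈ (weylL2 Q h).graph := by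
  rw [mem_graph_weylL2_iff]
  intro φ
  have h1 : ∀ f g : 𝓢(Fin n → ℝ, ℂ), ∫ x, schwartzL2 f x * g x = ∫ x, f x * g x := by
    intro f g
    refine integral_congr_ae ?_
    filter_upwards [coeFn_schwartzL2 f] with x hx
    rw [hx]
  rw [h1, h1, integral_mul_schwartzWeyl hQ]

theorem dense_domain_weylL2 {Q : Matrix (Fin n ⊕ Fin n) (Fin n ⊕ Fin n) ℂ} (hQ : Q.IsSymm)
    (h : ℝ) : Dense ((weylL2 Q h).domain : Set (L2 n)) := by
  refine denseRange_schwartzL2.mono ?_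
  rintro _ ⟨f, rfl⟩
  exact LinearPMap.mem_domain_of_mem_graph (schwartz_mem_graph hQ h f)

/-- `q^w(x, hD_x) - ζ` is surjective on `L²` when `Re q ≥ 0` and `Re ζ < 0`, because its transpose
is bounded below on Schwartz functions. -/
theorem exists_mem_graph_sub (q : QuadraticMap ℝ (Fin n ⊕ Fin n → ℝ) ℂ)
    (hre : ∀ X, 0 ≤ (q X).re) (h : ℝ) {ζ : ℂ} (hζ : ζ.re < 0) (f : L2 n) :
    ∃ u, (u, ζ • u + f) ∈ (weylL2 (coeffMatrix q) h).graph := by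
  let S : 𝓢(Fin n → ℝ, ℂ) →ₗ[ℂ] L2 n :=
    schwartzL2 ∘ₗ (schwartzWeyl (coeffMatrix q) (-h)).toLinearMap - ζ • schwartzL2
  have hS : ∀ φ, S φ = schwartzL2 (schwartzWeyl (coeffMatrix q) (-h) φ) - ζ • schwartzL2 φ :=
    fun φ => rfl
  have hbd : ∀ φ, ‖schwartzL2 φ‖ ≤ (-ζ.re)⁻¹ * ‖S φ‖ := by
    intro φ
    rw [hS]
    refine norm_le_of_re_inner_nonneg ?_ hζ
    rw [inner_schwartzL2_schwartzL2]
    exact re_integral_conj_mul_schwartzWeyl q hre (-h) φ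
  obtain ⟨g, hg⟩ := exists_inner_eq_of_le S schwartzL2 hbd (star f)
  refine ⟨star g, ?_⟩
  rw [mem_graph_weylL2_iff]
  intro φ
  have h1 := hg φ
  rw [hS, inner_sub_right, inner_smul_right, sub_eq_iff_eq_add, inner_schwartzL2_right,
    inner_schwartzL2_right, inner_schwartzL2_right, star_star] at h1
  rw [h1]
  have h2 : ∫ x, (ζ • star g + f : L2 n) x * φ x =
      ∫ x, (ζ * ((star g : L2 n) x * φ x) + f x * φ x) := by
    refine integral_congr_ae ?_
    filter_upwards [Lp.coeFn_add (ζ • star g) f, Lp.coeFn_smul ζ (star g)] with x e1 e2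
    rw [e1, Pi.add_apply, e2, Pi.smul_apply, smul_eq_mul]
    ring
  rw [h2, integral_add ((integrable_mul_schwartz _ φ).const_mul _) (integrable_mul_schwartz _ φ),
    integral_const_mul]
  ring

end L2

/-! ### The FBI transform intertwines the quantizations -/

theorem eq_of_isSymm_of_quadratic {ι : Type*} [Fintype ι] [DecidableEq ι] {A B : Matrix ι ι ℂ}
    (hA : A.IsSymm) (hB : B.IsSymm) (h : ∀ X, X ⬝ᵥ (A *ᵥ X) = X ⬝ᵥ (B *ᵥ X)) : A = B := by
  have key : ∀ (C : Matrix ι ι ℂ), C.IsSymm → ∀ a b, C a b =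
      ((Pi.single a 1 + Pi.single b 1) ⬝ᵥ (C *ᵥ (Pi.single a 1 + Pi.single b 1)) -
        Pi.single a 1 ⬝ᵥ (C *ᵥ Pi.single a 1) - Pi.single b 1 ⬝ᵥ (C *ᵥ Pi.single b 1)) / 2 := by
    intro C hC a b
    rw [mulVec_add, add_dotProduct, dotProduct_add, dotProduct_add]
    simp only [single_one_dotProduct, mulVec_single_one, col_apply]
    rw [hC.apply a b]
    ring
  ext a b
  rw [key A hA, key B hB, h, h, h]

section Intertwining

variable {n : ℕ} {q : QuadraticMap ℝ (Fin n ⊕ Fin n → ℝ) ℂ} (N : NormalForm q) {h : ℝ}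

theorem normalMatrix_isSymm (M : Matrix (Fin n) (Fin n) ℂ) : (normalMatrix M).IsSymm := by
  rw [IsSymm, normalMatrix, fromBlocks_transpose]
  simp [transpose_smul]

/-- The coefficients of `q` are those of `(x, ξ) ↦ (M x) · ξ` transformed by `κ`. -/
theorem NormalForm.coeffMatrix_eq : coeffMatrix q =
    (LinearMap.toMatrix' N.κ.toLinearMap)ᵀ * normalMatrix N.M *
      LinearMap.toMatrix' N.κ.toLinearMap := by
  refine eq_of_isSymm_of_quadratic (coeffMatrix_isSymm q) ?_ fun X => ?_
  · rw [IsSymm, transpose_mul, transpose_mul, transpose_transpose,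
      (normalMatrix_isSymm N.M).eq, Matrix.mul_assoc]
  · have h1 := N.symbol (fun j => N.κ X (Sum.inl j)) (fun j => N.κ X (Sum.inr j))
    have h2 : Sum.elim (fun j => N.κ X (Sum.inl j)) (fun j => N.κ X (Sum.inr j)) = N.κ X := by
      funext a; cases a <;> rfl
    rw [← normalMatrix_apply, h2, LinearEquiv.symm_apply_apply, complexify] at h1
    rw [h1, ← mulVec_mulVec, ← mulVec_mulVec, dotProduct_mulVec X, vecMul_transpose]
    have h3 : LinearMap.toMatrix' N.κ.toLinearMap *ᵥ X = N.κ X := by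
      rw [LinearMap.toMatrix'_mulVec]; rfl
    rw [h3]

/-- `d_a(ℓ) = (h / i) ℓ(∂_{x_j})` for `a = inr j`, and zero for `a = inl j`. -/
def shiftX (h : ℝ) (a : Fin n ⊕ Fin n) (l : (Fin n ⊕ Fin n → ℂ) →L[ℂ] ℂ) : ℂ :=
  match a with
  | Sum.inl _ => 0
  | Sum.inr j => (h : ℂ) / Complex.I * l (Sum.elim (Pi.single j 1) 0)

/-- `d_a(ℓ) = (h / i) ℓ(∂_{y_j})` for `a = inr j`, and zero for `a = inl j`. -/
def shiftY (h : ℝ) (a : Fin n ⊕ Fin n) (l : (Fin n ⊕ Fin n → ℂ) →L[ℂ] ℂ) : ℂ :=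
  match a with
  | Sum.inl _ => 0
  | Sum.inr j => (h : ℂ) / Complex.I * l (Sum.elim 0 (Pi.single j 1))

theorem inlVec_single (j : Fin n) :
    inlVec (Pi.single j 1 : Fin n → ℂ) =
      Sum.elim (Pi.single j 1 : Fin n → ℂ) (0 : Fin n → ℂ) := inlVec_apply _

theorem inrReal_single (j : Fin n) :
    inrReal (Pi.single j 1 : Fin n → ℝ) =
      Sum.elim (0 : Fin n → ℂ) (Pi.single j 1 : Fin n → ℂ) := by
  rw [inrReal_apply]
  congr 1
  funext i
  by_cases hij : i = j
  · subst hij; simp [ofRealVec]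
  · simp [ofRealVec, Pi.single_eq_of_ne hij]

theorem NormalForm.phaseForm_single_left (v : Fin n ⊕ Fin n → ℂ) (j : Fin n) :
    N.phaseForm v (Sum.elim (Pi.single j 1) 0) = N.κ (N.lift v) (Sum.inr j) := by
  rw [phaseForm_elim]
  simp [Pi.single_apply]

theorem NormalForm.phaseForm_single_right (v : Fin n ⊕ Fin n → ℂ) (j : Fin n) :
    N.phaseForm v (Sum.elim 0 (Pi.single j 1)) = -N.lift v (Sum.inr j) := by
  rw [phaseForm_elim]
  simp [Pi.single_apply]

/-- Action of `x_j` and `h D_{x_j}` on a multiple of the FBI kernel. -/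
theorem NormalForm.phaseOp_fbi_left (hh : 0 < h) (a : Fin n ⊕ Fin n) {f : (Fin n ⊕ Fin n → ℂ) → ℂ}
    {f' : (Fin n ⊕ Fin n → ℂ) →L[ℂ] ℂ} (x : Fin n → ℂ) (y : Fin n → ℝ)
    (hf : HasFDerivAt f f' (Sum.elim x (ofRealVec y))) :
    phaseOp h a (fun x => f (Sum.elim x (ofRealVec y)) * N.fbi h x y) x =
      (N.κ (N.lift (Sum.elim x (ofRealVec y))) a * f (Sum.elim x (ofRealVec y)) + shiftX h a f') *
        N.fbi h x y := by
  have hh0 : (h : ℂ) ≠ 0 := by exact_mod_cast hh.ne'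
  cases a with
  | inl j =>
    simp only [phaseOp, shiftX, κ_lift_inl, add_zero]
    exact (mul_assoc _ _ _).symm
  | inr j =>
    set v : Fin n ⊕ Fin n → ℂ := Sum.elim x (ofRealVec y) with hv
    have hE : HasFDerivAt (fun x : Fin n → ℂ => (Sum.elim x (ofRealVec y) : Fin n ⊕ Fin n → ℂ))
        inlVec x := by
      simp only [elim_ofRealVec]
      exact inlVec.hasFDerivAt.add_const _
    have h1 : HasFDerivAt (fun x => f (Sum.elim x (ofRealVec y))) (f'.comp inlVec) x :=
      HasFDerivAt.comp x hf hE
    have h2 : HasFDerivAt (fun x => N.phase (Sum.elim x (ofRealVec y)))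
        ((N.phaseForm v).comp inlVec) x := 
      HasFDerivAt.comp (g := N.phase) x (N.hasFDerivAt_phase _) hE
    have h3 := (h1.mul (((h2.const_mul Complex.I).mul_const (h : ℂ)⁻¹).cexp)).fderiv
    have h4 : (fun x => f (Sum.elim x (ofRealVec y)) * N.fbi h x y) =
        (fun x => f (Sum.elim x (ofRealVec y))) *
          fun x => Complex.exp (Complex.I * N.phase (Sum.elim x (ofRealVec y)) * (h : ℂ)⁻¹) := by
      funext x; simp only [fbi, Pi.mul_apply, div_eq_mul_inv]
    simp only [phaseOp, shiftX]
    rw [h4, h3]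
    simp only [_root_.add_apply, _root_.smul_apply, ContinuousLinearMap.comp_apply, inlVec_single,
      phaseForm_single_left, smul_eq_mul, fbi, ← hv, div_eq_mul_inv]
    field_simp

/-- Action of `y_j` and `-h D_{y_j}` on a multiple of the FBI kernel. -/
theorem NormalForm.phaseOp_fbi_right (hh : 0 < h) (a : Fin n ⊕ Fin n)
    {f : (Fin n ⊕ Fin n → ℂ) → ℂ}
    {f' : (Fin n ⊕ Fin n → ℂ) →L[ℂ] ℂ} (x : Fin n → ℂ) (y : Fin n → ℝ)
    (hf : HasFDerivAt f f' (Sum.elim x (ofRealVec y))) :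
    phaseOp (-h) a (fun y => f (Sum.elim x (ofRealVec y)) * N.fbi h x y) y =
      (N.lift (Sum.elim x (ofRealVec y)) a * f (Sum.elim x (ofRealVec y)) + shiftY (-h) a f') *
        N.fbi h x y := by
  have hh0 : (h : ℂ) ≠ 0 := by exact_mod_cast hh.ne'
  cases a with
  | inl j =>
    simp only [phaseOp, shiftY, lift_inl, add_zero, ofRealVec]
    exact (mul_assoc _ _ _).symm
  | inr j =>
    set v : Fin n ⊕ Fin n → ℂ := Sum.elim x (ofRealVec y) with hv
    have hE : HasFDerivAt (fun y : Fin n → ℝ => (Sum.elim x (ofRealVec y) : Fin n ⊕ Fin n → ℂ))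
        inrReal y := by
      simp only [elim_ofRealVec]
      exact inrReal.hasFDerivAt.const_add _
    have h1 : HasFDerivAt (fun y => f (Sum.elim x (ofRealVec y)))
        ((f'.restrictScalars ℝ).comp inrReal) y :=
      HasFDerivAt.comp y (hf.restrictScalars ℝ) hE
    have h2 : HasFDerivAt (fun y => N.phase (Sum.elim x (ofRealVec y)))
        (((N.phaseForm v).restrictScalars ℝ).comp inrReal) y :=
      
      HasFDerivAt.comp (g := N.phase) y ((N.hasFDerivAt_phase _).restrictScalars ℝ) hE
    have h3 := (h1.mul (((h2.const_mul Complex.I).mul_const (h : ℂ)⁻¹).cexp)).fderiv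
    have h4 : (fun y => f (Sum.elim x (ofRealVec y)) * N.fbi h x y) =
        (fun y => f (Sum.elim x (ofRealVec y))) *
          fun y => Complex.exp (Complex.I * N.phase (Sum.elim x (ofRealVec y)) * (h : ℂ)⁻¹) := by
      funext x; simp only [fbi, Pi.mul_apply, div_eq_mul_inv]
    simp only [phaseOp, shiftY]
    rw [h4, h3]
    simp only [_root_.add_apply, _root_.smul_apply, ContinuousLinearMap.comp_apply, inrReal_single,
      ContinuousLinearMap.coe_restrictScalars',
      phaseForm_single_right, smul_eq_mul, fbi, ← hv, div_eq_mul_inv, Complex.ofReal_neg]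
    field_simp
    ring

/-- The coordinate `X_a` as a function of the base point `v = (x, y)`. -/
def NormalForm.liftCoord (a : Fin n ⊕ Fin n) : (Fin n ⊕ Fin n → ℂ) →L[ℂ] ℂ :=
  (LinearMap.proj (R := ℂ) (φ := fun _ : Fin n ⊕ Fin n => ℂ) a ∘ₗ
    N.lift.toLinearMap).toContinuousLinearMap

/-- The coordinate `(κ X)_a` as a function of the base point `v = (x, y)`. -/
def NormalForm.imageCoord (a : Fin n ⊕ Fin n) : (Fin n ⊕ Fin n → ℂ) →L[ℂ] ℂ :=
  (LinearMap.proj (R := ℂ) (φ := fun _ : Fin n ⊕ Fin n => ℂ) a ∘ₗ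
    N.κ.toLinearMap ∘ₗ N.lift.toLinearMap).toContinuousLinearMap

theorem NormalForm.liftCoord_apply (a : Fin n ⊕ Fin n) (v : Fin n ⊕ Fin n → ℂ) :
    N.liftCoord a v = N.lift v a := rfl

theorem NormalForm.imageCoord_apply (a : Fin n ⊕ Fin n) (v : Fin n ⊕ Fin n → ℂ) :
    N.imageCoord a v = N.κ (N.lift v) a := rfl

theorem NormalForm.imageCoord_eq_sum (a : Fin n ⊕ Fin n) :
    N.imageCoord a = ∑ b, LinearMap.toMatrix' N.κ.toLinearMap a b • N.liftCoord b := by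
  ext v
  rw [imageCoord_apply]
  have h3 : N.κ (N.lift v) = LinearMap.toMatrix' N.κ.toLinearMap *ᵥ N.lift v := by
    rw [LinearMap.toMatrix'_mulVec]; rfl
  rw [h3]
  simp [mulVec, dotProduct, liftCoord_apply]

theorem shiftX_sum (a : Fin n ⊕ Fin n) {ι : Type*} (s : Finset ι) (c : ι → ℂ)
    (l : ι → (Fin n ⊕ Fin n → ℂ) →L[ℂ] ℂ) :
    shiftX h a (∑ i ∈ s, c i • l i) = ∑ i ∈ s, c i * shiftX h a (l i) := by
  cases a with
  | inl j => simp [shiftX]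
  | inr j =>
    simp only [shiftX, _root_.sum_apply, _root_.smul_apply, smul_eq_mul, Finset.mul_sum]
    exact Finset.sum_congr rfl fun i _ => by ring

theorem shiftY_sum (a : Fin n ⊕ Fin n) {ι : Type*} (s : Finset ι) (c : ι → ℂ)
    (l : ι → (Fin n ⊕ Fin n → ℂ) →L[ℂ] ℂ) :
    shiftY h a (∑ i ∈ s, c i • l i) = ∑ i ∈ s, c i * shiftY h a (l i) := by
  cases a with
  | inl j => simp [shiftY]
  | inr j =>
    simp only [shiftY, _root_.sum_apply, _root_.smul_apply, smul_eq_mul, Finset.mul_sum]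
    exact Finset.sum_congr rfl fun i _ => by ring

/-- The commutation of the operators in `x` with those in `y`, applied to the FBI kernel. -/
theorem NormalForm.shiftX_liftCoord (a c : Fin n ⊕ Fin n) :
    shiftX h a (N.liftCoord c) = shiftY (-h) c (N.imageCoord a) := by
  have hI : ∀ i : Fin n, N.liftCoord (Sum.inl i) (Sum.elim (Pi.single i 1) 0) = 0 := fun i => by
    rw [liftCoord_apply, lift_inl]; rfl
  cases a with
  | inl j =>
    cases c with
    | inl i => rfl
    | inr i =>
      simp only [shiftX, shiftY, imageCoord_apply, κ_lift_inl]
      simp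
  | inr j =>
    cases c with
    | inl i =>
      simp only [shiftX, shiftY, liftCoord_apply, lift_inl]
      simp
    | inr i =>
      simp only [shiftX, shiftY, liftCoord_apply, imageCoord_apply, ← phaseForm_single_left]
      have h1 := N.phaseForm_single_right (Sum.elim (Pi.single j 1) 0) i
      rw [← neg_eq_iff_eq_neg] at h1
      rw [← h1, N.phaseForm_comm (Sum.elim 0 (Pi.single i 1))]
      push_cast
      ring

/-- The two quantizations agree on the FBI kernel. -/
theorem NormalForm.weylOp_fbi (hh : 0 < h) (x : Fin n → ℂ) (y : Fin n → ℝ) :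
    weylOp (normalMatrix N.M) h (fun x => N.fbi h x y) x =
      weylOp (coeffMatrix q) (-h) (N.fbi h x) y := by
  set K := LinearMap.toMatrix' N.κ.toLinearMap with hK
  set v : Fin n ⊕ Fin n → ℂ := Sum.elim x (ofRealVec y) with hv
  have hx1 : ∀ b, phaseOp h b (fun x => N.fbi h x y) =
      fun x => N.imageCoord b (Sum.elim x (ofRealVec y)) * N.fbi h x y := by
    intro b
    funext x
    have := N.phaseOp_fbi_left hh b (f := fun _ => 1) x y (hasFDerivAt_const _ _)
    simp only [one_mul, mul_one] at this
    rw [this, imageCoord_apply]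
    cases b <;> simp [shiftX]
  have hy1 : ∀ b, phaseOp (-h) b (N.fbi h x) =
      fun y => N.liftCoord b (Sum.elim x (ofRealVec y)) * N.fbi h x y := by
    intro b
    funext y
    have := N.phaseOp_fbi_right hh b (f := fun _ => 1) x y (hasFDerivAt_const _ _)
    simp only [one_mul, mul_one] at this
    rw [this, liftCoord_apply]
    cases b <;> simp [shiftY]
  have hx2 : ∀ a b, phaseOp h a (phaseOp h b (fun x => N.fbi h x y)) x =
      ∑ d, ∑ c, (K a d * K b c) * (N.lift v c * N.lift v d + shiftY (-h) c (N.liftCoord d)) *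
        N.fbi h x y := by
    intro a b
    rw [hx1, N.phaseOp_fbi_left hh a x y (N.imageCoord b).hasFDerivAt, ← hv, ← imageCoord_apply]
    rw [N.imageCoord_eq_sum b, shiftX_sum]
    simp only [shiftX_liftCoord]
    rw [N.imageCoord_eq_sum a]
    simp only [shiftY_sum, _root_.sum_apply, _root_.smul_apply, smul_eq_mul, liftCoord_apply,
      ← hK, Finset.sum_mul, Finset.mul_sum, ← Finset.sum_add_distrib]
    rw [Finset.sum_comm]
    refine Finset.sum_congr rfl fun d _ => ?_
    refine Finset.sum_congr rfl fun c _ => ?_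
    ring
  have hy2 : ∀ c d, phaseOp (-h) c (phaseOp (-h) d (N.fbi h x)) y =
      (N.lift v c * N.lift v d + shiftY (-h) c (N.liftCoord d)) * N.fbi h x y := by
    intro c d
    rw [hy1, N.phaseOp_fbi_right hh c x y (N.liftCoord d).hasFDerivAt, ← hv]
    rfl
  simp only [weylOp, hx2, hy2]
  rw [N.coeffMatrix_eq, ← hK]
  -- both sides are `∑ Q c d * P c d`, with `Q = Kᵀ * normalMatrix M * K` the matrix of `q`
  set P : Fin n ⊕ Fin n → Fin n ⊕ Fin n → ℂ := fun c d =>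
    (N.lift v c * N.lift v d + shiftY (-h) c (N.liftCoord d)) * N.fbi h x y
  have e1 : ∀ a b, normalMatrix N.M a b * ∑ d, ∑ c, K a d * K b c *
      (N.lift v c * N.lift v d + shiftY (-h) c (N.liftCoord d)) * N.fbi h x y =
      ∑ c, ∑ d, K b c * normalMatrix N.M b a * K a d * P c d := by
    intro a b
    rw [Finset.sum_comm, Finset.mul_sum]
    refine Finset.sum_congr rfl fun c _ => ?_
    rw [Finset.mul_sum]
    refine Finset.sum_congr rfl fun d _ => ?_
    rw [(normalMatrix_isSymm N.M).apply a b]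
    ring
  have e2 : ∀ c d, (Kᵀ * normalMatrix N.M * K) c d * P c d =
      ∑ a, ∑ b, K b c * normalMatrix N.M b a * K a d * P c d := by
    intro c d
    simp only [Matrix.mul_apply, transpose_apply, Finset.sum_mul]
  have e3 : ∀ c d, (N.lift v c * N.lift v d + shiftY (-h) c (N.liftCoord d)) * N.fbi h x y =
    P c d := fun _ _ => rfl
  simp only [e1, e3, e2]
  calc ∑ a, ∑ b, ∑ c, ∑ d, K b c * normalMatrix N.M b a * K a d * P c d
      = ∑ a, ∑ c, ∑ b, ∑ d, K b c * normalMatrix N.M b a * K a d * P c d :=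
        Finset.sum_congr rfl fun a _ => Finset.sum_comm
    _ = ∑ c, ∑ a, ∑ b, ∑ d, K b c * normalMatrix N.M b a * K a d * P c d := Finset.sum_comm
    _ = ∑ c, ∑ a, ∑ d, ∑ b, K b c * normalMatrix N.M b a * K a d * P c d :=
        Finset.sum_congr rfl fun c _ => Finset.sum_congr rfl fun a _ => Finset.sum_comm
    _ = ∑ c, ∑ d, ∑ a, ∑ b, K b c * normalMatrix N.M b a * K a d * P c d :=
        Finset.sum_congr rfl fun c _ => Finset.sum_comm

theorem phaseOp_integral {Y : Type*} [TopologicalSpace Y]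
    [SecondCountableTopology Y] [MeasurableSpace Y]
    [OpensMeasurableSpace Y] {μ : Measure Y} {k : Y → (Fin n → ℂ) → ℂ}
    (hk : Continuous (Function.uncurry k)) (hd : ∀ y, Differentiable ℂ (k y)) {u : Y → ℂ}
    (hu : AEStronglyMeasurable u μ)
    (hb : ∀ R : ℝ, ∃ g : Y → ℝ, Integrable g μ ∧ ∀ᵐ y ∂μ, ∀ x, ‖x‖ ≤ R → ‖k y x * u y‖ ≤ g y)
    (a : Fin n ⊕ Fin n) (x : Fin n → ℂ) :
    phaseOp h a (fun x => ∫ y, k y x * u y ∂μ) x = ∫ y, phaseOp h a (k y) x * u y ∂μ := by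
  cases a with
  | inl j =>
    simp only [phaseOp, mul_assoc, integral_const_mul]
  | inr j =>
    simp only [phaseOp, mul_assoc, integral_const_mul]
    rw [fderiv_integral_holomorphic hk hd hu hb]

/-- Local domination of `(1 + ‖y‖) exp(i φ(x, y) / h) u(y)`. -/
theorem NormalForm.exists_fbi_dominated (hh : 0 < h) (u : L2 n)
    (f : (Fin n ⊕ Fin n → ℂ) → ℂ) {C : ℝ} (hC : 0 ≤ C) (hf : ∀ v, ‖f v‖ ≤ C * (1 + ‖v‖)) (R : ℝ) :
    ∃ g : (Fin n → ℝ) → ℝ, Integrable g ∧ ∀ᵐ y, ∀ x : Fin n → ℂ, ‖x‖ ≤ R →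
      ‖f (Sum.elim x (ofRealVec y)) * N.fbi h x y * u y‖ ≤ g y := by
  obtain ⟨c, D, hc, hD, hb⟩ := N.exists_norm_fbi_le hh
  rcases lt_or_ge R 0 with hR | hR
  · exact ⟨0, integrable_zero _ _ _, Eventually.of_forall fun y x hx =>
      absurd (hx.trans_lt hR) (not_lt.2 (norm_nonneg x))⟩
  set G : (Fin n → ℝ) → ℝ := fun y => (1 + ‖y‖) ^ 1 * Real.exp (-c * ‖y‖ ^ 2) with hG
  have hGm : MemLp G 2 := by
    have hGc : Continuous G := by rw [hG]; fun_prop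
    rw [memLp_two_iff_integrable_sq_norm hGc.aestronglyMeasurable]
    refine (integrable_pow_mul_gaussian volume 2 (a := 2 * c) (by positivity)).congr
      (Eventually.of_forall fun y => ?_)
    simp only [hG, pow_one]
    rw [norm_mul, mul_pow, Real.norm_of_nonneg (Real.exp_pos _).le,
      Real.norm_of_nonneg (by positivity), ← Real.exp_nat_mul]
    congr 2
    push_cast
    ring
  refine ⟨fun y => C * (1 + R) * Real.exp (D * R ^ 2) * (G y * ‖u y‖),
    ((hGm.integrable_mul (Lp.memLp u).norm).const_mul _), Eventually.of_forall fun y x hx => ?_⟩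
  have h1 : ‖(Sum.elim x (ofRealVec y) : Fin n ⊕ Fin n → ℂ)‖ ≤ R + ‖y‖ := by
    refine (pi_norm_le_iff_of_nonneg (by positivity)).2 fun a => ?_
    cases a with
    | inl j => exact ((norm_le_pi_norm x j).trans hx).trans (by simp)
    | inr j =>
      have : ‖ofRealVec y j‖ ≤ ‖y‖ := by simpa [ofRealVec] using norm_le_pi_norm y j
      exact this.trans (by simpa using hR)
  have h2 : ‖f (Sum.elim x (ofRealVec y))‖ ≤ C * ((1 + R) * (1 + ‖y‖)) := by
    refine (hf _).trans (mul_le_mul_of_nonneg_left ?_ hC)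
    nlinarith [norm_nonneg y]
  have h3 : ‖N.fbi h x y‖ ≤ Real.exp (D * R ^ 2) * Real.exp (-c * ‖y‖ ^ 2) := by
    refine (hb x y).trans ?_
    gcongr
  rw [norm_mul, norm_mul]
  calc _ ≤ (C * ((1 + R) * (1 + ‖y‖))) * (Real.exp (D * R ^ 2) * Real.exp (-c * ‖y‖ ^ 2)) *
        ‖u y‖ := by gcongr
    _ = _ := by simp only [hG]; ring

/-- `weylOp` can be taken under the integral sign of the FBI transform. -/
theorem NormalForm.weylOp_integral_fbi (hh : 0 < h)
    (Q : Matrix (Fin n ⊕ Fin n) (Fin n ⊕ Fin n) ℂ) (u : L2 n) (x : Fin n → ℂ) :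
    weylOp Q h (fun x => ∫ y, N.fbi h x y * u y) x =
      ∫ y, weylOp Q h (fun x => N.fbi h x y) x * u y := by
  have hu := (Lp.memLp u).aestronglyMeasurable
  have hfc : Continuous (Function.uncurry fun (y : Fin n → ℝ) x => N.fbi h x y) :=
    (N.continuous_fbi h).comp (f := fun z : (Fin n → ℝ) × (Fin n → ℂ) => (z.2, z.1)) (by fun_prop)
  have hb1 : ∀ R : ℝ, ∃ g : (Fin n → ℝ) → ℝ, Integrable g ∧ ∀ᵐ y, ∀ x : Fin n → ℂ, ‖x‖ ≤ R →
      ‖N.fbi h x y * u y‖ ≤ g y := by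
    intro R
    have := N.exists_fbi_dominated hh u (fun _ => 1) zero_le_one (fun v => by
      simp) R
    simpa only [one_mul] using this
  have hx1 : ∀ b y, phaseOp h b (fun x => N.fbi h x y) =
      fun x => N.imageCoord b (Sum.elim x (ofRealVec y)) * N.fbi h x y := by
    intro b y
    funext x
    have := N.phaseOp_fbi_left hh b (f := fun _ => 1) x y (hasFDerivAt_const _ _)
    simp only [one_mul, mul_one] at this
    rw [this, imageCoord_apply]
    cases b <;> simp [shiftX]
  have hb2 : ∀ b R, ∃ g : (Fin n → ℝ) → ℝ, Integrable g ∧ ∀ᵐ y, ∀ x : Fin n → ℂ, ‖x‖ ≤ R →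
      ‖phaseOp h b (fun x => N.fbi h x y) x * u y‖ ≤ g y := by
    intro b R
    simp only [hx1]
    refine N.exists_fbi_dominated hh u (N.imageCoord b) (norm_nonneg (N.imageCoord b))
      (fun v => ?_) R
    refine ((N.imageCoord b).le_opNorm v).trans ?_
    exact mul_le_mul_of_nonneg_left (by linarith) (norm_nonneg _)
  have hc2 : ∀ b, Continuous (Function.uncurry fun (y : Fin n → ℝ) (x : Fin n → ℂ) =>
      phaseOp h b (fun x => N.fbi h x y) x) := by
    intro b
    simp only [hx1]
    refine Continuous.mul ?_ hfc
    simp only [elim_ofRealVec]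
    fun_prop
  have hd2 : ∀ b (y : Fin n → ℝ), Differentiable ℂ
      (phaseOp h b (fun x : Fin n → ℂ => N.fbi h x y)) := by
    intro b y
    rw [hx1]
    refine Differentiable.mul ?_ (N.differentiable_fbi h y)
    simp only [elim_ofRealVec]
    fun_prop
  have h1 : ∀ b, phaseOp h b (fun x => ∫ y, N.fbi h x y * u y) =
      fun x => ∫ y, phaseOp h b (fun x => N.fbi h x y) x * u y := by
    intro b
    funext x
    exact phaseOp_integral hfc (N.differentiable_fbi h) hu hb1 b x
  have h2 : ∀ a b, phaseOp h a (phaseOp h b (fun x => ∫ y, N.fbi h x y * u y)) x =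
      ∫ y, phaseOp h a (phaseOp h b (fun x => N.fbi h x y)) x * u y := by
    intro a b
    rw [h1]
    exact phaseOp_integral (hc2 b) (hd2 b) hu (hb2 b) a x
  have hint : ∀ a b, Integrable fun y =>
      phaseOp h a (phaseOp h b (fun x => N.fbi h x y)) x * u y := by
    intro a b
    cases a with
    | inl j =>
      obtain ⟨g, hg, hgb⟩ := hb2 b ‖x‖
      have h3 : Integrable fun y => phaseOp h b (fun x => N.fbi h x y) x * u y := by
        refine hg.mono' (((hc2 b).comp (Continuous.prodMk_left x)).aestronglyMeasurable.mul hu) ?_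
        filter_upwards [hgb] with y hy
        exact hy x le_rfl
      simp only [phaseOp, mul_assoc]
      exact h3.const_mul _
    | inr j =>
      have h3 := (hasFDerivAt_integral_holomorphic (hc2 b) (hd2 b) hu (hb2 b) x).1
      have h4 := (h3.apply_continuousLinearMap (Pi.single j 1 : Fin n → ℂ)).const_mul
        ((h : ℂ) / Complex.I)
      refine h4.congr (Eventually.of_forall fun y => ?_)
      simp only [_root_.smul_apply, smul_eq_mul]
      rw [mul_comm (u y), ← mul_assoc]
      rfl
  have h5 : ∀ y, weylOp Q h (fun x => N.fbi h x y) x * u y = ∑ a, ∑ b, Q a b *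
      (phaseOp h a (phaseOp h b (fun x => N.fbi h x y)) x * u y) := by
    intro y
    simp only [weylOp, Finset.sum_mul, mul_assoc]
  simp only [h5]
  rw [integral_finsetSum Finset.univ (f := fun a y => ∑ b, Q a b *
    (phaseOp h a (phaseOp h b (fun x => N.fbi h x y)) x * u y))
    fun a _ => integrable_finsetSum _ fun b _ => (hint a b).const_mul _]
  have h6 : ∀ a, ∫ y, ∑ b, Q a b * (phaseOp h a (phaseOp h b (fun x => N.fbi h x y)) x * u y) =
      ∑ b, Q a b * ∫ y, phaseOp h a (phaseOp h b (fun x => N.fbi h x y)) x * u y := by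
    intro a
    rw [integral_finsetSum Finset.univ (f := fun b y => Q a b *
      (phaseOp h a (phaseOp h b (fun x => N.fbi h x y)) x * u y)) fun b _ =>
        (hint a b).const_mul _]
    simp only [integral_const_mul]
  simp only [h6, weylOp, h2]

/-- The FBI transform maps the graph of `q^w` into the graph of `q̃^w`. -/
theorem NormalForm.map_graph (hh : 0 < h) {T : L2 n ≃ₗᵢ[ℂ] HPhi N.Φ h} {c : ℂ}
    (hT : ∀ u x, rep (T u) x = c * ∫ y, N.fbi h x y * u y) {u v : L2 n}
    (huv : (u, v) ∈ (weylL2 (coeffMatrix q) h).graph) : (T u, T v) ∈ (N.op h).graph := by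
  rw [NormalForm.op, mem_graph_weylH]
  funext x
  have h1 : rep (T u) = c • fun x => ∫ y, N.fbi h x y * u y := funext fun x => hT u x
  have h2 : Entire fun x => ∫ y, N.fbi h x y * u y := by
    have hfc : Continuous (Function.uncurry fun (y : Fin n → ℝ) x => N.fbi h x y) :=
      (N.continuous_fbi h).comp (f := fun z : (Fin n → ℝ) × (Fin n → ℂ) => (z.2, z.1))
        (by fun_prop)
    refine entire_integral hfc (N.differentiable_fbi h) (Lp.memLp u).aestronglyMeasurable
      fun R => ?_
    have := N.exists_fbi_dominated hh u (fun _ => 1) zero_le_one (fun v => by simp) R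
    simpa only [one_mul] using this
  rw [h1, weylOp_smul _ _ _ h2, Pi.smul_apply, N.weylOp_integral_fbi hh, hT, smul_eq_mul]
  congr 1
  obtain ⟨ψ, hψ⟩ := N.exists_schwartz_fbi hh x
  have h3 := (mem_graph_weylL2 _ _ _ _).1 huv ψ
  have h4 : (ψ : (Fin n → ℝ) → ℂ) = N.fbi h x := funext hψ
  rw [h4] at h3
  simp only [N.weylOp_fbi hh]
  simp only [mul_comm _ ((u : L2 n) _), mul_comm _ ((v : L2 n) _)]
  exact h3.symm

end Intertwining

/-! ### Action of the normal form on Taylor coefficients -/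

section Taylor

variable {n : ℕ} {M : Matrix (Fin n) (Fin n) ℂ} {lam : Fin n → ℂ} {h : ℝ}

/-- `q̃^w(x, hD_x) = (h / i) (M x · ∂_x + tr M / 2)`. -/
theorem weylOp_normalMatrix (M : Matrix (Fin n) (Fin n) ℂ) (h : ℝ) {f : (Fin n → ℂ) → ℂ}
    (hf : Entire f) : weylOp (normalMatrix M) h f =
      ((h : ℂ) / Complex.I) • (∑ i, ∑ j, M i j • (fun x => x j * partialD i f x) +
        (M.trace / 2) • f) := by
  funext x
  have e1 : ∀ i j, phaseOp h (Sum.inl i) (phaseOp h (Sum.inr j) f) x =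
      (h : ℂ) / Complex.I * (x i * partialD j f x) := by
    intro i j
    simp only [phaseOp, partialD]
    change x i * _ = _
    ring
  have e2 : ∀ i j, phaseOp h (Sum.inr i) (phaseOp h (Sum.inl j) f) x =
      (h : ℂ) / Complex.I * ((if i = j then f x else 0) + x j * partialD i f x) := by
    intro i j
    have h1 := congrFun (partialD_coord_mul hf i j) x
    have h2 : phaseOp h (Sum.inr i) (phaseOp h (Sum.inl j) f) x =
        (h : ℂ) / Complex.I * partialD i (fun x => x j * f x) x := rfl
    rw [h2, h1]
    simp only [Pi.add_apply, Pi.smul_apply, smul_eq_mul, ite_mul, one_mul, zero_mul]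
  simp only [weylOp, Fintype.sum_sum_type, normalMatrix, fromBlocks_apply₁₁, fromBlocks_apply₁₂,
    fromBlocks_apply₂₁, fromBlocks_apply₂₂, Matrix.zero_apply, zero_mul, Finset.sum_const_zero,
    add_zero, zero_add, e1, e2, Matrix.smul_apply, transpose_apply, smul_eq_mul, Pi.smul_apply,
    Pi.add_apply, Finset.sum_apply]
  rw [Finset.sum_comm, ← Finset.sum_add_distrib]
  have e3 : ∀ i, (∑ j, 1 / 2 * M i j * ((h : ℂ) / Complex.I * (x j * partialD i f x)) +
      ∑ j, 1 / 2 * M i j * ((h : ℂ) / Complex.I * ((if i = j then f x else 0) +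
        x j * partialD i f x))) =
      (h : ℂ) / Complex.I * (∑ j, M i j * (x j * partialD i f x) + M i i / 2 * f x) := by
    intro i
    have h3 : M i i / 2 * f x = ∑ j, M i j / 2 * (if i = j then f x else 0) := by simp
    rw [h3, ← Finset.sum_add_distrib, ← Finset.sum_add_distrib, Finset.mul_sum]
    refine Finset.sum_congr rfl fun j _ => ?_
    ring
  rw [Finset.sum_congr rfl fun i _ => e3 i, ← Finset.mul_sum, Finset.sum_add_distrib, trace,
    Finset.sum_div, Finset.sum_mul]
  rfl

theorem Entire.weylOp {f : (Fin n → ℂ) → ℂ} (hf : Entire f)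
    (Q : Matrix (Fin n ⊕ Fin n) (Fin n ⊕ Fin n) ℂ) (h : ℝ) : Entire (weylOp Q h f) := by
  have h1 : QuadOp.weylOp Q h f = ∑ a, ∑ b, Q a b • QuadOp.phaseOp h a (QuadOp.phaseOp h b f) := by
    funext x
    simp [QuadOp.weylOp, Finset.sum_apply]
  rw [h1]
  exact Entire.sum fun a _ => Entire.sum fun b _ => ((hf.phaseOp h b).phaseOp h a).smul _

/-- The exponent `α` after one application of `x_j ∂_{x_i}`, seen from the Taylor coefficients. -/
def moveIndex (α : Fin n → ℕ) (i j : Fin n) : Fin n → ℕ := α - Pi.single j 1 + Pi.single i 1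

/-- The weight `∑ j α_j`, which the nilpotent part of `M` lowers. -/
def weight (α : Fin n → ℕ) : ℕ := ∑ j : Fin n, (j : ℕ) * α j

theorem moveIndex_self (α : Fin n → ℕ) (j : Fin n) (hj : α j ≠ 0) : moveIndex α j j = α := by
  funext k
  by_cases hk : k = j
  · subst hk
    simp only [moveIndex, Pi.add_apply, Pi.sub_apply, Pi.single_eq_same]
    omega
  · simp [moveIndex, Pi.single_eq_of_ne hk]

theorem moveIndex_add (α : Fin n → ℕ) (i j : Fin n) (hj : α j ≠ 0) :
    moveIndex α i j + Pi.single j 1 = α + Pi.single i 1 := by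
  rw [moveIndex, add_right_comm]
  congr 1
  funext k
  by_cases hk : k = j
  · subst hk
    simp only [Pi.add_apply, Pi.sub_apply, Pi.single_eq_same]
    omega
  · simp [Pi.single_eq_of_ne hk]

/-- `q̃^w` acts on the Taylor coefficients at the origin by the diagonal `μ_α` and by terms which
move a unit of `α` from `j` to `i`, for the nonzero entries `M i j` off the diagonal. -/
theorem multiD_weylOp (hM : ∀ j, M j j = 2 * lam j) {f : (Fin n → ℂ) → ℂ} (hf : Entire f)
    (α : Fin n → ℕ) : multiD α (weylOp (normalMatrix M) h f) 0 = mu h lam α * multiD α f 0 +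
      (h : ℂ) / Complex.I * ∑ i, ∑ j, (if j = i then 0 else M i j * α j) *
        multiD (moveIndex α i j) f 0 := by
  have hE : ∀ i j : Fin n, Entire (fun x => x j * partialD i f x) := fun i j =>
    (hf.partialD i).coord_mul j
  have hE1 : ∀ i, Entire (∑ j, M i j • (fun x => x j * partialD i f x)) := fun i =>
    Entire.sum fun j _ => (hE i j).smul _
  rw [weylOp_normalMatrix M h hf, multiD_smul ((Entire.sum fun i _ => hE1 i).add (hf.smul _)),
    multiD_add (Entire.sum fun i _ => hE1 i) (hf.smul _), multiD_sum (fun i _ => hE1 i),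
    multiD_smul hf]
  have h1 : ∀ i j, multiD α (fun x => x j * partialD i f x) 0 =
      α j * multiD (moveIndex α i j) f 0 := by
    intro i j
    rw [multiD_coord_mul (hf.partialD i), moveIndex, multiD_add_single hf]
  have h2 : ∀ i, multiD α (∑ j, M i j • (fun x => x j * partialD i f x)) 0 =
      ∑ j, M i j * (α j * multiD (moveIndex α i j) f 0) := by
    intro i
    rw [multiD_sum (fun j _ => (hE i j).smul _), Finset.sum_apply]
    refine Finset.sum_congr rfl fun j _ => ?_
    rw [multiD_smul (hE i j), Pi.smul_apply, smul_eq_mul, h1]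
  simp only [Pi.smul_apply, Pi.add_apply, Finset.sum_apply, smul_eq_mul, h2]
  have h3 : ∀ i, ∑ j, M i j * (α j * multiD (moveIndex α i j) f 0) =
      2 * lam i * α i * multiD α f 0 + ∑ j, (if j = i then 0 else M i j * α j) *
        multiD (moveIndex α i j) f 0 := by
    intro i
    have h4 : 2 * lam i * α i * multiD α f 0 =
        ∑ j, (if j = i then M i j * α j else 0) * multiD (moveIndex α i j) f 0 := by
      simp only [ite_mul, zero_mul, Finset.sum_ite_eq', Finset.mem_univ, if_true]
      rw [hM]
      by_cases h0 : α i = 0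
      · simp [h0]
      · rw [moveIndex_self α i h0]
    rw [h4, ← Finset.sum_add_distrib]
    refine Finset.sum_congr rfl fun j _ => ?_
    split_ifs <;> ring
  rw [Finset.sum_congr rfl fun i _ => h3 i, Finset.sum_add_distrib, mu, trace]
  simp only [diag_apply, hM]
  have h5 : ∑ i, 2 * lam i * α i * multiD α f 0 + (∑ i, 2 * lam i) / 2 * multiD α f 0 =
      (∑ i, (2 * (α i : ℂ) + 1) * lam i) * multiD α f 0 := by
    rw [Finset.sum_div, Finset.sum_mul, Finset.sum_mul, ← Finset.sum_add_distrib]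
    exact Finset.sum_congr rfl fun i _ => by ring
  rw [mul_assoc, ← h5]
  ring

theorem mu_eq_sum (α : Fin n → ℕ) : mu h lam α =
    (h : ℂ) / Complex.I * (∑ j, (α j : ℂ) * (2 * lam j) + ∑ j, lam j) := by
  rw [mu, ← Finset.sum_add_distrib]
  congr 1
  exact Finset.sum_congr rfl fun j _ => by ring

/-- The off-diagonal entries of a Jordan matrix connect `j = i + 1` to `i` and equal eigenvalues only:
moving a unit lowers the weight and preserves both the degree and `μ_α`. -/
theorem moveIndex_lower (hJ : IsJordanForm M) (hM : ∀ j, M j j = 2 * lam j) (α : Fin n → ℕ)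
    {i j : Fin n} (hij : j ≠ i) (hne : M i j * α j ≠ 0) :
    weight (moveIndex α i j) < weight α ∧ ∑ k, moveIndex α i j k = ∑ k, α k ∧
      mu h lam (moveIndex α i j) = mu h lam α := by
  have hα : α j ≠ 0 := by
    intro h0
    rw [h0] at hne
    simp at hne
  have hMij : M i j ≠ 0 := fun h0 => hne (by rw [h0, zero_mul])
  have hj1 : (j : ℕ) = i + 1 := by
    by_contra hcon
    exact hMij (hJ.1 i j hij hcon)
  have hlam : lam i = lam j := by
    have h1 := ((hJ.2 i j hj1).resolve_left hMij).2
    rw [hM, hM] at h1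
    exact mul_left_cancel₀ two_ne_zero h1
  have hadd := moveIndex_add α i j hα
  have key : ∀ {R : Type} [CommRing R] (g : Fin n → R),
      ∑ k, (moveIndex α i j k : R) * g k + g j = ∑ k, (α k : R) * g k + g i := by
    intro R _ g
    have h1 : ∀ (β : Fin n → ℕ) (l : Fin n),
        ∑ k, ((β + Pi.single l 1 : Fin n → ℕ) k : R) * g k = ∑ k, (β k : R) * g k + g l := by
      intro β l
      simp only [Pi.add_apply, Nat.cast_add, add_mul, Finset.sum_add_distrib]
      congr 1
      rw [Finset.sum_eq_single l]
      · simp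
      · intro k _ hk
        simp [Pi.single_eq_of_ne hk]
      · simp
    rw [← h1, ← h1, hadd]
  refine ⟨?_, ?_, ?_⟩
  · have h1 := key (R := ℤ) fun k => (k : ℤ)
    have h2 : ∀ β : Fin n → ℕ, (weight β : ℤ) = ∑ k, (β k : ℤ) * (k : ℤ) := by
      intro β
      rw [weight]
      push_cast
      exact Finset.sum_congr rfl fun k _ => mul_comm _ _
    zify
    rw [h2, h2]
    have h3 : ((j : ℕ) : ℤ) = i + 1 := by exact_mod_cast hj1
    linarith
  · have h1 := key (R := ℤ) fun k => 1
    simp only [mul_one] at h1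
    zify
    linarith
  · have h1 := key (R := ℂ) fun k => 2 * lam k
    rw [hlam, add_left_inj] at h1
    rw [mu_eq_sum, mu_eq_sum, h1]

/-- On Taylor coefficients `q̃^w` is triangular with diagonal entries `μ_α`: the coefficient of
index `α` only involves indices of lower weight, of the same degree and with the same `μ`. -/
theorem exists_multiD_weylOp (hJ : IsJordanForm M) (hM : ∀ j, M j j = 2 * lam j) (h : ℝ)
    (α : Fin n → ℕ) : ∃ (S : Finset (Fin n × Fin n)) (c : Fin n × Fin n → ℂ)
      (β : Fin n × Fin n → Fin n → ℕ),
      (∀ p ∈ S, weight (β p) < weight α ∧ ∑ k, β p k = ∑ k, α k ∧ mu h lam (β p) = mu h lam α) ∧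
      ∀ f : (Fin n → ℂ) → ℂ, Entire f → multiD α (weylOp (normalMatrix M) h f) 0 =
        mu h lam α * multiD α f 0 + ∑ p ∈ S, c p * multiD (β p) f 0 := by
  classical
  refine ⟨Finset.univ.filter fun p => p.2 ≠ p.1 ∧ M p.1 p.2 * α p.2 ≠ 0,
    fun p => (h : ℂ) / Complex.I * (M p.1 p.2 * α p.2), fun p => moveIndex α p.1 p.2,
    fun p hp => ?_, fun f hf => ?_⟩
  · rw [Finset.mem_filter] at hp
    exact moveIndex_lower hJ hM α hp.2.1 hp.2.2
  · rw [multiD_weylOp hM hf, Finset.sum_filter, ← Finset.sum_product', Finset.mul_sum,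
      Finset.univ_product_univ]
    congr 1
    refine Finset.sum_congr rfl fun p _ => ?_
    by_cases h1 : p.2 = p.1
    · simp [h1]
    · by_cases h2 : M p.1 p.2 * α p.2 = 0
      · rw [if_neg h1, if_neg (by simp [h2]), h2, zero_mul, mul_zero]
      · rw [if_neg h1, if_pos ⟨h1, h2⟩]
        simp only [mul_assoc]

theorem weight_induction {p : (Fin n → ℕ) → Prop}
    (hp : ∀ α, (∀ β, weight β < weight α → p β) → p α) (α : Fin n → ℕ) : p α := by
  induction hw : weight α using Nat.strong_induction_on generalizing α with
  | _ m ih => exact hp α fun β hβ => ih _ (hw ▸ hβ) β rfl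

theorem multiD_smul_sub_weylOp {f : (Fin n → ℂ) → ℂ} (hf : Entire f) (ζ : ℂ) (α : Fin n → ℕ)
    (M : Matrix (Fin n) (Fin n) ℂ) (h : ℝ) :
    multiD α (ζ • f - weylOp (normalMatrix M) h f) 0 =
      ζ * multiD α f 0 - multiD α (weylOp (normalMatrix M) h f) 0 := by
  have hw := hf.weylOp (normalMatrix M) h
  have e : ζ • f - weylOp (normalMatrix M) h f = ζ • f + (-1 : ℂ) • weylOp (normalMatrix M) h f := by
    rw [neg_one_smul, sub_eq_add_neg]
  rw [e, multiD_add (hf.smul _) (hw.smul _), multiD_smul hf, multiD_smul hw]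
  simp [sub_eq_add_neg]

/-- `ζ - q̃^w` is injective on entire functions when `ζ` is none of the `μ_α`. -/
theorem eq_zero_of_weylOp_eq (hJ : IsJordanForm M) (hM : ∀ j, M j j = 2 * lam j) {ζ : ℂ}
    (hζ : ∀ α, ζ ≠ mu h lam α) {f : (Fin n → ℂ) → ℂ} (hf : Entire f)
    (heq : weylOp (normalMatrix M) h f = ζ • f) : f = 0 := by
  refine entire_eq_zero_of_multiD hf (weight_induction fun α ih => ?_)
  obtain ⟨S, c, β, hS, hrec⟩ := exists_multiD_weylOp hJ hM h α
  have h1 := hrec f hf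
  rw [heq, multiD_smul hf, Pi.smul_apply, smul_eq_mul,
    Finset.sum_eq_zero fun p hp => by rw [ih _ (hS p hp).1, mul_zero], add_zero] at h1
  have h2 : (ζ - mu h lam α) * multiD α f 0 = 0 := by rw [sub_mul, h1, sub_self]
  exact (mul_eq_zero.1 h2).resolve_left (sub_ne_zero.2 (hζ α))

theorem finite_degree_lt (N : ℕ) : {α : Fin n → ℕ | ∑ j, α j < N}.Finite := by
  refine (Set.Finite.pi' (t := fun _ : Fin n => Set.Iio N) fun _ => Set.finite_Iio N).subset ?_
  intro α hα j
  exact (Finset.single_le_sum (f := α) (fun _ _ => Nat.zero_le _) (Finset.mem_univ j)).trans_lt hα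

/-- `(ζ - q̃^w) f = v` can be solved up to order `N` at the origin by a polynomial `f`. -/
theorem exists_polynomial_solution (hJ : IsJordanForm M) (hM : ∀ j, M j j = 2 * lam j) {ζ : ℂ}
    (hζ : ∀ α, ζ ≠ mu h lam α) (N : ℕ) (v : (Fin n → ℂ) → ℂ) :
    ∃ (S : Finset (Fin n → ℕ)) (c : (Fin n → ℕ) → ℂ), ∀ α : Fin n → ℕ, ∑ j, α j < N →
      multiD α (ζ • (∑ γ ∈ S, c γ • monomialFun γ) -
        weylOp (normalMatrix M) h (∑ γ ∈ S, c γ • monomialFun γ)) 0 = multiD α v 0 := by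
  classical
  set S := (finite_degree_lt (n := n) N).toFinset with hS
  have hmem : ∀ α, α ∈ S ↔ ∑ j, α j < N := fun α => by simp [hS]
  let poly : (S → ℂ) → (Fin n → ℂ) → ℂ := fun c => ∑ γ : S, c γ • monomialFun γ.1
  have hpoly : ∀ c, Entire (poly c) := fun c =>
    Entire.sum fun γ _ => (entire_monomialFun _).smul _
  have hD : ∀ c (α : Fin n → ℕ), multiD α (poly c) 0 =
      ∑ γ : S, c γ * (if α = γ.1 then ∏ j, ((α j).factorial : ℂ) else 0) := by
    intro c α
    simp only [poly]
    rw [multiD_sum fun γ _ => (entire_monomialFun _).smul _, Finset.sum_apply]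
    refine Finset.sum_congr rfl fun γ _ => ?_
    rw [multiD_smul (entire_monomialFun _), Pi.smul_apply, smul_eq_mul, multiD_monomialFun]
  -- the operator induced on Taylor polynomials of degree less than `N` is injective, hence onto
  let L : (S → ℂ) →ₗ[ℂ] (S → ℂ) :=
    { toFun := fun c α => multiD α.1 (ζ • poly c - weylOp (normalMatrix M) h (poly c)) 0
      map_add' := fun c d => by
        have e : poly (c + d) = poly c + poly d := by
          simp only [poly, Pi.add_apply, add_smul, Finset.sum_add_distrib]
        funext α
        rw [Pi.add_apply, e, multiD_smul_sub_weylOp ((hpoly c).add (hpoly d)),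
          multiD_smul_sub_weylOp (hpoly c), multiD_smul_sub_weylOp (hpoly d),
          weylOp_add _ _ (hpoly c) (hpoly d), multiD_add (hpoly c) (hpoly d),
          multiD_add ((hpoly c).weylOp _ _) ((hpoly d).weylOp _ _)]
        simp only [Pi.add_apply]
        ring
      map_smul' := fun r c => by
        have e : poly (r • c) = r • poly c := by
          simp only [poly, Pi.smul_apply, smul_eq_mul, mul_smul, Finset.smul_sum]
        funext α
        rw [RingHom.id_apply, Pi.smul_apply, e, multiD_smul_sub_weylOp ((hpoly c).smul r),
          multiD_smul_sub_weylOp (hpoly c), weylOp_smul _ _ _ (hpoly c), multiD_smul (hpoly c),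
          multiD_smul ((hpoly c).weylOp _ _)]
        simp only [Pi.smul_apply, smul_eq_mul]
        ring }
  have hinj : Function.Injective L := by
    rw [injective_iff_map_eq_zero]
    intro c hc
    have h1 : weylOp (normalMatrix M) h (poly c) = ζ • poly c := by
      refine entire_eq_of_multiD ((hpoly c).weylOp _ _) ((hpoly c).smul _) fun α => ?_
      rw [multiD_smul (hpoly c), Pi.smul_apply, smul_eq_mul]
      by_cases hα : α ∈ S
      · have h2 := congrFun hc ⟨α, hα⟩
        change multiD α (ζ • poly c - weylOp (normalMatrix M) h (poly c)) 0 = 0 at h2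
        rw [multiD_smul_sub_weylOp (hpoly c), sub_eq_zero] at h2
        exact h2.symm
      · have h0 : ∀ β : Fin n → ℕ, ∑ j, β j = ∑ j, α j → multiD β (poly c) 0 = 0 := by
          intro β hβ
          rw [hD]
          refine Finset.sum_eq_zero fun γ _ => ?_
          have : β ≠ γ.1 := by
            rintro rfl
            exact hα ((hmem α).2 (hβ ▸ (hmem _).1 γ.2))
          rw [if_neg this, mul_zero]
        obtain ⟨T, d, β, hT, hrec⟩ := exists_multiD_weylOp hJ hM h α
        rw [hrec _ (hpoly c), h0 α rfl,
          Finset.sum_eq_zero fun p hp => by rw [h0 _ (hT p hp).2.1, mul_zero]]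
        simp
    have h2 := eq_zero_of_weylOp_eq hJ hM hζ (hpoly c) h1
    funext γ
    have h3 := hD c γ.1
    rw [h2, Finset.sum_eq_single γ (fun b _ hb => by
      rw [if_neg (fun h => hb (Subtype.ext h).symm), mul_zero]) (by simp), if_pos rfl] at h3
    have h4 : multiD γ.1 (0 : (Fin n → ℂ) → ℂ) 0 = 0 := by
      have := multiD_smul (n := n) entire_zero 0 γ.1
      rw [zero_smul, zero_smul] at this
      rw [this]; rfl
    rw [h4] at h3
    refine (mul_eq_zero.1 h3.symm).resolve_right ?_
    exact Finset.prod_ne_zero_iff.2 fun j _ => by exact_mod_cast (Nat.factorial_ne_zero _)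
  obtain ⟨c, hc⟩ := LinearMap.injective_iff_surjective.1 hinj fun α => multiD α.1 v 0
  refine ⟨S, fun γ => if hγ : γ ∈ S then c ⟨γ, hγ⟩ else 0, fun α hα => ?_⟩
  have e : ∑ γ ∈ S, (if hγ : γ ∈ S then c ⟨γ, hγ⟩ else 0) • monomialFun γ = poly c := by
    rw [← Finset.sum_coe_sort]
    refine Finset.sum_congr rfl fun γ _ => ?_
    rw [dif_pos γ.2]
  rw [e]
  exact congrFun hc ⟨α, (hmem α).2 hα⟩

end Taylor

/-! ### The linear flow generated by the normal form -/

section ExpFlow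

variable {E : Type*} [NormedAddCommGroup E] [NormedSpace ℂ E]

/-- The one-parameter group `e^{t A}`. -/
def expFlow (A : E →L[ℂ] E) (t : ℝ) : E →L[ℂ] E := NormedSpace.exp ((t : ℂ) • A)

theorem expFlow_zero (A : E →L[ℂ] E) : expFlow A 0 = ContinuousLinearMap.id ℂ E := by
  rw [expFlow, Complex.ofReal_zero, zero_smul, NormedSpace.exp_zero]; rfl

theorem expFlow_add [CompleteSpace E] (A : E →L[ℂ] E) (s t : ℝ) (x : E) :
    expFlow A (s + t) x = expFlow A s (expFlow A t x) := by
  let _ : NormedAlgebra ℚ (E →L[ℂ] E) := NormedAlgebra.restrictScalars ℚ ℂ _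
  rw [expFlow, Complex.ofReal_add, add_smul, NormedSpace.exp_add_of_commute]
  · rfl
  · exact ((Commute.refl A).smul_left (s : ℂ)).smul_right (t : ℂ)

theorem hasDerivAt_expFlow_clm [CompleteSpace E] (A : E →L[ℂ] E) (t : ℝ) :
    HasDerivAt (expFlow A) (A * expFlow A t) t := by
  have h := hasDerivAt_exp_smul_const' (𝕂 := ℂ) A (t : ℂ)
  refine (HasDerivAt.scomp (𝕜' := ℂ) t h Complex.ofRealCLM.hasDerivAt).congr_deriv ?_
  rw [Complex.ofRealCLM_apply, Complex.ofReal_one, one_smul]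
  rfl

theorem hasDerivAt_expFlow [CompleteSpace E] (A : E →L[ℂ] E) (t : ℝ) (x : E) :
    HasDerivAt (fun t => expFlow A t x) (A (expFlow A t x)) t :=
  (((ContinuousLinearMap.apply ℂ E x).restrictScalars ℝ).hasFDerivAt
    (x := expFlow A t)).comp_hasDerivAt t (hasDerivAt_expFlow_clm A t)

theorem continuous_expFlow [CompleteSpace E] (A : E →L[ℂ] E) : Continuous (expFlow A) :=
  continuous_iff_continuousAt.2 fun t => (hasDerivAt_expFlow_clm A t).continuousAt

end ExpFlow

section Flow

variable {n : ℕ}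

/-- The linear vector field `x ↦ i M x`. -/
def flowGen (M : Matrix (Fin n) (Fin n) ℂ) : (Fin n → ℂ) →L[ℂ] (Fin n → ℂ) :=
  (Matrix.toLin' (Complex.I • M)).toContinuousLinearMap

theorem flowGen_apply (M : Matrix (Fin n) (Fin n) ℂ) (x : Fin n → ℂ) :
    flowGen M x = Complex.I • (M *ᵥ x) := by
  simp [flowGen]

/-- The flow `e^{i t M}`. -/
def flow (M : Matrix (Fin n) (Fin n) ℂ) (t : ℝ) : (Fin n → ℂ) →L[ℂ] (Fin n → ℂ) :=
  expFlow (flowGen M) t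

variable (M : Matrix (Fin n) (Fin n) ℂ)

theorem flow_zero : flow M 0 = ContinuousLinearMap.id ℂ (Fin n → ℂ) := expFlow_zero _

theorem flow_add (s t : ℝ) (x : Fin n → ℂ) : flow M (s + t) x = flow M s (flow M t x) :=
  expFlow_add _ s t x

theorem hasDerivAt_flow (t : ℝ) (x : Fin n → ℂ) :
    HasDerivAt (fun t => flow M t x) (flowGen M (flow M t x)) t := hasDerivAt_expFlow _ t x

theorem continuous_flow : Continuous (flow M) := continuous_expFlow _

/-- The flow of a Jordan matrix with spectrum in the upper half-plane decays exponentially: in the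
norm `∑ r^j |x_j|²` with `r` large, the nilpotent part is a small perturbation. -/
theorem exists_flow_decay {M : Matrix (Fin n) (Fin n) ℂ} (hJ : IsJordanForm M)
    (hpos : ∀ j, 0 < (M j j).im) :
    ∃ c C : ℝ, 0 < c ∧ 0 < C ∧ ∀ t, 0 ≤ t → ∀ x, ‖flow M t x‖ ≤ C * Real.exp (-c * t) * ‖x‖ := by
  obtain ⟨c, hc, hcb⟩ : ∃ c : ℝ, 0 < c ∧ ∀ j, c ≤ (M j j).im := by
    rcases isEmpty_or_nonempty (Fin n) with he | he
    · exact ⟨1, one_pos, fun j => (he.false j).elim⟩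
    · obtain ⟨j, hj⟩ := Finite.exists_min fun j => (M j j).im
      exact ⟨_, hpos j, hj⟩
  -- with `r = ε⁻²` an entry `1` above the diagonal costs at most `ε` times the weighted norm, and
  -- `2nε ≤ c` leaves half of the dissipation of the diagonal
  set ε : ℝ := min 1 (c / (2 * (n + 1))) with hε
  have hε0 : 0 < ε := lt_min one_pos (by positivity)
  have hε1 : ε ≤ 1 := min_le_left _ _
  have hεc : 2 * n * ε ≤ c := by
    have h1 : ε ≤ c / (2 * (n + 1)) := min_le_right _ _
    rw [le_div_iff₀ (by positivity)] at h1
    nlinarith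
  set r : ℝ := (ε ^ 2)⁻¹ with hr
  have hr1 : 1 ≤ r := (one_le_inv₀ (by positivity)).2 (by nlinarith)
  have hr0 : 0 < r := by linarith
  let W : (Fin n → ℂ) → ℝ := fun x => ∑ j : Fin n, r ^ (j : ℕ) * Complex.normSq (x j)
  -- dissipation of the weighted norm
  have hdiss : ∀ x : Fin n → ℂ, ∑ j : Fin n, r ^ (j : ℕ) *
      (2 * (conj (x j) * flowGen M x j).re) ≤ -c * W x := by
    intro x
    have hterm : ∀ j k : Fin n, r ^ (j : ℕ) * (2 * (conj (x j) * (Complex.I * (M j k * x k))).re) ≤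
        (if k = j then -2 * c * (r ^ (j : ℕ) * Complex.normSq (x j)) else 0) +
        ε * (r ^ (j : ℕ) * Complex.normSq (x j) + r ^ (k : ℕ) * Complex.normSq (x k)) := by
      intro j k
      have hnn : 0 ≤ ε * (r ^ (j : ℕ) * Complex.normSq (x j) +
          r ^ (k : ℕ) * Complex.normSq (x k)) := by
        have := Complex.normSq_nonneg (x j)
        have := Complex.normSq_nonneg (x k)
        positivity
      by_cases hkj : k = j
      · subst hkj
        rw [if_pos rfl]
        have e1 : (conj (x k) * (Complex.I * (M k k * x k))).re =
            -(M k k).im * Complex.normSq (x k) := by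
          rw [Complex.normSq_apply]
          simp only [Complex.mul_re, Complex.mul_im, Complex.conj_re, Complex.conj_im,
            Complex.I_re, Complex.I_im]
          ring
        rw [e1]
        have h2 : r ^ (k : ℕ) * Complex.normSq (x k) * c ≤
            r ^ (k : ℕ) * Complex.normSq (x k) * (M k k).im :=
          mul_le_mul_of_nonneg_left (hcb k) (mul_nonneg (by positivity) (Complex.normSq_nonneg _))
        linarith
      · rw [if_neg hkj, zero_add]
        by_cases hk1 : (k : ℕ) = j + 1
        · rcases hJ.2 j k hk1 with h0 | ⟨h1, -⟩
          · rw [h0]; simpa using hnn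
          · rw [h1, one_mul]
            have e1 : (conj (x j) * (Complex.I * x k)).re ≤ ‖x j‖ * ‖x k‖ := by
              refine (Complex.re_le_norm _).trans ?_
              rw [norm_mul, norm_mul, Complex.norm_I, one_mul, RCLike.norm_conj]
            rw [hk1, pow_succ, Complex.normSq_eq_norm_sq, Complex.normSq_eq_norm_sq]
            have e2 : 2 * (‖x j‖ * ‖x k‖) ≤ ε * (‖x j‖ ^ 2 + r * ‖x k‖ ^ 2) := by
              have h3 : ε * r = ε⁻¹ := by rw [hr]; field_simp
              have h4 : 0 ≤ ε * (‖x j‖ - ε⁻¹ * ‖x k‖) ^ 2 := by positivity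
              have h5 : ε * (‖x j‖ - ε⁻¹ * ‖x k‖) ^ 2 =
                  ε * ‖x j‖ ^ 2 - 2 * (‖x j‖ * ‖x k‖) + ε⁻¹ * ‖x k‖ ^ 2 := by
                field_simp; ring
              have h6 : ε * (‖x j‖ ^ 2 + r * ‖x k‖ ^ 2) = ε * ‖x j‖ ^ 2 + (ε * r) * ‖x k‖ ^ 2 := by
                ring
              rw [h6, h3]
              linarith
            calc r ^ (j : ℕ) * (2 * (conj (x j) * (Complex.I * x k)).re)
                ≤ r ^ (j : ℕ) * (ε * (‖x j‖ ^ 2 + r * ‖x k‖ ^ 2)) :=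
                  mul_le_mul_of_nonneg_left (by linarith) (by positivity)
              _ = _ := by ring
        · rw [hJ.1 j k hkj hk1]
          simpa using hnn
    have h1 : ∀ j : Fin n, r ^ (j : ℕ) * (2 * (conj (x j) * flowGen M x j).re) =
        ∑ k, r ^ (j : ℕ) * (2 * (conj (x j) * (Complex.I * (M j k * x k))).re) := by
      intro j
      rw [flowGen_apply, Pi.smul_apply, smul_eq_mul, mulVec, dotProduct, Finset.mul_sum,
        Finset.mul_sum, Complex.re_sum, Finset.mul_sum, Finset.mul_sum]
    rw [Finset.sum_congr rfl fun j _ => h1 j]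
    refine (Finset.sum_le_sum fun j _ => Finset.sum_le_sum fun k _ => hterm j k).trans ?_
    have h2 : ∑ j : Fin n, ∑ k : Fin n, ((if k = j then
        -2 * c * (r ^ (j : ℕ) * Complex.normSq (x j)) else 0) +
        ε * (r ^ (j : ℕ) * Complex.normSq (x j) + r ^ (k : ℕ) * Complex.normSq (x k))) =
        -2 * c * W x + 2 * n * ε * W x := by
      simp only [Finset.sum_add_distrib, Finset.sum_ite_eq', Finset.mem_univ, if_true, mul_add,
        Finset.sum_const, Finset.card_univ, Fintype.card_fin, nsmul_eq_mul, ← Finset.mul_sum]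
      simp only [W]
      ring
    rw [h2]
    have hW0 : 0 ≤ W x := Finset.sum_nonneg fun j _ =>
      mul_nonneg (by positivity) (Complex.normSq_nonneg _)
    nlinarith
  have hWd : ∀ x t, HasDerivAt (fun t => W (flow M t x))
      (∑ j : Fin n, r ^ (j : ℕ) * (2 * (conj (flow M t x j) * flowGen M (flow M t x) j).re)) t := by
    intro x t
    have h1 := hasDerivAt_pi.1 (hasDerivAt_flow M t x)
    refine HasDerivAt.fun_sum fun j _ => HasDerivAt.const_mul _ ?_
    have hre : HasDerivAt (fun t => (flow M t x j).re) (flowGen M (flow M t x) j).re t :=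
      Complex.reCLM.hasFDerivAt.comp_hasDerivAt t (h1 j)
    have him : HasDerivAt (fun t => (flow M t x j).im) (flowGen M (flow M t x) j).im t :=
      Complex.imCLM.hasFDerivAt.comp_hasDerivAt t (h1 j)
    have h2 := (hre.mul hre).add (him.mul him)
    have e : (fun t => Complex.normSq (flow M t x j)) =
        (fun t => (flow M t x j).re) * (fun t => (flow M t x j).re) +
          (fun t => (flow M t x j).im) * (fun t => (flow M t x j).im) := by
      funext t
      simp [Complex.normSq_apply]
    rw [e]
    refine h2.congr_deriv ?_
    simp only [Complex.mul_re, Complex.conj_re, Complex.conj_im]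
    ring
  have hWdecay : ∀ x t, 0 ≤ t → W (flow M t x) ≤ Real.exp (-c * t) * W x := by
    intro x t ht
    have hexp : ∀ s : ℝ, HasDerivAt (fun s => Real.exp (c * s)) (c * Real.exp (c * s)) s := by
      intro s
      have := ((hasDerivAt_id s).const_mul c).exp
      simpa [mul_comm] using this
    have hprod : ∀ s, HasDerivAt (fun s => Real.exp (c * s) * W (flow M s x)) _ s := fun s =>
      (hexp s).mul (hWd x s)
    have hanti : Antitone fun s => Real.exp (c * s) * W (flow M s x) := by
      refine antitone_of_deriv_nonpos (fun s => (hprod s).differentiableAt) fun s => ?_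
      rw [(hprod s).deriv]
      have h1 := hdiss (flow M s x)
      have h2 := Real.exp_pos (c * s)
      nlinarith
    have h1 := hanti ht
    simp only [mul_zero, Real.exp_zero, one_mul, flow_zero, ContinuousLinearMap.id_apply] at h1
    rw [neg_mul, Real.exp_neg]
    rw [inv_mul_eq_div, le_div_iff₀ (Real.exp_pos _)]
    linarith
  set K : ℝ := ∑ j : Fin n, r ^ (j : ℕ)
  have hK0 : 0 ≤ K := Finset.sum_nonneg fun j _ => by positivity
  have hWle : ∀ x, W x ≤ K * ‖x‖ ^ 2 := by
    intro x
    rw [Finset.sum_mul]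
    refine Finset.sum_le_sum fun j _ => ?_
    rw [Complex.normSq_eq_norm_sq]
    have := norm_le_pi_norm x j
    gcongr
  have hWge : ∀ x, ‖x‖ ^ 2 ≤ W x := by
    intro x
    have hW0 : 0 ≤ W x := Finset.sum_nonneg fun j _ =>
      mul_nonneg (by positivity) (Complex.normSq_nonneg _)
    have h1 : ‖x‖ ≤ Real.sqrt (W x) := by
      refine (pi_norm_le_iff_of_nonneg (Real.sqrt_nonneg _)).2 fun j => ?_
      refine Real.le_sqrt_of_sq_le ?_
      have h2 : r ^ (j : ℕ) * Complex.normSq (x j) ≤ W x :=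
        Finset.single_le_sum (f := fun j : Fin n => r ^ (j : ℕ) * Complex.normSq (x j))
          (fun j _ => mul_nonneg (by positivity) (Complex.normSq_nonneg _)) (Finset.mem_univ j)
      have h3 : 1 ≤ r ^ (j : ℕ) := one_le_pow₀ hr1
      rw [← Complex.normSq_eq_norm_sq]
      nlinarith [Complex.normSq_nonneg (x j)]
    calc ‖x‖ ^ 2 ≤ Real.sqrt (W x) ^ 2 := by gcongr
      _ = W x := Real.sq_sqrt hW0
  refine ⟨c / 2, Real.sqrt K + 1, by positivity, by positivity, fun t ht x => ?_⟩
  have h1 : ‖flow M t x‖ ^ 2 ≤ (Real.sqrt K * Real.exp (-(c / 2) * t) * ‖x‖) ^ 2 := by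
    refine (hWge _).trans ((hWdecay x t ht).trans ?_)
    rw [mul_pow, mul_pow, Real.sq_sqrt hK0, ← Real.exp_nat_mul]
    have e : ((2 : ℕ) : ℝ) * (-(c / 2) * t) = -c * t := by push_cast; ring
    rw [e]
    nlinarith [hWle x, Real.exp_pos (-c * t)]
  refine (abs_le_of_sq_le_sq' h1 (by positivity)).2.trans ?_
  have := Real.exp_pos (-(c / 2) * t)
  gcongr
  linarith

end Flow

section WeightDecreases

variable {n : ℕ} {q : QuadraticMap ℝ (Fin n ⊕ Fin n → ℝ) ℂ} (N : NormalForm q)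

/-- The weight decreases along the flow, its derivative being `-Re q`. -/
theorem NormalForm.form_flow_le (hre : ∀ X, 0 ≤ (q X).re) {t : ℝ} (ht : 0 ≤ t) (x : Fin n → ℂ) :
    N.Φ (flow N.M t x) ≤ N.Φ x := by
  have hneg : ∀ x, 2 * polarForm N.Φ x (flowGen N.M x) ≤ 0 := by
    intro x
    obtain ⟨X, hX⟩ := N.exists_real x
    have h1 := N.symbol x (momentum N.Φ x)
    rw [← hX, LinearEquiv.symm_apply_apply, complexify_realPoint, dotProduct_comm, dotProduct,
      momentum_dot] at h1
    have h2 := congrArg Complex.re h1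
    have h3 : (-2 * Complex.I * (polarForm N.Φ x (N.M *ᵥ x) : ℂ) -
        2 * (polarForm N.Φ x (Complex.I • N.M *ᵥ x) : ℂ)).re =
        -2 * polarForm N.Φ x (Complex.I • N.M *ᵥ x) := by
      simp
    rw [h3] at h2
    rw [flowGen_apply]
    linarith [hre X]
  have hd : ∀ s, HasDerivAt (fun s => N.Φ (flow N.M s x))
      (2 * polarForm N.Φ (flow N.M s x) (flowGen N.M (flow N.M s x))) s := by
    intro s
    have hdiff : DifferentiableAt ℝ N.Φ (flow N.M s x) := by
      have e : (N.Φ : (Fin n → ℂ) → ℝ) = fun x => polarForm N.Φ x x := by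
        funext x; rw [polarForm_self]
      let b := (LinearMap.toContinuousLinearMap.toLinearMap ∘ₗ polarForm N.Φ).toContinuousLinearMap
      have hb : ∀ x y, b x y = polarForm N.Φ x y := fun _ _ => rfl
      rw [e]
      simp only [← hb]
      fun_prop
    have h1 := hdiff.hasFDerivAt.comp_hasDerivAt s (hasDerivAt_flow N.M s x)
    rw [fderiv_form] at h1
    exact h1
  have hanti : Antitone fun s => N.Φ (flow N.M s x) :=
    antitone_of_deriv_nonpos (fun s => (hd s).differentiableAt) fun s => by
      rw [(hd s).deriv]; exact hneg _
  have := hanti ht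
  simpa [flow_zero] using this

theorem NormalForm.im_diag_pos (j : Fin n) : 0 < (N.M j j).im := by
  have h1 : N.lam j ∈ Finset.univ.val.map N.lam :=
    Multiset.mem_map_of_mem _ (Finset.mem_univ_val j)
  rw [N.eigenvalues, Multiset.mem_filter] at h1
  rw [N.diag]
  simpa using h1.2

theorem NormalForm.im_lam_pos (j : Fin n) : 0 < (N.lam j).im := by
  have := N.im_diag_pos j
  rw [N.diag] at this
  simpa using this

end WeightDecreases

/-! ### Integration along the flow -/

section FlowIntegral

variable {n : ℕ} {M : Matrix (Fin n) (Fin n) ℂ} {h : ℝ} {τ : ℂ} {g : (Fin n → ℂ) → ℂ}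

/-- Along the flow, `q̃^w(x, hD_x)` is a first order operator with constant coefficients. -/
theorem weylOp_normalMatrix_apply (M : Matrix (Fin n) (Fin n) ℂ) (h : ℝ) {f : (Fin n → ℂ) → ℂ}
    (hf : Entire f) (x : Fin n → ℂ) : weylOp (normalMatrix M) h f x =
      -h * fderiv ℂ f x (flowGen M x) + h / Complex.I * (M.trace / 2) * f x := by
  have h1 : fderiv ℂ f x (flowGen M x) =
      Complex.I * ∑ i, ∑ j, M i j * (x j * partialD i f x) := by
    rw [flowGen_apply, map_smul, smul_eq_mul]
    congr 1
    conv_lhs => rw [pi_eq_sum_univ' (M *ᵥ x)]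
    rw [map_sum]
    refine Finset.sum_congr rfl fun i _ => ?_
    rw [map_smul, smul_eq_mul, mulVec, dotProduct, Finset.sum_mul]
    refine Finset.sum_congr rfl fun j _ => ?_
    rw [partialD]; ring
  rw [weylOp_normalMatrix M h hf, h1]
  simp only [Pi.smul_apply, Pi.add_apply, Finset.sum_apply, smul_eq_mul]
  field_simp
  rw [Complex.I_sq]
  ring

theorem continuous_flow_apply (M : Matrix (Fin n) (Fin n) ℂ) :
    Continuous fun p : ℝ × (Fin n → ℂ) => flow M p.1 p.2 :=
  isBoundedBilinearMap_apply.continuous.comp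
    (((continuous_flow M).comp continuous_fst).prodMk continuous_snd)

/-- The integral of `e^{τ t} g` along the trajectories of the flow, over the times in `s`. -/
def flowIntegral (τ : ℂ) (M : Matrix (Fin n) (Fin n) ℂ) (g : (Fin n → ℂ) → ℂ) (s : Set ℝ)
    (x : Fin n → ℂ) : ℂ :=
  ∫ t in s, Complex.exp (τ * t) * g (flow M t x)

theorem continuous_flowKernel (hg : Continuous g) : Continuous
    (Function.uncurry fun (t : ℝ) (x : Fin n → ℂ) => Complex.exp (τ * t) * g (flow M t x)) := by
  have h1 := hg.comp (continuous_flow_apply M)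
  have h2 : Continuous fun p : ℝ × (Fin n → ℂ) => Complex.exp (τ * p.1) := by fun_prop
  exact h2.mul h1

/-- A function which vanishes to high order at the origin and has at most quadratic exponential
growth decays along the flow as fast as required. -/
theorem norm_flowKernel_le {c C B D : ℝ} {N : ℕ} (hg : Entire g)
    (hgB : ∀ z, ‖g z‖ ≤ B * Real.exp (D * ‖z‖ ^ 2)) (hD : 0 ≤ D)
    (h0 : ∀ α : Fin n → ℕ, ∑ j, α j < N → multiD α g 0 = 0)
    (hc : 0 < c) (hC : 0 < C)
    (hfl : ∀ t, 0 ≤ t → ∀ x, ‖flow M t x‖ ≤ C * Real.exp (-c * t) * ‖x‖)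
    (hN : τ.re + 1 ≤ c * N / 2) {t : ℝ} (ht : 0 < t) (x : Fin n → ℂ) :
    ‖Complex.exp (τ * t) * g (flow M t x)‖ ≤
      B * Real.exp (D * C ^ 2 * Real.exp (-c * t) * (‖x‖ + 1) ^ 2) * Real.exp (-t) := by
  have hB : 0 ≤ B := by
    have := (norm_nonneg _).trans (hgB 0)
    simpa using this
  set ρ : ℝ := Real.exp (-(c * t / 2)) with hρ
  have hρ0 : 0 < ρ := Real.exp_pos _
  have hρ1 : ρ < 1 := Real.exp_lt_one_iff.2 (by have := mul_pos hc ht; linarith)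
  have hρ2 : ρ * ρ = Real.exp (-c * t) := by rw [hρ, ← Real.exp_add]; congr 1; ring
  -- the Schwarz lemma on the ball of radius `R`, which shrinks like `ρ = exp(-ct/2)` and still
  -- contains the point of the flow, at `ρ` times its radius
  set R : ℝ := C * ρ * (‖x‖ + 1) with hR
  have hx1 : 0 < ‖x‖ + 1 := by positivity
  have hR0 : 0 < R := by positivity
  have h1 : ‖flow M t x‖ ≤ ρ * R := by
    refine (hfl t ht.le x).trans ?_
    rw [← hρ2, hR]
    have : C * (ρ * ρ) * ‖x‖ ≤ C * (ρ * ρ) * (‖x‖ + 1) := by gcongr; linarith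
    linarith
  have h2 := norm_le_pow_of_multiD_eq_zero hg N h0 hR0 (B := B * Real.exp (D * R ^ 2))
    (fun z hz => (hgB z).trans (by gcongr)) hρ1 h1
  have h3 : D * R ^ 2 = D * C ^ 2 * Real.exp (-c * t) * (‖x‖ + 1) ^ 2 := by
    rw [hR, ← hρ2]; ring
  rw [h3] at h2
  rw [norm_mul, Complex.norm_exp]
  have h4 : (τ * t).re = τ.re * t := by simp
  have h5 : ρ ^ N = Real.exp (-(c * N / 2) * t) := by
    rw [hρ, ← Real.exp_nat_mul]; congr 1; ring
  rw [h4]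
  calc Real.exp (τ.re * t) * ‖g (flow M t x)‖
      ≤ Real.exp (τ.re * t) * (B * Real.exp (D * C ^ 2 * Real.exp (-c * t) * (‖x‖ + 1) ^ 2) *
        Real.exp (-(c * N / 2) * t)) := by rw [← h5]; gcongr
    _ = B * Real.exp (D * C ^ 2 * Real.exp (-c * t) * (‖x‖ + 1) ^ 2) *
        Real.exp (τ.re * t + -(c * N / 2) * t) := by rw [Real.exp_add]; ring
    _ ≤ _ := by
      gcongr
      nlinarith

section

variable {A : ℝ} (hg : Entire g) (hA : 0 ≤ A)
  {B : ℝ} (hB : 0 ≤ B) (hk : ∀ t : ℝ, 0 < t → ∀ x, ‖Complex.exp (τ * t) * g (flow M t x)‖ ≤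
    B * Real.exp (A * (‖x‖ + 1) ^ 2) * Real.exp (-t))

include hg hA hB hk in
theorem entire_flowIntegral {s : Set ℝ} (hs : MeasurableSet s) (hs0 : s ⊆ Ioi 0) :
    Entire (flowIntegral τ M g s) := by
  have h1 : flowIntegral τ M g s = fun x =>
      ∫ t : ℝ in s, (Complex.exp (τ * t) * g (flow M t x)) * (fun _ : ℝ => (1 : ℂ)) t := by
    funext x
    simp [flowIntegral]
  rw [h1]
  refine entire_integral (μ := volume.restrict s)
    (k := fun (t : ℝ) (x : Fin n → ℂ) => Complex.exp (τ * t) * g (flow M t x))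
    (continuous_flowKernel hg.differentiable.continuous) (fun t => ?_)
    aestronglyMeasurable_const fun R => ?_
  · exact (hg.differentiable.comp (flow M t).differentiable).const_mul _
  · refine ⟨fun t => B * Real.exp (A * (R + 1) ^ 2) * Real.exp (-t),
      ((integrableOn_exp_neg_Ioi 0).mono_set hs0).const_mul _, ?_⟩
    filter_upwards [ae_restrict_mem hs] with t ht x hx
    rw [mul_one]
    refine (hk t (hs0 ht) x).trans ?_
    gcongr

include hg hk in
theorem integrableOn_flowKernel (x : Fin n → ℂ) :
    IntegrableOn (fun t : ℝ => Complex.exp (τ * t) * g (flow M t x)) (Ioi 0) := by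
  have hc : Continuous fun t : ℝ => Complex.exp (τ * t) * g (flow M t x) :=
    (continuous_flowKernel (M := M) (τ := τ) hg.differentiable.continuous).comp
      (continuous_id.prodMk continuous_const)
  refine Integrable.mono' ((integrableOn_exp_neg_Ioi 0).const_mul
    (B * Real.exp (A * (‖x‖ + 1) ^ 2))) hc.aestronglyMeasurable ?_
  filter_upwards [ae_restrict_mem measurableSet_Ioi] with t ht
  exact hk t ht x

include hg hA hB hk in
/-- The integral over all positive times inverts the generator of the flow. -/
theorem fderiv_flowIntegral (x : Fin n → ℂ) :
    fderiv ℂ (flowIntegral τ M g (Ioi 0)) x (flowGen M x) =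
      -τ * flowIntegral τ M g (Ioi 0) x - g x := by
  set U := flowIntegral τ M g (Ioi 0) with hU
  have hUe : Entire U := entire_flowIntegral hg hA hB hk measurableSet_Ioi Subset.rfl
  set F : ℝ → ℂ := fun t => Complex.exp (τ * t) * g (flow M t x) with hF
  have hFc : Continuous F :=
    (continuous_flowKernel (M := M) (τ := τ) hg.differentiable.continuous).comp
      (continuous_id.prodMk continuous_const)
  have hFi : IntegrableOn F (Ioi 0) := integrableOn_flowKernel hg hk x
  have hFi' : ∀ s : ℝ, IntegrableOn F (Ioi s) := by
    intro s
    have h1 : IntegrableOn F (Icc s 0 ∪ Ioi 0) :=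
      (hFc.continuousOn.integrableOn_compact isCompact_Icc).union hFi
    refine h1.mono_set fun t ht => ?_
    rcases le_or_gt t 0 with h | h
    · exact Or.inl ⟨le_of_lt ht, h⟩
    · exact Or.inr h
  -- along the flow `U` is, up to the factor `exp(-τs)`, the integral over the times after `s`
  have hUF : ∀ s : ℝ, U (flow M s x) = Complex.exp (-τ * s) * (U x - ∫ t in (0 : ℝ)..s, F t) := by
    intro s
    have h1 : U (flow M s x) = ∫ t : ℝ in Ioi 0, Complex.exp (-τ * s) * F (t + s) := by
      rw [hU, flowIntegral]
      refine setIntegral_congr_fun measurableSet_Ioi fun t _ => ?_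
      simp only [hF]
      rw [flow_add, ← mul_assoc, ← Complex.exp_add]
      congr 2
      push_cast; ring
    have h2 : ∫ t : ℝ in Ioi 0, F (t + s) = ∫ t in Ioi s, F t := by
      have hmp := measurePreserving_add_right (volume : Measure ℝ) s
      have h3 := hmp.setIntegral_preimage_emb (measurableEmbedding_addRight s) F (Ioi s)
      rw [← h3]
      congr 2
      ext t; simp
    rw [h1, integral_const_mul, h2, ← intervalIntegral.integral_Ioi_sub_Ioi' hFi (hFi' s)]
    congr 1
    change _ = (∫ t in Ioi 0, F t) - _
    ring
  -- differentiate both sides at `s = 0`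
  have hd1 : HasDerivAt (fun s : ℝ => U (flow M s x)) (fderiv ℂ U x (flowGen M x)) 0 := by
    have h0 : flow M 0 x = x := by rw [flow_zero]; rfl
    have h1 := hasDerivAt_flow M 0 x
    have h2 : HasFDerivAt U ((fderiv ℂ U (flow M 0 x)).restrictScalars ℝ) (flow M 0 x) :=
      ((hUe.differentiable _).hasFDerivAt).restrictScalars ℝ
    have h3 := h2.comp_hasDerivAt (0 : ℝ) h1
    rw [h0] at h3
    exact h3
  have hd2 : HasDerivAt (fun s : ℝ => Complex.exp (-τ * s) * (U x - ∫ t in (0 : ℝ)..s, F t))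
      (-τ * U x - g x) 0 := by
    have h1 : HasDerivAt (fun s : ℝ => ∫ t in (0 : ℝ)..s, F t) (F 0) 0 :=
      hFc.integral_hasStrictDerivAt 0 0 |>.hasDerivAt
    have h2 : HasDerivAt (fun s : ℝ => Complex.exp (-τ * s)) (-τ) 0 := by
      have h3 := ((Complex.ofRealCLM.hasDerivAt (x := (0 : ℝ))).const_mul (-τ)).cexp
      simpa using h3
    have h4 := h2.mul (h1.const_sub (U x))
    refine h4.congr_deriv ?_
    have hF0 : F 0 = g x := by simp [hF, flow_zero]
    rw [hF0]
    simp
    ring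
  have := (funext hUF) ▸ hd1
  exact this.unique hd2

include hg hA hB hk in
/-- The Laplace transform of the flow solves the resolvent equation. -/
theorem weylOp_flowIntegral (hh : h ≠ 0) {ζ : ℂ} (hτ : τ = (ζ - h / Complex.I * (M.trace / 2)) / h) :
    weylOp (normalMatrix M) h ((-(h : ℂ)⁻¹) • flowIntegral τ M g (Ioi 0)) =
      ζ • ((-(h : ℂ)⁻¹) • flowIntegral τ M g (Ioi 0)) - g := by
  have hUe := entire_flowIntegral hg hA hB hk measurableSet_Ioi Subset.rfl
  have hhc : (h : ℂ) ≠ 0 := by exact_mod_cast hh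
  rw [weylOp_smul _ _ _ hUe]
  funext x
  rw [Pi.smul_apply, weylOp_normalMatrix_apply M h hUe, fderiv_flowIntegral hg hA hB hk]
  simp only [Pi.sub_apply, Pi.smul_apply, smul_eq_mul]
  have : ζ = h * τ + h / Complex.I * (M.trace / 2) := by rw [hτ]; field_simp; ring
  rw [this]
  field_simp
  ring

end

/-- A change of variables by the flow costs a bounded factor on compact time intervals. -/
theorem exists_lintegral_flow_le (M : Matrix (Fin n) (Fin n) ℂ) (t₁ : ℝ) :
    ∃ K : ENNReal, K ≠ ⊤ ∧ ∀ t ∈ Icc 0 t₁, ∀ G : (Fin n → ℂ) → ENNReal, Measurable G →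
      ∫⁻ x, G (flow M t x) ≤ K * ∫⁻ x, G x := by
  let L : ℝ → (Fin n → ℂ) →L[ℝ] (Fin n → ℂ) := fun t => (flow M t).restrictScalars ℝ
  have hL : Continuous L :=
    (ContinuousLinearMap.continuous_restrictScalars (𝕜' := ℝ)).comp (continuous_flow M)
  have hdet : Continuous fun t => (L t).det := ContinuousLinearMap.continuous_det.comp hL
  have hmul : ∀ t, (L t).det * (L (-t)).det = 1 := by
    intro t
    have h1 : (L t : (Fin n → ℂ) →ₗ[ℝ] (Fin n → ℂ)) ∘ₗ (L (-t) : (Fin n → ℂ) →ₗ[ℝ] (Fin n → ℂ)) =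
        LinearMap.id := by
      refine LinearMap.ext fun x => ?_
      change flow M t (flow M (-t) x) = x
      rw [← flow_add, add_neg_cancel, flow_zero]; rfl
    have h2 := congrArg LinearMap.det h1
    rwa [LinearMap.det_comp, LinearMap.det_id] at h2
  obtain ⟨K, hK⟩ := (isCompact_Icc (a := (0 : ℝ)) (b := t₁)).exists_bound_of_continuousOn
    (f := fun t => (L (-t)).det) (hdet.comp continuous_neg).continuousOn
  refine ⟨ENNReal.ofReal K, ENNReal.ofReal_ne_top, fun t ht G hG => ?_⟩
  have hne : (L t).det ≠ 0 := left_ne_zero_of_mul_eq_one (hmul t)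
  have hmap := Measure.map_linearMap_addHaar_eq_smul_addHaar
    (volume : Measure (Fin n → ℂ)) (f := (L t : (Fin n → ℂ) →ₗ[ℝ] (Fin n → ℂ))) hne
  have h1 : ∫⁻ x, G (flow M t x) = ∫⁻ x, G x ∂(Measure.map (L t) volume) :=
    (lintegral_map hG (L t).continuous.measurable).symm
  have h2 : Measure.map (L t) (volume : Measure (Fin n → ℂ)) =
      ENNReal.ofReal |((L t).det)⁻¹| • volume := hmap
  rw [h1, h2, lintegral_smul_measure, smul_eq_mul]
  gcongr
  rw [inv_eq_of_mul_eq_one_right (hmul t)]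
  exact hK t ht

theorem sq_lintegral_le {α : Type*} [MeasurableSpace α] {ν : Measure α} {f : α → ENNReal}
    (hf : AEMeasurable f ν) : (∫⁻ a, f a ∂ν) ^ 2 ≤ ν univ * ∫⁻ a, f a ^ 2 ∂ν := by
  have h1 := ENNReal.lintegral_mul_le_Lp_mul_Lq ν Real.HolderConjugate.two_two hf
    (aemeasurable_const (b := (1 : ENNReal)))
  simp only [Pi.mul_apply, mul_one, ENNReal.one_rpow, lintegral_const, one_mul] at h1
  have h2 : ∀ a : ENNReal, (a ^ (1 / (2 : ℝ))) ^ 2 = a := fun a => by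
    rw [← ENNReal.rpow_natCast, ← ENNReal.rpow_mul]; norm_num
  refine (pow_le_pow_left' h1 2).trans (le_of_eq ?_)
  rw [mul_pow, h2, h2, mul_comm]
  simp

/-- If the weight decreases along the flow, the integral over a bounded time interval preserves
`L²(e^{-2Φ/h})`. -/
theorem memLp_flowIntegral_Ioc {Φ : QuadraticForm ℝ (Fin n → ℂ)} (hh : 0 < h) (hg : Continuous g)
    (hg2 : MemLp g 2 (weightMeasure Φ h)) (hΦ : ∀ t, 0 ≤ t → ∀ x, Φ (flow M t x) ≤ Φ x) (t₁ : ℝ)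
    (hm : Continuous (flowIntegral τ M g (Ioc 0 t₁))) :
    MemLp (flowIntegral τ M g (Ioc 0 t₁)) 2 (weightMeasure Φ h) := by
  refine ⟨hm.aestronglyMeasurable, ?_⟩
  set w : (Fin n → ℂ) → ENNReal := fun x => ENNReal.ofReal (Real.exp (-2 * Φ x / h)) with hw
  have hwm : Measurable w :=
    (ENNReal.continuous_ofReal.comp (continuous_weight Φ h)).measurable
  have hiff : ∀ {f : (Fin n → ℂ) → ℂ}, Continuous f →
      (eLpNorm f 2 (weightMeasure Φ h) < ⊤ ↔ ∫⁻ x, w x * ‖f x‖ₑ ^ 2 < ⊤) := by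
    intro f hf
    rw [eLpNorm_lt_top_iff_lintegral_rpow_enorm_lt_top (by norm_num) (by norm_num), weightMeasure,
      lintegral_withDensity_eq_lintegral_mul _ hwm (by fun_prop)]
    simp
  rw [hiff hm]
  have hg2' := (hiff hg).1 hg2.2
  set k : ℝ → (Fin n → ℂ) → ℂ := fun t x => Complex.exp (τ * t) * g (flow M t x) with hk
  have hkc : Continuous (Function.uncurry k) := continuous_flowKernel hg
  obtain ⟨K, hKtop, hK⟩ := exists_lintegral_flow_le M t₁
  set E : ENNReal := ENNReal.ofReal (Real.exp (|τ.re| * t₁)) ^ 2 with hE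
  set V : ENNReal := (volume.restrict (Ioc 0 t₁)) univ with hV
  have hVtop : V ≠ ⊤ := measure_ne_top _ _
  -- at a fixed time the weight decreases along the flow and the Jacobian is bounded
  have hstep : ∀ t ∈ Ioc 0 t₁, ∫⁻ x, w x * ‖k t x‖ₑ ^ 2 ≤
      E * (K * ∫⁻ x, w x * ‖g x‖ₑ ^ 2) := by
    intro t ht
    calc ∫⁻ x, w x * ‖k t x‖ₑ ^ 2 ≤ ∫⁻ x, E * (w (flow M t x) * ‖g (flow M t x)‖ₑ ^ 2) := by
          refine lintegral_mono fun x => ?_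
          have h1 : w x ≤ w (flow M t x) := by
            refine ENNReal.ofReal_le_ofReal (Real.exp_le_exp.2 ?_)
            rw [div_le_div_iff_of_pos_right hh]
            linarith [hΦ t ht.1.le x]
          have h2 : ‖Complex.exp (τ * t)‖ₑ ^ 2 ≤ E := by
            rw [← ofReal_norm, Complex.norm_exp, hE]
            gcongr
            have : (τ * t).re = τ.re * t := by simp
            rw [this]
            exact mul_le_mul (le_abs_self _) ht.2 ht.1.le (abs_nonneg _)
          simp only [hk, enorm_mul, mul_pow]
          calc w x * (‖Complex.exp (τ * t)‖ₑ ^ 2 * ‖g (flow M t x)‖ₑ ^ 2)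
              ≤ w (flow M t x) * (E * ‖g (flow M t x)‖ₑ ^ 2) := by gcongr
            _ = _ := by ring
      _ = E * ∫⁻ x, w (flow M t x) * ‖g (flow M t x)‖ₑ ^ 2 :=
          lintegral_const_mul' _ _ (by rw [hE]; finiteness)
      _ ≤ _ := by
          gcongr
          exact hK t ⟨ht.1.le, ht.2⟩ (fun x => w x * ‖g x‖ₑ ^ 2)
            (hwm.mul (hg.measurable.enorm.pow_const 2))
  have hkm : Measurable (Function.uncurry fun (x : Fin n → ℂ) (t : ℝ) => w x * ‖k t x‖ₑ ^ 2) := by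
    have h1 : Measurable fun p : (Fin n → ℂ) × ℝ => ‖k p.2 p.1‖ₑ :=
      (hkc.comp continuous_swap).measurable.enorm
    exact (hwm.comp measurable_fst).mul (h1.pow_const 2)
  -- Cauchy-Schwarz in the time variable
  calc ∫⁻ x, w x * ‖flowIntegral τ M g (Ioc 0 t₁) x‖ₑ ^ 2
      ≤ ∫⁻ x, V * ∫⁻ t in Ioc 0 t₁, w x * ‖k t x‖ₑ ^ 2 := by
        refine lintegral_mono fun x => ?_
        have hkx : Continuous fun t => k t x :=
          hkc.comp (continuous_id.prodMk continuous_const)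
        have h1 : ‖flowIntegral τ M g (Ioc 0 t₁) x‖ₑ ≤ ∫⁻ t in Ioc 0 t₁, ‖k t x‖ₑ :=
          enorm_integral_le_lintegral_enorm _
        have h2 := sq_lintegral_le (ν := volume.restrict (Ioc 0 t₁))
          (f := fun t => ‖k t x‖ₑ) hkx.measurable.enorm.aemeasurable
        rw [lintegral_const_mul' _ _ ENNReal.ofReal_ne_top]
        calc w x * ‖flowIntegral τ M g (Ioc 0 t₁) x‖ₑ ^ 2
            ≤ w x * (V * ∫⁻ t in Ioc 0 t₁, ‖k t x‖ₑ ^ 2) := by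
              gcongr
              exact (pow_le_pow_left' h1 2).trans h2
          _ = _ := by ring
    _ = V * ∫⁻ t in Ioc 0 t₁, ∫⁻ x, w x * ‖k t x‖ₑ ^ 2 := by
        rw [lintegral_const_mul' _ _ hVtop, lintegral_lintegral_swap hkm.aemeasurable]
    _ ≤ V * ∫⁻ _t in Ioc 0 t₁, E * (K * ∫⁻ x, w x * ‖g x‖ₑ ^ 2) := by
        gcongr V * ?_
        refine lintegral_mono_ae ?_
        filter_upwards [ae_restrict_mem measurableSet_Ioc] with t ht
        exact hstep t ht
    _ = V * (E * (K * ∫⁻ x, w x * ‖g x‖ₑ ^ 2) * V) := by rw [lintegral_const]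
    _ < ⊤ := by
        have : E ≠ ⊤ := by rw [hE]; finiteness
        have h3 := hg2'.ne
        finiteness

end FlowIntegral

/-! ### Polynomial growth -/

section PolyGrowth

variable {n : ℕ} {f g : (Fin n → ℂ) → ℂ}

/-- Functions of at most polynomial growth. -/
def PolyGrowth (f : (Fin n → ℂ) → ℂ) : Prop :=
  ∃ (C : ℝ) (k : ℕ), 0 ≤ C ∧ ∀ x, ‖f x‖ ≤ C * (1 + ‖x‖) ^ k

theorem PolyGrowth.add (hf : PolyGrowth f) (hg : PolyGrowth g) : PolyGrowth (f + g) := by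
  obtain ⟨C, k, hC, hf⟩ := hf
  obtain ⟨D, l, hD, hg⟩ := hg
  refine ⟨C + D, k + l, by positivity, fun x => (norm_add_le _ _).trans ?_⟩
  have h1 : (1 : ℝ) ≤ 1 + ‖x‖ := by linarith [norm_nonneg x]
  rw [add_mul]
  refine add_le_add ((hf x).trans ?_) ((hg x).trans ?_)
  · gcongr
    omega
  · gcongr
    omega

theorem PolyGrowth.smul (hf : PolyGrowth f) (c : ℂ) : PolyGrowth (c • f) := by
  obtain ⟨C, k, hC, hf⟩ := hf
  refine ⟨‖c‖ * C, k, by positivity, fun x => ?_⟩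
  rw [Pi.smul_apply, norm_smul, mul_assoc]
  gcongr
  exact hf x

theorem polyGrowth_zero : PolyGrowth (0 : (Fin n → ℂ) → ℂ) := ⟨0, 0, le_rfl, fun x => by simp⟩

theorem PolyGrowth.sum {ι : Type*} {s : Finset ι} {F : ι → (Fin n → ℂ) → ℂ}
    (hF : ∀ i ∈ s, PolyGrowth (F i)) : PolyGrowth (∑ i ∈ s, F i) := by
  classical
  induction s using Finset.induction_on with
  | empty => simpa using polyGrowth_zero
  | insert a s ha ih =>
    rw [Finset.sum_insert ha]
    exact (hF a (Finset.mem_insert_self a s)).add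
      (ih fun i hi => hF i (Finset.mem_insert_of_mem hi))

theorem polyGrowth_monomialFun (β : Fin n → ℕ) : PolyGrowth (monomialFun β) := by
  refine ⟨1, ∑ j, β j, zero_le_one, fun x => ?_⟩
  rw [monomialFun, norm_prod, one_mul, ← Finset.prod_pow_eq_pow_sum]
  refine Finset.prod_le_prod (fun j _ => norm_nonneg _) fun j _ => ?_
  rw [norm_pow]
  gcongr
  exact (norm_le_pi_norm x j).trans (by linarith)

theorem PolyGrowth.phaseOp (hf : Entire f) (hp : PolyGrowth f) (h : ℝ) (a : Fin n ⊕ Fin n) :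
    PolyGrowth (phaseOp h a f) := by
  obtain ⟨C, k, hC, hp⟩ := hp
  cases a with
  | inl j =>
    refine ⟨C, k + 1, hC, fun x => ?_⟩
    change ‖x j * f x‖ ≤ _
    rw [norm_mul, pow_succ]
    have h1 := norm_le_pi_norm x j
    calc ‖x j‖ * ‖f x‖ ≤ (1 + ‖x‖) * (C * (1 + ‖x‖) ^ k) := by
          gcongr
          · linarith
          · exact hp x
      _ = _ := by ring
  | inr j =>
    refine ⟨‖(h : ℂ) / Complex.I‖ * (2 * (C * 2 ^ k)), k, by positivity, fun x => ?_⟩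
    change ‖(h : ℂ) / Complex.I * fderiv ℂ f x (Pi.single j 1)‖ ≤ _
    have h1 : ‖fderiv ℂ f x‖ ≤ 2 * (C * (2 * (1 + ‖x‖)) ^ k) / 1 := by
      refine norm_fderiv_le_of_bounded hf.differentiable one_pos fun z hz => (hp z).trans ?_
      have h2 : ‖z‖ ≤ ‖x‖ + 1 := by
        have := norm_le_norm_add_norm_sub' z x
        linarith
      gcongr
      linarith [norm_nonneg x]
    have h3 := (fderiv ℂ f x).le_opNorm (Pi.single j 1)
    have h4 : ‖(Pi.single j 1 : Fin n → ℂ)‖ = 1 := by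
      rw [Pi.norm_single, norm_one]
    rw [h4, mul_one] at h3
    rw [norm_mul, mul_assoc]
    gcongr
    refine h3.trans (h1.trans (le_of_eq ?_))
    rw [mul_pow]
    ring

theorem PolyGrowth.weylOp (hf : Entire f) (hp : PolyGrowth f)
    (Q : Matrix (Fin n ⊕ Fin n) (Fin n ⊕ Fin n) ℂ) (h : ℝ) : PolyGrowth (weylOp Q h f) := by
  have h1 : QuadOp.weylOp Q h f = ∑ a, ∑ b, Q a b • QuadOp.phaseOp h a (QuadOp.phaseOp h b f) := by
    funext x
    simp [QuadOp.weylOp, Finset.sum_apply]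
  rw [h1]
  exact PolyGrowth.sum fun a _ => PolyGrowth.sum fun b _ =>
    (PolyGrowth.phaseOp (hf.phaseOp h b) (PolyGrowth.phaseOp hf hp h b) h a).smul _

theorem exists_form_ge {Φ : QuadraticForm ℝ (Fin n → ℂ)} (hΦ : ∀ x, x ≠ 0 → 0 < Φ x) :
    ∃ m : ℝ, 0 < m ∧ ∀ x, m * ‖x‖ ^ 2 ≤ Φ x :=
  exists_le_of_homogeneous (continuous_quadratic Φ) (form_smul_real Φ) hΦ

/-- Entire functions of polynomial growth belong to `H_Φ`. -/
theorem PolyGrowth.memLp {Φ : QuadraticForm ℝ (Fin n → ℂ)} {h : ℝ}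
    (hΦ : ∀ x, x ≠ 0 → 0 < Φ x) (hh : 0 < h) (hf : Continuous f) (hp : PolyGrowth f) :
    MemLp f 2 (weightMeasure Φ h) := by
  obtain ⟨m, hm, hmΦ⟩ := exists_form_ge hΦ
  obtain ⟨C, k, hC, hp⟩ := hp
  have ha : 0 < 2 * m / h := by positivity
  refine memLp_weightMeasure_of_le hf
    ((integrable_pow_mul_gaussian volume (2 * k) ha).const_mul (C ^ 2)) fun x => ?_
  have h1 : -2 * Φ x / h ≤ -(2 * m / h) * ‖x‖ ^ 2 := by
    rw [div_le_iff₀ hh]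
    have := hmΦ x
    have e : -(2 * m / h) * ‖x‖ ^ 2 * h = -(2 * (m * ‖x‖ ^ 2)) := by field_simp
    rw [e]; linarith
  calc ‖f x‖ ^ 2 * Real.exp (-2 * Φ x / h)
      ≤ (C * (1 + ‖x‖) ^ k) ^ 2 * Real.exp (-(2 * m / h) * ‖x‖ ^ 2) := by
        gcongr
        exact hp x
    _ = _ := by ring

end PolyGrowth

/-! ### Solvability of the resolvent equation -/

section Solvability

variable {n : ℕ} {M : Matrix (Fin n) (Fin n) ℂ} {lam : Fin n → ℂ} {h : ℝ}
  {Φ : QuadraticForm ℝ (Fin n → ℂ)} {ζ : ℂ}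

theorem Entire.sub {f g : (Fin n → ℂ) → ℂ} (hf : Entire f) (hg : Entire g) : Entire (f - g) :=
  fun x hx => (hf x hx).sub (hg x hx)

theorem multiD_sub {f g : (Fin n → ℂ) → ℂ} (hf : Entire f) (hg : Entire g) (α : Fin n → ℕ) :
    multiD α (f - g) = multiD α f - multiD α g := by
  have h1 : f - g = f + (-1 : ℂ) • g := by
    funext x; simp [sub_eq_add_neg]
  rw [h1, multiD_add hf (hg.smul _), multiD_smul hg]
  funext x; simp [sub_eq_add_neg]

/-- The resolvent equation is solvable in `H_Φ` for right hand sides which vanish to high order at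
the origin. -/
theorem exists_solution_of_vanishing (hΦ : ∀ x, x ≠ 0 → 0 < Φ x) (hh : 0 < h)
    (hJ : IsJordanForm M) (hpos : ∀ j, 0 < (M j j).im)
    (hdec : ∀ t, 0 ≤ t → ∀ x, Φ (flow M t x) ≤ Φ x) (ζ : ℂ) :
    ∃ N : ℕ, ∀ v : HPhi Φ h, (∀ α : Fin n → ℕ, ∑ j, α j < N → multiD α (rep v) 0 = 0) →
      ∃ u : HPhi Φ h, ζ • rep u - weylOp (normalMatrix M) h (rep u) = rep v := by
  obtain ⟨c, C, hc, hC, hfl⟩ := exists_flow_decay hJ hpos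
  obtain ⟨m, hm, hmΦ⟩ := exists_form_ge hΦ
  -- the equation reads `-h (L + τ) u = v`, with `L` the generator of composition with the flow
  set τ : ℂ := (ζ - h / Complex.I * (M.trace / 2)) / h with hτ
  obtain ⟨N, hN⟩ := exists_nat_ge (2 * (τ.re + 1) / c)
  rw [div_le_iff₀ hc] at hN
  refine ⟨N, fun v hv => ?_⟩
  obtain ⟨D, hD, hrep⟩ := exists_norm_rep_le hΦ hh
  set g := rep v with hg
  have hge : Entire g := entire_rep v
  set B : ℝ := D * ‖v‖ with hB
  have hB0 : 0 ≤ B := by positivity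
  have hgB : ∀ z, ‖g z‖ ≤ B * Real.exp (D * ‖z‖ ^ 2) := fun z => by
    rw [mul_comm]; exact hrep v z
  have hk : ∀ t : ℝ, 0 < t → ∀ x, ‖Complex.exp (τ * t) * g (flow M t x)‖ ≤
      B * Real.exp (D * C ^ 2 * Real.exp (-c * t) * (‖x‖ + 1) ^ 2) * Real.exp (-t) :=
    fun t ht x => norm_flowKernel_le hge hgB hD hv hc hC hfl (by linarith) ht x
  have hk' : ∀ t : ℝ, 0 < t → ∀ x, ‖Complex.exp (τ * t) * g (flow M t x)‖ ≤
      B * Real.exp (D * C ^ 2 * (‖x‖ + 1) ^ 2) * Real.exp (-t) := by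
    intro t ht x
    refine (hk t ht x).trans ?_
    have h1 : Real.exp (-c * t) ≤ 1 := Real.exp_le_one_iff.2 (by have := mul_pos hc ht; linarith)
    have h2 : D * C ^ 2 * Real.exp (-c * t) ≤ D * C ^ 2 := mul_le_of_le_one_right (by positivity) h1
    gcongr
  have hA : 0 ≤ D * C ^ 2 := by positivity
  -- after the time `t₁` the growth of the integrand is absorbed by the weight
  obtain ⟨t₁, ht₁, hδ⟩ : ∃ t₁ : ℝ, 0 ≤ t₁ ∧ 4 * (D * C ^ 2 * Real.exp (-c * t₁)) ≤ m / h := by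
    have hlim : Tendsto (fun t : ℝ => 4 * (D * C ^ 2 * Real.exp (-c * t))) atTop (𝓝 0) := by
      have h1 : Tendsto (fun t : ℝ => Real.exp (-c * t)) atTop (𝓝 0) :=
        Real.tendsto_exp_atBot.comp (tendsto_id.const_mul_atTop_of_neg (by linarith))
      simpa using (h1.const_mul (D * C ^ 2)).const_mul 4
    obtain ⟨t₁, h1, h2⟩ := ((hlim.eventually_lt_const (show 0 < m / h by positivity)).and
      (eventually_ge_atTop 0)).exists
    exact ⟨t₁, h2, h1.le⟩
  set δ : ℝ := D * C ^ 2 * Real.exp (-c * t₁) with hδdef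
  have hδ0 : 0 ≤ δ := by positivity
  have hheadE : Entire (flowIntegral τ M g (Ioc 0 t₁)) :=
    entire_flowIntegral hge hA hB0 hk' measurableSet_Ioc fun t ht => ht.1
  have htailE : Entire (flowIntegral τ M g (Ioi t₁)) :=
    entire_flowIntegral hge hA hB0 hk' measurableSet_Ioi fun t ht => ht₁.trans_lt ht
  have hE : Entire (flowIntegral τ M g (Ioi 0)) :=
    entire_flowIntegral hge hA hB0 hk' measurableSet_Ioi Subset.rfl
  have hsum : flowIntegral τ M g (Ioi 0) =
      flowIntegral τ M g (Ioc 0 t₁) + flowIntegral τ M g (Ioi t₁) := by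
    funext x
    have hi := integrableOn_flowKernel hge hk' x
    simp only [Pi.add_apply, flowIntegral]
    rw [← setIntegral_union (Ioc_disjoint_Ioi le_rfl) measurableSet_Ioi
      (hi.mono_set fun t ht => ht.1) (hi.mono_set fun t ht => ht₁.trans_lt ht),
      Ioc_union_Ioi_eq_Ioi ht₁]
  have hhead := memLp_flowIntegral_Ioc (τ := τ) hh hge.differentiable.continuous (memLp_rep v) hdec
    t₁ hheadE.differentiable.continuous
  have htail : MemLp (flowIntegral τ M g (Ioi t₁)) 2 (weightMeasure Φ h) := by
    have hbd : ∀ x, ‖flowIntegral τ M g (Ioi t₁) x‖ ≤ B * Real.exp (δ * (‖x‖ + 1) ^ 2) := by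
      intro x
      have h1 : ‖flowIntegral τ M g (Ioi t₁) x‖ ≤
          ∫ t in Ioi t₁, B * Real.exp (δ * (‖x‖ + 1) ^ 2) * Real.exp (-t) := by
        refine norm_integral_le_of_norm_le ((integrableOn_exp_neg_Ioi t₁).const_mul _) ?_
        filter_upwards [ae_restrict_mem measurableSet_Ioi] with t ht
        refine (hk t (ht₁.trans_lt ht) x).trans ?_
        have h2 : Real.exp (-c * t) ≤ Real.exp (-c * t₁) := by
          have := mul_le_mul_of_nonneg_left (le_of_lt ht) hc.le
          exact Real.exp_le_exp.2 (by linarith)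
        rw [hδdef]
        gcongr
      refine h1.trans ?_
      rw [integral_const_mul, integral_exp_neg_Ioi]
      exact mul_le_of_le_one_right (by positivity) (Real.exp_le_one_iff.2 (by linarith))
    have ha : 0 < m / h := by positivity
    refine memLp_weightMeasure_of_le htailE.differentiable.continuous
      ((integrable_gaussian volume ha).const_mul (B ^ 2 * Real.exp (4 * δ))) fun x => ?_
    calc ‖flowIntegral τ M g (Ioi t₁) x‖ ^ 2 * Real.exp (-2 * Φ x / h)
        ≤ (B * Real.exp (δ * (‖x‖ + 1) ^ 2)) ^ 2 * Real.exp (-2 * Φ x / h) := by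
          gcongr
          exact hbd x
      _ = B ^ 2 * Real.exp (2 * (δ * (‖x‖ + 1) ^ 2) + -2 * Φ x / h) := by
          rw [mul_pow, ← Real.exp_nat_mul, mul_assoc, ← Real.exp_add]; norm_cast
      _ ≤ B ^ 2 * Real.exp (4 * δ + -(m / h) * ‖x‖ ^ 2) := by
          gcongr B ^ 2 * Real.exp ?_
          have h1 : (‖x‖ + 1) ^ 2 ≤ 2 * ‖x‖ ^ 2 + 2 := by nlinarith [sq_nonneg (‖x‖ - 1)]
          have h2 : -2 * Φ x / h ≤ -2 * (m / h) * ‖x‖ ^ 2 := by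
            rw [div_le_iff₀ hh]
            have e : -2 * (m / h) * ‖x‖ ^ 2 * h = -2 * (m * ‖x‖ ^ 2) := by field_simp
            rw [e]; linarith [hmΦ x]
          have h3 : δ * (‖x‖ + 1) ^ 2 ≤ δ * (2 * ‖x‖ ^ 2 + 2) := by gcongr
          have h4 := mul_le_mul_of_nonneg_right hδ (sq_nonneg ‖x‖)
          linarith
      _ = _ := by rw [Real.exp_add]; ring
  have hL : MemLp ((-(h : ℂ)⁻¹) • flowIntegral τ M g (Ioi 0)) 2 (weightMeasure Φ h) := by
    rw [hsum]
    exact (hhead.add htail).const_smul _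
  obtain ⟨u, hu⟩ := exists_rep_eq (hE.smul _) hL
  refine ⟨u, ?_⟩
  rw [hu, weylOp_flowIntegral hge hA hB0 hk' hh.ne' hτ]
  abel

/-- Outside the set of the numbers `μ_α` the resolvent equation is solvable in `H_Φ`: a polynomial
takes care of the Taylor coefficients of low order. -/
theorem exists_solution (hΦ : ∀ x, x ≠ 0 → 0 < Φ x) (hh : 0 < h)
    (hJ : IsJordanForm M) (hM : ∀ j, M j j = 2 * lam j) (hpos : ∀ j, 0 < (M j j).im)
    (hdec : ∀ t, 0 ≤ t → ∀ x, Φ (flow M t x) ≤ Φ x) (hζ : ∀ α, ζ ≠ mu h lam α) (v : HPhi Φ h) :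
    ∃ u : HPhi Φ h, ζ • rep u - weylOp (normalMatrix M) h (rep u) = rep v := by
  obtain ⟨N, hN⟩ := exists_solution_of_vanishing hΦ hh hJ hpos hdec ζ
  obtain ⟨S, c, hS⟩ := exists_polynomial_solution hJ hM hζ N (rep v)
  -- the right hand side corrected by the polynomial `p` vanishes to order `N`
  set p : (Fin n → ℂ) → ℂ := ∑ γ ∈ S, c γ • monomialFun γ with hp
  have hpE : Entire p := Entire.sum fun γ _ => (entire_monomialFun γ).smul _
  have hpG : PolyGrowth p := PolyGrowth.sum fun γ _ => (polyGrowth_monomialFun γ).smul _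
  have hwE : Entire (weylOp (normalMatrix M) h p) := hpE.weylOp _ _
  have hwG : PolyGrowth (weylOp (normalMatrix M) h p) := PolyGrowth.weylOp hpE hpG _ _
  have hpL := hpG.memLp hΦ hh hpE.differentiable.continuous
  have hwL := hwG.memLp hΦ hh hwE.differentiable.continuous
  obtain ⟨g, hg⟩ := exists_rep_eq (Φ := Φ) (h := h)
    ((entire_rep v).sub ((hpE.smul ζ).sub hwE))
    ((memLp_rep v).sub ((hpL.const_smul ζ).sub hwL))
  obtain ⟨w, hw⟩ := hN g fun α hα => by
    rw [hg, multiD_sub (entire_rep v) ((hpE.smul ζ).sub hwE), Pi.sub_apply, hS α hα, sub_self]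
  obtain ⟨u, hu⟩ := exists_rep_eq ((entire_rep w).add hpE) ((memLp_rep w).add hpL)
  refine ⟨u, ?_⟩
  rw [hu, weylOp_add _ _ (entire_rep w) hpE, smul_add]
  have h1 : ζ • rep w = weylOp (normalMatrix M) h (rep w) + rep g := by rw [← hw]; abel
  rw [h1, hg]
  abel

end Solvability

/-! ### Resolvents -/

section Resolvent

variable {H : Type*} [NormedAddCommGroup H] [NormedSpace ℂ H] {A : H →ₗ.[ℂ] H} {ζ : ℂ}

theorem IsResolventAt.mem_graph {R : H →L[ℂ] H} (hR : IsResolventAt A ζ R) (v : H) :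
    (R v, ζ • R v - v) ∈ A.graph := by
  obtain ⟨hv, h1⟩ := hR.1 v
  have h2 : ζ • R v - v = A ⟨R v, hv⟩ := by
    rw [sub_eq_iff_eq_add, add_comm, ← sub_eq_iff_eq_add, h1]
  rw [h2]
  exact A.mem_graph ⟨R v, hv⟩

theorem isResolventAt_of_graph {R : H →L[ℂ] H} (h1 : ∀ v, (R v, ζ • R v - v) ∈ A.graph)
    (h2 : ∀ u w, (u, w) ∈ A.graph → R (ζ • u - w) = u) : IsResolventAt A ζ R := by
  refine ⟨fun v => ?_, fun u => h2 _ _ (A.mem_graph u)⟩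
  obtain ⟨y, hy1, hy2⟩ := (LinearPMap.mem_graph_iff A).1 (h1 v)
  dsimp only at hy1 hy2
  have hv : R v ∈ A.domain := hy1 ▸ y.2
  refine ⟨hv, ?_⟩
  have h3 : (⟨R v, hv⟩ : A.domain) = y := Subtype.ext hy1.symm
  rw [h3, hy2, sub_sub_cancel]

theorem IsResolventAt.apply_of_mem_graph {R : H →L[ℂ] H} (hR : IsResolventAt A ζ R) {u w : H}
    (huw : (u, w) ∈ A.graph) : R (ζ • u - w) = u := by
  obtain ⟨y, hy1, hy2⟩ := (LinearPMap.mem_graph_iff A).1 huw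
  dsimp only at hy1 hy2
  rw [← hy1, ← hy2]
  exact hR.2 y

theorem isResolventAt_resolv (hζ : ζ ∉ spec A) : IsResolventAt A ζ (resolv A ζ) := by
  have h1 : ∃ R : H →L[ℂ] H, IsResolventAt A ζ R := not_not.1 hζ
  rw [resolv, dif_pos h1]
  exact Classical.choose_spec h1

/-- A bijective `ζ - A` with `A` closed has a bounded inverse, by the closed graph theorem. -/
theorem notMem_spec_of_bijective [CompleteSpace H] (hA : A.IsClosed)
    (hinj : ∀ u, (u, ζ • u) ∈ A.graph → u = 0) (hsurj : ∀ v, ∃ u, (u, ζ • u - v) ∈ A.graph) :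
    ζ ∉ spec A := by
  choose r hr using hsurj
  have huniq : ∀ u v, (u, ζ • u - v) ∈ A.graph → r v = u := by
    intro u v huv
    have h1 := A.graph.sub_mem (hr v) huv
    have h2 : ((r v, ζ • r v - v) : H × H) - (u, ζ • u - v) = (r v - u, ζ • (r v - u)) := by
      rw [Prod.mk_sub_mk, smul_sub]
      congr 1
      abel
    rw [h2] at h1
    exact sub_eq_zero.1 (hinj _ h1)
  let R : H →ₗ[ℂ] H :=
    { toFun := r
      map_add' := fun v w => huniq _ _ (by
        have h1 := A.graph.add_mem (hr v) (hr w)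
        rw [Prod.mk_add_mk] at h1
        convert h1 using 2
        rw [smul_add]; abel)
      map_smul' := fun c v => huniq _ _ (by
        have h1 := A.graph.smul_mem c (hr v)
        rw [Prod.smul_mk, smul_sub, smul_comm c ζ] at h1
        exact h1) }
  have hcl : IsClosed (R.graph : Set (H × H)) := by
    have h1 : (R.graph : Set (H × H)) =
        (fun p : H × H => (p.2, ζ • p.2 - p.1)) ⁻¹' (A.graph : Set (H × H)) := by
      ext ⟨v, u⟩
      rw [SetLike.mem_coe, LinearMap.mem_graph_iff]
      exact ⟨fun h => by
        have h2 : u = r v := h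
        rw [h2]; exact hr v, fun h => (huniq u v h).symm⟩
    rw [h1]
    exact IsClosed.preimage (by fun_prop) hA
  refine not_not.2 ⟨ContinuousLinearMap.ofIsClosedGraph hcl, isResolventAt_of_graph hr ?_⟩
  intro u w huw
  exact huniq u _ (by rwa [sub_sub_cancel])

/-- The resolvent identity. -/
theorem resolv_sub_resolv {ζ η : ℂ} (hζ : ζ ∉ spec A) (hη : η ∉ spec A) (v : H) :
    resolv A ζ v - resolv A η v = (η - ζ) • resolv A ζ (resolv A η v) := by
  have h1 := (isResolventAt_resolv hζ).apply_of_mem_graph ((isResolventAt_resolv hη).mem_graph v)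
  have h2 : ζ • resolv A η v - (η • resolv A η v - v) = v - (η - ζ) • resolv A η v := by
    rw [sub_smul]; abel
  rw [h2, map_sub, map_smul] at h1
  rw [sub_eq_iff_eq_add] at h1
  rw [h1]; abel

/-- The resolvent identity gives local boundedness of the resolvent, and then continuity. -/
theorem continuousOn_resolv : ContinuousOn (fun ζ => resolv A ζ) (spec A)ᶜ := by
  intro η hη
  set R := ‖resolv A η‖ with hR
  have hR0 : 0 ≤ R := norm_nonneg _
  have hdiff : ∀ ζ ∉ spec A, ‖resolv A ζ - resolv A η‖ ≤ ‖ζ - η‖ * (‖resolv A ζ‖ * R) := by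
    intro ζ hζ
    refine ContinuousLinearMap.opNorm_le_bound _ (by positivity) fun v => ?_
    rw [_root_.sub_apply, resolv_sub_resolv hζ hη, norm_smul, norm_sub_rev]
    have h1 := (resolv A ζ).le_opNorm (resolv A η v)
    have h2 := (resolv A η).le_opNorm v
    calc ‖ζ - η‖ * ‖resolv A ζ (resolv A η v)‖
        ≤ ‖ζ - η‖ * (‖resolv A ζ‖ * (R * ‖v‖)) := by
          gcongr
          exact h1.trans (by gcongr)
      _ = _ := by ring
  have hbound : ∀ ζ ∉ spec A, ‖ζ - η‖ * R ≤ 1 / 2 → ‖resolv A ζ‖ ≤ 2 * R := by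
    intro ζ hζ hsmall
    have h1 := hdiff ζ hζ
    have h2 : ‖resolv A ζ‖ ≤ ‖resolv A ζ - resolv A η‖ + R := by
      have := norm_add_le (resolv A ζ - resolv A η) (resolv A η)
      rwa [sub_add_cancel] at this
    have h3 := mul_le_mul_of_nonneg_right hsmall (norm_nonneg (resolv A ζ))
    linarith
  rw [ContinuousWithinAt, tendsto_iff_norm_sub_tendsto_zero]
  have hlim : Tendsto (fun ζ : ℂ => ‖ζ - η‖ * (2 * R * R)) (𝓝[(spec A)ᶜ] η) (𝓝 0) := by
    have h1 : Continuous fun ζ : ℂ => ‖ζ - η‖ * (2 * R * R) := by fun_prop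
    have := h1.tendsto η
    simp only [sub_self, norm_zero, zero_mul] at this
    exact this.mono_left nhdsWithin_le_nhds
  refine squeeze_zero' (Eventually.of_forall fun ζ => norm_nonneg _) ?_ hlim
  have hnear : ∀ᶠ ζ in 𝓝[(spec A)ᶜ] η, ‖ζ - η‖ * R < 1 / 2 := by
    have h1 : Continuous fun ζ : ℂ => ‖ζ - η‖ * R := by fun_prop
    have h2 := h1.tendsto η
    simp only [sub_self, norm_zero, zero_mul] at h2
    exact (h2.eventually_lt_const (by norm_num)).filter_mono nhdsWithin_le_nhds
  filter_upwards [hnear, self_mem_nhdsWithin] with ζ h1 h2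
  refine (hdiff ζ h2).trans ?_
  have := hbound ζ h2 h1.le
  gcongr

end Resolvent

/-! ### Contour integrals of principal parts -/

section Contour

open Polynomial

theorem circleIntegral_clm_comp {E F : Type*} [NormedAddCommGroup E] [NormedSpace ℂ E]
    [CompleteSpace E] [NormedAddCommGroup F] [NormedSpace ℂ F] [CompleteSpace F] (L : E →L[ℂ] F)
    {f : ℂ → E} {z : ℂ} {r : ℝ} (hf : CircleIntegrable f z r) :
    L (circleIntegral f z r) = circleIntegral (fun ζ => L (f ζ)) z r := by
  rw [circleIntegral, circleIntegral, ← L.intervalIntegral_comp_comm hf.out]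
  simp only [map_smul]

theorem apply_smul_circleIntegral {E : Type*} [NormedAddCommGroup E] [NormedSpace ℂ E]
    [CompleteSpace E] (L : E →L[ℂ] ℂ) (u : E) (k : ℂ) {f : ℂ → E →L[ℂ] E} {z : ℂ} {r : ℝ}
    (hf : CircleIntegrable f z r) :
    L ((k • circleIntegral f z r) u) = k * circleIntegral (fun ζ => L (f ζ u)) z r := by
  rw [_root_.smul_apply, map_smul, smul_eq_mul]
  congr 1
  exact circleIntegral_clm_comp (L.comp (ContinuousLinearMap.apply ℂ E u)) hf

/-- A principal part without residue integrates to zero. -/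
theorem circleIntegral_sq_mul_eval (p : ℂ[X]) (z : ℂ) {r : ℝ} (hr : 0 < r) :
    circleIntegral (fun ζ => (ζ - z)⁻¹ ^ 2 * p.eval (ζ - z)⁻¹) z r = 0 := by
  have hne : ∀ ζ ∈ Metric.sphere z r, ζ - z ≠ 0 := by
    intro ζ hζ h0
    rw [mem_sphere_iff_norm, h0, norm_zero] at hζ
    exact hr.ne hζ
  have hcont : ∀ p : ℂ[X],
      CircleIntegrable (fun ζ => (ζ - z)⁻¹ ^ 2 * p.eval (ζ - z)⁻¹) z r := by
    intro p
    refine ContinuousOn.circleIntegrable hr.le ?_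
    have h1 : ContinuousOn (fun ζ : ℂ => (ζ - z)⁻¹) (Metric.sphere z r) :=
      ContinuousOn.inv₀ (by fun_prop) hne
    exact (h1.pow 2).mul (p.continuous.comp_continuousOn h1)
  induction p using Polynomial.induction_on' with
  | add p q hp hq =>
    simp only [Polynomial.eval_add, mul_add]
    rw [circleIntegral.integral_add (hcont p) (hcont q), hp, hq, add_zero]
  | monomial k a =>
    have h1 : ∀ ζ : ℂ, (ζ - z)⁻¹ ^ 2 * ((monomial k a).eval (ζ - z)⁻¹) =
        a * (ζ - z) ^ (-((k + 2 : ℕ) : ℤ)) := by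
      intro ζ
      rw [Polynomial.eval_monomial, _root_.zpow_neg, zpow_natCast, ← inv_pow, pow_add]
      ring
    simp only [h1]
    rw [circleIntegral.integral_const_mul, circleIntegral.integral_sub_zpow_of_ne (by
      push_cast; omega), mul_zero]

theorem circleIntegral_principalPart {z μ a : ℂ} {r : ℝ} (hr : 0 < r) (p : ℂ[X])
    (hμ : μ = z ∨ μ ∉ Metric.closedBall z r) :
    circleIntegral (fun ζ => a * (ζ - μ)⁻¹ + (ζ - μ)⁻¹ ^ 2 * p.eval (ζ - μ)⁻¹) z r =
      if μ = z then a * (2 * Real.pi * Complex.I) else 0 := by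
  by_cases hz : μ = z
  · subst hz
    have hne : ∀ ζ ∈ Metric.sphere μ r, ζ - μ ≠ 0 := by
      intro ζ hζ h0
      rw [mem_sphere_iff_norm, h0, norm_zero] at hζ
      exact hr.ne hζ
    have h1 : ContinuousOn (fun ζ : ℂ => (ζ - μ)⁻¹) (Metric.sphere μ r) :=
      ContinuousOn.inv₀ (by fun_prop) hne
    rw [if_pos rfl, circleIntegral.integral_add, circleIntegral_sq_mul_eval p μ hr, add_zero,
      circleIntegral.integral_const_mul, circleIntegral.integral_sub_center_inv μ hr.ne']
    · exact (continuousOn_const.mul h1).circleIntegrable hr.le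
    · exact ((h1.pow 2).mul (p.continuous.comp_continuousOn h1)).circleIntegrable hr.le
  · rw [if_neg hz]
    have hμ' := hμ.resolve_left hz
    have hne : ∀ ζ ∈ Metric.closedBall z r, ζ - μ ≠ 0 := fun ζ hζ h0 =>
      hμ' (sub_eq_zero.1 h0 ▸ hζ)
    refine Complex.circleIntegral_eq_zero_of_differentiable_on_off_countable hr.le
      countable_empty ?_ ?_
    · have h1 : ContinuousOn (fun ζ : ℂ => (ζ - μ)⁻¹) (Metric.closedBall z r) :=
        ContinuousOn.inv₀ (by fun_prop) hne
      exact (continuousOn_const.mul h1).add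
        ((h1.pow 2).mul (p.continuous.comp_continuousOn h1))
    · intro ζ hζ
      have h1 : DifferentiableAt ℂ (fun ζ : ℂ => (ζ - μ)⁻¹) ζ :=
        DifferentiableAt.inv (by fun_prop) (hne ζ (Metric.ball_subset_closedBall hζ.1))
      exact (h1.const_mul a).add ((h1.pow 2).mul (p.differentiable.differentiableAt.comp ζ h1))

end Contour

/-! ### The numbers `μ_α` -/

section Mu

variable {n : ℕ} {h : ℝ} {lam : Fin n → ℂ}

theorem re_mu (h : ℝ) (lam : Fin n → ℂ) (α : Fin n → ℕ) :
    (mu h lam α).re = h * ∑ j, (2 * (α j : ℝ) + 1) * (lam j).im := by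
  have h1 : (h : ℂ) / Complex.I = h * (-Complex.I) := by
    rw [div_eq_mul_inv, Complex.inv_I]
  rw [mu, h1, mul_assoc, Complex.re_ofReal_mul]
  congr 1
  rw [Finset.mul_sum, Complex.re_sum]
  refine Finset.sum_congr rfl fun j _ => ?_
  simp

theorem re_mu_nonneg (hh : 0 < h) (hpos : ∀ j, 0 < (lam j).im) (α : Fin n → ℕ) :
    0 ≤ (mu h lam α).re := by
  rw [re_mu]
  refine mul_nonneg hh.le (Finset.sum_nonneg fun j _ => mul_nonneg (by positivity) (hpos j).le)

/-- The numbers `μ_α` have no accumulation point. -/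
theorem finite_norm_mu_sub_le (hh : 0 < h) (hpos : ∀ j, 0 < (lam j).im) (z : ℂ) (r : ℝ) :
    {α : Fin n → ℕ | ‖mu h lam α - z‖ ≤ r}.Finite := by
  obtain ⟨ε, hε, hεb⟩ : ∃ ε : ℝ, 0 < ε ∧ ∀ j, ε ≤ (lam j).im := by
    rcases isEmpty_or_nonempty (Fin n) with he | he
    · exact ⟨1, one_pos, fun j => (he.false j).elim⟩
    · obtain ⟨j, hj⟩ := Finite.exists_min fun j => (lam j).im
      exact ⟨_, hpos j, hj⟩
  obtain ⟨N, hN⟩ := exists_nat_gt ((r + ‖z‖) / (h * ε))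
  refine (finite_degree_lt N).subset fun α hα => ?_
  have h1 : (mu h lam α).re ≤ r + ‖z‖ := by
    refine (Complex.re_le_norm _).trans ?_
    have := norm_add_le (mu h lam α - z) z
    rw [sub_add_cancel] at this
    exact this.trans (add_le_add_left hα _)
  have h2 : h * ε * (∑ j, α j : ℕ) ≤ (mu h lam α).re := by
    rw [re_mu, mul_assoc]
    refine mul_le_mul_of_nonneg_left ?_ hh.le
    rw [Nat.cast_sum, Finset.mul_sum]
    refine Finset.sum_le_sum fun j _ => ?_
    have h3 := hεb j
    have h4 : (0 : ℝ) ≤ α j := by positivity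
    nlinarith
  rw [div_lt_iff₀ (by positivity)] at hN
  have h3 : h * ε * (∑ j, α j : ℕ) < h * ε * N := by linarith
  exact_mod_cast lt_of_mul_lt_mul_left h3 (by positivity)

theorem exists_isolating_radius (hh : 0 < h) (hpos : ∀ j, 0 < (lam j).im) (z : ℂ) :
    ∃ r : ℝ, 0 < r ∧ Metric.closedBall z r ∩ range (mu h lam) ⊆ {z} := by
  have hfin : (mu h lam '' {α | ‖mu h lam α - z‖ ≤ 1} \ {z}).Finite :=
    ((finite_norm_mu_sub_le hh hpos z 1).image _).sdiff
  have hopen : (mu h lam '' {α | ‖mu h lam α - z‖ ≤ 1} \ {z})ᶜ ∈ 𝓝 z :=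
    hfin.isClosed.isOpen_compl.mem_nhds fun h => h.2 rfl
  obtain ⟨ε, hε, hεs⟩ := Metric.nhds_basis_closedBall.mem_iff.1 hopen
  refine ⟨min ε 1, lt_min hε one_pos, ?_⟩
  rintro _ ⟨hb, α, rfl⟩
  by_contra hne
  rw [Metric.mem_closedBall, dist_eq_norm] at hb
  exact hεs (Metric.mem_closedBall.2 ((dist_eq_norm _ _).le.trans (hb.trans (min_le_left _ _))))
    ⟨⟨α, hb.trans (min_le_right _ _), rfl⟩, hne⟩

end Mu

/-! ### Taylor coefficients as functionals on `H_Φ` -/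

section TaylorFunctional

variable {n : ℕ} {h : ℝ} {Φ : QuadraticForm ℝ (Fin n → ℂ)}

theorem exists_taylorFunctional (hΦ : ∀ x, x ≠ 0 → 0 < Φ x) (hh : 0 < h) (α : Fin n → ℕ) :
    ∃ L : HPhi Φ h →L[ℂ] ℂ, ∀ u, L u = multiD α (rep u) 0 := by
  obtain ⟨C, hC, hrep⟩ := exists_norm_rep_le hΦ hh
  let L : HPhi Φ h →ₗ[ℂ] ℂ :=
    { toFun := fun u => multiD α (rep u) 0
      map_add' := fun u v => by
        rw [rep_add, multiD_add (entire_rep u) (entire_rep v), Pi.add_apply]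
      map_smul' := fun c u => by
        rw [rep_smul, multiD_smul (entire_rep u), Pi.smul_apply, RingHom.id_apply] }
  set s : ℝ := ((∑ j, α j : ℕ) : ℝ) with hs
  refine ⟨L.mkContinuous (2 ^ (∑ j, α j) * (Real.exp (C * s ^ 2) * C)) fun u => ?_, fun u => rfl⟩
  have h1 := norm_multiD_le (entire_rep u) α (R := 0) (B := Real.exp (C * s ^ 2) * (C * ‖u‖))
    (fun z hz => (hrep u z).trans (by
      rw [zero_add] at hz
      gcongr)) (x := 0) (by simp)
  refine h1.trans (le_of_eq ?_)
  ring

end TaylorFunctional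

/-! ### Spectrum and Riesz projections -/

section Spectrum

variable {n : ℕ} {q : QuadraticMap ℝ (Fin n ⊕ Fin n → ℝ) ℂ} (N : NormalForm q) {h : ℝ}

theorem NormalForm.mem_graph_op {u v : HPhi N.Φ h} :
    (u, v) ∈ (N.op h).graph ↔ rep v = weylOp (normalMatrix N.M) h (rep u) :=
  mem_graph_weylH _ _ _ _ _

/-- The FBI transform is a unitary equivalence of `q^w` and `q̃^w` with their maximal domains. -/
theorem NormalForm.exists_unitary (hre : ∀ X, 0 ≤ (q X).re) (hh : 0 < h) :
    ∃ T : L2 n ≃ₗᵢ[ℂ] HPhi N.Φ h, ∀ u v : L2 n,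
      (u, v) ∈ (weylL2 (coeffMatrix q) h).graph ↔ (T u, T v) ∈ (N.op h).graph := by
  obtain ⟨T, c, -, hT⟩ := N.exists_fbi_unitary hh
  refine ⟨T, fun u v => ⟨N.map_graph hh hT, fun huv => ?_⟩⟩
  -- `-1` is in the resolvent set, so that neither operator properly extends the other
  obtain ⟨u', hu'⟩ := exists_mem_graph_sub q hre h (ζ := -1) (by simp) (v - (-1 : ℂ) • u)
  have h1 := N.map_graph hh hT hu'
  have h2 := (N.op h).graph.sub_mem h1 huv
  have h3 : ((T u', T ((-1 : ℂ) • u' + (v - (-1 : ℂ) • u))) : HPhi N.Φ h × HPhi N.Φ h) -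
      (T u, T v) = (T (u' - u), (-1 : ℂ) • T (u' - u)) := by
    rw [Prod.mk_sub_mk]
    simp only [map_add, map_sub, map_smul, smul_sub]
    congr 1
    abel
  rw [h3, N.mem_graph_op, rep_smul] at h2
  have h4 : rep (T (u' - u)) = 0 := by
    refine eq_zero_of_weylOp_eq N.jordan N.diag (fun α hα => ?_) (entire_rep _) h2.symm
    have h5 := re_mu_nonneg hh N.im_lam_pos α
    rw [← hα] at h5
    norm_num at h5
  have h5 : T (u' - u) = 0 := rep_injective (h4.trans rep_zero.symm)
  have h6 : u' = u := by
    rw [← sub_eq_zero]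
    exact (LinearIsometryEquiv.map_eq_zero_iff T).1 h5
  rw [h6] at hu'
  convert hu' using 2
  abel

theorem NormalForm.isClosed_op (hre : ∀ X, 0 ≤ (q X).re) (hh : 0 < h) : (N.op h).IsClosed := by
  obtain ⟨T, hT⟩ := N.exists_unitary hre hh
  have h1 : ((N.op h).graph : Set (HPhi N.Φ h × HPhi N.Φ h)) =
      (fun p : HPhi N.Φ h × HPhi N.Φ h => (T.symm p.1, T.symm p.2)) ⁻¹'
        ((weylL2 (coeffMatrix q) h).graph : Set (L2 n × L2 n)) := by
    ext ⟨u, v⟩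
    rw [mem_preimage, SetLike.mem_coe, SetLike.mem_coe, hT, T.apply_symm_apply,
      T.apply_symm_apply]
  rw [LinearPMap.IsClosed, h1]
  refine IsClosed.preimage ?_ (isClosed_weylL2 _ _)
  exact (T.symm.continuous.comp continuous_fst).prodMk (T.symm.continuous.comp continuous_snd)

theorem NormalForm.dense_domain_op (hre : ∀ X, 0 ≤ (q X).re) (hh : 0 < h) :
    Dense ((N.op h).domain : Set (HPhi N.Φ h)) := by
  obtain ⟨T, hT⟩ := N.exists_unitary hre hh
  have h1 := (T.surjective.denseRange).dense_image T.continuous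
    (dense_domain_weylL2 (coeffMatrix_isSymm q) h)
  refine h1.mono ?_
  rintro _ ⟨u, hu, rfl⟩
  obtain ⟨v, hv⟩ := LinearPMap.mem_domain_iff.1 hu
  exact LinearPMap.mem_domain_of_mem_graph ((hT u v).1 hv)

/-- The spectrum of `q̃^w(x, hD_x)` is the set of the numbers `μ_α`. -/
theorem NormalForm.spec_op (hre : ∀ X, 0 ≤ (q X).re) (hh : 0 < h) :
    spec (N.op h) = range (mu h N.lam) := by
  have := completeSpace_HPhi (h := h) N.pos hh
  apply Subset.antisymm
  · intro ζ hζ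
    by_contra hne
    have hζμ : ∀ α, ζ ≠ mu h N.lam α := fun α hα => hne ⟨α, hα.symm⟩
    refine notMem_spec_of_bijective (N.isClosed_op hre hh) ?_ ?_ hζ
    · intro u hu
      rw [N.mem_graph_op, rep_smul] at hu
      exact rep_injective ((eq_zero_of_weylOp_eq N.jordan N.diag hζμ (entire_rep u) hu.symm).trans
        rep_zero.symm)
    · intro v
      obtain ⟨u, hu⟩ := exists_solution N.pos hh N.jordan N.diag N.im_diag_pos
        (fun t ht x => N.form_flow_le hre ht x) hζμ v
      refine ⟨u, ?_⟩
      rw [N.mem_graph_op, sub_eq_add_neg, rep_add, rep_smul, ← neg_one_smul ℂ v, rep_smul,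
        neg_one_smul, ← hu]
      abel
  · rintro _ ⟨α, rfl⟩
    rw [spec, mem_ofPred_eq]
    rintro ⟨R, hR⟩
    -- an index of minimal weight gives a functional which vanishes on the range
    obtain ⟨β, hβ, hmin⟩ : ∃ β, mu h N.lam β = mu h N.lam α ∧
        ∀ γ, mu h N.lam γ = mu h N.lam α → QuadOp.weight β ≤ QuadOp.weight γ := by
      obtain ⟨β, hβ, hmin⟩ := (measure (QuadOp.weight (n := n))).wf.has_min
        {β | mu h N.lam β = mu h N.lam α} ⟨α, rfl⟩
      exact ⟨β, hβ, fun γ hγ => not_lt.1 (hmin γ hγ)⟩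
    obtain ⟨S, c, b, hS, hrec⟩ := exists_multiD_weylOp N.jordan N.diag h β
    obtain ⟨v, hv⟩ := exists_rep_eq (entire_monomialFun β)
      ((polyGrowth_monomialFun β).memLp N.pos hh (entire_monomialFun β).differentiable.continuous)
    have h1 := hR.mem_graph v
    rw [N.mem_graph_op, sub_eq_add_neg, rep_add, rep_smul, ← neg_one_smul ℂ v, rep_smul, hv] at h1
    have h2 := hrec (rep (R v)) (entire_rep _)
    rw [← h1, multiD_add ((entire_rep _).smul _) ((entire_monomialFun β).smul _),
      multiD_smul (entire_rep _), multiD_smul (entire_monomialFun β), Finset.sum_eq_zero, ← hβ]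
      at h2
    · simp only [Pi.add_apply, Pi.smul_apply, smul_eq_mul, add_zero, neg_mul, one_mul,
        add_eq_left, neg_eq_zero, multiD_monomialFun, if_true] at h2
      rw [Finset.prod_eq_zero_iff] at h2
      obtain ⟨j, -, hj⟩ := h2
      exact (Nat.factorial_ne_zero (β j)) (by exact_mod_cast hj)
    · intro p hp
      obtain ⟨h3, -, h4⟩ := hS p hp
      exact absurd (hmin (b p) (h4.trans hβ)) (not_le.2 h3)

/-- On Taylor coefficients the resolvent is triangular: off the diagonal it contributes higher order
poles only. -/
theorem NormalForm.multiD_resolv (u : HPhi N.Φ h) (α : Fin n → ℕ) : ∃ p : Polynomial ℂ,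
    ∀ ζ, ζ ∉ spec (N.op h) → ζ ≠ mu h N.lam α → multiD α (rep (resolv (N.op h) ζ u)) 0 =
      multiD α (rep u) 0 * (ζ - mu h N.lam α)⁻¹ +
        (ζ - mu h N.lam α)⁻¹ ^ 2 * p.eval (ζ - mu h N.lam α)⁻¹ := by
  induction α using weight_induction with
  | hp α ih =>
    obtain ⟨S, c, b, hS, hrec⟩ := exists_multiD_weylOp N.jordan N.diag h α
    choose! P hP using ih
    refine ⟨∑ p ∈ S, Polynomial.C (c p) * (Polynomial.C (multiD (b p) (rep u) 0) +
      Polynomial.X * P (b p)), fun ζ hζ hζα => ?_⟩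
    have h1 := (isResolventAt_resolv hζ).mem_graph u
    rw [N.mem_graph_op, sub_eq_add_neg, rep_add, rep_smul, ← neg_one_smul ℂ u, rep_smul] at h1
    have h2 := hrec (rep (resolv (N.op h) ζ u)) (entire_rep _)
    rw [← h1, multiD_add ((entire_rep _).smul _) ((entire_rep _).smul _),
      multiD_smul (entire_rep _), multiD_smul (entire_rep _)] at h2
    simp only [Pi.add_apply, Pi.smul_apply, smul_eq_mul, neg_mul, one_mul] at h2
    have hne : ζ - mu h N.lam α ≠ 0 := sub_ne_zero.2 hζα
    set s := (ζ - mu h N.lam α)⁻¹ with hs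
    have hsum : ∑ p ∈ S, c p * multiD (b p) (rep (resolv (N.op h) ζ u)) 0 =
        s * (∑ p ∈ S, Polynomial.C (c p) * (Polynomial.C (multiD (b p) (rep u) 0) +
          Polynomial.X * P (b p))).eval s := by
      rw [Polynomial.eval_finsetSum, Finset.mul_sum]
      refine Finset.sum_congr rfl fun p hp => ?_
      obtain ⟨h3, -, h4⟩ := hS p hp
      rw [hP (b p) h3 ζ hζ (h4.symm ▸ hζα), h4, ← hs]
      simp only [Polynomial.eval_mul, Polynomial.eval_add, Polynomial.eval_C, Polynomial.eval_X]
      ring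
    rw [hsum] at h2
    have h5 : (ζ - mu h N.lam α) * multiD α (rep (resolv (N.op h) ζ u)) 0 =
        multiD α (rep u) 0 + s * (∑ p ∈ S, Polynomial.C (c p) *
          (Polynomial.C (multiD (b p) (rep u) 0) + Polynomial.X * P (b p))).eval s := by
      linear_combination h2
    have h6 : multiD α (rep (resolv (N.op h) ζ u)) 0 =
        s * ((ζ - mu h N.lam α) * multiD α (rep (resolv (N.op h) ζ u)) 0) := by
      rw [hs, inv_mul_cancel_left₀ hne]
    rw [h6, h5]
    ring

/-- The Taylor coefficients of the contour integral of the resolvent. -/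
theorem NormalForm.multiD_circleIntegral (hre : ∀ X, 0 ≤ (q X).re) (hh : 0 < h) {z : ℂ} {r : ℝ}
    (hr : 0 < r) (hrz : Metric.closedBall z r ∩ spec (N.op h) ⊆ {z}) (u : HPhi N.Φ h)
    (α : Fin n → ℕ) :
    multiD α (rep (((2 * (Real.pi : ℂ) * Complex.I)⁻¹ •
      circleIntegral (fun ζ => resolv (N.op h) ζ) z r) u)) 0 =
      if mu h N.lam α = z then multiD α (rep u) 0 else 0 := by
  have := completeSpace_HPhi (h := h) N.pos hh
  have hsph : ∀ ζ ∈ Metric.sphere z r, ζ ∉ spec (N.op h) := by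
    intro ζ hζ hs
    have h1 : ζ = z := hrz ⟨Metric.sphere_subset_closedBall hζ, hs⟩
    rw [h1, mem_sphere_iff_norm, sub_self, norm_zero] at hζ
    exact hr.ne hζ
  have hint : CircleIntegrable (fun ζ => resolv (N.op h) ζ) z r :=
    (continuousOn_resolv.mono hsph).circleIntegrable hr.le
  obtain ⟨L, hL⟩ := exists_taylorFunctional N.pos hh α
  have hμ : mu h N.lam α ∈ spec (N.op h) := by
    rw [N.spec_op hre hh]; exact ⟨α, rfl⟩
  obtain ⟨p, hp⟩ := N.multiD_resolv u α
  have h2 : circleIntegral (fun ζ => L (resolv (N.op h) ζ u)) z r = if mu h N.lam α = z then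
        multiD α (rep u) 0 * (2 * Real.pi * Complex.I) else 0 := by
    rw [← circleIntegral_principalPart hr p (by
      by_cases hz : mu h N.lam α = z
      · exact Or.inl hz
      · exact Or.inr fun hb => hz (hrz ⟨hb, hμ⟩))]
    refine circleIntegral.integral_congr hr.le fun ζ hζ => ?_
    have h3 : ζ ∉ spec (N.op h) := hsph ζ hζ
    exact (hL _).trans (hp ζ h3 fun h4 => h3 (h4 ▸ hμ))
  rw [← hL, apply_smul_circleIntegral L u _ hint, h2]
  split_ifs
  · rw [mul_comm (multiD α (rep u) 0), inv_mul_cancel_left₀ Complex.two_pi_I_ne_zero]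
  · rw [mul_zero]

/-- The contour integral retains exactly the Taylor coefficients with `μ_α = z`. -/
theorem NormalForm.exists_rieszProjection (hre : ∀ X, 0 ≤ (q X).re) (hh : 0 < h) (z : ℂ) :
    {α : Fin n → ℕ | mu h N.lam α = z}.Finite ∧
      ∃ P : HPhi N.Φ h →L[ℂ] HPhi N.Φ h, IsRieszProjection (N.op h) z P ∧
        ∀ (u : HPhi N.Φ h) (x : Fin n → ℂ),
          rep (P u) x = ∑ᶠ α ∈ {α : Fin n → ℕ | mu h N.lam α = z},
            ((∏ j, ((α j).factorial : ℂ))⁻¹ * multiD α (rep u) 0) * ∏ j, x j ^ α j := by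
  have hfin : {α : Fin n → ℕ | mu h N.lam α = z}.Finite := by
    refine (finite_norm_mu_sub_le hh N.im_lam_pos z 0).subset fun α hα => ?_
    rw [mem_ofPred_eq] at hα ⊢
    rw [hα, sub_self, norm_zero]
  -- the Taylor coefficients of the contour integral do not depend on the isolating circle
  obtain ⟨r, hr, hrz⟩ := exists_isolating_radius hh N.im_lam_pos z
  rw [← N.spec_op hre hh] at hrz
  refine ⟨hfin, (2 * (Real.pi : ℂ) * Complex.I)⁻¹ •
    circleIntegral (fun ζ => resolv (N.op h) ζ) z r,
    ⟨N.isClosed_op hre hh, N.dense_domain_op hre hh, ⟨r, hr, hrz⟩, fun r' hr' hrz' => ?_⟩,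
    fun u x => ?_⟩
  · refine ContinuousLinearMap.ext fun u => rep_injective
      (entire_eq_of_multiD (entire_rep _) (entire_rep _) fun α => ?_)
    rw [N.multiD_circleIntegral hre hh hr hrz, N.multiD_circleIntegral hre hh hr' hrz']
  · set F : (Fin n → ℂ) → ℂ := ∑ α ∈ hfin.toFinset,
      ((∏ j, ((α j).factorial : ℂ))⁻¹ * multiD α (rep u) 0) • monomialFun α with hF
    have hFe : Entire F := Entire.sum fun α _ => (entire_monomialFun α).smul _
    have h1 : rep (((2 * (Real.pi : ℂ) * Complex.I)⁻¹ •
        circleIntegral (fun ζ => resolv (N.op h) ζ) z r) u) = F := by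
      refine entire_eq_of_multiD (entire_rep _) hFe fun β => ?_
      rw [N.multiD_circleIntegral hre hh hr hrz, hF,
        multiD_sum fun α _ => (entire_monomialFun α).smul _, Finset.sum_apply]
      have h2 : ∀ α ∈ hfin.toFinset, multiD β (((∏ j, ((α j).factorial : ℂ))⁻¹ *
          multiD α (rep u) 0) • monomialFun α) 0 =
          if β = α then multiD β (rep u) 0 else 0 := by
        intro α _
        rw [multiD_smul (entire_monomialFun α), Pi.smul_apply, multiD_monomialFun, smul_eq_mul]
        split_ifs with hβ
        · subst hβ
          have h3 : (∏ j, ((β j).factorial : ℂ)) ≠ 0 :=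
            Finset.prod_ne_zero_iff.2 fun j _ => by exact_mod_cast (β j).factorial_ne_zero
          rw [mul_right_comm, inv_mul_cancel₀ h3, one_mul]
        · rw [mul_zero]
      rw [Finset.sum_congr rfl h2, Finset.sum_ite_eq]
      simp only [Set.Finite.mem_toFinset, mem_ofPred_eq]
    rw [h1, finsum_mem_eq_finite_toFinset_sum _ hfin, hF, Finset.sum_apply]
    rfl

end Spectrum

/-! ### Jordan bases -/

section Jordan

open Module

/-- A Jordan block. -/
theorem isJordanForm_block (m : ℕ) (μ : ℂ) : IsJordanForm (Matrix.of fun i j : Fin m =>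
    if i = j then μ else if (j : ℕ) = i + 1 then 1 else 0) := by
  refine ⟨fun i j h1 h2 => ?_, fun i j h1 => Or.inr ⟨?_, ?_⟩⟩
  · rw [of_apply, if_neg (Ne.symm h1), if_neg h2]
  · have : i ≠ j := fun h => by rw [h] at h1; omega
    rw [of_apply, if_neg this, if_pos h1]
  · simp

theorem IsJordanForm.fromBlocks {m d : ℕ} {J : Matrix (Fin m) (Fin m) ℂ}
    {M : Matrix (Fin d) (Fin d) ℂ} (hJ : IsJordanForm J) (hM : IsJordanForm M) :
    IsJordanForm (Matrix.reindex finSumFinEquiv finSumFinEquiv (fromBlocks J 0 0 M)) := by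
  have hl : ∀ a : Fin m, finSumFinEquiv.symm (Fin.castAdd d a) = Sum.inl a := fun a =>
    finSumFinEquiv_symm_apply_castAdd a
  have hr : ∀ a : Fin d, finSumFinEquiv.symm (Fin.natAdd m a) = Sum.inr a := fun a =>
    finSumFinEquiv_symm_apply_natAdd a
  constructor
  · intro i j
    induction i using Fin.addCases with
    | left a =>
      induction j using Fin.addCases with
      | left b =>
        intro h1 h2
        simp only [reindex_apply, submatrix_apply, hl, fromBlocks_apply₁₁]
        exact hJ.1 a b (fun h => h1 (by rw [h])) h2
      | right b => simp [hl, hr]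
    | right a =>
      induction j using Fin.addCases with
      | left b => simp [hl, hr]
      | right b =>
        intro h1 h2
        simp only [reindex_apply, submatrix_apply, hr, fromBlocks_apply₂₂]
        refine hM.1 a b (fun h => h1 (by rw [h])) fun h => h2 ?_
        simp only [Fin.val_natAdd, h]
        ring
  · intro i j
    induction i using Fin.addCases with
    | left a =>
      induction j using Fin.addCases with
      | left b =>
        intro h1
        simp only [reindex_apply, submatrix_apply, hl, fromBlocks_apply₁₁]
        exact hJ.2 a b h1
      | right b => simp [hl, hr]
    | right a =>
      induction j using Fin.addCases with
      | left b => simp [hl, hr]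
      | right b =>
        intro h1
        simp only [reindex_apply, submatrix_apply, hr, fromBlocks_apply₂₂]
        refine hM.2 a b ?_
        simp only [Fin.val_natAdd] at h1
        omega

variable {W : Type*} [AddCommGroup W] [Module ℂ W]

/-- The vectors all of whose images under the powers of `g` are annihilated by `φ`. -/
def annihilatedOrbit (g : End ℂ W) (φ : W →ₗ[ℂ] ℂ) : Submodule ℂ W where
  carrier := {w | ∀ k : ℕ, φ ((g ^ k) w) = 0}
  zero_mem' := fun k => by simp
  add_mem' := fun {v w} hv hw k => by rw [map_add, map_add, hv k, hw k, add_zero]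
  smul_mem' := fun c w hw k => by rw [map_smul, map_smul, hw k, smul_zero]

variable {g : End ℂ W} {φ : W →ₗ[ℂ] ℂ} {v : W} {m : ℕ}

theorem pow_apply_eq_zero_of_lt (hv : (g ^ (m + 1)) v = 0) {k : ℕ} (hk : m < k) : (g ^ k) v = 0 := by
  obtain ⟨l, rfl⟩ := Nat.exists_eq_add_of_lt hk
  rw [show m + l + 1 = l + (m + 1) by ring, pow_add, Module.End.mul_apply, hv, map_zero]

theorem eq_zero_of_cyclic_mem (hv : (g ^ (m + 1)) v = 0) (hφ : φ ((g ^ m) v) ≠ 0)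
    {a : Fin (m + 1) → ℂ}
    (ha : ∑ k, a k • (g ^ (m - (k : ℕ))) v ∈ annihilatedOrbit g φ) : a = 0 := by
  have key : ∀ s : ℕ, ∀ i : Fin (m + 1), m - (i : ℕ) = s → a i = 0 := by
    intro s
    induction s using Nat.strong_induction_on with
    | _ s ih =>
      intro i hi
      have h1 := ha i
      rw [map_sum, map_sum, Finset.sum_eq_single i] at h1
      · rw [map_smul, map_smul, ← Module.End.mul_apply, ← pow_add, smul_eq_mul,
          show (i : ℕ) + (m - i) = m by omega] at h1
        exact (mul_eq_zero.1 h1).resolve_right hφ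
      · intro k _ hki
        rcases lt_or_ge (i : ℕ) (k : ℕ) with h2 | h2
        · rw [ih (m - k) (by omega) k rfl]; simp
        · have h3 : (k : ℕ) ≠ i := fun h => hki (Fin.ext h)
          rw [map_smul, map_smul, ← Module.End.mul_apply, ← pow_add,
            pow_apply_eq_zero_of_lt hv (by omega)]
          simp
      · simp
  exact funext fun i => key _ i rfl

theorem span_cyclic_sup_eq_top (hv : (g ^ (m + 1)) v = 0) (hφ : φ ((g ^ m) v) ≠ 0)
    (hran : ∀ w, φ ((g ^ (m + 1)) w) = 0) :
    Submodule.span ℂ (range fun k : Fin (m + 1) => (g ^ (m - (k : ℕ))) v) ⊔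
      annihilatedOrbit g φ = ⊤ := by
  refine eq_top_iff.2 fun w _ => ?_
  set C := Submodule.span ℂ (range fun k : Fin (m + 1) => (g ^ (m - (k : ℕ))) v)
  -- kill `φ (g^i (w - y))` for descending `i`, by multiples of the vectors of the block
  have key : ∀ s ≤ m + 1, ∃ y ∈ C, ∀ i, m + 1 - s ≤ i → φ ((g ^ i) (w - y)) = 0 := by
    intro s
    induction s with
    | zero =>
      refine fun _ => ⟨0, C.zero_mem, fun i hi => ?_⟩
      obtain ⟨l, rfl⟩ := Nat.exists_eq_add_of_le hi
      rw [pow_add, Nat.sub_zero, Module.End.mul_apply]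
      exact hran _
    | succ s ih =>
      intro hs
      obtain ⟨y, hy, hyi⟩ := ih (by omega)
      set t := φ ((g ^ (m - s)) (w - y)) / φ ((g ^ m) v) with ht
      refine ⟨y + t • (g ^ s) v, C.add_mem hy (C.smul_mem _ (Submodule.subset_span
        ⟨⟨m - s, by omega⟩, ?_⟩)), fun i hi => ?_⟩
      · simp only
        rw [show m - (m - s) = s by omega]
      · rw [← sub_sub, map_sub, map_sub, map_smul, map_smul, ← Module.End.mul_apply (g ^ i),
          ← pow_add]
        rcases eq_or_lt_of_le hi with h1 | h1
        · have h2 : i = m - s := by omega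
          rw [h2, show m - s + s = m by omega, ht, smul_eq_mul, div_mul_cancel₀ _ hφ, sub_self]
        · rw [hyi i (by omega), pow_apply_eq_zero_of_lt hv (by omega)]
          simp
  obtain ⟨y, hy, hyi⟩ := key (m + 1) le_rfl
  rw [← add_sub_cancel y w]
  exact Submodule.add_mem_sup hy fun k => hyi k (by omega)

/-- Every endomorphism of a finite dimensional complex vector space has a Jordan basis. The
induction splits off one cyclic block of maximal size; an invariant complement is cut out by a
functional which does not vanish on the last vector of the block. -/
theorem exists_jordan_basis {W : Type*} [AddCommGroup W] [Module ℂ W] [FiniteDimensional ℂ W]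
    (f : End ℂ W) : ∃ (d : ℕ) (b : Fin d → W) (M : Matrix (Fin d) (Fin d) ℂ),
      LinearIndependent ℂ b ∧ Submodule.span ℂ (range b) = ⊤ ∧ IsJordanForm M ∧
        (∀ j, f (b j) = ∑ i, M i j • b i) ∧ ∀ j, ∃ w, w ≠ 0 ∧ f w = M j j • w := by
  induction hd : finrank ℂ W using Nat.strong_induction_on generalizing W with
  | _ d ih =>
    rcases subsingleton_or_nontrivial W with hW | hW
    · exact ⟨0, Fin.elim0, 0, linearIndependent_empty_type, Subsingleton.elim _ _,
        ⟨fun i => i.elim0, fun i => i.elim0⟩, fun j => j.elim0, fun j => j.elim0⟩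
    obtain ⟨μ, hμ⟩ := Module.End.exists_eigenvalue f
    obtain ⟨w₀, hw₀⟩ := hμ.exists_hasEigenvector
    set g : End ℂ W := f - μ • 1 with hg
    have hfg : ∀ w, f w = μ • w + g w := fun w => by simp [hg]
    have hgw₀ : g w₀ = 0 := by
      have h1 := hfg w₀
      rw [hw₀.apply_eq_smul] at h1
      simpa using h1.symm
    -- the nilpotency index `m + 1` of `g` on its generalized kernel
    have hex : ∃ k, LinearMap.ker (g ^ k) = LinearMap.ker (g ^ (k + 1)) := by
      obtain ⟨k, -, hk⟩ := Module.End.exists_ker_pow_eq_ker_pow_succ g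
      exact ⟨k, hk⟩
    classical
    obtain ⟨m, hm⟩ : ∃ m, Nat.find hex = m + 1 := by
      refine Nat.exists_eq_succ_of_ne_zero fun h0 => ?_
      have h1 := Nat.find_spec hex
      rw [h0] at h1
      have h2 : w₀ ∈ LinearMap.ker (g ^ 0) := by
        rw [h1, LinearMap.mem_ker, zero_add, pow_one, hgw₀]
      rw [LinearMap.mem_ker, pow_zero, Module.End.one_apply] at h2
      exact hw₀.2 h2
    have hspec : LinearMap.ker (g ^ (m + 1)) = LinearMap.ker (g ^ (m + 1 + 1)) :=
      hm ▸ Nat.find_spec hex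
    have hne : LinearMap.ker (g ^ m) ≠ LinearMap.ker (g ^ (m + 1)) :=
      Nat.find_min hex (hm ▸ Nat.lt_succ_self m)
    obtain ⟨v, hv, hv'⟩ : ∃ v, (g ^ (m + 1)) v = 0 ∧ (g ^ m) v ≠ 0 := by
      by_contra! hall
      refine hne (le_antisymm (fun w hw => ?_) fun w hw => hall w hw)
      rw [LinearMap.mem_ker] at hw ⊢
      rw [pow_succ', Module.End.mul_apply, hw, map_zero]
    have hnot : (g ^ m) v ∉ LinearMap.range (g ^ (m + 1)) := by
      rintro ⟨w, hw⟩
      have h1 : w ∈ LinearMap.ker (g ^ (m + 1 + 1)) := by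
        rw [LinearMap.mem_ker, pow_succ', Module.End.mul_apply, hw, ← Module.End.mul_apply,
          ← pow_succ', hv]
      rw [← hspec, LinearMap.mem_ker, hw] at h1
      exact hv' h1
    obtain ⟨φ, hφ, hφr⟩ := Submodule.exists_le_ker_of_notMem hnot
    have hran : ∀ w, φ ((g ^ (m + 1)) w) = 0 := fun w => hφr ⟨w, rfl⟩
    set K := annihilatedOrbit g φ with hK
    have hgK : ∀ w ∈ K, f w ∈ K := by
      intro w hw
      rw [hfg]
      refine K.add_mem (K.smul_mem _ hw) fun k => ?_
      rw [← Module.End.mul_apply, ← pow_succ]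
      exact hw (k + 1)
    have hKlt : finrank ℂ K < d := by
      rw [← hd]
      refine Submodule.finrank_lt fun h => ?_
      have h1 : v ∈ K := h ▸ Submodule.mem_top
      exact hφ (h1 m)
    obtain ⟨d₂, b₂, M₂, hli₂, hsp₂, hJ₂, hf₂, he₂⟩ := ih _ hKlt (f.restrict hgK) rfl
    set c : Fin (m + 1) → W := fun k => (g ^ (m - (k : ℕ))) v with hc
    set J : Matrix (Fin (m + 1)) (Fin (m + 1)) ℂ :=
      Matrix.of fun i j => if i = j then μ else if (j : ℕ) = i + 1 then 1 else 0 with hJ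
    have hdisj : Disjoint (Submodule.span ℂ (range c)) K := by
      rw [Submodule.disjoint_def]
      intro w hw hwK
      obtain ⟨a, rfl⟩ := (Submodule.mem_span_range_iff_exists_fun ℂ).1 hw
      have h1 : a = 0 := eq_zero_of_cyclic_mem hv hφ hwK
      simp [h1]
    have hlic : LinearIndependent ℂ c := by
      rw [Fintype.linearIndependent_iff]
      intro a ha i
      have h1 : ∑ k, a k • c k ∈ K := ha ▸ K.zero_mem
      exact congrFun (eq_zero_of_cyclic_mem hv hφ h1) i
    have hspan₂ : Submodule.span ℂ (range fun i => (b₂ i : W)) = K := by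
      have h1 : (range fun i => (b₂ i : W)) = K.subtype '' range b₂ := by
        rw [← range_comp]; rfl
      rw [h1, Submodule.span_image, hsp₂, Submodule.map_top, Submodule.range_subtype]
    have hfc : ∀ j, f (c j) = ∑ i, J i j • c i := by
      intro j
      rw [hfg]
      have h1 : ∀ i, J i j • c i = (if i = j then μ • c j else 0) +
          if (j : ℕ) = i + 1 then c i else 0 := by
        intro i
        simp only [hJ, of_apply]
        by_cases h1 : i = j
        · subst h1; simp
        · rw [if_neg h1, if_neg h1, zero_add]
          split_ifs <;> simp
      rw [Finset.sum_congr rfl fun i _ => h1 i, Finset.sum_add_distrib, Finset.sum_ite_eq',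
        if_pos (Finset.mem_univ j)]
      congr 1
      have h2 : g (c j) = (g ^ (m - (j : ℕ) + 1)) v := by
        rw [pow_succ', Module.End.mul_apply]
      rw [h2]
      rcases Nat.eq_zero_or_pos (j : ℕ) with h0 | h0
      · rw [h0, Nat.sub_zero, hv, Finset.sum_eq_zero]
        intro i _
        rw [if_neg (by omega)]
      · rw [Finset.sum_eq_single ⟨(j : ℕ) - 1, by omega⟩]
        · rw [if_pos (by simp only; omega), hc]
          simp only
          congr 2
          omega
        · intro i _ hi
          rw [if_neg]
          intro h3
          exact hi (Fin.ext (by simp only; omega))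
        · simp
    refine ⟨m + 1 + d₂, Sum.elim c (fun i => (b₂ i : W)) ∘ finSumFinEquiv.symm,
      Matrix.reindex finSumFinEquiv finSumFinEquiv (Matrix.fromBlocks J 0 0 M₂), ?_, ?_,
      (isJordanForm_block (m + 1) μ).fromBlocks hJ₂, ?_, ?_⟩
    · refine LinearIndependent.comp ?_ _ finSumFinEquiv.symm.injective
      refine hlic.sum_type (hli₂.map' K.subtype K.ker_subtype) ?_
      rw [hspan₂]
      exact hdisj
    · rw [EquivLike.range_comp, Set.Sum.elim_range, Submodule.span_union, hspan₂]
      exact span_cyclic_sup_eq_top hv hφ hran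
    · intro j
      obtain ⟨j, rfl⟩ := finSumFinEquiv.surjective j
      rw [← finSumFinEquiv.sum_comp, Fintype.sum_sum_type]
      simp only [Function.comp_apply, Equiv.symm_apply_apply, reindex_apply, submatrix_apply,
        Sum.elim_inl, Sum.elim_inr]
      cases j with
      | inl j => simpa using hfc j
      | inr j =>
        have h1 := congrArg Subtype.val (hf₂ j)
        simpa using h1
    · intro j
      obtain ⟨j, rfl⟩ := finSumFinEquiv.surjective j
      simp only [reindex_apply, submatrix_apply, Equiv.symm_apply_apply]
      cases j with
      | inl j =>
        refine ⟨w₀, hw₀.2, ?_⟩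
        simp [hJ, hfg, hgw₀]
      | inr j =>
        obtain ⟨w, hw, hfw⟩ := he₂ j
        refine ⟨w, fun h => hw (Subtype.ext h), ?_⟩
        have h1 := congrArg Subtype.val hfw
        simpa using h1

end Jordan

/-! ### The symplectic form and the Hamilton map -/

section Symplectic

variable {n : ℕ}

theorem sympForm_comm (X Y : Fin n ⊕ Fin n → ℂ) : sympForm Y X = -sympForm X Y := by
  rw [sympForm, sympForm, ← Finset.sum_neg_distrib]
  exact Finset.sum_congr rfl fun j _ => by ring

theorem sympForm_add_right (X Y Z : Fin n ⊕ Fin n → ℂ) :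
    sympForm X (Y + Z) = sympForm X Y + sympForm X Z := by
  simp only [sympForm, Pi.add_apply, ← Finset.sum_add_distrib]
  exact Finset.sum_congr rfl fun j _ => by ring

theorem sympForm_smul_right (c : ℂ) (X Y : Fin n ⊕ Fin n → ℂ) :
    sympForm X (c • Y) = c * sympForm X Y := by
  simp only [sympForm, Pi.smul_apply, smul_eq_mul, Finset.mul_sum]
  exact Finset.sum_congr rfl fun j _ => by ring

/-- The symplectic form as a bilinear map. -/
def sympBilin : (Fin n ⊕ Fin n → ℂ) →ₗ[ℂ] (Fin n ⊕ Fin n → ℂ) →ₗ[ℂ] ℂ :=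
  LinearMap.mk₂ ℂ sympForm
    (fun X Y Z => by
      rw [sympForm_comm, sympForm_add_right, sympForm_comm X, sympForm_comm Y]; ring)
    (fun c X Y => by rw [sympForm_comm, sympForm_smul_right, sympForm_comm X, smul_eq_mul]; ring)
    sympForm_add_right sympForm_smul_right

theorem sympBilin_apply (X Y : Fin n ⊕ Fin n → ℂ) : sympBilin X Y = sympForm X Y := rfl

theorem sympForm_smul_left (c : ℂ) (X Y : Fin n ⊕ Fin n → ℂ) :
    sympForm (c • X) Y = c * sympForm X Y := by
  rw [← sympBilin_apply, map_smul]; rfl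

theorem sympForm_eq_zero {X : Fin n ⊕ Fin n → ℂ} (hX : ∀ Y, sympForm X Y = 0) : X = 0 := by
  funext a
  cases a with
  | inl j =>
    have := hX (Pi.single (Sum.inr j) 1)
    simpa [sympForm, Pi.single_apply] using this
  | inr j =>
    have := hX (Pi.single (Sum.inl j) 1)
    simpa [sympForm, Pi.single_apply] using this

theorem sympForm_star (X Y : Fin n ⊕ Fin n → ℂ) :
    sympForm (star X) (star Y) = conj (sympForm X Y) := by
  simp [sympForm, Pi.star_apply]

theorem re_sympForm_star_self (X : Fin n ⊕ Fin n → ℂ) : (sympForm (star X) X).re = 0 := by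
  have h1 := sympForm_star (star X) X
  rw [star_star, sympForm_comm] at h1
  have h2 := congrArg Complex.re h1
  rw [Complex.neg_re, Complex.conj_re] at h2
  linarith

theorem continuous_sympForm :
    Continuous fun p : (Fin n ⊕ Fin n → ℂ) × (Fin n ⊕ Fin n → ℂ) => sympForm p.1 p.2 := by
  unfold sympForm
  fun_prop

theorem hasDerivAt_sympForm {x y : ℝ → Fin n ⊕ Fin n → ℂ} {x' y' : Fin n ⊕ Fin n → ℂ} {t : ℝ}
    (hx : HasDerivAt x x' t) (hy : HasDerivAt y y' t) :
    HasDerivAt (fun t => sympForm (x t) (y t)) (sympForm x' (y t) + sympForm (x t) y') t := by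
  have hx' := hasDerivAt_pi.1 hx
  have hy' := hasDerivAt_pi.1 hy
  have h1 : HasDerivAt (fun t => sympForm (x t) (y t)) _ t :=
    HasDerivAt.fun_sum fun j (_ : j ∈ Finset.univ) =>
      ((hx' (Sum.inr j)).mul (hy' (Sum.inl j))).sub ((hy' (Sum.inr j)).mul (hx' (Sum.inl j)))
  refine h1.congr_deriv ?_
  rw [sympForm, sympForm, ← Finset.sum_add_distrib]
  exact Finset.sum_congr rfl fun j _ => by ring

variable (q : QuadraticMap ℝ (Fin n ⊕ Fin n → ℝ) ℂ)

theorem sympForm_hamiltonMap_right (X Y : Fin n ⊕ Fin n → ℂ) :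
    sympForm X (hamiltonMap q *ᵥ Y) = X ⬝ᵥ (coeffMatrix q *ᵥ Y) := by
  simp only [sympForm, hamiltonMap, mulVec, dotProduct, Fintype.sum_sum_type,
    fromBlocks_apply₁₁, fromBlocks_apply₁₂, fromBlocks_apply₂₁, fromBlocks_apply₂₂,
    toBlocks₁₁, toBlocks₁₂, toBlocks₂₁, toBlocks₂₂, Matrix.neg_apply, of_apply, neg_mul,
    Finset.sum_neg_distrib]
  rw [← Finset.sum_add_distrib]
  refine Finset.sum_congr rfl fun j _ => ?_
  ring

/-- The Hamilton map is skew with respect to the symplectic form. -/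
theorem sympForm_hamiltonMap_left (X Y : Fin n ⊕ Fin n → ℂ) :
    sympForm (hamiltonMap q *ᵥ X) Y = -sympForm X (hamiltonMap q *ᵥ Y) := by
  rw [sympForm_comm, sympForm_hamiltonMap_right, sympForm_hamiltonMap_right, dotProduct_mulVec,
    ← mulVec_transpose, (coeffMatrix_isSymm q).eq, dotProduct_comm]

theorem re_sympForm_star_hamiltonMap (X : Fin n ⊕ Fin n → ℂ) :
    (sympForm (star X) (hamiltonMap q *ᵥ X)).re =
      (q fun a => (X a).re).re + (q fun a => (X a).im).re := by
  rw [sympForm_hamiltonMap_right, ← re_conj_dot_coeffMatrix_eq]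
  simp only [dotProduct, mulVec, Finset.mul_sum, Pi.star_apply, RCLike.star_def]
  congr 1
  exact Finset.sum_congr rfl fun a _ => Finset.sum_congr rfl fun b _ => by ring

/-- A real zero of the nonnegative form `Re q` is in the kernel of `Re F`. -/
theorem re_hamiltonMap_mulVec_eq_zero (hre : ∀ X, 0 ≤ (q X).re) {X : Fin n ⊕ Fin n → ℝ}
    (hX : (q X).re = 0) : (hamiltonMap q).map Complex.re *ᵥ X = 0 := by
  set A := (coeffMatrix q).map Complex.re with hA
  have hq : ∀ X, X ⬝ᵥ (A *ᵥ X) = (q X).re := by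
    intro X
    rw [← complexify_realPoint]
    simp [complexify, dotProduct, mulVec, realPoint, hA, Complex.re_sum]
  have hpsd : A.PosSemidef := by
    refine PosSemidef.of_dotProduct_mulVec_nonneg ?_ fun X => ?_
    · ext a b
      simp only [hA, conjTranspose_apply, map_apply, star_trivial]
      rw [(coeffMatrix_isSymm q).apply a b]
    · rw [star_trivial, hq]
      exact hre X
  have h1 := (hpsd.dotProduct_mulVec_zero_iff X).1 (by rw [star_trivial, hq, hX])
  funext a
  cases a with
  | inl j =>
    have h2 := congrFun h1 (Sum.inr j)
    simpa [mulVec, dotProduct, hamiltonMap, hA, Fintype.sum_sum_type, toBlocks₂₁, toBlocks₂₂]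
      using h2
  | inr j =>
    have h2 := congrFun h1 (Sum.inl j)
    simp only [mulVec, dotProduct, hA, Fintype.sum_sum_type, map_apply, Pi.zero_apply] at h2
    simp only [mulVec, dotProduct, hamiltonMap, Fintype.sum_sum_type, toBlocks₁₁, toBlocks₁₂,
      map_apply, fromBlocks_apply₂₁, fromBlocks_apply₂₂, Matrix.neg_apply, of_apply, Complex.neg_re,
      neg_mul, Finset.sum_neg_distrib, Pi.zero_apply]
    linarith

theorem ofReal_mulVec_eq_zero_iff {ι : Type*} [Fintype ι] {A : Matrix ι ι ℝ} {Z : ι → ℂ} :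
    A.map Complex.ofReal *ᵥ Z = 0 ↔
      A *ᵥ (fun a => (Z a).re) = 0 ∧ A *ᵥ (fun a => (Z a).im) = 0 := by
  have h1 : ∀ i, (A.map Complex.ofReal *ᵥ Z) i =
      ((A *ᵥ fun a => (Z a).re) i : ℝ) + ((A *ᵥ fun a => (Z a).im) i : ℝ) * Complex.I := by
    intro i
    apply Complex.ext <;> simp [mulVec, dotProduct, Complex.re_sum, Complex.im_sum]
  constructor
  · intro h
    have h2 : ∀ i, _ := fun i => (h1 i).symm.trans (congrFun h i)
    constructor
    · funext i
      simpa using congrArg Complex.re (h2 i)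
    · funext i
      simpa using congrArg Complex.im (h2 i)
  · rintro ⟨h2, h3⟩
    funext i
    rw [h1, h2, h3]
    simp

theorem hasDerivAt_mulVec {ι : Type*} [Fintype ι] (A : Matrix ι ι ℂ) {x : ℝ → ι → ℂ} {x' : ι → ℂ}
    {t : ℝ} (hx : HasDerivAt x x' t) : HasDerivAt (fun t => A *ᵥ x t) (A *ᵥ x') t :=
  ((A.mulVecLin.toContinuousLinearMap.restrictScalars ℝ).hasFDerivAt (x := x t)).comp_hasDerivAt
    t hx

/-- Since the singular space is trivial, a trajectory of the Hamilton flow along which nothing is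
dissipated vanishes. -/
theorem eq_zero_of_no_dissipation (hre : ∀ X, 0 ≤ (q X).re) (hS : singularSpace q = ⊥) {s : ℂ}
    (hs : s ≠ 0) {x : ℝ → Fin n ⊕ Fin n → ℂ}
    (hx : ∀ t, HasDerivAt x (s • (hamiltonMap q *ᵥ x t)) t)
    (h0 : ∀ t, 0 < t → (sympForm (star (x t)) (hamiltonMap q *ᵥ x t)).re = 0) {t : ℝ} (ht : 0 < t) :
    x t = 0 := by
  set R := (hamiltonMap q).map Complex.re with hR
  set J := (hamiltonMap q).map Complex.im with hJ
  have hF : ∀ X, hamiltonMap q *ᵥ X =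
      R.map Complex.ofReal *ᵥ X + Complex.I • (J.map Complex.ofReal *ᵥ X) := by
    intro X
    have e : hamiltonMap q = R.map Complex.ofReal + Complex.I • J.map Complex.ofReal := by
      ext a b
      simp only [hR, hJ, Matrix.add_apply, Matrix.smul_apply, map_apply, smul_eq_mul]
      rw [mul_comm, Complex.re_add_im]
    conv_lhs => rw [e]
    rw [add_mulVec, smul_mulVec]
  have hRx : ∀ t, 0 < t → R.map Complex.ofReal *ᵥ x t = 0 := by
    intro t ht
    have h1 := h0 t ht
    rw [re_sympForm_star_hamiltonMap] at h1
    have h2 := hre fun a => (x t a).re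
    have h3 := hre fun a => (x t a).im
    exact ofReal_mulVec_eq_zero_iff.2 ⟨re_hamiltonMap_mulVec_eq_zero q hre (by linarith),
      re_hamiltonMap_mulVec_eq_zero q hre (by linarith)⟩
  -- differentiating `(Re F) (Im F)ᵏ x(t) = 0` and using `(Re F) x(t) = 0` gives the next power
  have hk : ∀ k : ℕ, ∀ t, 0 < t → (R * J ^ k).map Complex.ofReal *ᵥ x t = 0 := by
    intro k
    induction k with
    | zero => simpa using hRx
    | succ k ih =>
      intro t ht
      have h1 := hasDerivAt_mulVec ((R * J ^ k).map Complex.ofReal) (hx t)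
      have h2 : (fun t => (R * J ^ k).map Complex.ofReal *ᵥ x t) =ᶠ[𝓝 t] fun _ => 0 := by
        filter_upwards [lt_mem_nhds ht] with u hu using ih u hu
      have h3 := (h1.congr_of_eventuallyEq h2.symm).unique (hasDerivAt_const t _)
      rw [hF, hRx t ht, zero_add, mulVec_smul, mulVec_smul, mulVec_mulVec, smul_smul] at h3
      have h4 := (smul_eq_zero.1 h3).resolve_left (mul_ne_zero hs Complex.I_ne_zero)
      have h5 : (R * J ^ (k + 1)).map Complex.ofReal =
          (R * J ^ k).map Complex.ofReal * J.map Complex.ofReal := by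
        rw [pow_succ, ← mul_assoc]
        exact map_mul (Complex.ofRealHom.mapMatrix) (R * J ^ k) J
      rw [h5, h4]
  have hmem : ∀ Y : Fin n ⊕ Fin n → ℝ, (∀ k : ℕ, (R * J ^ k) *ᵥ Y = 0) → Y = 0 := by
    intro Y hY
    have h1 : Y ∈ singularSpace q := by
      rw [singularSpace, Submodule.mem_iInf]
      exact hY
    rw [hS] at h1
    exact h1
  have hre0 := hmem _ fun k => (ofReal_mulVec_eq_zero_iff.1 (hk k t ht)).1
  have him0 := hmem _ fun k => (ofReal_mulVec_eq_zero_iff.1 (hk k t ht)).2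
  funext a
  exact Complex.ext (congrFun hre0 a) (congrFun him0 a)

/-- The Hamilton map has no real eigenvalues. -/
theorem im_ne_zero_of_eigenvector (hre : ∀ X, 0 ≤ (q X).re) (hS : singularSpace q = ⊥) {μ : ℂ}
    {X : Fin n ⊕ Fin n → ℂ} (hX : X ≠ 0) (hμ : hamiltonMap q *ᵥ X = μ • X) : μ.im ≠ 0 := by
  intro him
  -- for real `μ` the trajectory `exp(iμt) X` dissipates nothing
  have h1 := eq_zero_of_no_dissipation q hre hS (s := Complex.I) Complex.I_ne_zero
    (x := fun t => Complex.exp (Complex.I * μ * t) • X) (fun t => ?_) (fun t _ => ?_) one_pos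
  · exact hX ((smul_eq_zero.1 h1).resolve_left (Complex.exp_ne_zero _))
  · have h2 : HasDerivAt (fun t : ℝ => Complex.exp (Complex.I * μ * t))
        (Complex.exp (Complex.I * μ * t) * (Complex.I * μ)) t := by
      have h3 := ((Complex.ofRealCLM.hasDerivAt (x := t)).const_mul (Complex.I * μ)).cexp
      simpa using h3
    refine (h2.smul_const X).congr_deriv ?_
    rw [mulVec_smul, hμ, smul_smul, smul_smul]
    congr 1
    ring
  · rw [mulVec_smul, hμ, sympForm_smul_right, sympForm_smul_right, star_smul, sympForm_smul_left]
    set e := Complex.exp (Complex.I * μ * t)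
    have h2 : e * (μ * (star e * sympForm (star X) X)) =
        ((Complex.normSq e * μ.re : ℝ) : ℂ) * sympForm (star X) X := by
      have h3 : μ = (μ.re : ℂ) := Complex.ext rfl (by simpa using him)
      conv_lhs => rw [h3]
      rw [Complex.ofReal_mul, ← Complex.mul_conj e, RCLike.star_def]
      ring
    rw [h2, Complex.re_ofReal_mul, re_sympForm_star_self, mul_zero]

end Symplectic

/-! ### Stable subspaces of the Hamilton flow -/

section Stable

variable {n : ℕ} {q : QuadraticMap ℝ (Fin n ⊕ Fin n → ℝ) ℂ}

/-- On an invariant subspace on which the eigenvalues of `s F` are in the upper half-plane the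
trajectories of the flow of `2 i s F` tend to the origin. -/
theorem exists_decaying_trajectory {W : Submodule ℂ (Fin n ⊕ Fin n → ℂ)} {s : ℝ} (hs : s ^ 2 = 1)
    (hW : ∀ X ∈ W, hamiltonMap q *ᵥ X ∈ W)
    (hev : ∀ X ∈ W, X ≠ 0 → ∀ μ : ℂ, hamiltonMap q *ᵥ X = μ • X → 0 < s * μ.im)
    {X : Fin n ⊕ Fin n → ℂ} (hX : X ∈ W) : ∃ x : ℝ → Fin n ⊕ Fin n → ℂ, x 0 = X ∧
      (∀ t, HasDerivAt x ((2 * Complex.I * s) • (hamiltonMap q *ᵥ x t)) t) ∧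
      Tendsto x atTop (𝓝 0) := by
  have hsc : (s : ℂ) ^ 2 = 1 := by exact_mod_cast hs
  let f : Module.End ℂ W := ((2 * s : ℂ) • (hamiltonMap q).mulVecLin).restrict fun X hX =>
    W.smul_mem _ (hW X hX)
  have hf : ∀ w : W, (f w : Fin n ⊕ Fin n → ℂ) = (2 * s : ℂ) • (hamiltonMap q *ᵥ w) := fun w => rfl
  -- in a Jordan basis of `2sF` the trajectories are those of the flow of a Jordan matrix
  obtain ⟨d, b, M, -, hsp, hJ, hfb, hev'⟩ := exists_jordan_basis f
  have hpos : ∀ j, 0 < (M j j).im := by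
    intro j
    obtain ⟨w, hw, hfw⟩ := hev' j
    have h1 := congrArg Subtype.val hfw
    rw [hf, Submodule.coe_smul] at h1
    have h2 : hamiltonMap q *ᵥ (w : Fin n ⊕ Fin n → ℂ) = (s / 2 * M j j) • (w : Fin n ⊕ Fin n → ℂ) := by
      rw [mul_smul, ← h1, smul_smul, show (s : ℂ) / 2 * (2 * s) = s ^ 2 by ring, hsc, one_smul]
    have h3 := hev w w.2 (fun h => hw (Subtype.ext h)) _ h2
    have h4 : ((s : ℂ) / 2 * M j j).im = s / 2 * (M j j).im := by
      rw [show (s : ℂ) / 2 = ((s / 2 : ℝ) : ℂ) by push_cast; ring, Complex.im_ofReal_mul]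
    rw [h4] at h3
    have h5 : s * (s / 2 * (M j j).im) = s ^ 2 * (M j j).im / 2 := by ring
    rw [h5, hs] at h3
    linarith
  have hmem : (⟨X, hX⟩ : W) ∈ Submodule.span ℂ (range b) := hsp ▸ Submodule.mem_top
  obtain ⟨c, hc⟩ := (Submodule.mem_span_range_iff_exists_fun ℂ).1 hmem
  refine ⟨fun t => ∑ j, flow M t c j • (b j : Fin n ⊕ Fin n → ℂ), ?_, fun t => ?_, ?_⟩
  · have h1 := congrArg Subtype.val hc
    simp only [flow_zero]
    simpa using h1
  · have h1 := hasDerivAt_pi.1 (hasDerivAt_flow M t c)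
    have h2 : HasDerivAt (fun t => ∑ j, flow M t c j • (b j : Fin n ⊕ Fin n → ℂ)) _ t :=
      HasDerivAt.fun_sum fun j (_ : j ∈ Finset.univ) => (h1 j).smul_const (b j : Fin n ⊕ Fin n → ℂ)
    refine h2.congr_deriv ?_
    have h3 : ∀ j, (2 * Complex.I * s) • (hamiltonMap q *ᵥ (flow M t c j • (b j : Fin n ⊕ Fin n → ℂ))) =
        ∑ i, (Complex.I * (M i j * flow M t c j)) • (b i : Fin n ⊕ Fin n → ℂ) := by
      intro j
      have h4 := congrArg Subtype.val (hfb j)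
      rw [hf] at h4
      have h5 : (2 * Complex.I * s) • (hamiltonMap q *ᵥ (flow M t c j • (b j : Fin n ⊕ Fin n → ℂ))) =
          (Complex.I * flow M t c j) • ((2 * s : ℂ) • (hamiltonMap q *ᵥ (b j : Fin n ⊕ Fin n → ℂ))) := by
        rw [mulVec_smul, smul_smul, smul_smul]
        congr 1
        ring
      rw [h5, h4, Submodule.coe_sum, Finset.smul_sum]
      refine Finset.sum_congr rfl fun i _ => ?_
      rw [Submodule.coe_smul, smul_smul]
      congr 1
      ring
    rw [mulVec_sum, Finset.smul_sum, Finset.sum_congr rfl fun j _ => h3 j, Finset.sum_comm]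
    refine Finset.sum_congr rfl fun i _ => ?_
    rw [← Finset.sum_smul, flowGen_apply, Pi.smul_apply, smul_eq_mul, mulVec, dotProduct,
      Finset.mul_sum]
  · obtain ⟨κ, C, hκ, hC, hfl⟩ := exists_flow_decay hJ hpos
    have h1 : Tendsto (fun t => flow M t c) atTop (𝓝 0) := by
      have h2 : Tendsto (fun t : ℝ => C * Real.exp (-κ * t) * ‖c‖) atTop (𝓝 0) := by
        have h3 : Tendsto (fun t : ℝ => Real.exp (-κ * t)) atTop (𝓝 0) :=
          Real.tendsto_exp_atBot.comp (tendsto_id.const_mul_atTop_of_neg (by linarith))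
        simpa using (h3.const_mul C).mul_const ‖c‖
      refine squeeze_zero_norm' ?_ h2
      filter_upwards [eventually_ge_atTop 0] with t ht using hfl t ht c
    have h2 := tendsto_pi_nhds.1 h1
    have h3 := tendsto_finsetSum Finset.univ fun j (_ : j ∈ Finset.univ) =>
      (h2 j).smul_const (b j : Fin n ⊕ Fin n → ℂ)
    simpa using h3

/-- Stable subspaces are isotropic: the symplectic form is constant along the flow and tends to `0`. -/
theorem sympForm_eq_zero_of_stable {W : Submodule ℂ (Fin n ⊕ Fin n → ℂ)} {s : ℝ} (hs : s ^ 2 = 1)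
    (hW : ∀ X ∈ W, hamiltonMap q *ᵥ X ∈ W)
    (hev : ∀ X ∈ W, X ≠ 0 → ∀ μ : ℂ, hamiltonMap q *ᵥ X = μ • X → 0 < s * μ.im)
    {X Y : Fin n ⊕ Fin n → ℂ} (hX : X ∈ W) (hY : Y ∈ W) : sympForm X Y = 0 := by
  obtain ⟨x, hx0, hx, hxl⟩ := exists_decaying_trajectory hs hW hev hX
  obtain ⟨y, hy0, hy, hyl⟩ := exists_decaying_trajectory hs hW hev hY
  set F : ℝ → ℂ := fun t => sympForm (x t) (y t) with hF
  have hd : ∀ t, HasDerivAt F 0 t := by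
    intro t
    refine (hasDerivAt_sympForm (hx t) (hy t)).congr_deriv ?_
    rw [sympForm_smul_left, sympForm_smul_right, sympForm_hamiltonMap_left]
    ring
  have hconst : ∀ t, F t = F 0 := fun t =>
    is_const_of_deriv_eq_zero (fun t => (hd t).differentiableAt) (fun t => (hd t).deriv) t 0
  have hp : Tendsto (fun t => (x t, y t)) atTop
      (𝓝 ((0 : Fin n ⊕ Fin n → ℂ), (0 : Fin n ⊕ Fin n → ℂ))) := hxl.prodMk_nhds hyl
  have hlim : Tendsto F atTop (𝓝 0) := by
    have h1 := (continuous_sympForm.tendsto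
      ((0 : Fin n ⊕ Fin n → ℂ), (0 : Fin n ⊕ Fin n → ℂ))).comp hp
    have h0 : sympForm (0 : Fin n ⊕ Fin n → ℂ) 0 = 0 := by simp [sympForm]
    rw [h0] at h1
    exact h1
  have h0 : F 0 = 0 := tendsto_nhds_unique
    (tendsto_const_nhds.congr fun t => (hconst t).symm) hlim
  rw [← hx0, ← hy0]
  exact h0

/-- The hermitian form `i⁻¹ σ(X̄, X)` is definite on stable subspaces: its derivative along the flow
is `4 Re q`. -/
theorem im_sympForm_star_neg_of_stable (hre : ∀ X, 0 ≤ (q X).re) (hS : singularSpace q = ⊥)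
    {W : Submodule ℂ (Fin n ⊕ Fin n → ℂ)} {s : ℝ} (hs : s ^ 2 = 1)
    (hW : ∀ X ∈ W, hamiltonMap q *ᵥ X ∈ W)
    (hev : ∀ X ∈ W, X ≠ 0 → ∀ μ : ℂ, hamiltonMap q *ᵥ X = μ • X → 0 < s * μ.im)
    {X : Fin n ⊕ Fin n → ℂ} (hX : X ∈ W) (hX0 : X ≠ 0) :
    s * (sympForm (star X) X).im < 0 := by
  obtain ⟨x, hx0, hx, hxl⟩ := exists_decaying_trajectory hs hW hev hX
  set g : ℝ → ℝ := fun t => s * (sympForm (star (x t)) (x t)).im with hg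
  have hd : ∀ t, HasDerivAt g (4 * (sympForm (star (x t)) (hamiltonMap q *ᵥ x t)).re) t := by
    intro t
    have h1 := hasDerivAt_sympForm (hx t).star (hx t)
    have h2 := (Complex.imCLM.hasFDerivAt.comp_hasDerivAt t h1).const_mul s
    refine h2.congr_deriv ?_
    set w := sympForm (star (x t)) (hamiltonMap q *ᵥ x t) with hw
    have h3 : sympForm (star ((2 * Complex.I * s) • (hamiltonMap q *ᵥ x t))) (x t) =
        2 * Complex.I * s * conj w := by
      have h4 := sympForm_star ((2 * Complex.I * s) • (hamiltonMap q *ᵥ x t)) (star (x t))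
      rw [star_star, sympForm_smul_left,
        sympForm_comm (star (x t)) (hamiltonMap q *ᵥ x t), ← hw] at h4
      rw [h4]
      simp only [map_mul, map_neg, Complex.conj_I, Complex.conj_ofReal, map_ofNat]
      ring
    rw [h3, sympForm_smul_right, ← hw, Complex.imCLM_apply]
    have h5 : s * (2 * Complex.I * s * conj w + 2 * Complex.I * s * w).im =
        s ^ 2 * (4 * w.re) := by
      simp
      ring
    rw [h5, hs, one_mul]
  have hnn : ∀ t, 0 ≤ 4 * (sympForm (star (x t)) (hamiltonMap q *ᵥ x t)).re := by
    intro t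
    rw [re_sympForm_star_hamiltonMap]
    linarith [hre fun a => (x t a).re, hre fun a => (x t a).im]
  have hmono : Monotone g := monotone_of_deriv_nonneg (fun t => (hd t).differentiableAt) fun t => by
    rw [(hd t).deriv]; exact hnn t
  have hlim : Tendsto g atTop (𝓝 0) := by
    have h1 : Continuous fun X : Fin n ⊕ Fin n → ℂ => s * (sympForm (star X) X).im := by
      have := continuous_sympForm.comp
        ((continuous_star (R := Fin n ⊕ Fin n → ℂ)).prodMk continuous_id)
      exact continuous_const.mul (Complex.continuous_im.comp this)
    have h2 := (h1.tendsto 0).comp hxl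
    have h0 : s * (sympForm (star (0 : Fin n ⊕ Fin n → ℂ)) 0).im = 0 := by simp [sympForm]
    rwa [h0] at h2
  -- increasing to the limit `0`, the form is nonpositive, and it vanishes only if it is constant
  have hle : ∀ t, g t ≤ 0 := fun t => hmono.ge_of_tendsto hlim t
  have hg0 : g 0 = s * (sympForm (star X) X).im := by simp only [hg, hx0]
  rw [← hg0]
  refine lt_of_le_of_ne (hle 0) fun hzero => ?_
  have hgz : ∀ t, 0 ≤ t → g t = 0 := fun t ht => le_antisymm (hle t) (hzero ▸ hmono ht)
  have hxz : ∀ t, 0 < t → x t = 0 := by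
    have hs0 : (2 * Complex.I * s : ℂ) ≠ 0 := by
      have : s ≠ 0 := by rintro rfl; norm_num at hs
      exact mul_ne_zero (mul_ne_zero two_ne_zero Complex.I_ne_zero) (by exact_mod_cast this)
    refine fun t ht => eq_zero_of_no_dissipation q hre hS hs0 hx (fun u hu => ?_) ht
    have h2 : g =ᶠ[𝓝 u] fun _ => 0 := by
      filter_upwards [lt_mem_nhds hu] with v hv using hgz v hv.le
    have h3 := ((hd u).congr_of_eventuallyEq h2.symm).unique (hasDerivAt_const u _)
    linarith
  have hcont : Tendsto x (𝓝[>] 0) (𝓝 (x 0)) :=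
    (hx 0).continuousAt.tendsto.mono_left nhdsWithin_le_nhds
  have hcont' : Tendsto x (𝓝[>] 0) (𝓝 0) := by
    refine tendsto_const_nhds.congr' ?_
    filter_upwards [self_mem_nhdsWithin] with t ht using (hxz t ht).symm
  exact hX0 (hx0 ▸ tendsto_nhds_unique hcont hcont')

end Stable

/-! ### A symplectic Jordan basis -/

section SymplecticBasis

variable {n : ℕ} (q : QuadraticMap ℝ (Fin n ⊕ Fin n → ℝ) ℂ)

/-- The sum of the generalized eigenspaces of the Hamilton map for the eigenvalues `μ` with
`s Im μ > 0`. -/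
def stableSpace (s : ℝ) : Submodule ℂ (Fin n ⊕ Fin n → ℂ) :=
  ⨆ μ : {μ : ℂ // 0 < s * μ.im}, Module.End.maxGenEigenspace (hamiltonMap q).mulVecLin μ

theorem mulVec_mem_stableSpace {s : ℝ} {X : Fin n ⊕ Fin n → ℂ} (hX : X ∈ stableSpace q s) :
    hamiltonMap q *ᵥ X ∈ stableSpace q s := by
  have h1 : stableSpace q s ≤ (stableSpace q s).comap (hamiltonMap q).mulVecLin := by
    refine iSup_le fun μ Y hY => ?_
    have h2 := Module.End.mapsTo_maxGenEigenspace_of_comm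
      (Commute.refl (hamiltonMap q).mulVecLin) (μ : ℂ) hY
    exact (le_iSup (fun μ : {μ : ℂ // 0 < s * μ.im} =>
      Module.End.maxGenEigenspace (hamiltonMap q).mulVecLin (μ : ℂ)) μ) h2
  exact h1 hX

theorem im_pos_of_mem_stableSpace {s : ℝ} {X : Fin n ⊕ Fin n → ℂ} (hX : X ∈ stableSpace q s)
    (hX0 : X ≠ 0) (μ : ℂ) (hμ : hamiltonMap q *ᵥ X = μ • X) : 0 < s * μ.im := by
  by_contra hneg
  have h1 := (Module.End.independent_maxGenEigenspace (hamiltonMap q).mulVecLin) μ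
  have h2 : X ∈ Module.End.maxGenEigenspace (hamiltonMap q).mulVecLin μ :=
    Module.End.eigenspace_le_maxGenEigenspace (Module.End.mem_eigenspace_iff.2 hμ)
  have h3 : stableSpace q s ≤ ⨆ ν, ⨆ (_ : ν ≠ μ),
      Module.End.maxGenEigenspace (hamiltonMap q).mulVecLin ν := by
    refine iSup_le fun ν => le_iSup₂_of_le (ν : ℂ) (fun h => hneg (h ▸ ν.2)) le_rfl
  exact hX0 ((Submodule.disjoint_def.1 h1) X h2 (h3 hX))

variable {q} (hre : ∀ X, 0 ≤ (q X).re) (hS : singularSpace q = ⊥)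

include hre hS in
theorem stableSpace_sup : stableSpace q 1 ⊔ stableSpace q (-1) = ⊤ := by
  rw [eq_top_iff, ← Module.End.iSup_maxGenEigenspace_eq_top (hamiltonMap q).mulVecLin]
  refine iSup_le fun μ => ?_
  rcases lt_trichotomy μ.im 0 with h | h | h
  · exact (le_iSup (fun μ : {μ : ℂ // 0 < (-1 : ℝ) * μ.im} =>
      Module.End.maxGenEigenspace (hamiltonMap q).mulVecLin (μ : ℂ))
        ⟨μ, by linarith⟩).trans le_sup_right
  · have h1 : Module.End.maxGenEigenspace (hamiltonMap q).mulVecLin μ = ⊥ := by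
      by_contra hne
      have h2 : Module.End.HasUnifEigenvalue (hamiltonMap q).mulVecLin μ ⊤ := hne
      have h3 : Module.End.HasEigenvalue (hamiltonMap q).mulVecLin μ := h2.lt one_pos
      obtain ⟨X, hX⟩ := h3.exists_hasEigenvector
      exact im_ne_zero_of_eigenvector q hre hS hX.2 hX.apply_eq_smul h
    rw [h1]
    exact bot_le
  · exact (le_iSup (fun μ : {μ : ℂ // 0 < (1 : ℝ) * μ.im} =>
      Module.End.maxGenEigenspace (hamiltonMap q).mulVecLin (μ : ℂ))
        ⟨μ, by linarith⟩).trans le_sup_left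

theorem sympForm_eq_zero_of_mem_stableSpace {s : ℝ} (hs : s ^ 2 = 1) {X Y : Fin n ⊕ Fin n → ℂ}
    (hX : X ∈ stableSpace q s) (hY : Y ∈ stableSpace q s) : sympForm X Y = 0 :=
  sympForm_eq_zero_of_stable hs (fun _ => mulVec_mem_stableSpace q)
    (fun _ => im_pos_of_mem_stableSpace q) hX hY

include hre hS in
theorem im_sympForm_star_neg {s : ℝ} (hs : s ^ 2 = 1) {X : Fin n ⊕ Fin n → ℂ}
    (hX : X ∈ stableSpace q s) (hX0 : X ≠ 0) : s * (sympForm (star X) X).im < 0 :=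
  im_sympForm_star_neg_of_stable hre hS hs (fun _ => mulVec_mem_stableSpace q)
    (fun _ => im_pos_of_mem_stableSpace q) hX hX0

include hre hS in
theorem isCompl_stableSpace : IsCompl (stableSpace q 1) (stableSpace q (-1)) := by
  refine ⟨Submodule.disjoint_def.2 fun X h1 h2 => ?_,
    codisjoint_iff.2 (stableSpace_sup hre hS)⟩
  by_contra h0
  have h3 := im_sympForm_star_neg hre hS (by norm_num) h1 h0
  have h4 := im_sympForm_star_neg hre hS (by norm_num) h2 h0
  linarith

/-- The symplectic form as a pairing of two stable spaces. -/
def stablePairing (q : QuadraticMap ℝ (Fin n ⊕ Fin n → ℝ) ℂ) (s s' : ℝ) :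
    stableSpace q s →ₗ[ℂ] Module.Dual ℂ (stableSpace q s') :=
  (sympBilin.compl₂ (stableSpace q s').subtype) ∘ₗ (stableSpace q s).subtype

include hre hS in
theorem stablePairing_injective {s : ℝ} (hs : s = 1 ∨ s = -1) :
    Function.Injective (stablePairing q s (-s)) := by
  rw [injective_iff_map_eq_zero]
  intro X hX
  refine Subtype.ext (sympForm_eq_zero fun Y => ?_)
  have hY : Y ∈ stableSpace q s ⊔ stableSpace q (-s) := by
    rcases hs with rfl | rfl
    · rw [stableSpace_sup hre hS]; trivial
    · rw [neg_neg, sup_comm, stableSpace_sup hre hS]; trivial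
  obtain ⟨Y₁, hY₁, Y₂, hY₂, rfl⟩ := Submodule.mem_sup.1 hY
  have hs2 : s ^ 2 = 1 := by rcases hs with rfl | rfl <;> norm_num
  rw [sympForm_add_right, sympForm_eq_zero_of_mem_stableSpace hs2 X.2 hY₁, zero_add]
  exact LinearMap.congr_fun hX ⟨Y₂, hY₂⟩

include hre hS in
theorem finrank_stableSpace : Module.finrank ℂ (stableSpace q 1) = n ∧
    Module.finrank ℂ (stableSpace q (-1)) = n := by
  have h1 := LinearMap.finrank_le_finrank_of_injective
    (stablePairing_injective hre hS (Or.inl rfl))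
  have h2 := LinearMap.finrank_le_finrank_of_injective
    (stablePairing_injective hre hS (Or.inr rfl))
  rw [Subspace.dual_finrank_eq] at h1 h2
  rw [neg_neg] at h2
  have h3 := Submodule.finrank_add_eq_of_isCompl (isCompl_stableSpace hre hS)
  rw [Module.finrank_fintype_fun_eq_card, Fintype.card_sum, Fintype.card_fin] at h3
  omega

include hre hS in
/-- There is a symplectic basis, the columns of `P`, in which the Hamilton map is block diagonal,
with Jordan form on the stable space of the upper half-plane. -/
theorem exists_symplectic_jordan : ∃ (P : Matrix (Fin n ⊕ Fin n) (Fin n ⊕ Fin n) ℂ)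
    (M : Matrix (Fin n) (Fin n) ℂ), IsJordanForm M ∧ (∀ j, 0 < (M j j).im) ∧
      (∀ Z Z', sympForm (P *ᵥ Z) (P *ᵥ Z') = sympForm Z Z') ∧
      hamiltonMap q * P = P * fromBlocks ((1 / 2 : ℂ) • M) 0 0 (-((1 / 2 : ℂ) • Mᵀ)) ∧
      (∀ x, P *ᵥ Sum.elim x 0 ∈ stableSpace q 1) ∧
      ∀ ξ, P *ᵥ Sum.elim 0 ξ ∈ stableSpace q (-1) := by
  obtain ⟨hd₁, hd₂⟩ := finrank_stableSpace hre hS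
  let f : Module.End ℂ (stableSpace q 1) :=
    ((2 : ℂ) • (hamiltonMap q).mulVecLin).restrict fun X hX =>
      (stableSpace q 1).smul_mem _ (mulVec_mem_stableSpace q hX)
  have hf : ∀ w : stableSpace q 1, (f w : Fin n ⊕ Fin n → ℂ) = (2 : ℂ) • (hamiltonMap q *ᵥ w) :=
    fun w => rfl
  obtain ⟨d, e, M, hli, hsp, hJ, hfe, hev⟩ := exists_jordan_basis f
  let b := Module.Basis.mk hli hsp.ge
  have hb : ∀ j, b j = e j := fun j => Module.Basis.mk_apply hli hsp.ge j
  obtain rfl : n = d := by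
    rw [← hd₁, Module.finrank_eq_card_basis b, Fintype.card_fin]
  have hpos : ∀ j, 0 < (M j j).im := by
    intro j
    obtain ⟨w, hw, hfw⟩ := hev j
    have h1 := congrArg Subtype.val hfw
    rw [hf, Submodule.coe_smul] at h1
    have h2 : hamiltonMap q *ᵥ (w : Fin n ⊕ Fin n → ℂ) =
        (1 / 2 * M j j) • (w : Fin n ⊕ Fin n → ℂ) := by
      rw [mul_smul, ← h1, smul_smul]; norm_num
    have h3 := im_pos_of_mem_stableSpace q w.2 (fun h => hw (Subtype.ext h)) _ h2
    rw [show (1 / 2 : ℂ) = ((1 / 2 : ℝ) : ℂ) by push_cast; ring, Complex.im_ofReal_mul] at h3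
    linarith
  have hFe : ∀ j, hamiltonMap q *ᵥ (e j : Fin n ⊕ Fin n → ℂ) =
      ∑ i, (1 / 2 * M i j) • (e i : Fin n ⊕ Fin n → ℂ) := by
    intro j
    have h1 := congrArg Subtype.val (hfe j)
    rw [hf, Submodule.coe_sum] at h1
    have h2 := congrArg (fun X => (1 / 2 : ℂ) • X) h1
    simp only [smul_smul, Finset.smul_sum, Submodule.coe_smul] at h2
    norm_num at h2
    simpa using h2
  -- the dual basis of the opposite stable space
  have hsurj : Function.Surjective (stablePairing q (-1) (- -1)) :=
    (LinearMap.injective_iff_surjective_of_finrank_eq_finrank (by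
      rw [Subspace.dual_finrank_eq, neg_neg, hd₁, hd₂])).1
      (stablePairing_injective hre hS (Or.inr rfl))
  have hdual : ∀ j, ∃ Y ∈ stableSpace q (-1), ∀ i, sympForm Y (e i) = if i = j then 1 else 0 := by
    intro j
    rw [neg_neg] at hsurj
    obtain ⟨Y, hY⟩ := hsurj (b.coord j)
    refine ⟨Y, Y.2, fun i => ?_⟩
    have h1 : stablePairing q (-1) 1 Y (e i) =
        sympForm (Y : Fin n ⊕ Fin n → ℂ) (e i : Fin n ⊕ Fin n → ℂ) := rfl
    rw [← h1, hY, ← hb i, Module.Basis.coord_apply, Module.Basis.repr_self,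
      Finsupp.single_apply]
  choose φ hφ hφe using hdual
  have hee : ∀ i j, sympForm (e i : Fin n ⊕ Fin n → ℂ) (e j) = 0 := fun i j =>
    sympForm_eq_zero_of_mem_stableSpace (by norm_num) (e i).2 (e j).2
  have hφφ : ∀ i j, sympForm (φ i) (φ j) = 0 := fun i j =>
    sympForm_eq_zero_of_mem_stableSpace (by norm_num) (hφ i) (hφ j)
  let B : Fin n ⊕ Fin n → Fin n ⊕ Fin n → ℂ := Sum.elim (fun j => (e j : Fin n ⊕ Fin n → ℂ)) φ
  let P : Matrix (Fin n ⊕ Fin n) (Fin n ⊕ Fin n) ℂ := Matrix.of fun a c => B c a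
  have hP : ∀ Z, P *ᵥ Z = ∑ j, Z (Sum.inl j) • (e j : Fin n ⊕ Fin n → ℂ) +
      ∑ j, Z (Sum.inr j) • φ j := by
    intro Z
    funext a
    simp only [mulVec, dotProduct, Fintype.sum_sum_type, Pi.add_apply, Finset.sum_apply,
      Pi.smul_apply, smul_eq_mul, P, B, of_apply, Sum.elim_inl, Sum.elim_inr]
    congr 1 <;> exact Finset.sum_congr rfl fun j _ => mul_comm _ _
  have hsum_left : ∀ (c : Fin n → ℂ) (V : Fin n → Fin n ⊕ Fin n → ℂ) (Y : Fin n ⊕ Fin n → ℂ),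
      sympForm (∑ j, c j • V j) Y = ∑ j, c j * sympForm (V j) Y := by
    intro c V Y
    rw [← sympBilin_apply, map_sum, LinearMap.sum_apply]
    exact Finset.sum_congr rfl fun j _ => sympForm_smul_left _ _ _
  have hsum_right : ∀ (c : Fin n → ℂ) (V : Fin n → Fin n ⊕ Fin n → ℂ) (Y : Fin n ⊕ Fin n → ℂ),
      sympForm Y (∑ j, c j • V j) = ∑ j, c j * sympForm Y (V j) := by
    intro c V Y
    rw [sympForm_comm, hsum_left, ← Finset.sum_neg_distrib]
    refine Finset.sum_congr rfl fun j _ => ?_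
    rw [sympForm_comm Y]; ring
  have hadd_left : ∀ X Y Z : Fin n ⊕ Fin n → ℂ, sympForm (X + Y) Z = sympForm X Z + sympForm Y Z :=
    fun X Y Z => by rw [← sympBilin_apply, map_add]; rfl
  have hφx : ∀ (i : Fin n) (c : Fin n → ℂ),
      sympForm (φ i) (∑ j, c j • (e j : Fin n ⊕ Fin n → ℂ)) = c i := by
    intro i c
    rw [hsum_right]
    simp [hφe]
  have hxφ : ∀ (i : Fin n) (c : Fin n → ℂ),
      sympForm (∑ j, c j • φ j) (e i : Fin n ⊕ Fin n → ℂ) = c i := by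
    intro i c
    rw [hsum_left]
    simp [hφe]
  have hFφ : ∀ j, hamiltonMap q *ᵥ φ j = ∑ i, (-(1 / 2 * M j i)) • φ i := by
    intro j
    refine sub_eq_zero.1 (sympForm_eq_zero fun Y => ?_)
    have hmem : hamiltonMap q *ᵥ φ j - ∑ i, (-(1 / 2 * M j i)) • φ i ∈ stableSpace q (-1) :=
      Submodule.sub_mem _ (mulVec_mem_stableSpace q (hφ j))
        (Submodule.sum_mem _ fun i _ => Submodule.smul_mem _ _ (hφ i))
    have hY : Y ∈ stableSpace q 1 ⊔ stableSpace q (-1) := by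
      rw [stableSpace_sup hre hS]; trivial
    obtain ⟨Y₁, hY₁, Y₂, hY₂, rfl⟩ := Submodule.mem_sup.1 hY
    have hrepr : Y₁ = ∑ i, b.repr ⟨Y₁, hY₁⟩ i • (e i : Fin n ⊕ Fin n → ℂ) := by
      have h1 := congrArg Subtype.val (b.sum_repr ⟨Y₁, hY₁⟩)
      rw [Submodule.coe_sum] at h1
      refine h1.symm.trans (Finset.sum_congr rfl fun i _ => ?_)
      rw [Submodule.coe_smul, hb]
    rw [sympForm_add_right, sympForm_eq_zero_of_mem_stableSpace (by norm_num) hmem hY₂, add_zero,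
      hrepr, hsum_right]
    refine Finset.sum_eq_zero fun i _ => ?_
    rw [sub_eq_add_neg, hadd_left, sympForm_hamiltonMap_left, hFe, hφx, ← neg_one_smul ℂ (∑ i, _),
      sympForm_smul_left, hxφ]
    ring
  refine ⟨P, M, hJ, hpos, fun Z Z' => ?_, ?_, fun x => ?_, fun ξ => ?_⟩
  · have h1 : ∀ j, sympForm (e j : Fin n ⊕ Fin n → ℂ) (P *ᵥ Z') = -Z' (Sum.inr j) := fun j => by
      rw [hP Z', sympForm_add_right, sympForm_comm (∑ i, Z' (Sum.inr i) • φ i),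
        hxφ j fun i => Z' (Sum.inr i), hsum_right]
      simp [hee]
    have h2 : ∀ j, sympForm (φ j) (P *ᵥ Z') = Z' (Sum.inl j) := fun j => by
      rw [hP Z', sympForm_add_right, hφx j fun i => Z' (Sum.inl i), hsum_right]
      simp [hφφ]
    rw [hP Z, hadd_left, hsum_left, hsum_left, ← Finset.sum_add_distrib, sympForm]
    refine Finset.sum_congr rfl fun j _ => ?_
    rw [h1, h2]
    ring
  · ext a c
    change (hamiltonMap q *ᵥ B c) a = _
    cases c with
    | inl j =>
      change (hamiltonMap q *ᵥ (e j : Fin n ⊕ Fin n → ℂ)) a = _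
      rw [hFe, Finset.sum_apply, mul_apply, Fintype.sum_sum_type]
      simp [P, B, mul_comm]
    | inr j =>
      change (hamiltonMap q *ᵥ φ j) a = _
      rw [hFφ, Finset.sum_apply, mul_apply, Fintype.sum_sum_type]
      simp [P, B, mul_comm]
  · rw [hP]
    refine Submodule.add_mem _ (Submodule.sum_mem _ fun j _ => Submodule.smul_mem _ _ (e j).2) ?_
    simp
  · rw [hP]
    refine Submodule.add_mem _ ?_ (Submodule.sum_mem _ fun j _ => Submodule.smul_mem _ _ (hφ j))
    simp

end SymplecticBasis

/-! ### Existence of the normal form -/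

section Existence

variable {n : ℕ}

theorem im_sympForm_realPoint (X Y : Fin n ⊕ Fin n → ℝ) :
    (sympForm (realPoint X) (realPoint Y)).im = 0 := by
  simp [sympForm, realPoint, Complex.im_sum]

/-- A real quadratic form which is positive away from the origin is strictly convex. -/
theorem strictConvexOn_of_pos (Φ : QuadraticForm ℝ (Fin n → ℂ)) (h : ∀ x, x ≠ 0 → 0 < Φ x) :
    StrictConvexOn ℝ Set.univ Φ := by
  refine ⟨convex_univ, fun x _ y _ hxy a b ha hb hab => ?_⟩
  have h1 := h (x - y) (sub_ne_zero.2 hxy)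
  have h2 : a * Φ x + b * Φ y - Φ (a • x + b • y) = a * b * Φ (x - y) := by
    obtain rfl : b = 1 - a := by linarith
    simp only [← polarForm_self, map_add, map_sub, map_smul, LinearMap.add_apply,
      LinearMap.sub_apply, LinearMap.smul_apply, smul_eq_mul, polarForm_comm Φ y x]
    ring
  have h3 := mul_pos (mul_pos ha hb) h1
  rw [smul_eq_mul, smul_eq_mul]
  linarith

/-- A canonical transformation `κ` for which `Im ξ · x` is negative on `κ(ℝ²ⁿ) ∖ {0}` maps the
real phase space onto the graph `Λ_Φ` of a strictly convex weight: `Φ(x) = -½ Im ξ · x` for the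
point `(x, ξ)` of `κ(ℝ²ⁿ)` above `x`. -/
theorem exists_weight (κ : (Fin n ⊕ Fin n → ℂ) ≃ₗ[ℂ] (Fin n ⊕ Fin n → ℂ))
    (hκ : ∀ X Y, sympForm (κ X) (κ Y) = sympForm X Y)
    (hneg : ∀ X : Fin n ⊕ Fin n → ℝ, X ≠ 0 →
      (∑ j, κ (realPoint X) (Sum.inr j) * κ (realPoint X) (Sum.inl j)).im < 0) :
    ∃ Φ : QuadraticForm ℝ (Fin n → ℂ), StrictConvexOn ℝ Set.univ Φ ∧
      Set.range (fun X : Fin n ⊕ Fin n → ℝ => κ (realPoint X)) = lagrangian Φ := by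
  let ι : (Fin n ⊕ Fin n → ℝ) →ₗ[ℝ] (Fin n ⊕ Fin n → ℂ) :=
    { toFun := realPoint
      map_add' := fun X Y => by funext a; simp [realPoint]
      map_smul' := fun c X => by funext a; simp [realPoint] }
  let κ' : (Fin n ⊕ Fin n → ℝ) →ₗ[ℝ] (Fin n ⊕ Fin n → ℂ) :=
    (κ.toLinearMap.restrictScalars ℝ) ∘ₗ ι
  have hκ' : ∀ X, κ' X = κ (realPoint X) := fun _ => rfl
  let ρ : (Fin n ⊕ Fin n → ℝ) →ₗ[ℝ] (Fin n → ℂ) := LinearMap.funLeft ℝ ℂ Sum.inl ∘ₗ κ'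
  have hρ : ∀ X j, ρ X j = κ (realPoint X) (Sum.inl j) := fun _ _ => rfl
  have hinj : Function.Injective ρ := by
    rw [injective_iff_map_eq_zero]
    intro X hX
    by_contra h0
    have h1 := hneg X h0
    simp only [← hρ, hX, Pi.zero_apply, mul_zero, Finset.sum_const_zero, Complex.zero_im,
      lt_self_iff_false] at h1
  have hdim : Module.finrank ℝ (Fin n ⊕ Fin n → ℝ) = Module.finrank ℝ (Fin n → ℂ) := by
    rw [Module.finrank_fintype_fun_eq_card, Module.finrank_pi_fintype, Fintype.card_sum]
    simp [Complex.finrank_real_complex, mul_two]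
  -- the projection of `κ(ℝ²ⁿ)` to the base is a real linear isomorphism, with inverse `R.symm`;
  -- the point above `x` is `(x, p x)`
  let R := LinearMap.linearEquivOfInjective ρ hinj hdim
  have hR : ∀ x, ρ (R.symm x) = x := fun x => R.apply_symm_apply x
  let p : (Fin n → ℂ) →ₗ[ℝ] (Fin n → ℂ) :=
    LinearMap.funLeft ℝ ℂ Sum.inr ∘ₗ κ' ∘ₗ R.symm.toLinearMap
  have hp : ∀ x, κ (realPoint (R.symm x)) = Sum.elim x (p x) := by
    intro x
    funext a
    cases a with
    | inl j => exact congrFun (hR x) j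
    | inr j => rfl
  let b : LinearMap.BilinForm ℝ (Fin n → ℂ) := LinearMap.mk₂ ℝ
    (fun x y => -(1 / 2) * (∑ j, p x j * y j).im)
    (fun x y z => by
      simp only [map_add, Pi.add_apply, add_mul, Finset.sum_add_distrib, Complex.add_im]; ring)
    (fun c x y => by
      simp only [map_smul, Pi.smul_apply, smul_mul_assoc, ← Finset.smul_sum, Complex.smul_im,
        smul_eq_mul]; ring)
    (fun x y z => by
      simp only [Pi.add_apply, mul_add, Finset.sum_add_distrib, Complex.add_im])
    (fun c x y => by
      simp only [Pi.smul_apply, mul_smul_comm, ← Finset.smul_sum, Complex.smul_im,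
        smul_eq_mul]; ring)
  have hb : ∀ x y, b x y = -(1 / 2) * (∑ j, p x j * y j).im := fun _ _ => rfl
  -- `b` is symmetric because `σ` is real on `κ(ℝ²ⁿ)`
  have hsymm : ∀ x y, b x y = b y x := by
    intro x y
    have h1 := im_sympForm_realPoint (R.symm x) (R.symm y)
    rw [← hκ, hp, hp] at h1
    simp only [sympForm, Sum.elim_inl, Sum.elim_inr, Finset.sum_sub_distrib, Complex.sub_im] at h1
    rw [hb, hb]
    linarith
  let Φ : QuadraticForm ℝ (Fin n → ℂ) := LinearMap.BilinMap.toQuadraticMap b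
  have hΦ : polarForm Φ = b := QuadraticMap.associated_left_inverse ℝ hsymm
  -- `2 ∂_{x_j} Φ = i p_j`
  have hmom : ∀ x, momentum Φ x = p x := by
    intro x
    funext j
    have h1 : ∀ c : ℂ, ∑ i, p x i * (Pi.single j c : Fin n → ℂ) i = p x j * c := fun c => by
      simp [Pi.single_apply]
    rw [momentum, wirtinger, fderiv_form, fderiv_form, hΦ, hb, hb, h1, h1]
    apply Complex.ext <;> simp <;> ring
  refine ⟨Φ, strictConvexOn_of_pos Φ fun x hx => ?_, ?_⟩
  · have h1 := hneg (R.symm x) (by simpa using hx)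
    rw [hp] at h1
    simp only [Sum.elim_inl, Sum.elim_inr] at h1
    rw [← polarForm_self, hΦ, hb]
    linarith
  · have h1 : lagrangian Φ = Set.range fun x => Sum.elim x (p x) := by
      rw [lagrangian]
      exact congrArg Set.range (funext fun x => by rw [← hmom x]; rfl)
    rw [h1]
    refine Set.Subset.antisymm ?_ ?_
    · rintro _ ⟨X, rfl⟩
      refine ⟨R X, ?_⟩
      change Sum.elim (R X) (p (R X)) = κ (realPoint X)
      rw [← hp, R.symm_apply_apply]
    · rintro _ ⟨x, rfl⟩
      exact ⟨R.symm x, hp x⟩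

theorem IsJordanForm.charpoly {M : Matrix (Fin n) (Fin n) ℂ} (hM : IsJordanForm M) (c : ℂ) :
    (c • M).charpoly = ∏ j, (Polynomial.X - Polynomial.C (c * M j j)) := by
  refine charpoly_of_isUpperTriangular _ fun i j hij => ?_
  have hij' : (j : ℕ) < i := hij
  rw [Matrix.smul_apply, hM.1 i j (fun h => by simp [h] at hij') (by omega), smul_zero]

/-- The eigenvalues of a Hamilton map in block diagonal form. -/
theorem roots_charpoly_hamiltonMap {F P : Matrix (Fin n ⊕ Fin n) (Fin n ⊕ Fin n) ℂ}
    {M : Matrix (Fin n) (Fin n) ℂ} (hM : IsJordanForm M) (hpos : ∀ j, 0 < (M j j).im)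
    (hP : IsUnit P)
    (hFP : F * P = P * fromBlocks ((1 / 2 : ℂ) • M) 0 0 (-((1 / 2 : ℂ) • Mᵀ))) :
    Finset.univ.val.map (fun j => 1 / 2 * M j j) = F.charpoly.roots.filter fun z => 0 < z.im := by
  obtain ⟨U, rfl⟩ := hP
  have h1 : F = U.val * fromBlocks ((1 / 2 : ℂ) • M) 0 0 (-((1 / 2 : ℂ) • Mᵀ)) * U.val⁻¹ := by
    rw [← hFP, mul_assoc, Matrix.mul_nonsing_inv _ ((Matrix.isUnit_iff_isUnit_det _).1 U.isUnit),
      mul_one]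
  have h2 : -((1 / 2 : ℂ) • Mᵀ) = ((-(1 / 2) : ℂ) • M)ᵀ := by
    rw [transpose_smul, neg_smul]
  have h3 : (1 / 2 : ℂ) = ((1 / 2 : ℝ) : ℂ) := by push_cast; ring
  have h4 : ∀ j, (1 / 2 * M j j).im = 1 / 2 * (M j j).im := fun j => by
    rw [h3, Complex.im_ofReal_mul]
  have h5 : ∀ j, (-(1 / 2) * M j j).im = -(1 / 2 * (M j j).im) := fun j => by
    rw [neg_mul, Complex.neg_im, h4]
  -- the roots are the numbers `M j j / 2` and their negatives
  have hprod : ∀ c : ℂ, (∏ j, (Polynomial.X - Polynomial.C (c * M j j))).roots =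
      Finset.univ.val.map fun j => c * M j j := fun c =>
    Polynomial.roots_multiset_prod_X_sub_C (Finset.univ.val.map fun j => c * M j j) ▸ by
      rw [Multiset.map_map]; rfl
  have hne : ∀ c : ℂ, (∏ j, (Polynomial.X - Polynomial.C (c * M j j))) ≠ 0 := fun c =>
    Finset.prod_ne_zero_iff.2 fun j _ => Polynomial.X_sub_C_ne_zero _
  rw [h1, charpoly_units_conj, charpoly_fromBlocks_zero₁₂, h2, charpoly_transpose, hM.charpoly,
    hM.charpoly, Polynomial.roots_mul (mul_ne_zero (hne _) (hne _)), hprod, hprod,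
    Multiset.filter_add, Multiset.filter_eq_self.2, Multiset.filter_eq_nil.2, add_zero]
  · intro z hz
    obtain ⟨j, -, rfl⟩ := Multiset.mem_map.1 hz
    rw [h5]
    have := hpos j
    linarith
  · intro z hz
    obtain ⟨j, -, rfl⟩ := Multiset.mem_map.1 hz
    rw [h4]
    have := hpos j
    linarith

/-- For real points `X = X₊ + X₋` decomposed along the two stable spaces,
`2 i Im σ(X₋, X₊) = σ(X̄₊, X₊) - σ(X̄₋, X₋)`, and both terms have the same sign. -/
theorem im_sympForm_neg_of_real {q : QuadraticMap ℝ (Fin n ⊕ Fin n → ℝ) ℂ}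
    (hre : ∀ X, 0 ≤ (q X).re) (hS : singularSpace q = ⊥) {X Y : Fin n ⊕ Fin n → ℂ}
    (hX : X ∈ stableSpace q 1) (hY : Y ∈ stableSpace q (-1)) (hreal : star (X + Y) = X + Y)
    (h0 : X + Y ≠ 0) : (sympForm Y X).im < 0 := by
  have hsub : ∀ A B C D : Fin n ⊕ Fin n → ℂ, A + B = C + D → ∀ Z,
      sympForm A Z + sympForm B Z = sympForm C Z + sympForm D Z := by
    intro A B C D h Z
    rw [← sympBilin_apply A, ← sympBilin_apply B, ← LinearMap.add_apply, ← map_add, h, map_add]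
    rfl
  rw [star_add] at hreal
  have h1 := hsub _ _ _ _ hreal X
  have h2 : sympForm (star Y) (star X) + sympForm (star Y) (star Y) =
      sympForm (star Y) X + sympForm (star Y) Y := by
    rw [← sympForm_add_right, hreal, sympForm_add_right]
  have hself : ∀ Z : Fin n ⊕ Fin n → ℂ, sympForm Z Z = 0 := fun Z => by
    have := sympForm_comm Z Z
    linear_combination this / 2
  rw [hself, zero_add] at h1
  rw [hself, add_zero, sympForm_star] at h2
  have h3 := congrArg Complex.im h1
  have h4 := congrArg Complex.im h2
  rw [Complex.add_im] at h3 h4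
  rw [Complex.conj_im] at h4
  have hle : ∀ {s : ℝ}, s ^ 2 = 1 → ∀ {Z : Fin n ⊕ Fin n → ℂ}, Z ∈ stableSpace q s →
      s * (sympForm (star Z) Z).im ≤ 0 := by
    intro s hs Z hZ
    by_cases hZ0 : Z = 0
    · rw [hZ0, star_zero, hself, Complex.zero_im, mul_zero]
    · exact (im_sympForm_star_neg hre hS hs hZ hZ0).le
  have h5 := hle (by norm_num) hX
  have h6 := hle (by norm_num) hY
  by_cases hX0 : X = 0
  · have h7 := im_sympForm_star_neg hre hS (by norm_num) hY
      (fun h => h0 (by rw [hX0, h, add_zero]))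
    linarith
  · have h7 := im_sympForm_star_neg hre hS (by norm_num) hX hX0
    linarith

/-- The inverse of the symplectic Jordan basis is the canonical transformation of a normal form: the
fibre `{x = 0}` corresponds to the stable space of the lower half-plane, and `{ξ = 0}` to that of
the upper half-plane. -/
theorem exists_normalForm {q : QuadraticMap ℝ (Fin n ⊕ Fin n → ℝ) ℂ}
    (hre : ∀ X, 0 ≤ (q X).re) (hS : singularSpace q = ⊥) : Nonempty (NormalForm q) := by
  obtain ⟨P, M, hJ, hpos, hsymp, hFP, hPx, hPξ⟩ := exists_symplectic_jordan hre hS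
  have hinj : Function.Injective P.mulVecLin := by
    rw [injective_iff_map_eq_zero]
    intro Z hZ
    refine sympForm_eq_zero fun Y => ?_
    have hZ' : P *ᵥ Z = (0 : ℂ) • (0 : Fin n ⊕ Fin n → ℂ) := by rw [smul_zero]; exact hZ
    rw [← hsymp, hZ', sympForm_smul_left, zero_mul]
  have hunit : IsUnit P := Matrix.mulVec_injective_iff_isUnit.1 hinj
  let K : (Fin n ⊕ Fin n → ℂ) ≃ₗ[ℂ] (Fin n ⊕ Fin n → ℂ) :=
    LinearEquiv.ofInjectiveEndo P.mulVecLin hinj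
  have hK : ∀ Z, K Z = P *ᵥ Z := fun _ => rfl
  have hcan : ∀ X Y, sympForm (K.symm X) (K.symm Y) = sympForm X Y := fun X Y => by
    rw [← hsymp, ← hK, ← hK, K.apply_symm_apply, K.apply_symm_apply]
  have hadd : ∀ x ξ : Fin n → ℂ, Sum.elim x ξ =
      Sum.elim x (0 : Fin n → ℂ) + Sum.elim (0 : Fin n → ℂ) ξ := by
    intro x ξ
    funext a
    cases a <;> simp
  obtain ⟨Φ, hΦ, hΛ⟩ := exists_weight K.symm hcan (by
    intro X hX
    set Z := K.symm (realPoint X) with hZ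
    have hX' : realPoint X = P *ᵥ Sum.elim (Z ∘ Sum.inl) 0 + P *ᵥ Sum.elim 0 (Z ∘ Sum.inr) := by
      rw [← mulVec_add, ← hadd, Sum.elim_comp_inl_inr, ← hK, hZ, K.apply_symm_apply]
    have h1 := im_sympForm_neg_of_real hre hS (hPx (Z ∘ Sum.inl)) (hPξ (Z ∘ Sum.inr))
      (by rw [← hX']; funext a; simp [realPoint])
      (by
        rw [← hX']
        exact fun h => hX (funext fun a => by simpa [realPoint] using congrFun h a))
    rw [hsymp] at h1
    simpa [sympForm] using h1)
  refine ⟨⟨K.symm, M, fun j => 1 / 2 * M j j, Φ, hcan, fun x ξ => ?_, hJ, fun j => by ring,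
    roots_charpoly_hamiltonMap hJ hpos hunit hFP, hΦ, hΛ⟩⟩
  rw [LinearEquiv.symm_symm, hK, ← sympForm_hamiltonMap, mulVec_mulVec, hFP, ← mulVec_mulVec,
    hsymp, fromBlocks_mulVec]
  simp only [sympForm, Sum.elim_inl, Sum.elim_inr, Sum.elim_comp_inl, Sum.elim_comp_inr,
    zero_mulVec, add_zero, zero_add, Finset.sum_sub_distrib]
  have h1 : ∑ j, ξ j * (((1 / 2 : ℂ) • M) *ᵥ x) j = 1 / 2 * ((M *ᵥ x) ⬝ᵥ ξ) := by
    rw [smul_mulVec, dotProduct_comm, ← smul_eq_mul, ← dotProduct_smul]; rfl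
  have h2 : ∑ j, ((-((1 / 2 : ℂ) • Mᵀ)) *ᵥ ξ) j * x j = -(1 / 2) * ((M *ᵥ x) ⬝ᵥ ξ) := by
    rw [dotProduct_comm, dotProduct_mulVec, ← mulVec_transpose, neg_mulVec, smul_mulVec,
      ← smul_eq_mul, neg_smul, ← smul_dotProduct, ← neg_dotProduct]; rfl
  rw [h1, h2]
  ring

end Existence

end QuadOp

end

theorem theorem1p2 {n : ℕ} (q : QuadraticMap ℝ (Fin n ⊕ Fin n → ℝ) ℂ)
    (hre : ∀ X, 0 ≤ (q X).re) (hS : QuadOp.singularSpace q = ⊥) :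
    Nonempty (QuadOp.NormalForm q) ∧
    ∀ (N : QuadOp.NormalForm q) (h : ℝ), 0 < h →
      (∃ T : QuadOp.L2 n ≃ₗᵢ[ℂ] QuadOp.HPhi N.Φ h, ∀ u v : QuadOp.L2 n,
        (u, v) ∈ (QuadOp.weylL2 (QuadOp.coeffMatrix q) h).graph ↔
          (T u, T v) ∈ (N.op h).graph) ∧
      ∀ z : ℂ, {α : Fin n → ℕ | QuadOp.mu h N.lam α = z}.Finite ∧
        ∃ P : QuadOp.HPhi N.Φ h →L[ℂ] QuadOp.HPhi N.Φ h,
          QuadOp.IsRieszProjection (N.op h) z P ∧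
          ∀ (u : QuadOp.HPhi N.Φ h) (x : Fin n → ℂ),
            QuadOp.rep (P u) x = ∑ᶠ α ∈ {α : Fin n → ℕ | QuadOp.mu h N.lam α = z},
              ((∏ j, ((α j).factorial : ℂ))⁻¹ * QuadOp.multiD α (QuadOp.rep u) 0) * ∏ j, x j ^ α j :=
  ⟨QuadOp.exists_normalForm hre hS, fun N _ hh =>
    ⟨N.exists_unitary hre hh, fun z => N.exists_rieszProjection hre hh z⟩⟩
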